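/- **Conventions.** Manifolds are smooth, four-dimensional, Hausdorff and second countable; Lorentzian metrics are smooth of signature $(-,+,+,+)$. On a time-oriented Lorentzian manifold write $p<q$ if there is a (piecewise smooth) future-pointing causal path from $p$ to $q$, $p\le q$ if $p=q$ or $p<q$, $J^+(A)=\{q: p\le q \text{ for some } p\in A\}$ and $J^-(A)=\{p: p\le q\text{ for some }q\in A\}$. A time-orientable Lorentzian manifold is *globally hyperbolic* if it has no closed causal paths and $J^+(p)\cap J^-(q)$ is compact whenever $p<q$. A subset is a *Cauchy surface* if every inextendible smooth timelike curve meets it exactly once. **Penrose map.** On $\mathbb R\times S^3$ use the metric $g_{\mathbb R\times S^3}=-dT^2+g_{S^3}$, time-oriented by $\partial_T$. Let $NP$, $SP=-NP$ be the poles of $S^3$. For $(t,y)\in\mathbb R\times\mathbb R^3$ put $r=|y|$, $v=t+r$, $u=t-r$, $\Omega=2\,((1+v^2)(1+u^2))^{-1/2}$, and let $\Phi(t,y)=(T,x)$, where $T=\arctan v+\arctan u$ and $x\in S^3$ is the point at distance $R=\arctan v-\arctan u$ from $NP$ in the direction of $y$. Let $\hat N=\Phi(\mathbb R^{1+3})$,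 $\mathcal I^+=\partial\hat N\cap\{0<T<\pi\}$, $\mathcal I^-=\partial\hat N\cap\{-\pi<T<0\}$, $i_\pm=(\pm\pi,NP)$, $i_0=(0,SP)$, and, with $J^\pm$ taken in $\mathbb R\times S^3$, $$N^+=J^+(\mathcal I^+\cup\{i_0\})\setminus J^+(i_+),\qquad N^-=J^-(\mathcal I^-\cup\{i_0\})\setminus J^-(i_-).$$ **Infinity.** Let $(M,g)$ be a time-oriented globally hyperbolic Lorentzian manifold with an asymptotically Minkowskian infinity $E$ that is visible in the whole of $M$: $E\subset M$ is open, $J^+_M(E)=J^-_M(E)=M$, and there is an isometry $F$ of $(E,g|_E)$ onto some $(V,g_V)$, where $V\subset\mathbb R^{1+3}$ and the Lorentzian metric $g_V$ satisfy, for some open $\hat V\subset\mathbb R\times S^3$ containing $\mathcal I^+\cup\mathcal I^-\cup\{i_0\}$ and some smooth Lorentzian metric $g_{\hat V}$ on $\hat V$: $V=\Phi^{-1}(\hat V\cap\hat N)$, $g_{\hat V}=g_{\mathbb R\times S^3}$ on $\hat V\setminus\hat N$, and $\Omega^2g_V=\Phi^*g_{\hat V}$ on $V$. Let $\omega_M\in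 C^\infty(M)$ be positive with $\omega_M=\Omega\circ F$ on $E$, and let $(N,g_N)=(M,\omega_M^2 g)$. **Extension.** Let $N_{\mathrm{ext}}=N\cup N^+\cup N^-$ be the space obtained by gluing $N$ and the open subset $\Phi(V)\cup N^+\cup N^-$ of $\mathbb R\times S^3$ along $\Phi\circ F:E\to\Phi(V)$, with the smooth structure inherited from both, and let $g_{\mathrm{ext}}$ be $g_N$ on $N$ and $g_{\mathbb R\times S^3}$ on $N^+\cup N^-$. **Lemma.** $N_{\mathrm{ext}}$ is Hausdorff and second countable, $g_{\mathrm{ext}}$ is a smooth Lorentzian metric, and $(N_{\mathrm{ext}},g_{\mathrm{ext}})$ is globally hyperbolic. Moreover, if $\Sigma$ is a Cauchy surface of $(N,g_N)$, then $\Sigma\cup\{i_0\}$ is a Cauchy surface of $(N_{\mathrm{ext}},g_{\mathrm{ext}})$. -/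

import Mathlib

open Set Filter Topology Bundle Manifold
open scoped ContDiff Manifold

noncomputable section

namespace Penrose

/-! ### Lorentzian metrics and causality on four-dimensional manifolds

All manifolds are modelled on `ℝ × ℝ³`, without boundary. -/

/-- Euclidean three-space. -/
abbrev E3 : Type := EuclideanSpace ℝ (Fin 3)

/-- Euclidean four-space. -/
abbrev E4 : Type := EuclideanSpace ℝ (Fin 4)

/-- The model space `ℝ × ℝ³` of the manifolds. -/
abbrev ModelH : Type := ModelProd ℝ E3

/-- The (boundaryless) model of four-dimensional manifolds on `ℝ × ℝ³`. -/
abbrev I₄ : ModelWithCorners ℝ (ℝ × E3) ModelH := 𝓘(ℝ, ℝ).prod 𝓘(ℝ, E3)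

/-- Bilinear forms on the model vector space. -/
abbrev Bilin : Type := (ℝ × E3) →L[ℝ] (ℝ × E3) →L[ℝ] ℝ

/-- A bilinear form is Lorentzian, of signature `(-, +, …, +)`: it is symmetric, and there is a
vector of negative square on whose orthogonal complement the form is positive definite. -/
structure IsLorentzForm {V : Type*} [AddCommGroup V] [Module ℝ V] [TopologicalSpace V]
    [IsTopologicalAddGroup V] [ContinuousConstSMul ℝ V] (B : V →L[ℝ] V →L[ℝ] ℝ) : Prop where
  symm : ∀ v w, B v w = B w v
  signature : ∃ v, B v v < 0 ∧ ∀ w, w ≠ 0 → B v w = 0 → 0 < B w w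

section Causality

variable {X : Type*} [TopologicalSpace X] [ChartedSpace ModelH X]

/-- Fields of bilinear forms on the tangent spaces of `X`. -/
abbrev MetricField (X : Type*) [TopologicalSpace X] [ChartedSpace ModelH X] : Type _ :=
  ∀ x : X, TangentSpace I₄ x →L[ℝ] TangentSpace I₄ x →L[ℝ] ℝ

/-- Vector fields on `X`. -/
abbrev VecField (X : Type*) [TopologicalSpace X] [ChartedSpace ModelH X] : Type _ :=
  ∀ x : X, TangentSpace I₄ x

/-- `g` is a `C^∞` Lorentzian metric on the subset `s` of `X`. -/
structure IsLorentzianOn [IsManifold I₄ ∞ X] (g : MetricField X) (s : Set X) : Prop where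
  smooth : ContMDiffOn I₄ (I₄.prod 𝓘(ℝ, Bilin)) ∞
    (fun x ↦ TotalSpace.mk' Bilin
      (E := fun x : X ↦ TangentSpace I₄ x →L[ℝ] TangentSpace I₄ x →L[ℝ] ℝ) x (g x)) s
  lorentz : ∀ x ∈ s, IsLorentzForm (g x)

/-- A time orientation of `(X, g)`: a smooth vector field that is timelike everywhere. -/
structure IsTimeOrientation [IsManifold I₄ ∞ X] (g : MetricField X) (Z : VecField X) : Prop where
  smooth : ContMDiff I₄ I₄.tangent ∞ (fun x ↦ (⟨x, Z x⟩ : TangentBundle I₄ X))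
  timelike : ∀ x, g x (Z x) (Z x) < 0

/-- The velocity at time `t` of a curve with parameter set `s`. -/
def velocity (γ : ℝ → X) (s : Set ℝ) (t : ℝ) : TangentSpace I₄ (γ t) :=
  mfderivWithin 𝓘(ℝ, ℝ) I₄ γ s t (1 : ℝ)

/-- A nonzero causal vector that points to the future, with respect to the time orientation
`Z`. -/
def IsFutureCausal (g : MetricField X) (Z : VecField X) (x : X) (v : TangentSpace I₄ x) : Prop :=
  v ≠ 0 ∧ g x v v ≤ 0 ∧ g x (Z x) v < 0

/-- There is a smooth future-pointing causal path `[0, 1] → X` from `p` to `q`. -/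
def CausalStep (g : MetricField X) (Z : VecField X) (p q : X) : Prop :=
  ∃ γ : ℝ → X, ContMDiffOn 𝓘(ℝ, ℝ) I₄ ∞ γ (Icc 0 1) ∧ γ 0 = p ∧ γ 1 = q ∧
    ∀ t ∈ Icc (0 : ℝ) 1, IsFutureCausal g Z (γ t) (velocity γ (Icc 0 1) t)

/-- There is a future-pointing causal path from `p` to `q`, that is, a concatenation of finitely
many (at least one) smooth ones. -/
def CausalLT (g : MetricField X) (Z : VecField X) : X → X → Prop :=
  Relation.TransGen (CausalStep g Z)

/-- `p = q`, or there is a future-pointing causal path from `p` to `q`. -/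
def CausalLE (g : MetricField X) (Z : VecField X) : X → X → Prop :=
  Relation.ReflTransGen (CausalStep g Z)

/-- The causal future `J⁺(A)`. -/
def causalFuture (g : MetricField X) (Z : VecField X) (A : Set X) : Set X :=
  {q | ∃ p ∈ A, CausalLE g Z p q}

/-- The causal past `J⁻(A)`. -/
def causalPast (g : MetricField X) (Z : VecField X) (A : Set X) : Set X :=
  {p | ∃ q ∈ A, CausalLE g Z p q}

/-- The causality conditions of global hyperbolicity, for the time orientation `Z`: there are no
closed causal paths, and the causal diamonds `J⁺(p) ∩ J⁻(q)`, `p < q`, are compact. -/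
structure IsCausallyHyperbolic (g : MetricField X) (Z : VecField X) : Prop where
  no_closed : ∀ p, ¬ CausalLT g Z p p
  compact_diamond : ∀ p q, CausalLT g Z p q →
    IsCompact (causalFuture g Z {p} ∩ causalPast g Z {q})

/-- `(X, g)` is a globally hyperbolic Lorentzian manifold: `g` is a smooth Lorentzian metric on
`X`, which is time-orientable, has no closed causal paths and has compact causal diamonds. -/
structure IsGloballyHyperbolic [IsManifold I₄ ∞ X] (g : MetricField X) : Prop where
  lorentzian : IsLorentzianOn g univ
  causal : ∃ Z : VecField X, IsTimeOrientation g Z ∧ IsCausallyHyperbolic g Z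

/-- `μ : (a, b) → X` is a smooth timelike curve without past and future endpoints. -/
structure IsInextendibleTimelike (g : MetricField X) (a b : ℝ) (μ : ℝ → X) : Prop where
  lt : a < b
  smooth : ContMDiffOn 𝓘(ℝ, ℝ) I₄ ∞ μ (Ioo a b)
  timelike : ∀ t ∈ Ioo a b,
    g (μ t) (velocity μ (Ioo a b) t) (velocity μ (Ioo a b) t) < 0
  no_past_endpoint : ¬ ∃ p, Tendsto μ (𝓝[>] a) (𝓝 p)
  no_future_endpoint : ¬ ∃ p, Tendsto μ (𝓝[<] b) (𝓝 p)

/-- `S` is a Cauchy surface: every inextendible timelike curve meets `S` exactly once. -/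
def IsCauchySurface (g : MetricField X) (S : Set X) : Prop :=
  ∀ (a b : ℝ) (μ : ℝ → X), IsInextendibleTimelike g a b μ → ∃! t, t ∈ Ioo a b ∧ μ t ∈ S

/-- The pull-back of a bilinear form by a linear map. -/
def pullback {V W : Type*} [AddCommGroup V] [Module ℝ V] [TopologicalSpace V]
    [AddCommGroup W] [Module ℝ W] [TopologicalSpace W]
    [IsTopologicalAddGroup V] [ContinuousConstSMul ℝ V]
    [IsTopologicalAddGroup W] [ContinuousConstSMul ℝ W]
    (B : W →L[ℝ] W →L[ℝ] ℝ) (L : V →L[ℝ] W) : V →L[ℝ] V →L[ℝ] ℝ :=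
  ContinuousLinearMap.precomp ℝ L ∘L B ∘L L

@[simp]
lemma pullback_apply {V W : Type*} [AddCommGroup V] [Module ℝ V] [TopologicalSpace V]
    [AddCommGroup W] [Module ℝ W] [TopologicalSpace W]
    [IsTopologicalAddGroup V] [ContinuousConstSMul ℝ V]
    [IsTopologicalAddGroup W] [ContinuousConstSMul ℝ W]
    (B : W →L[ℝ] W →L[ℝ] ℝ) (L : V →L[ℝ] W) (v w : V) :
    pullback B L v w = B (L v) (L w) := rfl

end Causality

/-! ### The Penrose map from Minkowski space to `ℝ × S³` -/

/-- Minkowski space `ℝ × ℝ³`, with points `(t, y)`. -/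
abbrev Minkowski : Type := ℝ × E3

/-- The unit sphere `S³` in `ℝ⁴`. -/
abbrev S3 : Type := Metric.sphere (0 : E4) 1

/-- The cylinder `ℝ × S³`, with points `(T, x)`. -/
abbrev Cyl : Type := ℝ × S3

lemma finrank_E4 : Fact (Module.finrank ℝ E4 = 3 + 1) :=
  ⟨by simp⟩

/-- The coordinate `v = t + r`, `r = |y|`. -/
def vCoord (x : Minkowski) : ℝ := x.1 + ‖x.2‖
/-- The coordinate `u = t - r`, `r = |y|`. -/
def uCoord (x : Minkowski) : ℝ := x.1 - ‖x.2‖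

/-- The conformal factor `Ω > 0`, `Ω² = 4 (1 + v²)⁻¹ (1 + u²)⁻¹`. -/
def conformalFactor (x : Minkowski) : ℝ :=
  2 / √((1 + vCoord x ^ 2) * (1 + uCoord x ^ 2))

/-- `T = arctan v + arctan u`. -/
def penroseT (x : Minkowski) : ℝ := Real.arctan (vCoord x) + Real.arctan (uCoord x)
/-- `R = arctan v - arctan u`. -/
def penroseR (x : Minkowski) : ℝ := Real.arctan (vCoord x) - Real.arctan (uCoord x)

/-- The point of `S³` at distance `R` from the north pole `(1, 0, 0, 0)` in the direction of `y`
(for `y = 0` it is used with `R = 0` only). -/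
def polar (R : ℝ) (y : E3) : E4 :=
  WithLp.toLp 2 (Fin.cons (Real.cos R) fun i ↦ Real.sin R * (‖y‖⁻¹ * y i))

/-- The auxiliary function `Ω / 2`. -/
def cc (x : Minkowski) : ℝ := Real.cos (Real.arctan (vCoord x)) * Real.cos (Real.arctan (uCoord x))

lemma cc_pos (x : Minkowski) : 0 < cc x :=
  mul_pos (Real.cos_arctan_pos _) (Real.cos_arctan_pos _)

lemma sin_arctan' (v : ℝ) : Real.sin (Real.arctan v) = v * Real.cos (Real.arctan v) := by
  rw [Real.sin_arctan, Real.cos_arctan]; ring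

lemma sin_penroseR (x : Minkowski) : Real.sin (penroseR x) = 2 * cc x * ‖x.2‖ := by
  simp only [penroseR, Real.sin_sub, sin_arctan', cc, vCoord, uCoord]; ring

lemma cos_penroseR (x : Minkowski) :
    Real.cos (penroseR x) = cc x * (1 + x.1 ^ 2 - ‖x.2‖ ^ 2) := by
  simp only [penroseR, Real.cos_sub, sin_arctan', cc, vCoord, uCoord]; ring

lemma sin_penroseT (x : Minkowski) : Real.sin (penroseT x) = 2 * cc x * x.1 := by
  simp only [penroseT, Real.sin_add, sin_arctan', cc, vCoord, uCoord]; ring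

lemma cos_penroseT (x : Minkowski) :
    Real.cos (penroseT x) = cc x * (1 - x.1 ^ 2 + ‖x.2‖ ^ 2) := by
  simp only [penroseT, Real.cos_add, sin_arctan', cc, vCoord, uCoord]; ring

lemma cc_eq (x : Minkowski) :
    cc x = (√(1 + 2 * (x.1 ^ 2 + ‖x.2‖ ^ 2) + (x.1 ^ 2 - ‖x.2‖ ^ 2) ^ 2))⁻¹ := by
  simp only [cc, Real.cos_arctan, vCoord, uCoord]
  rw [one_div, one_div, ← mul_inv, ← Real.sqrt_mul (by positivity)]
  congr 2; ring

lemma contDiff_cc : ContDiff ℝ ∞ cc := by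
  have : cc = fun x : Minkowski ↦
      (√(1 + 2 * (x.1 ^ 2 + ‖x.2‖ ^ 2) + (x.1 ^ 2 - ‖x.2‖ ^ 2) ^ 2))⁻¹ := funext cc_eq
  rw [this]
  have h : ContDiff ℝ ∞ fun x : Minkowski ↦ ‖x.2‖ ^ 2 := contDiff_snd.norm_sq ℝ
  have h1 : ContDiff ℝ ∞ fun x : Minkowski ↦ x.1 ^ 2 := contDiff_fst.pow 2
  have h2 : ∀ x : Minkowski, 0 < 1 + 2 * (x.1 ^ 2 + ‖x.2‖ ^ 2) + (x.1 ^ 2 - ‖x.2‖ ^ 2) ^ 2 :=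
    fun x ↦ by positivity
  refine ContDiff.inv (ContDiff.sqrt ?_ fun x ↦ (h2 x).ne') fun x ↦ (Real.sqrt_pos.2 (h2 x)).ne'
  exact (contDiff_const.add (contDiff_const.mul (h1.add h))).add ((h1.sub h).pow 2)

lemma polar_eq (x : Minkowski) : polar (penroseR x) x.2 =
    WithLp.toLp 2 (Fin.cons (cc x * (1 + x.1 ^ 2 - ‖x.2‖ ^ 2)) fun i ↦ 2 * cc x * x.2 i) := by
  unfold polar
  congr 2
  · exact cos_penroseR x
  · ext i
    rw [sin_penroseR]
    by_cases h : ‖x.2‖ = 0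
    · have : x.2 = 0 := norm_eq_zero.1 h
      simp [this]
    · field_simp

lemma norm_E4_sq (a : ℝ) (y : Fin 3 → ℝ) :
    ‖(WithLp.toLp 2 (Fin.cons a y : Fin 4 → ℝ) : E4)‖ ^ 2 = a ^ 2 + ∑ i, y i ^ 2 := by
  rw [EuclideanSpace.norm_sq_eq, Fin.sum_univ_succ]
  simp

lemma polar_mem (R : ℝ) (y : E3) (h : y = 0 → Real.sin R = 0) :
    polar R y ∈ Metric.sphere (0 : E4) 1 := by
  rw [mem_sphere_zero_iff_norm, ← sq_eq_sq₀ (norm_nonneg _) zero_le_one, polar, norm_E4_sq]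
  simp only [mul_pow, ← Finset.mul_sum]
  by_cases hy : y = 0
  · have := Real.sin_sq_add_cos_sq R
    rw [h hy] at this ⊢
    simpa using this
  · have h1 : ∑ i, y i ^ 2 = ‖y‖ ^ 2 := by rw [EuclideanSpace.norm_sq_eq]; simp
    have h2 : ‖y‖ ≠ 0 := norm_ne_zero_iff.2 hy
    rw [h1]
    field_simp
    linarith [Real.sin_sq_add_cos_sq R]

/-- Penrose's conformal map `Φ : ℝ × ℝ³ → ℝ × S³`. -/
def penroseMap (x : Minkowski) : Cyl :=
  (penroseT x, ⟨polar (penroseR x) x.2, polar_mem _ _ fun h ↦ by simp [sin_penroseR, h]⟩)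

/-- The inverse of the Penrose map on its image. -/
def penroseInv (p : Cyl) : Minkowski :=
  ((Real.cos p.1 + p.2.1 0)⁻¹ * Real.sin p.1,
    WithLp.toLp 2 fun i ↦ (Real.cos p.1 + p.2.1 0)⁻¹ * p.2.1 i.succ)

/-- The Penrose compactification `Φ(ℝ × ℝ³)` of Minkowski space. -/
def physical : Set Cyl := range penroseMap

lemma penroseInv_penroseMap (x : Minkowski) : penroseInv (penroseMap x) = x := by
  have h := (cc_pos x).ne'
  have h0 : (penroseMap x).2.1 = WithLp.toLp 2
      (Fin.cons (cc x * (1 + x.1 ^ 2 - ‖x.2‖ ^ 2)) fun i ↦ 2 * cc x * x.2 i) := polar_eq x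
  have h1 : Real.cos (penroseMap x).1 + (penroseMap x).2.1 0 = 2 * cc x := by
    rw [h0]; simp only [penroseMap, cos_penroseT, Fin.cons_zero]; ring
  refine Prod.ext ?_ ?_
  · simp only [penroseInv, h1]
    simp only [penroseMap, sin_penroseT]
    field_simp
  · simp only [penroseInv, h1]
    rw [h0]
    ext i
    simp only [Fin.cons_succ]
    field_simp

/-- The distance of a point of `S³` from the north pole. -/
def polarAngle (x : S3) : ℝ := Real.arccos (x.1 0)

lemma polarAngle_penroseMap (x : Minkowski) : polarAngle (penroseMap x).2 = penroseR x := by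
  have hle : uCoord x ≤ vCoord x := by
    unfold uCoord vCoord; linarith [norm_nonneg x.2]
  have h1 := Real.arctan_mono hle
  have h2 := Real.arctan_lt_pi_div_two (vCoord x)
  have h3 := Real.neg_pi_div_two_lt_arctan (uCoord x)
  unfold polarAngle
  have : (penroseMap x).2.1 0 = Real.cos (penroseR x) := rfl
  rw [this, Real.arccos_cos] <;> unfold penroseR <;> linarith

lemma sphere_sq (x : S3) : x.1 0 ^ 2 + ∑ i : Fin 3, x.1 i.succ ^ 2 = 1 := by
  have h : ‖x.1‖ = 1 := mem_sphere_zero_iff_norm.1 x.2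
  have h2 := EuclideanSpace.norm_sq_eq x.1
  rw [h, Fin.sum_univ_succ] at h2
  simpa using h2.symm

lemma sphere_bound (x : S3) : -1 ≤ x.1 0 ∧ x.1 0 ≤ 1 := by
  have h := sphere_sq x
  have : 0 ≤ ∑ i : Fin 3, x.1 i.succ ^ 2 := Finset.sum_nonneg fun i _ ↦ sq_nonneg _
  constructor <;> nlinarith

lemma cos_polarAngle (x : S3) : Real.cos (polarAngle x) = x.1 0 :=
  Real.cos_arccos (sphere_bound x).1 (sphere_bound x).2

lemma continuous_polarAngle : Continuous polarAngle := by
  unfold polarAngle; fun_prop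

lemma penroseMap_penroseInv (p : Cyl) (h1 : p.1 + polarAngle p.2 < Real.pi)
    (h2 : -p.1 + polarAngle p.2 < Real.pi) : penroseMap (penroseInv p) = p := by
  obtain ⟨T, x⟩ := p
  simp only at h1 h2
  set R := polarAngle x with hR
  have hR0 : 0 ≤ R := Real.arccos_nonneg _
  have hRpi : R ≤ Real.pi := Real.arccos_le_pi _
  have hc : x.1 0 = Real.cos R := (cos_polarAngle x).symm
  set a := (T + R) / 2 with ha
  set b := (T - R) / 2 with hb
  have ha1 : 0 < Real.cos a := Real.cos_pos_of_mem_Ioo ⟨by linarith, by linarith⟩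
  have hb1 : 0 < Real.cos b := Real.cos_pos_of_mem_Ioo ⟨by linarith, by linarith⟩
  have hT : T = a + b := by rw [ha, hb]; ring
  have hRab : R = a - b := by rw [ha, hb]; ring
  have hω : Real.cos T + x.1 0 = 2 * (Real.cos a * Real.cos b) := by
    rw [hc, hT, hRab, Real.cos_add, Real.cos_sub]; ring
  have hωpos : 0 < 2 * (Real.cos a * Real.cos b) := by positivity
  have hsum : ∑ i : Fin 3, x.1 i.succ ^ 2 = Real.sin R ^ 2 := by
    have := sphere_sq x
    rw [hc] at this
    linarith [Real.sin_sq_add_cos_sq R]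
  have hsin : 0 ≤ Real.sin R := Real.sin_nonneg_of_nonneg_of_le_pi hR0 hRpi
  have hn : ‖(penroseInv (T, x)).2‖ = (2 * (Real.cos a * Real.cos b))⁻¹ * Real.sin R := by
    rw [← sq_eq_sq₀ (norm_nonneg _) (by positivity), EuclideanSpace.norm_sq_eq]
    simp only [penroseInv, hω, Real.norm_eq_abs, sq_abs, mul_pow, ← Finset.mul_sum, hsum]
  have h1' : (penroseInv (T, x)).1 = (2 * (Real.cos a * Real.cos b))⁻¹ * Real.sin T := by
    simp only [penroseInv, hω]
  have hv : Real.arctan (vCoord (penroseInv (T, x))) = a := by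
    have : vCoord (penroseInv (T, x)) = Real.tan a := by
      rw [vCoord, hn, h1', Real.tan_eq_sin_div_cos, hT, hRab, Real.sin_add, Real.sin_sub]
      field_simp; ring
    rw [this, Real.arctan_tan] <;> linarith
  have hu : Real.arctan (uCoord (penroseInv (T, x))) = b := by
    have : uCoord (penroseInv (T, x)) = Real.tan b := by
      rw [uCoord, hn, h1', Real.tan_eq_sin_div_cos, hT, hRab, Real.sin_add, Real.sin_sub]
      field_simp; ring
    rw [this, Real.arctan_tan] <;> linarith
  have hTT : penroseT (penroseInv (T, x)) = T := by rw [penroseT, hv, hu, hT]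
  have hRR : penroseR (penroseInv (T, x)) = R := by rw [penroseR, hv, hu, hRab]
  refine Prod.ext hTT (Subtype.ext ?_)
  change polar (penroseR (penroseInv (T, x))) (penroseInv (T, x)).2 = x.1
  rw [hRR]
  ext i
  refine Fin.cases ?_ (fun i ↦ ?_) i
  · simp [polar, hc]
  · simp only [polar, hn, Fin.cons_succ]
    simp only [penroseInv, hω]
    by_cases h0 : Real.sin R = 0
    · rw [h0] at hsum ⊢
      have := (Finset.sum_eq_zero_iff_of_nonneg (fun i _ ↦ sq_nonneg _)).1
        (hsum.trans (by norm_num)) i (Finset.mem_univ _)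
      simp only [pow_eq_zero_iff two_ne_zero] at this
      simp [this]
    · field_simp

lemma mem_physical_iff (p : Cyl) :
    p ∈ physical ↔ p.1 + polarAngle p.2 < Real.pi ∧ -p.1 + polarAngle p.2 < Real.pi := by
  constructor
  · rintro ⟨x, rfl⟩
    rw [polarAngle_penroseMap]
    have h2 := Real.arctan_lt_pi_div_two (vCoord x)
    have h3 := Real.neg_pi_div_two_lt_arctan (uCoord x)
    have : (penroseMap x).1 = penroseT x := rfl
    rw [this]
    unfold penroseT penroseR
    constructor <;> linarith
  · rintro ⟨h1, h2⟩
    exact ⟨_, penroseMap_penroseInv p h1 h2⟩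

lemma penroseT_eq (x : Minkowski) : penroseT x =
    2 * Real.arctan (2 * cc x * x.1 / (1 + cc x * (1 - x.1 ^ 2 + ‖x.2‖ ^ 2))) := by
  have h2 := Real.arctan_lt_pi_div_two (vCoord x)
  have h3 := Real.neg_pi_div_two_lt_arctan (uCoord x)
  have h2' := Real.arctan_lt_pi_div_two (uCoord x)
  have h3' := Real.neg_pi_div_two_lt_arctan (vCoord x)
  rw [← cos_penroseT, ← sin_penroseT]
  obtain ⟨s, hs⟩ : ∃ s, s = penroseT x / 2 := ⟨_, rfl⟩
  have hs1 : s < Real.pi / 2 := by rw [hs]; unfold penroseT; linarith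
  have hs2 : -(Real.pi / 2) < s := by rw [hs]; unfold penroseT; linarith
  have hT : penroseT x = 2 * s := by rw [hs]; ring
  have hc : 0 < Real.cos s := Real.cos_pos_of_mem_Ioo ⟨hs2, hs1⟩
  rw [hT, Real.sin_two_mul, Real.cos_two_mul]
  have : 2 * Real.sin s * Real.cos s / (1 + (2 * Real.cos s ^ 2 - 1)) = Real.tan s := by
    rw [Real.tan_eq_sin_div_cos]; field_simp; ring
  rw [this, Real.arctan_tan hs2 hs1]

lemma contDiff_penroseT : ContDiff ℝ ∞ penroseT := by
  rw [show penroseT = _ from funext penroseT_eq]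
  have h : ContDiff ℝ ∞ fun x : Minkowski ↦ ‖x.2‖ ^ 2 := contDiff_snd.norm_sq ℝ
  have h1 : ContDiff ℝ ∞ fun x : Minkowski ↦ x.1 := contDiff_fst
  have h3 : ∀ x : Minkowski, 1 + cc x * (1 - x.1 ^ 2 + ‖x.2‖ ^ 2) ≠ 0 := by
    intro x
    rw [← cos_penroseT]
    have h2 := Real.arctan_lt_pi_div_two (vCoord x)
    have h3 := Real.neg_pi_div_two_lt_arctan (uCoord x)
    have h2' := Real.arctan_lt_pi_div_two (uCoord x)
    have h3' := Real.neg_pi_div_two_lt_arctan (vCoord x)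
    have hc : 0 < Real.cos (penroseT x / 2) := Real.cos_pos_of_mem_Ioo
      ⟨by unfold penroseT; linarith, by unfold penroseT; linarith⟩
    have : Real.cos (penroseT x) = 2 * Real.cos (penroseT x / 2) ^ 2 - 1 := by
      rw [← Real.cos_two_mul]; ring_nf
    rw [this]
    have := pow_pos hc 2
    linarith
  refine contDiff_const.mul (ContDiff.arctan (ContDiff.div ?_ ?_ h3))
  · exact (contDiff_const.mul contDiff_cc).mul h1
  · exact contDiff_const.add (contDiff_cc.mul ((contDiff_const.sub (h1.pow 2)).add h))

lemma contDiff_polar : ContDiff ℝ ∞ fun x : Minkowski ↦ polar (penroseR x) x.2 := by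
  rw [show (fun x : Minkowski ↦ polar (penroseR x) x.2) = _ from funext polar_eq]
  have h : ContDiff ℝ ∞ fun x : Minkowski ↦ ‖x.2‖ ^ 2 := contDiff_snd.norm_sq ℝ
  have h1 : ContDiff ℝ ∞ fun x : Minkowski ↦ x.1 := contDiff_fst
  rw [contDiff_euclidean]
  intro i
  refine Fin.cases ?_ (fun i ↦ ?_) i
  · exact contDiff_cc.mul ((contDiff_const.add (h1.pow 2)).sub h)
  · have h4 : ContDiff ℝ ∞ fun x : Minkowski ↦ x.2 i :=
      (contDiff_euclidean.1 (contDiff_snd (𝕜 := ℝ) (E := ℝ) (F := E3))) i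
    exact (contDiff_const.mul contDiff_cc).mul h4

lemma contMDiff_penroseMap : ContMDiff I₄ I₄ ∞ penroseMap := by
  have := finrank_E4
  have key : ∀ {F : Type} [NormedAddCommGroup F] [NormedSpace ℝ F] {f : Minkowski → F},
      ContDiff ℝ ∞ f → ContMDiff I₄ 𝓘(ℝ, F) ∞ f := by
    intro F _ _ f hf
    have := hf.contMDiff
    rw [modelWithCornersSelf_prod, ← chartedSpaceSelf_prod] at this
    exact this
  exact (key contDiff_penroseT).prodMk (ContMDiff.codRestrict_sphere (key contDiff_polar) _)

lemma isOpen_physical : IsOpen physical := by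
  have : physical = {p : Cyl | p.1 + polarAngle p.2 < Real.pi} ∩
      {p | -p.1 + polarAngle p.2 < Real.pi} := by
    ext p; exact mem_physical_iff p
  rw [this]
  have := continuous_polarAngle
  exact (isOpen_lt (by fun_prop) continuous_const).inter (isOpen_lt (by fun_prop) continuous_const)

lemma physical_ne_zero {p : Cyl} (hp : p ∈ physical) : Real.cos p.1 + p.2.1 0 ≠ 0 := by
  obtain ⟨x, rfl⟩ := hp
  have : Real.cos (penroseMap x).1 + (penroseMap x).2.1 0 = 2 * cc x := by
    change Real.cos (penroseT x) + Real.cos (penroseR x) = _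
    rw [cos_penroseT, cos_penroseR]; ring
  rw [this]
  exact (mul_pos two_pos (cc_pos x)).ne'

lemma contMDiffOn_penroseInv : ContMDiffOn I₄ I₄ ∞ penroseInv physical := by
  have := finrank_E4
  have hc : ContMDiff (𝓡 3) 𝓘(ℝ, E4) ∞ (fun x : S3 ↦ (x : E4)) := contMDiff_coe_sphere
  have hc' : ContMDiff I₄ 𝓘(ℝ, E4) ∞ (fun p : Cyl ↦ (p.2 : E4)) := hc.comp contMDiff_snd
  have hi : ∀ i, ContMDiff I₄ 𝓘(ℝ, ℝ) ∞ (fun p : Cyl ↦ (p.2 : E4) i) := fun i ↦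
    ((contDiff_euclidean.1 (contDiff_id (𝕜 := ℝ) (E := E4))) i).contMDiff.comp hc'
  have hT : ContMDiff I₄ 𝓘(ℝ, ℝ) ∞ (fun p : Cyl ↦ p.1) := contMDiff_fst
  have hcos : ContMDiff I₄ 𝓘(ℝ, ℝ) ∞ (fun p : Cyl ↦ Real.cos p.1) :=
    Real.contDiff_cos.contMDiff.comp hT
  have hsin : ContMDiff I₄ 𝓘(ℝ, ℝ) ∞ (fun p : Cyl ↦ Real.sin p.1) :=
    Real.contDiff_sin.contMDiff.comp hT
  have hω : ContMDiffOn I₄ 𝓘(ℝ, ℝ) ∞ (fun p : Cyl ↦ (Real.cos p.1 + p.2.1 0)⁻¹) physical :=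
    ((hcos.add (hi 0)).contMDiffOn).inv₀ fun p hp ↦ physical_ne_zero hp
  refine ContMDiffOn.prodMk (hω.mul hsin.contMDiffOn) ?_
  have : ContMDiffOn I₄ 𝓘(ℝ, Fin 3 → ℝ) ∞
      (fun p : Cyl ↦ fun i : Fin 3 ↦ (Real.cos p.1 + p.2.1 0)⁻¹ * p.2.1 i.succ) physical := by
    rw [contMDiffOn_pi_space]
    exact fun i ↦ hω.mul (hi _).contMDiffOn
  exact (PiLp.contDiff_toLp (𝕜 := ℝ) (p := 2)).contMDiff.comp_contMDiffOn this

/-- The Penrose map as a homeomorphism onto its open image. -/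
def penrose : OpenPartialHomeomorph Minkowski Cyl where
  toFun := penroseMap
  invFun := penroseInv
  source := univ
  target := physical
  map_source' x _ := mem_range_self x
  map_target' _ _ := mem_univ _
  left_inv' x _ := penroseInv_penroseMap x
  right_inv' p hp := penroseMap_penroseInv p ((mem_physical_iff p).1 hp).1 ((mem_physical_iff p).1 hp).2
  continuousOn_toFun := contMDiff_penroseMap.continuous.continuousOn
  continuousOn_invFun := contMDiffOn_penroseInv.continuousOn
  open_source := isOpen_univ
  open_target := isOpen_physical

/-! ### The standard Lorentzian structure of `ℝ × S³` -/

/-- The form `-dT² + |dz|²` on `ℝ × ℝ⁴`. -/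
def ambientForm : (ℝ × E4) →L[ℝ] (ℝ × E4) →L[ℝ] ℝ :=
  pullback (innerSL ℝ) (ContinuousLinearMap.snd ℝ ℝ E4) -
    pullback (ContinuousLinearMap.mul ℝ ℝ) (ContinuousLinearMap.fst ℝ ℝ E4)

lemma ambientForm_apply (v w : ℝ × E4) :
    ambientForm v w = inner ℝ v.2 w.2 - v.1 * w.1 := rfl

/-- The inclusion of `ℝ × S³` in `ℝ × ℝ⁴`. -/
def cylIncl (p : Cyl) : ℝ × E4 := (p.1, p.2)

/-- The standard metric `-dT² + g_{S³}` of `ℝ × S³`, induced from `ℝ × ℝ⁴`. -/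
def cylMetric : MetricField Cyl := fun p ↦
  pullback (W := ℝ × E4) ambientForm (mfderiv I₄ 𝓘(ℝ, ℝ × E4) cylIncl p)

/-- The vector field `∂/∂T` on `ℝ × S³`. -/
def cylTime : VecField Cyl := fun _ ↦ ((1 : ℝ), (0 : E3))

lemma contMDiff_cylIncl : ContMDiff I₄ 𝓘(ℝ, ℝ × E4) ∞ cylIncl := by
  have := finrank_E4
  have hc : ContMDiff (𝓡 3) 𝓘(ℝ, E4) ∞ (fun x : S3 ↦ (x : E4)) := contMDiff_coe_sphere
  exact (contMDiff_fst (I := 𝓘(ℝ, ℝ)) (J := 𝓘(ℝ, E3))).prodMk_space (hc.comp contMDiff_snd)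

lemma mdifferentiableAt_cylIncl (p : Cyl) : MDifferentiableAt I₄ 𝓘(ℝ, ℝ × E4) cylIncl p :=
  contMDiff_cylIncl.mdifferentiableAt (by simp)

lemma mfderiv_cylIncl_time (p : Cyl) :
    mfderiv I₄ 𝓘(ℝ, ℝ × E4) cylIncl p (cylTime p) = ((1 : ℝ), (0 : E4)) := by
  have h1 : HasMFDerivAt 𝓘(ℝ, ℝ) I₄ (fun t : ℝ ↦ ((t, p.2) : Cyl)) p.1
      ((ContinuousLinearMap.id ℝ ℝ).prod 0) :=
    (hasMFDerivAt_id p.1).prodMk (hasMFDerivAt_const p.2 p.1)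
  have h2 := (mdifferentiableAt_cylIncl p).hasMFDerivAt.comp p.1 h1
  have h3 : HasFDerivAt (fun t : ℝ ↦ (t, (p.2 : E4)))
      ((ContinuousLinearMap.id ℝ ℝ).prod (0 : ℝ →L[ℝ] E4)) p.1 :=
    (hasFDerivAt_id p.1).prodMk (hasFDerivAt_const _ _)
  have h4 := hasMFDerivAt_unique h2 h3.hasMFDerivAt
  have h5 := congrArg (fun L : ℝ →L[ℝ] ℝ × E4 ↦ L 1) h4
  have h6 : ((ContinuousLinearMap.id ℝ ℝ).prod (0 : ℝ →L[ℝ] E4)) 1 = ((1 : ℝ), (0 : E4)) := by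
    simp
  exact h5.trans h6

/-- The velocity of a curve in `ℝ × S³`, seen in `ℝ × ℝ⁴`. -/
lemma hasDerivWithinAt_cyl {γ : ℝ → Cyl} {s : Set ℝ} {t : ℝ}
    (hγ : MDifferentiableWithinAt 𝓘(ℝ, ℝ) I₄ γ s t) :
    HasDerivWithinAt (fun t ↦ cylIncl (γ t))
      (mfderiv I₄ 𝓘(ℝ, ℝ × E4) cylIncl (γ t) (velocity γ s t)) s t := by
  have h := (mdifferentiableAt_cylIncl (γ t)).hasMFDerivAt.comp_hasMFDerivWithinAt t
    hγ.hasMFDerivWithinAt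
  let L : ℝ →L[ℝ] ℝ × E4 := (mfderiv I₄ 𝓘(ℝ, ℝ × E4) cylIncl (γ t)).comp
    (mfderivWithin 𝓘(ℝ, ℝ) I₄ γ s t)
  have h' : HasFDerivWithinAt (fun t ↦ cylIncl (γ t)) L s t :=
    hasMFDerivWithinAt_iff_hasFDerivWithinAt.1 h
  exact h'.hasDerivWithinAt

lemma isFutureCausal_cyl_iff (p : Cyl) (v : TangentSpace I₄ p) (a : ℝ) (b : E4)
    (hv : mfderiv I₄ 𝓘(ℝ, ℝ × E4) cylIncl p v = (a, b)) :
    IsFutureCausal cylMetric cylTime p v ↔ 0 < a ∧ ‖b‖ ≤ a := by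
  have h1 : cylMetric p v v = ‖b‖ ^ 2 - a * a := by
    have : cylMetric p v v = ambientForm (mfderiv I₄ 𝓘(ℝ, ℝ × E4) cylIncl p v)
      (mfderiv I₄ 𝓘(ℝ, ℝ × E4) cylIncl p v) := rfl
    rw [this, hv, ambientForm_apply, real_inner_self_eq_norm_sq]
  have h2 : cylMetric p (cylTime p) v = -a := by
    have : cylMetric p (cylTime p) v = ambientForm (mfderiv I₄ 𝓘(ℝ, ℝ × E4) cylIncl p (cylTime p))
      (mfderiv I₄ 𝓘(ℝ, ℝ × E4) cylIncl p v) := rfl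
    rw [this, hv, mfderiv_cylIncl_time, ambientForm_apply]
    simp
  unfold IsFutureCausal
  rw [h1, h2]
  constructor
  · rintro ⟨-, h, h'⟩
    exact ⟨by linarith, abs_le_of_sq_le_sq' (by nlinarith) (by linarith) |>.2⟩
  · rintro ⟨h, h'⟩
    refine ⟨?_, by nlinarith [norm_nonneg b], by linarith⟩
    rintro rfl
    rw [map_zero] at hv
    exact h.ne (congrArg Prod.fst hv)

open InnerProductGeometry in
lemma angle_le_of_step {p q : Cyl} (h : CausalStep cylMetric cylTime p q) :
    angle (p.2 : E4) (q.2 : E4) ≤ q.1 - p.1 := by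
  obtain ⟨γ, hγ, rfl, rfl, hc⟩ := h
  have hd : ∀ t ∈ Icc (0 : ℝ) 1, HasDerivWithinAt (fun t ↦ cylIncl (γ t))
      (mfderiv I₄ 𝓘(ℝ, ℝ × E4) cylIncl (γ t) (velocity γ (Icc 0 1) t)) (Icc 0 1) t := fun t ht ↦
    hasDerivWithinAt_cyl ((hγ t ht).mdifferentiableWithinAt (by simp))
  have hcs : ∀ t ∈ Icc (0 : ℝ) 1, ∃ (a : ℝ) (b : E4), HasDerivWithinAt (fun t ↦ (γ t).1) a (Icc 0 1) t ∧
      HasDerivWithinAt (fun t ↦ ((γ t).2 : E4)) b (Icc 0 1) t ∧ ‖b‖ ≤ a := by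
    intro t ht
    refine ⟨_, _, (hd t ht).fst, (hd t ht).snd, ?_⟩
    exact ((isFutureCausal_cyl_iff _ _ _ _ rfl).1 (hc t ht)).2
  choose! a b ha hb hab using hcs
  have hn : ∀ t, ‖((γ t).2 : E4)‖ = 1 := fun t ↦ mem_sphere_zero_iff_norm.1 (γ t).2.2
  have hne : ∀ t, ((γ t).2 : E4) ≠ 0 := fun t ↦ by
    rw [← norm_ne_zero_iff, hn]; exact one_ne_zero
  set f : ℝ → ℝ := fun t ↦ angle ((γ 0).2 : E4) ((γ t).2 : E4) with hf
  have hxc : ContinuousOn (fun t ↦ ((γ t).2 : E4)) (Icc 0 1) := fun t ht ↦ (hb t ht).continuousWithinAt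
  have hang : ∀ s ∈ Icc (0 : ℝ) 1, ContinuousOn (fun t ↦ angle ((γ s).2 : E4) ((γ t).2 : E4)) (Icc 0 1) := by
    intro s hs t ht
    have := continuousAt_angle (x := (((γ s).2 : E4), ((γ t).2 : E4))) (hne s) (hne t)
    exact this.comp_continuousWithinAt (f := fun t ↦ (((γ s).2 : E4), ((γ t).2 : E4)))
      (continuousWithinAt_const.prodMk (hxc t ht))
  suffices H : ∀ ε > 0, ∀ ⦃x⦄, x ∈ Icc (0 : ℝ) 1 → f x ≤ (γ x).1 - (γ 0).1 + ε * x by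
    refine le_of_forall_pos_le_add fun ε hε ↦ ?_
    have := H ε hε (x := 1) ⟨zero_le_one, le_rfl⟩
    simpa [hf] using this
  intro ε hε
  refine image_le_of_liminf_slope_right_lt_deriv_boundary' (f' := fun t ↦ ‖b t‖)
    (B' := fun t ↦ a t + ε) (hang 0 ⟨le_rfl, zero_le_one⟩) ?_ ?_ ?_ ?_ ?_
  · intro s hs r hr
    have hs' : s ∈ Icc (0 : ℝ) 1 := ⟨hs.1, hs.2.le⟩
    apply Eventually.frequently
    have hsub : ∀ᶠ z in 𝓝[>] s, z ∈ Icc (0 : ℝ) 1 ∧ s < z := by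
      have : Ioo s 1 ∈ 𝓝[>] s := Ioo_mem_nhdsGT hs.2
      filter_upwards [this] with z hz using ⟨⟨hs.1.trans hz.1.le, hz.2.le⟩, hz.1⟩
    have hle : 𝓝[>] s ≤ 𝓝[Icc 0 1] s := by
      rw [nhdsWithin, nhdsWithin]
      refine le_inf inf_le_left ?_
      exact le_principal_iff.2 (hsub.mono fun z hz ↦ hz.1)
    -- the angle between nearby points tends to zero
    set θ : ℝ → ℝ := fun z ↦ angle ((γ s).2 : E4) ((γ z).2 : E4) with hθ
    have hθ0 : Tendsto θ (𝓝[>] s) (𝓝 0) := by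
      have := ((hang s hs') s hs').mono_left hle
      simpa [hθ, angle_self (hne s)] using this
    have hslope : Tendsto (fun z ↦ ‖((γ z).2 : E4) - (γ s).2‖ / (z - s)) (𝓝[>] s) (𝓝 ‖b s‖) := by
      have h1 : HasDerivWithinAt (fun t ↦ ((γ t).2 : E4)) (b s) (Ioi s) s :=
        (hb s hs').mono_of_mem_nhdsWithin (hsub.mono fun z hz ↦ hz.1)
      have h2 := (hasDerivWithinAt_iff_tendsto_slope' (by simp)).1 h1
      refine h2.norm.congr' ?_
      filter_upwards [hsub] with z hz
      rw [slope_def_module, norm_smul, norm_inv, Real.norm_of_nonneg (by linarith [hz.2])]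
      field_simp
    have hfac : Tendsto (fun z ↦ ‖((γ z).2 : E4) - (γ s).2‖ / (z - s) / (1 - θ z ^ 2 / 4))
        (𝓝[>] s) (𝓝 ‖b s‖) := by
      have : Tendsto (fun z ↦ 1 - θ z ^ 2 / 4) (𝓝[>] s) (𝓝 1) := by
        have := ((hθ0.pow 2).div_const 4).const_sub 1
        simpa using this
      have h5 := hslope.div this one_ne_zero
      rw [div_one] at h5
      exact h5
    filter_upwards [hsub, hfac.eventually (gt_mem_nhds hr), hθ0.eventually (gt_mem_nhds (zero_lt_one))]
      with z hz hz1 hz2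
    refine lt_of_le_of_lt ?_ hz1
    have hzs : 0 < z - s := by linarith [hz.2]
    have hθn : 0 ≤ θ z := angle_nonneg _ _
    have hden : 0 < 1 - θ z ^ 2 / 4 := by nlinarith
    have hchord : θ z * (1 - θ z ^ 2 / 4) ≤ ‖((γ z).2 : E4) - (γ s).2‖ := by
      have hcos : ‖((γ z).2 : E4) - (γ s).2‖ ^ 2 = (2 * Real.sin (θ z / 2)) ^ 2 := by
        rw [norm_sub_sq_real, hn, hn, real_inner_comm, inner_eq_cos_angle_of_norm_eq_one (hn s) (hn z)]
        have : Real.cos (θ z) = 1 - 2 * Real.sin (θ z / 2) ^ 2 := by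
          have h1 := Real.cos_two_mul (θ z / 2)
          have h2 := Real.sin_sq_add_cos_sq (θ z / 2)
          rw [show 2 * (θ z / 2) = θ z by ring] at h1
          linarith
        change 1 ^ 2 - 2 * Real.cos (θ z) + 1 ^ 2 = _
        rw [this]; ring
      have hsn : 0 ≤ Real.sin (θ z / 2) :=
        Real.sin_nonneg_of_nonneg_of_le_pi (by linarith) (by linarith [Real.pi_gt_three])
      have heq := (sq_eq_sq₀ (norm_nonneg _) (by positivity)).1 hcos
      rw [heq]
      rcases hθn.eq_or_lt with h0 | h0
      · rw [← h0]; simp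
      · have := Real.sin_gt_sub_cube (x := θ z / 2) (by linarith)
        nlinarith [pow_pos h0 3]
    rw [slope_def_field]
    have htri : f z - f s ≤ θ z := by
      have := angle_le_angle_add_angle ((γ 0).2 : E4) ((γ s).2 : E4) ((γ z).2 : E4)
      simp only [hf, hθ]; linarith
    rw [div_div, div_le_div_iff₀ hzs (by positivity)]
    calc (f z - f s) * ((z - s) * (1 - θ z ^ 2 / 4))
        ≤ θ z * ((z - s) * (1 - θ z ^ 2 / 4)) := by gcongr
      _ = (θ z * (1 - θ z ^ 2 / 4)) * (z - s) := by ring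
      _ ≤ _ := by gcongr
  · simp [angle_self (hne 0)]
  · intro t ht
    exact (((ha t ht).continuousWithinAt).sub continuousWithinAt_const).add
      (by fun_prop)
  · intro t ht
    have h1 : HasDerivWithinAt (fun t ↦ (γ t).1) (a t) (Ici t) t :=
      (ha t ⟨ht.1, ht.2.le⟩).mono_of_mem_nhdsWithin (by
        have : Ico t 1 ∈ 𝓝[≥] t := Ico_mem_nhdsGE ht.2
        filter_upwards [this] with z hz using ⟨ht.1.trans hz.1, hz.2.le⟩)
    have h2 : HasDerivWithinAt (fun x : ℝ ↦ ε * x) ε (Ici t) t := by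
      simpa using (hasDerivWithinAt_id t (Ici t)).const_mul ε
    exact (h1.sub_const _).add h2
  · intro t ht _
    have := hab t ⟨ht.1, ht.2.le⟩
    linarith

open InnerProductGeometry in
lemma angle_le_of_causalLE {p q : Cyl} (h : CausalLE cylMetric cylTime p q) :
    angle (p.2 : E4) (q.2 : E4) ≤ q.1 - p.1 := by
  induction h with
  | refl =>
    have : (p.2 : E4) ≠ 0 := by
      rw [← norm_ne_zero_iff, mem_sphere_zero_iff_norm.1 p.2.2]; exact one_ne_zero
    simp [angle_self this]
  | tail _ h ih =>
    refine (angle_le_angle_add_angle _ _ _).trans ((add_le_add ih (angle_le_of_step h)).trans ?_)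
    linarith

lemma exists_orthogonal_unit (x : S3) : ∃ e : E4, ‖e‖ = 1 ∧ inner ℝ (x : E4) e = 0 := by
  have h : (Submodule.span ℝ {(x : E4)})ᗮ ≠ ⊥ := by
    intro h
    have h1 := Submodule.finrank_add_finrank_orthogonal (Submodule.span ℝ {(x : E4)})
    have hx : (x : E4) ≠ 0 := by
      rw [← norm_ne_zero_iff, mem_sphere_zero_iff_norm.1 x.2]; exact one_ne_zero
    have h2 := finrank_span_singleton (K := ℝ) hx
    rw [h, finrank_bot, finrank_euclideanSpace_fin] at h1
    omega
  obtain ⟨e, he, hne⟩ := Submodule.exists_mem_ne_zero_of_ne_bot h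
  refine ⟨‖e‖⁻¹ • e, ?_, ?_⟩
  · rw [norm_smul, norm_inv, norm_norm, inv_mul_cancel₀ (norm_ne_zero_iff.2 hne)]
  · rw [inner_smul_right, Submodule.mem_orthogonal_singleton_iff_inner_right.1 he, mul_zero]

open InnerProductGeometry in
lemma exists_great_circle (x y : S3) : ∃ e : E4, ‖e‖ = 1 ∧ inner ℝ (x : E4) e = 0 ∧
    (y : E4) = Real.cos (angle (x : E4) (y : E4)) • (x : E4) +
      Real.sin (angle (x : E4) (y : E4)) • e := by
  have hx : ‖(x : E4)‖ = 1 := mem_sphere_zero_iff_norm.1 x.2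
  have hy : ‖(y : E4)‖ = 1 := mem_sphere_zero_iff_norm.1 y.2
  set θ := angle (x : E4) (y : E4) with hθ
  have hin : inner ℝ (x : E4) (y : E4) = Real.cos θ := inner_eq_cos_angle_of_norm_eq_one hx hy
  have hnorm : ‖(y : E4) - Real.cos θ • (x : E4)‖ ^ 2 = Real.sin θ ^ 2 := by
    rw [norm_sub_sq_real, norm_smul, inner_smul_right, real_inner_comm, hin, hx, hy,
      Real.norm_eq_abs, mul_one, sq_abs]
    linarith [Real.sin_sq_add_cos_sq θ]
  by_cases h : Real.sin θ = 0
  · obtain ⟨e, he, hxe⟩ := exists_orthogonal_unit x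
    refine ⟨e, he, hxe, ?_⟩
    rw [h] at hnorm ⊢
    have : (y : E4) - Real.cos θ • (x : E4) = 0 := by
      rw [← norm_eq_zero]; exact pow_eq_zero_iff two_ne_zero |>.1 (hnorm.trans (by norm_num))
    rw [zero_smul, add_zero]
    exact sub_eq_zero.1 this
  · refine ⟨(Real.sin θ)⁻¹ • ((y : E4) - Real.cos θ • (x : E4)), ?_, ?_, ?_⟩
    · rw [norm_smul, ← sq_eq_sq₀ (by positivity) zero_le_one, mul_pow, hnorm, norm_inv,
        Real.norm_eq_abs, inv_pow, sq_abs]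
      field_simp
    · rw [inner_smul_right, inner_sub_right, inner_smul_right, hin, real_inner_self_eq_norm_sq, hx]
      ring
    · rw [smul_smul, mul_inv_cancel₀ h, one_smul]; abel

open InnerProductGeometry in
/-- The causal relation of `ℝ × S³`. -/
lemma cyl_causalLE_iff {p q : Cyl} :
    CausalLE cylMetric cylTime p q ↔ angle (p.2 : E4) (q.2 : E4) ≤ q.1 - p.1 := by
  refine ⟨angle_le_of_causalLE, fun h ↦ ?_⟩
  have hx : ‖(p.2 : E4)‖ = 1 := mem_sphere_zero_iff_norm.1 p.2.2
  have hy : ‖(q.2 : E4)‖ = 1 := mem_sphere_zero_iff_norm.1 q.2.2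
  set θ := angle (p.2 : E4) (q.2 : E4) with hθ
  have hθ0 : 0 ≤ θ := angle_nonneg _ _
  rcases (hθ0.trans h).eq_or_lt with h0 | h0
  · have hθz : θ = 0 := le_antisymm (h.trans h0.ge) hθ0
    have : p = q := by
      refine Prod.ext (by linarith) (Subtype.ext ?_)
      rw [← sub_eq_zero, ← norm_eq_zero, ← pow_eq_zero_iff two_ne_zero, norm_sub_sq_real, hx, hy,
        inner_eq_cos_angle_of_norm_eq_one hx hy, ← hθ, hθz, Real.cos_zero]
      norm_num
    rw [this]
    exact Relation.ReflTransGen.refl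
  · obtain ⟨e, he, hxe, hye⟩ := exists_great_circle p.2 q.2
    rw [← hθ] at hye
    have hmem : ∀ s : ℝ, Real.cos (s * θ) • (p.2 : E4) + Real.sin (s * θ) • e ∈
        Metric.sphere (0 : E4) 1 := by
      intro s
      rw [mem_sphere_zero_iff_norm, ← sq_eq_sq₀ (norm_nonneg _) zero_le_one, norm_add_sq_real,
        norm_smul, norm_smul, inner_smul_left, inner_smul_right, hxe, hx, he]
      simp
    set c : ℝ → E4 := fun s ↦ Real.cos (s * θ) • (p.2 : E4) + Real.sin (s * θ) • e with hc
    have hcd : ContDiff ℝ ∞ c := by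
      have h1 : ContDiff ℝ ∞ fun s : ℝ ↦ s * θ := contDiff_id.mul contDiff_const
      exact ((Real.contDiff_cos.comp h1).smul contDiff_const).add
        ((Real.contDiff_sin.comp h1).smul contDiff_const)
    set γ : ℝ → Cyl := fun s ↦ (p.1 + s * (q.1 - p.1), ⟨c s, hmem s⟩) with hγ
    have hT : ContDiff ℝ ∞ fun s : ℝ ↦ p.1 + s * (q.1 - p.1) :=
      contDiff_const.add (contDiff_id.mul contDiff_const)
    have hγs : ContMDiff 𝓘(ℝ, ℝ) I₄ ∞ γ := by
      have := finrank_E4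
      exact hT.contMDiff.prodMk (ContMDiff.codRestrict_sphere hcd.contMDiff hmem)
    refine Relation.ReflTransGen.single ⟨γ, hγs.contMDiffOn, ?_, ?_, fun t ht ↦ ?_⟩
    · refine Prod.ext (by simp [hγ]) (Subtype.ext (by simp [hγ, hc]))
    · refine Prod.ext (by simp [hγ]) (Subtype.ext (by simp [hγ, hc, hye.symm]))
    · have hu := (uniqueDiffOn_Icc (zero_lt_one (α := ℝ))) t ht
      have h1 := hasDerivWithinAt_cyl (s := Icc 0 1) ((hγs t).contMDiffWithinAt.mdifferentiableWithinAt (by simp))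
      have h2 : HasDerivAt (fun s : ℝ ↦ s * θ) θ t := by
        simpa using (hasDerivAt_id t).mul_const θ
      have h3 : HasDerivAt (fun s ↦ cylIncl (γ s)) ((q.1 - p.1),
          (-Real.sin (t * θ) * θ) • (p.2 : E4) + (Real.cos (t * θ) * θ) • e) t := by
        refine HasDerivAt.prodMk ?_ ?_
        · have h5 := ((hasDerivAt_id t).mul_const (q.1 - p.1)).const_add p.1
          rw [one_mul] at h5
          exact h5
        · exact (h2.cos.smul_const _).add (h2.sin.smul_const _)
      have h4 := hu.eq_deriv _ h1 h3.hasDerivWithinAt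
      refine (isFutureCausal_cyl_iff _ _ _ _ h4).2 ⟨h0, ?_⟩
      refine le_trans (le_of_eq ?_) h
      rw [← sq_eq_sq₀ (norm_nonneg _) hθ0, norm_add_sq_real,
        norm_smul, norm_smul, inner_smul_left, inner_smul_right, hxe, hx, he]
      simp only [mul_one, Real.norm_eq_abs, sq_abs, mul_zero, add_zero]
      linear_combination θ ^ 2 * Real.sin_sq_add_cos_sq (t * θ)

/-! ### The infinities of the Penrose compactification and the non-physical pieces -/

/-- The north pole of `S³`. -/
def northPole : S3 := ⟨EuclideanSpace.single 0 1, by simp⟩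

/-- The south pole of `S³`. -/
def southPole : S3 := -northPole

/-- Future time-like infinity `i₊`. -/
def iPlus : Cyl := (Real.pi, northPole)

/-- Past time-like infinity `i₋`. -/
def iMinus : Cyl := (-Real.pi, northPole)

/-- Space-like infinity `i₀`. -/
def iZero : Cyl := (0, southPole)

/-- Future light-like infinity `ℐ⁺`. -/
def scriPlus : Set Cyl := frontier physical ∩ {p | 0 < p.1 ∧ p.1 < Real.pi}

/-- Past light-like infinity `ℐ⁻`. -/
def scriMinus : Set Cyl := frontier physical ∩ {p | -Real.pi < p.1 ∧ p.1 < 0}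

/-- The non-physical piece `N⁺ = J⁺(ℐ⁺ ∪ i₀) \ J⁺(i₊)` of `ℝ × S³`. -/
def nPlus : Set Cyl :=
  causalFuture cylMetric cylTime (scriPlus ∪ {iZero}) \ causalFuture cylMetric cylTime {iPlus}

/-- The non-physical piece `N⁻ = J⁻(ℐ⁻ ∪ i₀) \ J⁻(i₋)` of `ℝ × S³`. -/
def nMinus : Set Cyl :=
  causalPast cylMetric cylTime (scriMinus ∪ {iZero}) \ causalPast cylMetric cylTime {iMinus}

section Pieces

open InnerProductGeometry

lemma angle_northPole (x : S3) : angle (northPole : E4) (x : E4) = polarAngle x := by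
  have hx : ‖(x : E4)‖ = 1 := mem_sphere_zero_iff_norm.1 x.2
  have hn : ‖(northPole : E4)‖ = 1 := mem_sphere_zero_iff_norm.1 northPole.2
  rw [angle, hx, hn, polarAngle]
  simp [northPole, EuclideanSpace.inner_single_left]

lemma angle_southPole (x : S3) : angle (southPole : E4) (x : E4) = Real.pi - polarAngle x := by
  rw [← angle_northPole, ← angle_neg_left]
  rfl

lemma polarAngle_nonneg (x : S3) : 0 ≤ polarAngle x := Real.arccos_nonneg _

lemma polarAngle_le_pi (x : S3) : polarAngle x ≤ Real.pi := Real.arccos_le_pi _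

lemma polarAngle_southPole : polarAngle southPole = Real.pi := by
  simp [polarAngle, southPole, northPole]

lemma frontier_physical_subset : frontier physical ⊆
    {p : Cyl | p.1 + polarAngle p.2 ≤ Real.pi ∧ -p.1 + polarAngle p.2 ≤ Real.pi ∧
      (Real.pi ≤ p.1 + polarAngle p.2 ∨ Real.pi ≤ -p.1 + polarAngle p.2)} := by
  intro p hp
  have hcont := continuous_polarAngle
  have hcl : closure physical ⊆
      {p : Cyl | p.1 + polarAngle p.2 ≤ Real.pi} ∩ {p | -p.1 + polarAngle p.2 ≤ Real.pi} := by
    refine closure_minimal (fun q hq ↦ ?_) ?_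
    · have := (mem_physical_iff q).1 hq
      exact ⟨this.1.le, this.2.le⟩
    · exact (isClosed_le (by fun_prop) continuous_const).inter
        (isClosed_le (by fun_prop) continuous_const)
  refine ⟨(hcl hp.1).1, (hcl hp.1).2, ?_⟩
  have h2 : p ∉ physical := by
    have := hp.2
    rwa [isOpen_physical.interior_eq] at this
  rw [mem_physical_iff] at h2
  by_contra hcon
  push Not at hcon
  exact h2 hcon

lemma mem_nPlus_iff (p : Cyl) :
    p ∈ nPlus ↔ Real.pi ≤ p.1 + polarAngle p.2 ∧ p.1 - polarAngle p.2 < Real.pi := by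
  have h1 : p ∈ causalFuture cylMetric cylTime {iPlus} ↔ Real.pi ≤ p.1 - polarAngle p.2 := by
    simp only [causalFuture, mem_singleton_iff, exists_eq_left, mem_ofPred_eq, cyl_causalLE_iff]
    simp only [iPlus, angle_northPole]
    constructor <;> intro h <;> linarith
  have h0 : CausalLE cylMetric cylTime iZero p ↔ Real.pi ≤ p.1 + polarAngle p.2 := by
    simp only [cyl_causalLE_iff, iZero, angle_southPole]
    constructor <;> intro h <;> linarith
  have h2 : p ∈ causalFuture cylMetric cylTime (scriPlus ∪ {iZero}) ↔
      Real.pi ≤ p.1 + polarAngle p.2 := by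
    constructor
    · rintro ⟨q, hq | hq, hqp⟩
      · obtain ⟨hf, hq0, hqpi⟩ := hq
        have h3 := frontier_physical_subset hf
        have h4 := angle_le_of_causalLE hqp
        have h5 := angle_le_angle_add_angle (northPole : E4) (p.2 : E4) (q.2 : E4)
        rw [angle_comm (p.2 : E4), angle_northPole, angle_northPole] at h5
        have h6 := polarAngle_le_pi q.2
        rcases h3.2.2 with h | h <;> linarith
      · rw [mem_singleton_iff.1 hq] at hqp
        exact h0.1 hqp
    · intro h
      exact ⟨iZero, Or.inr rfl, h0.2 h⟩
  rw [nPlus, Set.mem_sdiff, h1, h2, not_le]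

lemma mem_nMinus_iff (p : Cyl) :
    p ∈ nMinus ↔ Real.pi ≤ -p.1 + polarAngle p.2 ∧ -p.1 - polarAngle p.2 < Real.pi := by
  have h1 : p ∈ causalPast cylMetric cylTime {iMinus} ↔ Real.pi ≤ -p.1 - polarAngle p.2 := by
    simp only [causalPast, mem_singleton_iff, exists_eq_left, mem_ofPred_eq, cyl_causalLE_iff]
    rw [angle_comm]
    simp only [iMinus, angle_northPole]
    constructor <;> intro h <;> linarith
  have h0 : CausalLE cylMetric cylTime p iZero ↔ Real.pi ≤ -p.1 + polarAngle p.2 := by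
    rw [cyl_causalLE_iff, angle_comm]
    simp only [iZero, angle_southPole]
    constructor <;> intro h <;> linarith
  have h2 : p ∈ causalPast cylMetric cylTime (scriMinus ∪ {iZero}) ↔
      Real.pi ≤ -p.1 + polarAngle p.2 := by
    constructor
    · rintro ⟨q, hq | hq, hqp⟩
      · obtain ⟨hf, hq0, hqpi⟩ := hq
        have h3 := frontier_physical_subset hf
        have h4 := angle_le_of_causalLE hqp
        have h5 := angle_le_angle_add_angle (northPole : E4) (p.2 : E4) (q.2 : E4)
        rw [angle_northPole, angle_northPole] at h5
        have h6 := polarAngle_le_pi q.2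
        rcases h3.2.2 with h | h <;> linarith
      · rw [mem_singleton_iff.1 hq] at hqp
        exact h0.1 hqp
    · intro h
      exact ⟨iZero, Or.inr rfl, h0.2 h⟩
  rw [nMinus, Set.mem_sdiff, h1, h2, not_le]

lemma iZero_mem : iZero ∈ nPlus ∪ nMinus := by
  refine Or.inl ((mem_nPlus_iff _).2 ?_)
  simp only [iZero, polarAngle_southPole]
  constructor <;> linarith [Real.pi_pos]

lemma disjoint_physical : Disjoint physical (nPlus ∪ nMinus) := by
  rw [Set.disjoint_left]
  rintro p hp (h | h)
  · linarith [((mem_nPlus_iff p).1 h).1, ((mem_physical_iff p).1 hp).1]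
  · linarith [((mem_nMinus_iff p).1 h).1, ((mem_physical_iff p).1 hp).2]

lemma mem_frontier_physical {p : Cyl} (h : (p.1 + polarAngle p.2 = Real.pi ∧ 0 < p.1) ∨
    (-p.1 + polarAngle p.2 = Real.pi ∧ p.1 < 0)) : p ∈ frontier physical := by
  have hp : p ∉ physical := by
    rw [mem_physical_iff]
    rintro ⟨h1, h2⟩
    rcases h with h | h <;> linarith [h.1]
  refine ⟨?_, fun h' ↦ hp (interior_subset h')⟩
  -- approach `p` by moving its time coordinate towards zero
  have hR := polarAngle_nonneg p.2
  have hlim : Tendsto (fun s : ℝ ↦ ((1 - s) * p.1, p.2)) (𝓝[>] 0) (𝓝 p) := by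
    have : Continuous (fun s : ℝ ↦ (((1 - s) * p.1, p.2) : Cyl)) := by fun_prop
    have h2 := this.tendsto 0
    simp only [sub_zero, one_mul] at h2
    exact h2.mono_left nhdsWithin_le_nhds
  refine mem_closure_of_tendsto hlim ?_
  have : Ioo (0 : ℝ) 1 ∈ 𝓝[>] (0 : ℝ) := Ioo_mem_nhdsGT zero_lt_one
  filter_upwards [this] with s hs
  rw [mem_physical_iff]
  have hpi := polarAngle_le_pi p.2
  rcases h with ⟨h1, h2⟩ | ⟨h1, h2⟩
  · have h3 := mul_pos hs.1 h2
    have h4 : 0 < (1 - s) * p.1 := mul_pos (by linarith [hs.2]) h2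
    constructor <;> simp only <;> nlinarith
  · have h3 := mul_neg_of_pos_of_neg hs.1 h2
    have h4 : (1 - s) * p.1 < 0 := mul_neg_of_pos_of_neg (by linarith [hs.2]) h2
    constructor <;> simp only <;> nlinarith

/-- The part of `ℝ × S³` that is glued to the physical space-time is open. -/
lemma isOpen_collar {Vh : Set Cyl} (hV : IsOpen Vh)
    (hsub : scriPlus ∪ scriMinus ∪ {iZero} ⊆ Vh) :
    IsOpen (Vh ∩ physical ∪ (nPlus ∪ nMinus)) := by
  have hcont := continuous_polarAngle
  have heq : Vh ∩ physical ∪ (nPlus ∪ nMinus) =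
      (Vh ∩ ({p : Cyl | p.1 - polarAngle p.2 < Real.pi} ∩
        {p | -p.1 - polarAngle p.2 < Real.pi})) ∪
      (({p : Cyl | Real.pi < p.1 + polarAngle p.2} ∩ {p | p.1 - polarAngle p.2 < Real.pi}) ∪
       ({p : Cyl | Real.pi < -p.1 + polarAngle p.2} ∩ {p | -p.1 - polarAngle p.2 < Real.pi})) := by
    ext p
    have hR := polarAngle_nonneg p.2
    have hpi := polarAngle_le_pi p.2
    simp only [mem_union, mem_inter_iff, mem_physical_iff, mem_nPlus_iff, mem_nMinus_iff,
      mem_ofPred_eq]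
    constructor
    · rintro (⟨h1, h2, h3⟩ | ⟨h1, h2⟩ | ⟨h1, h2⟩)
      · exact Or.inl ⟨h1, by linarith, by linarith⟩
      · rcases h1.eq_or_lt with h | h
        · refine Or.inl ⟨hsub ?_, h2, by linarith⟩
          by_cases h0 : p.1 = 0
          · refine Or.inr ?_
            have hc := cos_polarAngle p.2
            rw [show polarAngle p.2 = Real.pi by linarith, Real.cos_pi] at hc
            refine Prod.ext h0 (Subtype.ext ?_)
            have hs := sphere_sq p.2
            rw [← hc] at hs
            have hz : ∑ i : Fin 3, p.2.1 i.succ ^ 2 = 0 := by linarith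
            have hz' := (Finset.sum_eq_zero_iff_of_nonneg (fun i _ ↦ sq_nonneg _)).1 hz
            ext i
            refine Fin.cases ?_ (fun i ↦ ?_) i
            · simp [iZero, southPole, northPole, ← hc]
            · have := hz' i (Finset.mem_univ _)
              simp only [pow_eq_zero_iff two_ne_zero] at this
              simp [iZero, southPole, northPole, this]
          · have hpos : 0 < p.1 := lt_of_le_of_ne (by linarith) (Ne.symm h0)
            exact Or.inl (Or.inl ⟨mem_frontier_physical (Or.inl ⟨h.symm, hpos⟩), hpos,
              by linarith⟩)
        · exact Or.inr (Or.inl ⟨h, h2⟩)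
      · rcases h1.eq_or_lt with h | h
        · refine Or.inl ⟨hsub ?_, by linarith, h2⟩
          by_cases h0 : p.1 = 0
          · refine Or.inr ?_
            have hc := cos_polarAngle p.2
            rw [show polarAngle p.2 = Real.pi by linarith, Real.cos_pi] at hc
            refine Prod.ext h0 (Subtype.ext ?_)
            have hs := sphere_sq p.2
            rw [← hc] at hs
            have hz : ∑ i : Fin 3, p.2.1 i.succ ^ 2 = 0 := by linarith
            have hz' := (Finset.sum_eq_zero_iff_of_nonneg (fun i _ ↦ sq_nonneg _)).1 hz
            ext i
            refine Fin.cases ?_ (fun i ↦ ?_) i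
            · simp [iZero, southPole, northPole, ← hc]
            · have := hz' i (Finset.mem_univ _)
              simp only [pow_eq_zero_iff two_ne_zero] at this
              simp [iZero, southPole, northPole, this]
          · have hneg : p.1 < 0 := lt_of_le_of_ne (by linarith) h0
            exact Or.inl (Or.inr ⟨mem_frontier_physical (Or.inr ⟨h.symm, hneg⟩), by linarith,
              hneg⟩)
        · exact Or.inr (Or.inr ⟨h, h2⟩)
    · rintro (⟨h1, h2, h3⟩ | ⟨h1, h2⟩ | ⟨h1, h2⟩)
      · by_cases h4 : Real.pi ≤ p.1 + polarAngle p.2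
        · exact Or.inr (Or.inl ⟨h4, h2⟩)
        · by_cases h5 : Real.pi ≤ -p.1 + polarAngle p.2
          · exact Or.inr (Or.inr ⟨h5, h3⟩)
          · exact Or.inl ⟨h1, not_le.1 h4, not_le.1 h5⟩
      · exact Or.inr (Or.inl ⟨h1.le, h2⟩)
      · exact Or.inr (Or.inr ⟨h1.le, h2⟩)
  rw [heq]
  refine (hV.inter ((isOpen_lt ?_ ?_).inter (isOpen_lt ?_ ?_))).union
    (((isOpen_lt ?_ ?_).inter (isOpen_lt ?_ ?_)).union
      ((isOpen_lt ?_ ?_).inter (isOpen_lt ?_ ?_))) <;> fun_prop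

end Pieces

/-! ### Asymptotically Minkowskian infinities -/

/-- `(V, g_V)` is a neighbourhood of the light-like infinity in Minkowski space with an
asymptotically Minkowskian metric. -/
def IsLightlikeInfinityNbhd (V : Set Minkowski) (gV : MetricField Minkowski) : Prop :=
  IsLorentzianOn gV V ∧ ∃ (Vh : Set Cyl) (gh : MetricField Cyl),
    IsOpen Vh ∧ scriPlus ∪ scriMinus ∪ {iZero} ⊆ Vh ∧
    V = penroseMap ⁻¹' (Vh ∩ physical) ∧
    IsLorentzianOn gh Vh ∧ (∀ p ∈ Vh \ physical, gh p = cylMetric p) ∧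
    ∀ x ∈ V, conformalFactor x ^ 2 • gV x =
      pullback (gh (penroseMap x)) (mfderiv I₄ I₄ penroseMap x)

/-- An asymptotically Minkowskian infinity `E` of `(M, g)`, with time orientation `Z`, that is
visible in the whole space-time: an open subset `E = iso.source` of `M`, an isometry `iso` of
`(E, g)` onto a neighbourhood `(V, g_V)`, `V = iso.target`, of the light-like infinity in Minkowski
space with an asymptotically Minkowskian metric, such that `J⁺(E) = J⁻(E) = M`. -/
structure MinkowskianInfinity {M : Type*} [TopologicalSpace M] [ChartedSpace ModelH M]
    (g : MetricField M) (Z : VecField M) where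
  /-- the isometry, defined on `E = iso.source` -/
  iso : OpenPartialHomeomorph M Minkowski
  smooth_iso : ContMDiffOn I₄ I₄ ∞ iso iso.source
  smooth_symm : ContMDiffOn I₄ I₄ ∞ iso.symm iso.target
  /-- the metric `g_V` on `V = iso.target` -/
  gV : MetricField Minkowski
  isometry : ∀ m ∈ iso.source, g m = pullback (gV (iso m)) (mfderiv I₄ I₄ iso m)
  nbhd : IsLightlikeInfinityNbhd iso.target gV
  visible_future : causalFuture g Z iso.source = univ
  visible_past : causalPast g Z iso.source = univ

namespace MinkowskianInfinity

variable {M : Type*} [TopologicalSpace M] [ChartedSpace ModelH M]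
  {g : MetricField M} {Z : VecField M} (𝓔 : MinkowskianInfinity g Z)

/-- The conformal identification `ψ` of `E` with a subset of `ℝ × S³`. -/
def psi : OpenPartialHomeomorph M Cyl := 𝓔.iso.trans penrose

lemma psi_source : 𝓔.psi.source = 𝓔.iso.source := by
  simp [psi, penrose]

lemma psi_target : 𝓔.psi.target = penroseMap '' 𝓔.iso.target := by
  ext p
  simp only [psi, OpenPartialHomeomorph.trans_target, mem_inter_iff, mem_preimage, mem_image]
  constructor
  · rintro ⟨h1, h2⟩
    exact ⟨penrose.symm p, h2, penrose.right_inv h1⟩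
  · rintro ⟨x, hx, rfl⟩
    refine ⟨mem_range_self x, ?_⟩
    have : penrose.symm (penroseMap x) = x := penroseInv_penroseMap x
    rwa [this]

lemma psi_target_subset : 𝓔.psi.target ⊆ physical := by
  rw [psi_target]
  rintro _ ⟨x, _, rfl⟩
  exact mem_range_self x

lemma disjoint_target : Disjoint 𝓔.psi.target (nPlus ∪ nMinus) :=
  disjoint_physical.mono_left 𝓔.psi_target_subset

lemma contMDiffOn_psi : ContMDiffOn I₄ I₄ ∞ 𝓔.psi 𝓔.psi.source := by
  rw [psi_source]
  exact contMDiff_penroseMap.comp_contMDiffOn 𝓔.smooth_iso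

lemma contMDiffOn_psi_symm : ContMDiffOn I₄ I₄ ∞ 𝓔.psi.symm 𝓔.psi.target := by
  refine 𝓔.smooth_symm.comp (contMDiffOn_penroseInv.mono 𝓔.psi_target_subset) ?_
  rw [psi_target]
  rintro _ ⟨x, hx, rfl⟩
  change penroseInv (penroseMap x) ∈ 𝓔.iso.target
  rwa [penroseInv_penroseMap]

/-- The part `ψ(E) ∪ N⁺ ∪ N⁻` of `ℝ × S³`. -/
def collar : Set Cyl := 𝓔.psi.target ∪ (nPlus ∪ nMinus)

lemma isOpen_collar : IsOpen 𝓔.collar := by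
  obtain ⟨-, Vh, gh, hV, hsub, hVV, -⟩ := 𝓔.nbhd
  have : 𝓔.psi.target = Vh ∩ physical := by
    rw [psi_target, hVV, image_preimage_eq_inter_range]
    exact inter_eq_left.2 inter_subset_right
  rw [collar, this]
  exact Penrose.isOpen_collar hV hsub

/-! ### The extended manifold -/

/-- The set `N_ext = N ∪ N⁺ ∪ N⁻`, where `N = M` as a set. -/
inductive Ext (𝓔 : MinkowskianInfinity g Z) : Type _
  | incl (m : M) : Ext 𝓔
  | nonphys (p : Cyl) (hp : p ∈ nPlus ∪ nMinus) : Ext 𝓔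

/-- The inclusion of `N = M` in `N_ext`. -/
abbrev incl (m : M) : 𝓔.Ext := Ext.incl m

open Classical in
/-- The inclusion of `ψ(E) ∪ N⁺ ∪ N⁻ ⊆ ℝ × S³` in `N_ext`, which identifies `ψ(E)` with `E`
(the values outside this set are irrelevant). -/
def glue (p : Cyl) : 𝓔.Ext :=
  if h : p ∈ nPlus ∪ nMinus then Ext.nonphys p h else Ext.incl (𝓔.psi.symm p)

/-- The inverse of `incl` (the values on `N⁺ ∪ N⁻` are irrelevant). -/
def toM : 𝓔.Ext → M
  | Ext.incl m => m
  | Ext.nonphys p _ => 𝓔.psi.symm p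

/-- The inverse of `glue` on `E ∪ N⁺ ∪ N⁻` (the values outside this set are irrelevant). -/
def toCyl : 𝓔.Ext → Cyl
  | Ext.incl m => 𝓔.psi m
  | Ext.nonphys p _ => p

/-- The point `i₀` of `N_ext`. -/
def iZeroExt : 𝓔.Ext := Ext.nonphys iZero iZero_mem

lemma glue_of_mem {p : Cyl} (h : p ∈ nPlus ∪ nMinus) : 𝓔.glue p = Ext.nonphys p h := dif_pos h

lemma glue_of_target {p : Cyl} (h : p ∈ 𝓔.psi.target) : 𝓔.glue p = 𝓔.incl (𝓔.psi.symm p) :=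
  dif_neg (Set.disjoint_left.1 𝓔.disjoint_target h)

lemma toCyl_glue {p : Cyl} (h : p ∈ 𝓔.collar) : 𝓔.toCyl (𝓔.glue p) = p := by
  rcases h with h | h
  · rw [glue_of_target _ h]; exact 𝓔.psi.right_inv h
  · rw [glue_of_mem _ h]; rfl

/-- A subset of `N_ext` is open when its parts in `N` and in `ψ(E) ∪ N⁺ ∪ N⁻` are open. -/
instance : TopologicalSpace 𝓔.Ext where
  IsOpen O := IsOpen (𝓔.incl ⁻¹' O) ∧ IsOpen (𝓔.collar ∩ 𝓔.glue ⁻¹' O)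
  isOpen_univ := ⟨isOpen_univ, by simpa using 𝓔.isOpen_collar⟩
  isOpen_inter s t hs ht := ⟨hs.1.inter ht.1, by
    have := hs.2.inter ht.2
    rwa [← inter_inter_distrib_left] at this⟩
  isOpen_sUnion S hS := by
    refine ⟨?_, ?_⟩
    · rw [preimage_sUnion]
      exact isOpen_biUnion fun s hs ↦ (hS s hs).1
    · rw [preimage_sUnion, inter_iUnion₂]
      exact isOpen_biUnion fun s hs ↦ (hS s hs).2

lemma isOpen_iff {O : Set 𝓔.Ext} :
    IsOpen O ↔ IsOpen (𝓔.incl ⁻¹' O) ∧ IsOpen (𝓔.collar ∩ 𝓔.glue ⁻¹' O) := Iff.rfl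

/-- `N` as an open subset of `N_ext`. -/
def homeoM : OpenPartialHomeomorph 𝓔.Ext M where
  toFun := 𝓔.toM
  invFun := 𝓔.incl
  source := range 𝓔.incl
  target := univ
  map_source' _ _ := mem_univ _
  map_target' m _ := mem_range_self m
  left_inv' := by rintro _ ⟨m, rfl⟩; rfl
  right_inv' _ _ := rfl
  open_source := by
    rw [isOpen_iff]
    refine ⟨by rw [preimage_range]; exact isOpen_univ, ?_⟩
    convert 𝓔.psi.open_target using 1
    ext p
    constructor
    · rintro ⟨h | h, m, hm⟩
      · exact h
      · rw [glue_of_mem _ h] at hm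
        cases hm
    · intro h
      exact ⟨Or.inl h, 𝓔.psi.symm p, (𝓔.glue_of_target h).symm⟩
  open_target := isOpen_univ
  continuousOn_toFun := by
    have key : ∀ W : Set M, IsOpen W → IsOpen (range 𝓔.incl ∩ 𝓔.toM ⁻¹' W) := by
      intro W hW
      rw [isOpen_iff]
      constructor
      · convert hW using 1
        ext m
        exact ⟨fun h ↦ h.2, fun h ↦ ⟨mem_range_self m, h⟩⟩
      · convert 𝓔.psi.symm.isOpen_inter_preimage hW using 1
        ext p
        constructor
        · rintro ⟨h | h, ⟨m, hm⟩, hW⟩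
          · refine ⟨h, ?_⟩
            rw [mem_preimage, glue_of_target _ h] at hW
            exact hW
          · rw [glue_of_mem _ h] at hm
            cases hm
        · rintro ⟨h, hW⟩
          refine ⟨Or.inl h, ⟨_, (𝓔.glue_of_target h).symm⟩, ?_⟩
          rw [mem_preimage, glue_of_target _ h]
          exact hW
    rw [continuousOn_iff']
    intro W hW
    exact ⟨_, key W hW, by ext; simp only [mem_inter_iff]; tauto⟩
  continuousOn_invFun := by
    refine Continuous.continuousOn ⟨fun O hO ↦ ?_⟩
    exact (𝓔.isOpen_iff.1 hO).1

/-- `E ∪ N⁺ ∪ N⁻` as an open subset of `N_ext`, identified with a subset of `ℝ × S³`. -/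
def homeoCyl : OpenPartialHomeomorph 𝓔.Ext Cyl where
  toFun := 𝓔.toCyl
  invFun := 𝓔.glue
  source := 𝓔.glue '' 𝓔.collar
  target := 𝓔.collar
  map_source' := by
    rintro _ ⟨p, hp, rfl⟩
    rwa [toCyl_glue _ hp]
  map_target' p hp := mem_image_of_mem _ hp
  left_inv' := by
    rintro _ ⟨p, hp, rfl⟩
    rw [toCyl_glue _ hp]
  right_inv' p hp := 𝓔.toCyl_glue hp
  open_source := by
    rw [isOpen_iff]
    constructor
    · convert 𝓔.psi.open_source using 1
      ext m
      constructor
      · rintro ⟨p, hp | hp, hpm⟩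
        · rw [glue_of_target _ hp] at hpm
          have : 𝓔.psi.symm p = m := Ext.incl.inj hpm
          rw [← this]
          exact 𝓔.psi.map_target hp
        · rw [glue_of_mem _ hp] at hpm
          cases hpm
      · intro hm
        refine ⟨𝓔.psi m, Or.inl (𝓔.psi.map_source hm), ?_⟩
        rw [glue_of_target _ (𝓔.psi.map_source hm), 𝓔.psi.left_inv hm]
    · convert 𝓔.isOpen_collar using 1
      exact inter_eq_left.2 fun p hp ↦ mem_image_of_mem _ hp
  open_target := 𝓔.isOpen_collar
  continuousOn_toFun := by
    have key : ∀ W : Set Cyl, IsOpen W → IsOpen (𝓔.glue '' 𝓔.collar ∩ 𝓔.toCyl ⁻¹' W) := by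
      intro W hW
      rw [isOpen_iff]
      constructor
      · convert 𝓔.psi.isOpen_inter_preimage hW using 1
        ext m
        constructor
        · rintro ⟨⟨p, hp | hp, hpm⟩, hmW⟩
          · rw [glue_of_target _ hp] at hpm
            have : 𝓔.psi.symm p = m := Ext.incl.inj hpm
            refine ⟨?_, hmW⟩
            rw [← this]
            exact 𝓔.psi.map_target hp
          · rw [glue_of_mem _ hp] at hpm
            cases hpm
        · rintro ⟨hm, hmW⟩
          refine ⟨⟨𝓔.psi m, Or.inl (𝓔.psi.map_source hm), ?_⟩, hmW⟩
          rw [glue_of_target _ (𝓔.psi.map_source hm), 𝓔.psi.left_inv hm]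
      · convert 𝓔.isOpen_collar.inter hW using 1
        ext p
        constructor
        · rintro ⟨hp, -, hpW⟩
          rw [mem_preimage, toCyl_glue _ hp] at hpW
          exact ⟨hp, hpW⟩
        · rintro ⟨hp, hpW⟩
          refine ⟨hp, mem_image_of_mem _ hp, ?_⟩
          rwa [mem_preimage, toCyl_glue _ hp]
    rw [continuousOn_iff']
    intro W hW
    exact ⟨_, key W hW, by ext; simp only [mem_inter_iff]; tauto⟩
  continuousOn_invFun := by
    rw [continuousOn_iff']
    intro O hO
    exact ⟨_, (𝓔.isOpen_iff.1 hO).2, by ext; simp only [mem_inter_iff]; tauto⟩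

/-- The atlas of `N_ext`: the charts of `N`, and the charts of `ℝ × S³` on `E ∪ N⁺ ∪ N⁻`. -/
instance : ChartedSpace ModelH 𝓔.Ext where
  atlas := {c | ∃ e ∈ atlas ModelH M, c = 𝓔.homeoM.trans e} ∪
    {c | ∃ e ∈ atlas ModelH Cyl, c = 𝓔.homeoCyl.trans e}
  chartAt
    | Ext.incl m => 𝓔.homeoM.trans (chartAt ModelH m)
    | Ext.nonphys p _ => 𝓔.homeoCyl.trans (chartAt ModelH p)
  mem_chart_source
    | Ext.incl m => by
      exact ⟨mem_range_self m, mem_chart_source ModelH m⟩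
    | Ext.nonphys p hp => by
      exact ⟨⟨p, Or.inr hp, 𝓔.glue_of_mem hp⟩, mem_chart_source ModelH p⟩
  chart_mem_atlas
    | Ext.incl m => Or.inl ⟨_, chart_mem_atlas _ _, rfl⟩
    | Ext.nonphys _ _ => Or.inr ⟨_, chart_mem_atlas _ _, rfl⟩

lemma contDiffOn_transition {X Y : Type*} [TopologicalSpace X] [ChartedSpace ModelH X]
    [IsManifold I₄ ∞ X] [TopologicalSpace Y] [ChartedSpace ModelH Y] [IsManifold I₄ ∞ Y]
    {f : X → Y} {s : Set X} (hf : ContMDiffOn I₄ I₄ ∞ f s)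
    {e : OpenPartialHomeomorph X ModelH} (he : e ∈ atlas ModelH X)
    {e' : OpenPartialHomeomorph Y ModelH} (he' : e' ∈ atlas ModelH Y)
    {c : ModelH → ModelH} {u : Set ModelH}
    (hu : ∀ z ∈ u, z ∈ e.target ∧ e.symm z ∈ s ∧ f (e.symm z) ∈ e'.source ∧
      c z = e' (f (e.symm z))) :
    ContDiffOn ℝ ∞ (I₄ ∘ c ∘ I₄.symm) (I₄.symm ⁻¹' u ∩ range I₄) := by
  have h := (contMDiffOn_iff_of_mem_maximalAtlas' (IsManifold.subset_maximalAtlas he)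
    (IsManifold.subset_maximalAtlas he') (s := e.symm '' u) (f := f) (n := ∞) ?_ ?_).1
    (hf.mono ?_)
  · refine (h.mono ?_).congr ?_
    · rintro y ⟨hy, hy'⟩
      refine ⟨_, mem_image_of_mem _ hy, ?_⟩
      simp only [OpenPartialHomeomorph.extend_coe, Function.comp_apply]
      rw [e.right_inv (hu _ hy).1]
      exact I₄.right_inv hy'
    · rintro y ⟨hy, hy'⟩
      simp only [Function.comp_apply, OpenPartialHomeomorph.extend_coe,
        OpenPartialHomeomorph.extend_coe_symm]
      rw [(hu (I₄.symm y) hy).2.2.2]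
  · rintro _ ⟨z, hz, rfl⟩
    exact e.map_target (hu z hz).1
  · rintro _ ⟨z, hz, rfl⟩
    exact (hu z hz).2.2.1
  · rintro _ ⟨z, hz, rfl⟩
    exact (hu z hz).2.1

instance [IsManifold I₄ ∞ M] : IsManifold I₄ ∞ 𝓔.Ext := by
  refine isManifold_of_contDiffOn I₄ ∞ _ ?_
  rintro c c' (⟨e, he, rfl⟩ | ⟨e, he, rfl⟩) (⟨e', he', rfl⟩ | ⟨e', he', rfl⟩)
  · refine contDiffOn_transition (f := id) (s := univ) contMDiffOn_id he he' ?_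
    rintro z ⟨⟨hz1, -⟩, -, hz2⟩
    exact ⟨hz1, mem_univ _, hz2, rfl⟩
  · refine contDiffOn_transition 𝓔.contMDiffOn_psi he he' ?_
    rintro z ⟨⟨hz1, -⟩, hz3, hz2⟩
    refine ⟨hz1, ?_, hz2, rfl⟩
    obtain ⟨p, hp | hp, hpm⟩ := hz3
    · rw [glue_of_target _ hp] at hpm
      have : 𝓔.psi.symm p = e.symm z := Ext.incl.inj hpm
      rw [← this]
      exact 𝓔.psi.map_target hp
    · rw [glue_of_mem _ hp] at hpm
      cases hpm
  · refine contDiffOn_transition 𝓔.contMDiffOn_psi_symm he he' ?_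
    rintro z ⟨⟨hz1, hz4⟩, hz3, hz2⟩
    have hz4' : e.symm z ∈ 𝓔.collar := hz4
    have ht : e.symm z ∈ 𝓔.psi.target := by
      rcases hz4' with h | h
      · exact h
      · obtain ⟨m, hm⟩ := hz3
        have hm' : 𝓔.incl m = 𝓔.glue (e.symm z) := hm
        rw [glue_of_mem _ h] at hm'
        cases hm'
    have hg : 𝓔.toM (𝓔.glue (e.symm z)) = 𝓔.psi.symm (e.symm z) := by
      rw [glue_of_target _ ht]; rfl
    refine ⟨hz1, ht, ?_, ?_⟩
    · have : 𝓔.toM (𝓔.glue (e.symm z)) ∈ e'.source := hz2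
      rwa [hg] at this
    · rw [← hg]; rfl
  · refine contDiffOn_transition (f := id) (s := univ) contMDiffOn_id he he' ?_
    rintro z ⟨⟨hz1, hz4⟩, hz3, hz2⟩
    have hg : 𝓔.toCyl (𝓔.glue (e.symm z)) = e.symm z := 𝓔.toCyl_glue hz4
    refine ⟨hz1, mem_univ _, ?_, ?_⟩
    · have : 𝓔.toCyl (𝓔.glue (e.symm z)) ∈ e'.source := hz2
      rwa [hg] at this
    · have : ((𝓔.homeoCyl.trans e).symm.trans (𝓔.homeoCyl.trans e')) z =
        e' (𝓔.toCyl (𝓔.glue (e.symm z))) := rfl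
      rw [this, hg]; rfl

/-- The metric of `N_ext`: on `N` it is the given metric `gN`, and on `N⁺ ∪ N⁻` it is the
standard metric of `ℝ × S³`. The tangent spaces of `N_ext` are identified with those of `N` and
`ℝ × S³` by the differentials of the local diffeomorphisms `toM` and `toCyl`. -/
def extMetric (gN : MetricField M) : MetricField 𝓔.Ext
  | Ext.incl m => pullback (gN m) (mfderiv I₄ I₄ 𝓔.toM (𝓔.incl m))
  | Ext.nonphys p hp => pullback (cylMetric p) (mfderiv I₄ I₄ 𝓔.toCyl (Ext.nonphys p hp))

end MinkowskianInfinity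

/-- The conformal metric `ω² g`. -/
def conformalMetric {M : Type*} [TopologicalSpace M] [ChartedSpace ModelH M]
    (ωM : M → ℝ) (g : MetricField M) : MetricField M := fun m ↦ ωM m ^ 2 • g m

end Penrose

end

open Penrose

/-! Write `σ = ±1` for a direction of time and `N^σ` for the corresponding piece `N⁺` or `N⁻`.
Reversing time exchanges the two pieces, so each argument is made for one sign and used for both.

Topology and metric. On the physical region the conformal factor is `cos T + cos R`, and this
function is nonpositive on `N⁺ ∪ N⁻`. Hence `ωM` extends to a continuous function on the extension
that is positive exactly on `N`, and it separates `N` from the new points (`t2Space`). The glued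
metric is smooth because the metric that extends `Ω² g_V` across `ℐ⁺ ∪ ℐ⁻ ∪ {i₀}` is standard
outside the physical region (`exists_collarMetric`). The orientation of `N` can differ from `∂/∂T`
near the new points only by one global sign, since `ℐ⁺` and `ℐ⁻` are connected and both adhere to
`i₀` (`exists_sign_near_nonphysical`). Once this sign is corrected, a partition of unity produces a
time orientation of the extension (`exists_isExtension`).

The decisive fact is that no future-directed causal curve leaves `N⁺` and, dually, no past-directed
one leaves `N⁻`. Near `N⁺` the metric differs from the standard one by at most a multiple of the
distance to `N⁺`, so the defect `f = π - R - T` grows along a causal curve at a rate of at most `C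
max(f, 0)`, and Grönwall's inequality keeps it nonpositive (`exists_forall_mem_nSig`,
`mem_extN_of_leIn`). Two consequences follow. A causal path between points of `N` stays in `N`, so
the causal relation of the extension induces that of `N` there. Inside `N^σ` the relation is the
explicit one of `ℝ × S³`: angle at most time difference (`leIn_iff`). In particular no causal path
is closed.

For compactness of diamonds, take an ultrafilter on points between `p` and `q`. If `p ∉ N⁻` and `q ∉
N⁺`, both have neighbourhoods bounded by points of `N`, and a compact diamond of `N` gives the limit
(`exists_tendsto_of_notMem`). If `q ∈ N⁺`, the past of `q` within `N⁺` is compact; a path to `q`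
either stays in a compact neighbourhood `K` of it, or enters `K` for the last time at a point whose
limit lies outside `N⁺` (`tendsto_or_exists`), which reduces to the first case. The case `p ∈ N⁻` is
dual.

These limits must again be causally related, which needs the causal relation to be locally closed.
That comes from geodesics: in a small chart, any two points are joined by a geodesic given by the
Hamiltonian flow of the inverse metric, and the gradient of the world function of a point is its
final momentum (`exists_geodesics`). So this function stays negative along causal paths once it is
negative (`ham_neg_of_step`), and limits of causally related points are joined by a causal geodesic
(`exists_closed_nhds`).

Cauchy surfaces. An inextendible timelike curve through `i₀` comes from `N⁻` and continues in `N⁺`,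
so it misses `N` and meets `i₀` once. Any other one must visit `N`: since `N⁺ ∩ N⁻ = {i₀}`, it would
otherwise remain in a single piece `N^σ`, where bounded time and the light cones force an endpoint.
Its part in `N` is a single interval, inextendible in `N`, and meets the given Cauchy surface once
(`existsUnique_mem`). -/

noncomputable section

namespace Penrose

set_option linter.unusedSectionVars false

/-! ### Lorentzian linear algebra -/

section LorentzAlgebra

variable {V : Type*} [AddCommGroup V] [Module ℝ V] [TopologicalSpace V]
  [IsTopologicalAddGroup V] [ContinuousConstSMul ℝ V] {B : V →L[ℝ] V →L[ℝ] ℝ}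

namespace IsLorentzForm

/-- The vector `B(v,w) z - B(v,z) w` is orthogonal to the timelike `v` of the signature, yet its
square is nonpositive if `B w w ≤ 0`; so it vanishes. Pairing with `z` gives `B(v,w) = 0`, which
contradicts definiteness on the complement of `v`. Thus any timelike vector can play the role of
`v`. -/
lemma pos_of_orthogonal (h : IsLorentzForm B) {z w : V} (hz : B z z < 0) (hw : w ≠ 0)
    (hzw : B z w = 0) : 0 < B w w := by
  obtain ⟨v, hv, hpos⟩ := h.signature
  by_contra hle
  push Not at hle
  have h1 : B v (B v w • z - B v z • w) = 0 := by simp; ring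
  have h2 : B (B v w • z - B v z • w) (B v w • z - B v z • w) =
      B v w ^ 2 * B z z + B v z ^ 2 * B w w := by
    simp [hzw, h.symm w z]; ring
  have h3 : B v w • z - B v z • w = 0 := by
    by_contra hne
    have := hpos _ hne h1
    rw [h2] at this
    nlinarith [sq_nonneg (B v w), sq_nonneg (B v z)]
  have h4 : B v w = 0 := by
    have := congrArg (B z) h3
    simp [hzw] at this
    exact this.resolve_right hz.ne
  exact absurd (hpos w hw h4) (not_lt.2 hle)

lemma ne_zero_of_causal (h : IsLorentzForm B) {z v : V} (hz : B z z < 0) (hv : v ≠ 0)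
    (hvv : B v v ≤ 0) : B z v ≠ 0 :=
  fun h0 ↦ absurd (h.pos_of_orthogonal hz hv h0) (not_lt.2 hvv)

/-- If `B z' v ≥ 0`, the combination `B(z',v) z - B(z,v) z'` has nonnegative coefficients, so it is
timelike, and it is orthogonal to the causal vector `v`, which is impossible. -/
lemma neg_of_same_cone (h : IsLorentzForm B) {z z' v : V} (hz : B z z < 0) (hz' : B z' z' < 0)
    (hzz' : B z z' < 0) (hv : v ≠ 0) (hvv : B v v ≤ 0) (hzv : B z v < 0) : B z' v < 0 := by
  by_contra hle
  push Not at hle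
  have hd : 0 < B z' v - B z v := by linarith
  have h1 : B (B z' v • z - B z v • z') v = 0 := by simp; ring
  have h2 : B (B z' v • z - B z v • z') (B z' v • z - B z v • z') < 0 := by
    have : B (B z' v • z - B z v • z') (B z' v • z - B z v • z') =
      B z' v ^ 2 * B z z + 2 * B z' v * (-B z v) * B z z' + B z v ^ 2 * B z' z' := by
      simp [h.symm z' z]; ring
    rw [this]
    have e1 : B z' v ^ 2 * B z z ≤ 0 := mul_nonpos_of_nonneg_of_nonpos (sq_nonneg _) hz.le
    have e2 : 2 * B z' v * (-B z v) * B z z' ≤ 0 :=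
      mul_nonpos_of_nonneg_of_nonpos (mul_nonneg (by linarith) (by linarith)) hzz'.le
    have e3 : B z v ^ 2 * B z' z' < 0 := mul_neg_of_pos_of_neg (sq_pos_of_neg hzv) hz'
    linarith
  exact h.ne_zero_of_causal h2 hv hvv h1

lemma ne_zero_of_timelike {z : V} (hz : B z z < 0) : z ≠ 0 := by
  rintro rfl; simp at hz

/-- The cross term `B v w` is negative for two vectors of the same cone. Convexity is what allows
time orientations to be patched by a partition of unity. -/
lemma convex_cone (h : IsLorentzForm B) {z : V} (hz : B z z < 0) :
    Convex ℝ {v | B v v < 0 ∧ B z v < 0} := by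
  rintro v ⟨hv, hzv⟩ w ⟨hw, hzw⟩ a b ha hb hab
  have hvw : B v w < 0 :=
    h.neg_of_same_cone hz hv hzv (ne_zero_of_timelike hw) hw.le hzw
  have hab' : 0 < a ∨ 0 < b := by
    by_contra hcon; push Not at hcon; linarith
  constructor
  · have : B (a • v + b • w) (a • v + b • w) =
        a ^ 2 * B v v + 2 * a * b * B v w + b ^ 2 * B w w := by
      simp [h.symm w v]; ring
    rw [this]
    have e2 : 2 * a * b * B v w ≤ 0 := mul_nonpos_of_nonneg_of_nonpos (by positivity) hvw.le
    rcases hab' with h0 | h0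
    · have e1 : a ^ 2 * B v v < 0 := mul_neg_of_pos_of_neg (by positivity) hv
      have e3 : b ^ 2 * B w w ≤ 0 := mul_nonpos_of_nonneg_of_nonpos (sq_nonneg _) hw.le
      linarith
    · have e1 : a ^ 2 * B v v ≤ 0 := mul_nonpos_of_nonneg_of_nonpos (sq_nonneg _) hv.le
      have e3 : b ^ 2 * B w w < 0 := mul_neg_of_pos_of_neg (by positivity) hw
      linarith
  · simp only [map_add, map_smul, smul_eq_mul]
    rcases hab' with h0 | h0
    · have e1 : a * B z v < 0 := mul_neg_of_pos_of_neg h0 hzv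
      have e2 : b * B z w ≤ 0 := mul_nonpos_of_nonneg_of_nonpos hb hzw.le
      linarith
    · have e1 : a * B z v ≤ 0 := mul_nonpos_of_nonneg_of_nonpos ha hzv.le
      have e2 : b * B z w < 0 := mul_neg_of_pos_of_neg h0 hzw
      linarith

lemma injective (h : IsLorentzForm B) : Function.Injective B := by
  rw [injective_iff_map_eq_zero]
  intro v hv
  by_contra hne
  obtain ⟨z, hz, hpos⟩ := h.signature
  have h1 : B z v = 0 := by rw [h.symm, hv]; rfl
  have h2 := hpos v hne h1
  rw [hv] at h2
  simp at h2

lemma const_smul (h : IsLorentzForm B) {c : ℝ} (hc : 0 < c) : IsLorentzForm (c • B) where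
  symm v w := by simp [h.symm v w]
  signature := by
    obtain ⟨v, hv, hpos⟩ := h.signature
    refine ⟨v, by simpa using mul_neg_of_pos_of_neg hc hv, fun w hw h0 ↦ ?_⟩
    have : B v w = 0 := by simpa [hc.ne'] using h0
    simpa using mul_pos hc (hpos w hw this)

lemma pullback {W : Type*} [AddCommGroup W] [Module ℝ W] [TopologicalSpace W]
    [IsTopologicalAddGroup W] [ContinuousConstSMul ℝ W] (h : IsLorentzForm B) {L : W →L[ℝ] V}
    (hL : Function.Bijective L) : IsLorentzForm (Penrose.pullback B L) where
  symm v w := h.symm _ _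
  signature := by
    obtain ⟨v, hv, hpos⟩ := h.signature
    obtain ⟨u, rfl⟩ := hL.2 v
    refine ⟨u, hv, fun w hw h0 ↦ hpos (L w) ?_ h0⟩
    exact fun h0 ↦ hw (hL.1 (by rw [h0, map_zero]))

end IsLorentzForm

end LorentzAlgebra

/-! ### Smooth metrics in coordinates -/

section Coordinates

variable {X : Type*} [TopologicalSpace X] [ChartedSpace ModelH X] [IsManifold I₄ ∞ X]

/-- The metric `g` at `x` in the coordinates around `x₀`. -/
def chartForm (g : MetricField X) (x₀ x : X) : Bilin :=
  pullback (g x) ((trivializationAt (ℝ × E3) (TangentSpace I₄) x₀).symmL ℝ x)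

/-- The coordinates around `x₀` of the vectors tangent at `x`. -/
def chartVec (x₀ x : X) : TangentSpace I₄ x →L[ℝ] ℝ × E3 :=
  (trivializationAt (ℝ × E3) (TangentSpace I₄) x₀).continuousLinearMapAt ℝ x

lemma symmL_chartVec {x₀ x : X} (hx : x ∈ (chartAt ModelH x₀).source) (v : TangentSpace I₄ x) :
    (trivializationAt (ℝ × E3) (TangentSpace I₄) x₀).symmL ℝ x (chartVec x₀ x v) = v :=
  Trivialization.symmL_continuousLinearMapAt (R := ℝ) _ hx v

lemma chartVec_symmL {x₀ x : X} (hx : x ∈ (chartAt ModelH x₀).source) (v : ℝ × E3) :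
    chartVec x₀ x ((trivializationAt (ℝ × E3) (TangentSpace I₄) x₀).symmL ℝ x v) = v :=
  Trivialization.continuousLinearMapAt_symmL (R := ℝ) _ hx v

lemma chartVec_eq_mfderiv {x₀ x : X} (hx : x ∈ (chartAt ModelH x₀).source) :
    chartVec x₀ x = mfderiv I₄ 𝓘(ℝ, ℝ × E3) (extChartAt I₄ x₀) x :=
  haveI : IsManifold I₄ 1 X := .of_le (n := ∞) (by simp)
  TangentBundle.continuousLinearMapAt_trivializationAt hx

lemma chartForm_chartVec (g : MetricField X) {x₀ x : X} (hx : x ∈ (chartAt ModelH x₀).source)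
    (v w : TangentSpace I₄ x) :
    chartForm g x₀ x (chartVec x₀ x v) (chartVec x₀ x w) = g x v w := by
  rw [chartForm, pullback_apply, symmL_chartVec hx, symmL_chartVec hx]

lemma chartVec_ne_zero {x₀ x : X} (hx : x ∈ (chartAt ModelH x₀).source) {v : TangentSpace I₄ x}
    (hv : v ≠ 0) : chartVec x₀ x v ≠ 0 := by
  intro h
  apply hv
  rw [← symmL_chartVec hx v, h, map_zero]

lemma IsLorentzForm.chartForm {g : MetricField X} {x₀ x : X}
    (hx : x ∈ (chartAt ModelH x₀).source) (h : IsLorentzForm (g x)) :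
    IsLorentzForm (chartForm g x₀ x) := by
  refine h.pullback ⟨fun v w hvw ↦ ?_, fun v ↦ ⟨_, symmL_chartVec hx v⟩⟩
  rw [← chartVec_symmL hx v, ← chartVec_symmL hx w, hvw]

set_option synthInstance.maxHeartbeats 200000 in
-- Smoothness of a metric as a section of a bundle becomes smoothness of a map into a fixed space of
-- bilinear forms. All later regularity statements about metrics pass through `chartForm`.
lemma contMDiffWithinAt_metric_iff {g : MetricField X} {s : Set X} {x₀ x₁ : X}
    (hx₁ : x₁ ∈ (chartAt ModelH x₀).source) :
    ContMDiffWithinAt I₄ (I₄.prod 𝓘(ℝ, Bilin)) ∞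
    (fun x ↦ TotalSpace.mk' Bilin
      (E := fun x : X ↦ TangentSpace I₄ x →L[ℝ] TangentSpace I₄ x →L[ℝ] ℝ) x (g x)) s x₁ ↔
    ContMDiffWithinAt I₄ 𝓘(ℝ, Bilin) ∞ (chartForm g x₀) s x₁ := by
  rw [Trivialization.contMDiffWithinAt_iff (e := trivializationAt Bilin
    (fun x : X ↦ TangentSpace I₄ x →L[ℝ] TangentSpace I₄ x →L[ℝ] ℝ) x₀)
    (by rw [hom_trivializationAt_source]; exact ⟨hx₁, hx₁, mem_univ _⟩)]
  have h1 : ContMDiffWithinAt I₄ I₄ ∞ (fun x : X ↦ x) s x₁ := contMDiffWithinAt_id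
  simp only [h1, true_and]
  have key : ∀ x ∈ (chartAt ModelH x₀).source, ContinuousLinearMap.inCoordinates (ℝ × E3)
      (fun x : X ↦ TangentSpace I₄ x) ((ℝ × E3) →L[ℝ] ℝ) (fun x : X ↦ TangentSpace I₄ x →L[ℝ] ℝ)
      x₀ x x₀ x (g x) = chartForm g x₀ x := by
    intro x hx
    have hx' : x ∈ (trivializationAt (ℝ × E3) (fun x : X ↦ TangentSpace I₄ x) x₀).baseSet := hx
    refine ContinuousLinearMap.ext fun v ↦ ContinuousLinearMap.ext fun w ↦ ?_
    rw [inCoordinates_apply_eq₂ hx' hx' (mem_univ _)]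
    simp [chartForm, Trivialization.symmL_apply _ hx']
  refine Filter.EventuallyEq.contMDiffWithinAt_iff ?_ (key x₁ hx₁)
  filter_upwards [mem_nhdsWithin_of_mem_nhds ((chartAt ModelH x₀).open_source.mem_nhds hx₁)] with
    x hx using key x hx

lemma contMDiffWithinAt_vecField_iff {Z : VecField X} {s : Set X} {x₀ x₁ : X}
    (hx₁ : x₁ ∈ (chartAt ModelH x₀).source) :
    ContMDiffWithinAt I₄ I₄.tangent ∞ (fun x ↦ (⟨x, Z x⟩ : TangentBundle I₄ X)) s x₁ ↔
    ContMDiffWithinAt I₄ 𝓘(ℝ, ℝ × E3) ∞ (fun x ↦ chartVec x₀ x (Z x)) s x₁ := by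
  rw [Trivialization.contMDiffWithinAt_iff (e := trivializationAt (ℝ × E3)
    (fun x : X ↦ TangentSpace I₄ x) x₀)
    (by rw [Trivialization.mem_source]; exact hx₁)]
  have h1 : ContMDiffWithinAt I₄ I₄ ∞ (fun x : X ↦ x) s x₁ := contMDiffWithinAt_id
  simp only [h1, true_and]
  have key : ∀ x ∈ (chartAt ModelH x₀).source, (trivializationAt (ℝ × E3)
    (fun x : X ↦ TangentSpace I₄ x) x₀ (⟨x, Z x⟩ : TangentBundle I₄ X)).2 = chartVec x₀ x (Z x) := by
    intro x hx
    rw [chartVec, Trivialization.continuousLinearMapAt_apply, Trivialization.coe_linearMapAt_of_mem _ hx]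
  refine Filter.EventuallyEq.contMDiffWithinAt_iff ?_ (key x₁ hx₁)
  filter_upwards [mem_nhdsWithin_of_mem_nhds ((chartAt ModelH x₀).open_source.mem_nhds hx₁)] with
    x hx using key x hx

set_option synthInstance.maxHeartbeats 200000 in
/-- Pull-back of bilinear forms is smooth. -/
lemma contDiff_pullback {V W : Type*} [NormedAddCommGroup V] [NormedSpace ℝ V]
    [NormedAddCommGroup W] [NormedSpace ℝ W] :
    ContDiff ℝ ∞ fun q : (W →L[ℝ] W →L[ℝ] ℝ) × (V →L[ℝ] W) ↦ pullback q.1 q.2 := by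
  have h : ContDiff ℝ ∞ fun L : V →L[ℝ] W ↦ (ContinuousLinearMap.precomp ℝ L : (W →L[ℝ] ℝ) →L[ℝ] V →L[ℝ] ℝ) :=
    ContinuousLinearMap.contDiff (𝕜 := ℝ) (E := V →L[ℝ] W) (F := (W →L[ℝ] ℝ) →L[ℝ] V →L[ℝ] ℝ)
      (n := ∞) (ContinuousLinearMap.flip (ContinuousLinearMap.compL ℝ V W ℝ))
  exact (h.comp contDiff_snd).clm_comp (contDiff_fst.clm_comp contDiff_snd)

/-- The pull-back of a smooth field of bilinear forms by a smooth map is smooth. -/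
lemma contMDiffAt_chartForm_pullback {E' H' Y : Type*} [NormedAddCommGroup E'] [NormedSpace ℝ E']
    [TopologicalSpace H'] {J : ModelWithCorners ℝ E' H'} [TopologicalSpace Y] [ChartedSpace H' Y]
    [IsManifold J ∞ Y] {q : ∀ y : Y, TangentSpace J y →L[ℝ] TangentSpace J y →L[ℝ] ℝ}
    {f : X → Y} {x₀ : X} (hf : ContMDiffAt I₄ J ∞ f x₀)
    (hq : ContMDiffAt J 𝓘(ℝ, E' →L[ℝ] E' →L[ℝ] ℝ) ∞
      (fun y ↦ pullback (q y) ((trivializationAt E' (TangentSpace J) (f x₀)).symmL ℝ y)) (f x₀)) :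
    ContMDiffAt I₄ 𝓘(ℝ, Bilin) ∞
      (chartForm (fun x ↦ pullback (q (f x)) (mfderiv I₄ J f x)) x₀) x₀ := by
  have hd := hf.mfderiv_const (m := ∞) (by simp)
  have h1 := hq.comp x₀ hf
  have h2 := (contDiff_pullback (V := ℝ × E3) (W := E')).contMDiff.contMDiffAt.comp x₀
    (h1.prodMk_space hd)
  refine h2.congr_of_eventuallyEq ?_
  have hs : f ⁻¹' (chartAt H' (f x₀)).source ∈ 𝓝 x₀ :=
    hf.continuousAt.preimage_mem_nhds (chart_source_mem_nhds H' (f x₀))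
  filter_upwards [hs, chart_source_mem_nhds ModelH x₀] with x hx hx'
  have hx2 : f x ∈ (trivializationAt E' (TangentSpace J) (f x₀)).baseSet := hx
  refine ContinuousLinearMap.ext fun v ↦ ContinuousLinearMap.ext fun w ↦ ?_
  have key : ∀ v, (trivializationAt E' (TangentSpace J) (f x₀)).symmL ℝ (f x)
      ((inTangentCoordinates I₄ J id f (fun x ↦ mfderiv I₄ J f x) x₀ x) v) =
      mfderiv I₄ J f x ((trivializationAt (ℝ × E3) (TangentSpace I₄) x₀).symmL ℝ x v) := by
    intro v
    exact Trivialization.symmL_continuousLinearMapAt (R := ℝ) _ hx2 _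
  simp only [Function.comp_apply, chartForm, pullback_apply]
  rw [key, key]

/-- The velocity of a curve in coordinates. -/
lemma hasDerivWithinAt_chart {γ : ℝ → X} {s : Set ℝ} {t : ℝ} {x₀ : X}
    (hγ : MDifferentiableWithinAt 𝓘(ℝ, ℝ) I₄ γ s t) (hx : γ t ∈ (chartAt ModelH x₀).source) :
    HasDerivWithinAt (fun t ↦ extChartAt I₄ x₀ (γ t)) (chartVec x₀ (γ t) (velocity γ s t)) s t := by
  have : IsManifold I₄ 1 X := .of_le (n := ∞) (by simp)
  have h := (mdifferentiableAt_extChartAt (I := I₄) hx).hasMFDerivAt.comp_hasMFDerivWithinAt t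
    hγ.hasMFDerivWithinAt
  rw [← chartVec_eq_mfderiv hx] at h
  let L : ℝ →L[ℝ] ℝ × E3 := (chartVec x₀ (γ t)).comp (mfderivWithin 𝓘(ℝ, ℝ) I₄ γ s t)
  have h' : HasFDerivWithinAt (fun t ↦ extChartAt I₄ x₀ (γ t)) L s t :=
    hasMFDerivWithinAt_iff_hasFDerivWithinAt.1 h
  exact h'.hasDerivWithinAt

/-- The velocity of the image of a curve. -/
lemma velocity_comp {Y : Type*} [TopologicalSpace Y] [ChartedSpace ModelH Y]
    {f : X → Y} {γ : ℝ → X} {s : Set ℝ} {t : ℝ} (hs : UniqueDiffWithinAt ℝ s t)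
    (hγ : MDifferentiableWithinAt 𝓘(ℝ, ℝ) I₄ γ s t) (hf : MDifferentiableAt I₄ I₄ f (γ t)) :
    velocity (f ∘ γ) s t = mfderiv I₄ I₄ f (γ t) (velocity γ s t) := by
  have h := hf.hasMFDerivAt.comp_hasMFDerivWithinAt t hγ.hasMFDerivWithinAt
  have h2 := h.mfderivWithin hs.uniqueMDiffWithinAt
  rw [velocity, h2]
  rfl

lemma velocity_subset {γ : ℝ → X} {s s' : Set ℝ} {t : ℝ} (h : s' ⊆ s)
    (hs : UniqueDiffWithinAt ℝ s' t) (hγ : MDifferentiableWithinAt 𝓘(ℝ, ℝ) I₄ γ s t) :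
    velocity γ s' t = velocity γ s t := by
  rw [velocity, velocity, mfderivWithin_subset h hs.uniqueMDiffWithinAt hγ]

end Coordinates

/-! ### Flows near equilibria -/

section Flow

open Metric NNReal

variable {P : Type*} [NormedAddCommGroup P] [NormedSpace ℝ P] [CompleteSpace P]

/-- Picard–Lindelöf, with solutions that stay in the ball. -/
lemma exists_solution_mem_closedBall {f : P → P} {p₀ p : P} {τ : ℝ} (hτ : 0 ≤ τ) {a r K : ℝ≥0}
    (hl : LipschitzOnWith K f (closedBall p₀ a)) (h0 : f p₀ = 0)
    (hm : (K * a : ℝ) * τ ≤ a - r) (hp : p ∈ closedBall p₀ r) :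
    ∃ α : ℝ → P, α 0 = p ∧ ∀ t ∈ Icc 0 τ, α t ∈ closedBall p₀ a ∧
      HasDerivWithinAt α (f (α t)) (Icc 0 τ) t := by
  -- As `f` vanishes at the centre, its Lipschitz constant also bounds its size on the ball, by `K
  -- a`.
  have hb : ∀ x ∈ closedBall p₀ a, ‖f x‖ ≤ (K * a : ℝ≥0) := by
    intro x hx
    have := hl.norm_sub_le hx (mem_closedBall_self a.2)
    rw [h0, sub_zero] at this
    refine this.trans ?_
    rw [NNReal.coe_mul]
    gcongr
    rwa [← mem_closedBall_iff_norm]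
  have hf : IsPicardLindelof (fun _ ↦ f) (⟨0, ⟨le_rfl, hτ⟩⟩ : Icc (0 : ℝ) τ) p₀ a r (K * a) K := by
    refine IsPicardLindelof.of_time_independent hb hl ?_
    simpa [max_eq_left hτ] using hm
  obtain ⟨α, hα⟩ := ODE.FunSpace.exists_isFixedPt_next hf hp
  refine ⟨α.compProj, ?_, fun t ht ↦ ⟨α.compProj_mem_closedBall hf.mul_max_le, ?_⟩⟩
  · have := ODE.FunSpace.compProj_val (α := α) (t := ⟨0, ⟨le_rfl, hτ⟩⟩)
    rw [this, ← hα, ODE.FunSpace.next_apply₀]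
  · apply ODE.hasDerivWithinAt_picard_Icc (⟨le_rfl, hτ⟩ : (0 : ℝ) ∈ Icc 0 τ) hf.continuousOn_uncurry
      α.continuous_compProj.continuousOn (fun _ ht' ↦ α.compProj_mem_closedBall hf.mul_max_le)
      p ht |>.congr_of_mem _ ht
    intro t' ht'
    nth_rw 1 [← hα]
    rw [ODE.FunSpace.compProj_of_mem ht', ODE.FunSpace.next_apply]

lemma HasDerivWithinAt.Icc_to_Ici {E : Type*} [NormedAddCommGroup E] [NormedSpace ℝ E]
    {f : ℝ → E} {f' : E} {a b t : ℝ} (h : HasDerivWithinAt f f' (Icc a b) t)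
    (ht : t ∈ Ico a b) : HasDerivWithinAt f f' (Ici t) t := by
  refine h.mono_of_mem_nhdsWithin ?_
  filter_upwards [Ico_mem_nhdsGE ht.2] with z hz using ⟨ht.1.trans hz.1, hz.2.le⟩

lemma HasDerivWithinAt.Icc_to_Iic {E : Type*} [NormedAddCommGroup E] [NormedSpace ℝ E]
    {f : ℝ → E} {f' : E} {a b t : ℝ} (h : HasDerivWithinAt f f' (Icc a b) t)
    (ht : t ∈ Ioc a b) : HasDerivWithinAt f f' (Iic t) t := by
  refine h.mono_of_mem_nhdsWithin ?_
  filter_upwards [Ioc_mem_nhdsLE ht.1] with z hz using ⟨hz.1.le, hz.2.trans ht.2⟩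

/-- The flow of a vector field near an equilibrium with nilpotent linearization. -/
lemma exists_flow {F : P → P} {p₀ : P} {B : P →L[ℝ] P} (hF : ContDiffAt ℝ 1 F p₀)
    (h0 : F p₀ = 0) (hB : HasFDerivAt F B p₀) (hBB : ∀ v, B (B v) = 0) {O : Set P}
    (hO : O ∈ 𝓝 p₀) :
    ∃ τ > 0, ∃ r > 0, ∃ α : P → ℝ → P,
      (∀ p ∈ ball p₀ r, α p 0 = p ∧ ∀ t ∈ Icc 0 τ, α p t ∈ O ∧
        HasDerivWithinAt (α p) (F (α p t)) (Icc 0 τ) t) ∧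
      (∀ p ∈ ball p₀ r, ∀ q ∈ ball p₀ r, ∀ t ∈ Icc 0 τ, ‖α p t - α q t‖ ≤ 2 * ‖p - q‖) ∧
      (∀ p ∈ ball p₀ r, ∀ t ∈ Icc 0 τ, F (α p t) = 0 → α p t = p) ∧
      (∀ p ∈ ball p₀ r, F p = 0 → ∀ t ∈ Icc 0 τ, α p t = p) ∧
      HasStrictFDerivAt (fun p ↦ α p τ) (ContinuousLinearMap.id ℝ P + τ • B) p₀ := by
  obtain ⟨K, s, hs, hl⟩ := hF.exists_lipschitzOnWith
  obtain ⟨a, ha, has⟩ := Metric.nhds_basis_closedBall.mem_iff.1 (inter_mem hs hO)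
  lift a to ℝ≥0 using ha.le
  have hlip : LipschitzOnWith K F (closedBall p₀ a) := hl.mono fun x hx ↦ (has hx).1
  -- With `K τ ≤ 1/2`, solutions starting in the ball of radius `a / 2` stay in the ball of radius
  -- `a`, and the Lipschitz factor `exp (K τ)` of the flow is at most `2`.
  set τ : ℝ := 1 / (2 * (K + 1)) with hτdef
  have hτ : 0 < τ := by positivity
  have hKτ : (K : ℝ) * τ ≤ 1 / 2 := by
    rw [hτdef, mul_one_div, div_le_div_iff₀ (by positivity) two_pos]; linarith [K.2]
  have hexp : Real.exp (K * τ) ≤ 2 := by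
    calc Real.exp (K * τ) ≤ Real.exp (1 / 2) := Real.exp_le_exp.2 hKτ
      _ ≤ 2 := by
        have h1 := Real.exp_one_lt_d9
        have h2 : Real.exp (1 / 2) * Real.exp (1 / 2) = Real.exp 1 := by
          rw [← Real.exp_add]; norm_num
        nlinarith [Real.exp_pos (1 / 2)]
  have hsol : ∀ p ∈ ball p₀ (a / 2 : ℝ), ∃ α : ℝ → P, α 0 = p ∧ ∀ t ∈ Icc 0 τ,
      α t ∈ closedBall p₀ a ∧ HasDerivWithinAt α (F (α t)) (Icc 0 τ) t := by
    intro p hp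
    refine exists_solution_mem_closedBall hτ.le (r := a / 2) hlip h0 ?_ ?_
    · have : (K * a : ℝ) * τ = (K * τ) * a := by ring
      rw [this]
      push_cast
      nlinarith [a.2]
    · have := ball_subset_closedBall hp
      simpa using this
  choose! α hα0 hα using hsol
  have hcont : ∀ p ∈ ball p₀ (a / 2 : ℝ), ContinuousOn (α p) (Icc 0 τ) := fun p hp t ht ↦
    (hα p hp t ht).2.continuousWithinAt
  have hdist : ∀ p ∈ ball p₀ (a / 2 : ℝ), ∀ q ∈ ball p₀ (a / 2 : ℝ), ∀ t ∈ Icc 0 τ,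
      ‖α p t - α q t‖ ≤ 2 * ‖p - q‖ := by
    intro p hp q hq t ht
    have := dist_le_of_trajectories_ODE_of_mem (v := fun _ ↦ F) (s := fun _ ↦ closedBall p₀ a)
      (fun _ _ ↦ hlip) (hcont p hp)
      (fun t ht ↦ (hα p hp t ⟨ht.1, ht.2.le⟩).2.Icc_to_Ici ht)
      (fun t ht ↦ (hα p hp t ⟨ht.1, ht.2.le⟩).1) (hcont q hq)
      (fun t ht ↦ (hα q hq t ⟨ht.1, ht.2.le⟩).2.Icc_to_Ici ht)
      (fun t ht ↦ (hα q hq t ⟨ht.1, ht.2.le⟩).1) le_rfl t ht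
    rw [hα0 p hp, hα0 q hq, dist_eq_norm, dist_eq_norm, sub_zero] at this
    refine this.trans ?_
    rw [mul_comm]
    gcongr
    refine le_trans (Real.exp_le_exp.2 ?_) hexp
    gcongr
    exact ht.2
  have hequi : ∀ p ∈ ball p₀ (a / 2 : ℝ), F p = 0 → ∀ t ∈ Icc 0 τ, α p t = p := by
    intro p hp hFp t ht
    have hpa : p ∈ closedBall p₀ a := by
      have := (hα p hp 0 ⟨le_rfl, hτ.le⟩).1
      rwa [hα0 p hp] at this
    have := dist_le_of_trajectories_ODE_of_mem (v := fun _ ↦ F) (s := fun _ ↦ closedBall p₀ a)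
      (fun _ _ ↦ hlip) (hcont p hp)
      (fun t ht ↦ (hα p hp t ⟨ht.1, ht.2.le⟩).2.Icc_to_Ici ht)
      (fun t ht ↦ (hα p hp t ⟨ht.1, ht.2.le⟩).1) (g := fun _ ↦ p) continuousOn_const
      (fun t ht ↦ by simpa [hFp] using hasDerivWithinAt_const t (Ici t) p)
      (fun _ _ ↦ hpa) (δ := 0) (by rw [hα0 p hp, dist_self]) t ht
    rw [zero_mul] at this
    exact dist_le_zero.1 this
  refine ⟨τ, hτ, a / 2, by positivity, α, fun p hp ↦ ⟨hα0 p hp, fun t ht ↦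
    ⟨(has (hα p hp t ht).1).2, (hα p hp t ht).2⟩⟩, hdist, ?_, hequi, ?_⟩
  -- Backward uniqueness: the solution agrees at time `t` with the constant solution at `α p t`,
  -- hence also at time `0`.
  · intro p hp t ht hFt
    rcases ht.1.eq_or_lt with h | h
    · rw [← h, hα0 p hp]
    · have := ODE_solution_unique_of_mem_Icc_left (v := fun _ ↦ F) (s := fun _ ↦ closedBall p₀ a)
        (a := 0) (b := t) (K := K) (f := α p) (g := fun _ ↦ α p t) (fun _ _ ↦ hlip)
        ((hcont p hp).mono (Icc_subset_Icc_right ht.2))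
        (fun u hu ↦ (hα p hp u ⟨hu.1.le, hu.2.trans ht.2⟩).2.Icc_to_Iic ⟨hu.1, hu.2.trans ht.2⟩)
        (fun u hu ↦ (hα p hp u ⟨hu.1.le, hu.2.trans ht.2⟩).1) continuousOn_const
        (fun u hu ↦ by simpa [hFt] using hasDerivWithinAt_const u (Iic u) (α p t))
        (fun u hu ↦ (hα p hp t ht).1) rfl (left_mem_Icc.2 h.le)
      simp only [hα0 p hp] at this
      exact this.symm
  -- The difference `u = α p - α q` satisfies `u' = B u + e` with `e` small relative to `p - q`. As
  -- `B² = 0`, the integrating factor is `exp (-t B) = 1 - t B`, and `w = u - t B u` has the small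
  -- derivative `e - t B e`. So `u τ` is close to `(1 + τ B) (p - q)`.
  · have hstrict : HasStrictFDerivAt F B p₀ := by
      have := hF.hasStrictFDerivAt (by simp)
      rwa [hB.fderiv] at this
    rw [hasStrictFDerivAt_iff_isLittleO, Asymptotics.isLittleO_iff]
    intro c hc
    -- `β` bounds the norms of `1 ± t B` for `t ≤ τ`. It enters twice, once for `w'` and once on
    -- returning from `w` to `u`, which explains the choice of `ε`.
    set β := 1 + τ * ‖B‖ with hβ
    have hβ1 : 1 ≤ β := by rw [hβ]; nlinarith [norm_nonneg B]
    set ε := c / (2 * τ * β * β) with hε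
    have hε0 : 0 < ε := by positivity
    have h1 := (Asymptotics.isLittleO_iff.1
      (hasStrictFDerivAt_iff_isLittleO.1 hstrict)) hε0
    rw [nhds_prod_eq] at h1
    obtain ⟨u, hu, hu'⟩ := Filter.mem_prod_self_iff.1 h1
    obtain ⟨a', ha', hau⟩ := Metric.nhds_basis_ball.mem_iff.1 hu
    have hmem : ∀ᶠ q : P × P in 𝓝 (p₀, p₀), q.1 ∈ ball p₀ (min (a / 2) (a' / 2)) ∧
        q.2 ∈ ball p₀ (min (a / 2) (a' / 2)) := by
      have hb : ball p₀ (min (a / 2 : ℝ) (a' / 2)) ∈ 𝓝 p₀ := ball_mem_nhds _ (by positivity)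
      rw [nhds_prod_eq]
      exact (eventually_of_mem hb fun _ h ↦ h).prod_mk (eventually_of_mem hb fun _ h ↦ h)
    filter_upwards [hmem] with ⟨p, q⟩ ⟨hp, hq⟩
    have hpa : p ∈ ball p₀ (a / 2 : ℝ) := ball_subset_ball (min_le_left _ _) hp
    have hqa : q ∈ ball p₀ (a / 2 : ℝ) := ball_subset_ball (min_le_left _ _) hq
    have hp₀ : p₀ ∈ ball p₀ (a / 2 : ℝ) := mem_ball_self (by positivity)
    have hsmall : ∀ p ∈ ball p₀ (min (a / 2 : ℝ) (a' / 2)), ∀ t ∈ Icc 0 τ, α p t ∈ u := by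
      intro p hp t ht
      apply hau
      have := hdist p (ball_subset_ball (min_le_left _ _) hp) p₀ hp₀ t ht
      rw [hequi p₀ hp₀ h0 t ht] at this
      have h2 := (ball_subset_ball (min_le_right _ _) hp)
      rw [mem_ball_iff_norm] at h2 ⊢
      linarith
    set e : ℝ → P := fun t ↦ F (α p t) - F (α q t) - B (α p t - α q t) with he
    have heb : ∀ t ∈ Icc 0 τ, ‖e t‖ ≤ ε * (2 * ‖p - q‖) := by
      intro t ht
      refine (hu' (mk_mem_prod (hsmall p hp t ht) (hsmall q hq t ht))).trans ?_
      gcongr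
      exact hdist p hpa q hqa t ht
    set w : ℝ → P := fun t ↦ (α p t - α q t) - t • B (α p t - α q t) with hw
    have hwd : ∀ t ∈ Icc 0 τ, HasDerivWithinAt w (e t - t • B (e t)) (Icc 0 τ) t := by
      intro t ht
      have hu := (hα p hpa t ht).2.sub (hα q hqa t ht).2
      have hBu := B.hasFDerivAt.comp_hasDerivWithinAt t hu
      have := hu.sub ((hasDerivWithinAt_id t _).smul hBu)
      refine this.congr_deriv ?_
      simp only [he, map_sub, hBB, id, one_smul, Function.comp_apply, Pi.sub_apply]
      module
    have hwb : ∀ t ∈ Icc 0 τ, ‖e t - t • B (e t)‖ ≤ β * (ε * (2 * ‖p - q‖)) := by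
      intro t ht
      calc ‖e t - t • B (e t)‖ ≤ ‖e t‖ + ‖t • B (e t)‖ := norm_sub_le _ _
        _ ≤ ‖e t‖ + τ * (‖B‖ * ‖e t‖) := by
            rw [norm_smul, Real.norm_of_nonneg ht.1]
            gcongr
            · exact ht.2
            · exact B.le_opNorm _
        _ = β * ‖e t‖ := by rw [hβ]; ring
        _ ≤ _ := by gcongr; exact heb t ht
    have hwτ := (convex_Icc (0 : ℝ) τ).norm_image_sub_le_of_norm_hasDerivWithin_le hwd hwb
      (left_mem_Icc.2 hτ.le) (right_mem_Icc.2 hτ.le)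
    have hw0 : w 0 = p - q := by simp [hw, hα0 p hpa, hα0 q hqa]
    have huτ : α p τ - α q τ = w τ + τ • B (w τ) := by
      simp [hw, hBB]
    have : α p τ - α q τ - (ContinuousLinearMap.id ℝ P + τ • B) (p - q) =
        (w τ - w 0) + τ • B (w τ - w 0) := by
      rw [huτ, hw0]; simp; module
    change ‖α p τ - α q τ - (ContinuousLinearMap.id ℝ P + τ • B) (p - q)‖ ≤ c * ‖p - q‖
    rw [this]
    calc ‖(w τ - w 0) + τ • B (w τ - w 0)‖ ≤ ‖w τ - w 0‖ + τ * (‖B‖ * ‖w τ - w 0‖) := by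
          refine (norm_add_le _ _).trans ?_
          rw [norm_smul, Real.norm_of_nonneg hτ.le]
          gcongr
          exact B.le_opNorm _
      _ = β * ‖w τ - w 0‖ := by rw [hβ]; ring
      _ ≤ β * (β * (ε * (2 * ‖p - q‖)) * ‖τ - 0‖) := by gcongr
      _ = c * ‖p - q‖ := by
          rw [sub_zero, Real.norm_of_nonneg hτ.le, hε]
          field_simp

end Flow

/-! ### The geodesic flow in Hamiltonian form -/

section Geodesics

open Metric NNReal

set_option linter.unusedSectionVars false

variable {E : Type*} [NormedAddCommGroup E] [NormedSpace ℝ E] (ι : E ≃L[ℝ] (E →L[ℝ] ℝ))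

/-- The Hamiltonian `ξ(A ξ) / 2` of the geodesic flow of a metric with inverse `A`; covectors are
represented by vectors by means of `ι`. -/
def ham (A : E → E →L[ℝ] E) (p : E × E) : ℝ := 1 / 2 * ι p.2 (A p.1 p.2)

/-- The Hamiltonian vector field of `ham ι A`. -/
def hamField (A : E → E →L[ℝ] E) (p : E × E) : E × E :=
  (A p.1 p.2, ι.symm ((-(1 / 2) : ℝ) • ι p.2 ∘L ((fderiv ℝ A p.1).flip p.2)))

variable {ι} {A : E → E →L[ℝ] E} {U : Set E} {y₀ : E}

lemma eventually_norm_lt {F : Type*} [NormedAddCommGroup F] {f : E → F} (hf : ContinuousAt f y₀) :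
    ∀ᶠ x in 𝓝 y₀, ‖f x‖ < ‖f y₀‖ + 1 :=
  hf.norm.eventually (gt_mem_nhds (by linarith))

lemma contDiffOn_ham (hA : ContDiffOn ℝ ∞ A U) :
    ContDiffOn ℝ ∞ (ham ι A) (U ×ˢ univ) := by
  have h1 : ContDiffOn ℝ ∞ (fun p : E × E ↦ A p.1) (U ×ˢ univ) :=
    hA.comp contDiff_fst.contDiffOn fun p hp ↦ hp.1
  exact contDiffOn_const.mul ((ι.contDiff.comp contDiff_snd).contDiffOn.clm_apply
    (h1.clm_apply contDiff_snd.contDiffOn))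

lemma contDiffOn_hamField (hU : IsOpen U) (hA : ContDiffOn ℝ ∞ A U) :
    ContDiffOn ℝ ∞ (hamField ι A) (U ×ˢ univ) := by
  have h1 : ContDiffOn ℝ ∞ (fun p : E × E ↦ A p.1) (U ×ˢ univ) :=
    hA.comp contDiff_fst.contDiffOn fun p hp ↦ hp.1
  have h2 : ContDiffOn ℝ ∞ (fun p : E × E ↦ fderiv ℝ A p.1) (U ×ˢ univ) :=
    (hA.fderiv_of_isOpen (m := ∞) hU (by simp)).comp contDiff_fst.contDiffOn fun p hp ↦ hp.1
  have h3 : ContDiffOn ℝ ∞ (fun p : E × E ↦ (fderiv ℝ A p.1).flip) (U ×ˢ univ) :=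
    (ContinuousLinearMap.flipₗᵢ ℝ E E E).toContinuousLinearEquiv.contDiff.comp_contDiffOn h2
  refine (h1.clm_apply contDiff_snd.contDiffOn).prodMk
    (ι.symm.contDiff.comp_contDiffOn (ContDiffOn.const_smul (-(1 / 2) : ℝ) ?_))
  exact (ι.contDiff.comp contDiff_snd).contDiffOn.clm_comp (h3.clm_apply contDiff_snd.contDiffOn)

set_option synthInstance.maxHeartbeats 200000 in
-- The position component is linear in the momentum and the momentum component is quadratic in it,
-- so at zero momentum the linearization is `(a, k) ↦ (A y₀ k, 0)`. Its square vanishes, as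
-- `exists_flow` requires.
lemma hasFDerivAt_hamField (hU : IsOpen U) (hA : ContDiffOn ℝ ∞ A U) (hy₀ : y₀ ∈ U) :
    HasFDerivAt (hamField ι A) (((A y₀).comp (ContinuousLinearMap.snd ℝ E E)).prod 0)
      (y₀, 0) := by
  have hA1 : HasFDerivAt A (fderiv ℝ A y₀) y₀ :=
    ((hA.contDiffAt (hU.mem_nhds hy₀)).differentiableAt (by simp)).hasFDerivAt
  have h1 : HasFDerivAt (fun p : E × E ↦ A p.1)
      ((fderiv ℝ A y₀).comp (ContinuousLinearMap.fst ℝ E E)) (y₀, 0) :=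
    HasFDerivAt.comp (y₀, (0 : E)) hA1 hasFDerivAt_fst
  have h2 : HasFDerivAt (fun p : E × E ↦ p.2)
      (ContinuousLinearMap.snd ℝ E E) (y₀, 0) := hasFDerivAt_snd
  refine HasFDerivAt.prodMk ?_ ?_
  · refine (h1.clm_apply h2).congr_fderiv ?_
    ext <;> simp
  · have hc : ContinuousAt (fderiv ℝ A) y₀ :=
      (hA.fderiv_of_isOpen (m := ∞) hU (by simp)).continuousOn.continuousAt (hU.mem_nhds hy₀)
    have hb' : ∀ᶠ x in 𝓝 y₀, ‖fderiv ℝ A x‖ < ‖fderiv ℝ A y₀‖ + 1 :=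
      eventually_norm_lt (F := E →L[ℝ] E →L[ℝ] E) (f := fderiv ℝ A) hc
    have hb : ∀ᶠ p : E × E in 𝓝 (y₀, 0), ‖fderiv ℝ A p.1‖ < ‖fderiv ℝ A y₀‖ + 1 :=
      hb'.prod_inl_nhds 0
    refine Asymptotics.IsBigO.hasFDerivAt (n := 2) (Asymptotics.IsBigO.of_bound
      (‖(ι.symm : (E →L[ℝ] ℝ) →L[ℝ] E)‖ * (1 / 2 * (‖(ι : E →L[ℝ] E →L[ℝ] ℝ)‖ *
        (‖fderiv ℝ A y₀‖ + 1)))) ?_) (by norm_num)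
    filter_upwards [hb] with p hp
    refine ((ι.symm : (E →L[ℝ] ℝ) →L[ℝ] E).le_opNorm _).trans ?_
    rw [mul_assoc]
    gcongr
    rw [norm_smul, norm_neg, Real.norm_of_nonneg (by norm_num), mul_assoc]
    gcongr
    have h4 : ‖p.2‖ ≤ ‖p - (y₀, 0)‖ := by
      have := norm_snd_le (p - (y₀, (0 : E)))
      simpa using this
    calc ‖ι p.2 ∘L (fderiv ℝ A p.1).flip p.2‖
        ≤ ‖ι p.2‖ * ‖(fderiv ℝ A p.1).flip p.2‖ := ContinuousLinearMap.opNorm_comp_le _ _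
      _ ≤ (‖(ι : E →L[ℝ] E →L[ℝ] ℝ)‖ * ‖p.2‖) * (‖(fderiv ℝ A p.1).flip‖ * ‖p.2‖) := by
        gcongr
        · exact (ι : E →L[ℝ] E →L[ℝ] ℝ).le_opNorm _
        · exact ContinuousLinearMap.le_opNorm _ _
      _ = ‖(ι : E →L[ℝ] E →L[ℝ] ℝ)‖ * ‖fderiv ℝ A p.1‖ * ‖p.2‖ ^ 2 := by
        rw [ContinuousLinearMap.opNorm_flip]; ring
      _ ≤ ‖(ι : E →L[ℝ] E →L[ℝ] ℝ)‖ * (‖fderiv ℝ A y₀‖ + 1) * ‖p - (y₀, 0)‖ ^ 2 := by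
        gcongr
      _ = _ := by rw [norm_pow, norm_norm, mul_assoc]

/-- Second order Taylor estimate. -/
lemma exists_taylor_bound {F : Type*} [NormedAddCommGroup F] [NormedSpace ℝ F] {f : E → F}
    (hU : IsOpen U) (hf : ContDiffOn ℝ ∞ f U) (hy₀ : y₀ ∈ U) :
    ∃ C ≥ 0, ∃ r > 0, ball y₀ r ⊆ U ∧ ∀ x ∈ ball y₀ r, ‖f x‖ ≤ C ∧
      ∀ x' ∈ ball y₀ r, ‖f x' - f x - fderiv ℝ f x (x' - x)‖ ≤ C * ‖x' - x‖ ^ 2 := by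
  have h1 : ContDiffAt ℝ 1 (fderiv ℝ f) y₀ :=
    ((hf.fderiv_of_isOpen (m := ∞) hU (by simp)).contDiffAt (hU.mem_nhds hy₀)).of_le (by simp)
  obtain ⟨K, s, hs, hl⟩ := h1.exists_lipschitzOnWith
  have hb := eventually_norm_lt (hf.continuousOn.continuousAt (hU.mem_nhds hy₀))
  obtain ⟨r, hr, hrs⟩ := Metric.nhds_basis_ball.mem_iff.1 (inter_mem (inter_mem hs (hU.mem_nhds hy₀)) hb)
  refine ⟨max K (‖f y₀‖ + 1), le_max_of_le_left K.2, r, hr, fun x hx ↦ (hrs hx).1.2, fun x hx ↦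
    ⟨(hrs hx).2.le.trans (le_max_right _ _), fun x' hx' ↦ ?_⟩⟩
  have hseg : segment ℝ x x' ⊆ ball y₀ r := (convex_ball y₀ r).segment_subset hx hx'
  -- Mean value inequality for `f` minus its linear part at `x`: on the segment the derivative moves
  -- by at most `K ‖x' - x‖`.
  have key := (convex_segment x x').norm_image_sub_le_of_norm_hasFDerivWithin_le' (f := f)
    (f' := fderiv ℝ f) (φ := fderiv ℝ f x) (C := K * ‖x' - x‖) (x := x) (y := x') ?_ ?_
    (left_mem_segment ℝ x x') (right_mem_segment ℝ x x')
  · refine key.trans ?_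
    rw [mul_assoc, ← sq]
    gcongr
    exact le_max_left _ _
  · intro z hz
    exact ((hf.contDiffAt (hU.mem_nhds (hrs (hseg hz)).1.2)).differentiableAt
      (by simp)).hasFDerivAt.hasFDerivWithinAt
  · intro z hz
    refine (hl.norm_sub_le (hrs (hseg hz)).1.1 (hrs hx).1.1).trans ?_
    gcongr
    obtain ⟨a, b, ha, hb, hab, rfl⟩ := hz
    have : a • x + b • x' - x = b • (x' - x) := by
      have : a = 1 - b := by linarith
      rw [this]; module
    rw [this, norm_smul, Real.norm_of_nonneg hb]
    exact mul_le_of_le_one_left (norm_nonneg _) (by linarith)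

end Geodesics

/-! ### Hamiltonian geodesics of a Lorentzian metric on an open subset of a vector space -/

section LorentzChart

open Metric NNReal

set_option linter.unusedSectionVars false

variable {E : Type*} [NormedAddCommGroup E] [NormedSpace ℝ E] {ι : E ≃L[ℝ] (E →L[ℝ] ℝ)}

variable (ι) in
/-- A smooth Lorentzian metric `G` on the open subset `U` of a vector space, with inverse `A`, and a
covector `ℓ` that is timelike on `U`. -/
structure LorentzChart (G : E → E →L[ℝ] E →L[ℝ] ℝ) (A : E → E →L[ℝ] E) (ℓ : E →L[ℝ] ℝ)
    (U : Set E) : Prop where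
  isOpen : IsOpen U
  smooth : ContDiffOn ℝ ∞ A U
  lorentz : ∀ x ∈ U, IsLorentzForm (G x)
  inv : ∀ x ∈ U, ∀ ξ v, G x (A x ξ) v = ι ξ v
  timelike : ∀ x ∈ U, ℓ (A x (ι.symm ℓ)) < 0

variable {G : E → E →L[ℝ] E →L[ℝ] ℝ} {A : E → E →L[ℝ] E} {ℓ : E →L[ℝ] ℝ} {U : Set E} {x y₀ : E}

namespace LorentzChart

lemma eq_zero (h : LorentzChart ι G A ℓ U) (hx : x ∈ U) {ξ : E} (hξ : A x ξ = 0) : ξ = 0 := by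
  have : ι ξ = 0 := by
    ext v
    rw [← h.inv x hx, hξ]; simp
  simpa using this

lemma apply_symm (h : LorentzChart ι G A ℓ U) (hx : x ∈ U) (v : E) :
    A x (ι.symm (G x v)) = v := by
  refine (h.lorentz x hx).injective ?_
  ext w
  rw [h.inv x hx, ContinuousLinearEquiv.apply_symm_apply]

lemma symm (h : LorentzChart ι G A ℓ U) (hx : x ∈ U) (ξ η : E) :
    ι ξ (A x η) = ι η (A x ξ) := by
  rw [← h.inv x hx, ← h.inv x hx, (h.lorentz x hx).symm]

lemma covector_eq (h : LorentzChart ι G A ℓ U) (hx : x ∈ U) (v : E) :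
    ℓ v = G x (A x (ι.symm ℓ)) v := by
  rw [h.inv x hx, ContinuousLinearEquiv.apply_symm_apply]

lemma ham_eq (h : LorentzChart ι G A ℓ U) (hx : x ∈ U) (ξ : E) :
    2 * ham ι A (x, ξ) = G x (A x ξ) (A x ξ) := by
  rw [h.inv x hx, ham]; ring

lemma covector_ne_zero (h : LorentzChart ι G A ℓ U) (hx : x ∈ U) {v : E} (hv : v ≠ 0)
    (hvv : G x v v ≤ 0) : ℓ v ≠ 0 := by
  rw [h.covector_eq hx]
  refine (h.lorentz x hx).ne_zero_of_causal ?_ hv hvv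
  rw [← h.covector_eq hx]
  exact h.timelike x hx

/-- Applied to the final momentum of a timelike geodesic, this says that the gradient of the world
function is negative on future causal vectors. -/
lemma neg_of_future (h : LorentzChart ι G A ℓ U) (hx : x ∈ U) {ξ v : E} (hv : v ≠ 0)
    (hvv : G x v v ≤ 0) (hℓv : ℓ v < 0) (hξ : ham ι A (x, ξ) < 0) (hℓ : ℓ (A x ξ) < 0) :
    ι ξ v < 0 := by
  rw [← h.inv x hx]
  have h1 := h.timelike x hx
  rw [h.covector_eq hx] at h1 hℓv hℓ
  refine (h.lorentz x hx).neg_of_same_cone h1 ?_ hℓ hv hvv hℓv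
  rw [← h.ham_eq hx]
  linarith

lemma hamField_snd (p : E × E) (v : E) :
    ι (hamField ι A p).2 v = -(1 / 2) * ι p.2 (fderiv ℝ A p.1 v p.2) := by
  simp [hamField]

/-- A geodesic in Hamiltonian form, parametrized by `[0, τ]`. -/
def _root_.Penrose.IsHamCurve (ι : E ≃L[ℝ] (E →L[ℝ] ℝ)) (A : E → E →L[ℝ] E) (U : Set E) (τ : ℝ)
    (p : ℝ → E × E) : Prop :=
  ∀ t ∈ Icc 0 τ, (p t).1 ∈ U ∧ HasDerivWithinAt p (hamField ι A (p t)) (Icc 0 τ) t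

/-- Conservation of energy: by symmetry of `A` the change of momentum contributes twice, and
Hamilton's equation makes this cancel the change of `A` along the curve. -/
lemma ham_eq_of_curve (h : LorentzChart ι G A ℓ U) {τ : ℝ} {p : ℝ → E × E}
    (hp : IsHamCurve ι A U τ p) : ∀ t ∈ Icc 0 τ, ham ι A (p t) = ham ι A (p 0) := by
  have hd : ∀ t ∈ Icc 0 τ, HasDerivWithinAt (fun t ↦ ham ι A (p t)) 0 (Icc 0 τ) t := by
    intro t ht
    obtain ⟨hU, hpt⟩ := hp t ht
    have h1 : HasDerivWithinAt (fun t ↦ (p t).1) (hamField ι A (p t)).1 (Icc 0 τ) t :=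
      (ContinuousLinearMap.fst ℝ E E).hasFDerivAt.comp_hasDerivWithinAt t hpt
    have h2 : HasDerivWithinAt (fun t ↦ (p t).2) (hamField ι A (p t)).2 (Icc 0 τ) t :=
      (ContinuousLinearMap.snd ℝ E E).hasFDerivAt.comp_hasDerivWithinAt t hpt
    have h3 : HasDerivWithinAt (fun t ↦ ι (p t).2) (ι (hamField ι A (p t)).2) (Icc 0 τ) t :=
      ι.hasFDerivAt.comp_hasDerivWithinAt t h2
    have hA : HasFDerivAt A (fderiv ℝ A (p t).1) (p t).1 :=
      ((h.smooth.contDiffAt (h.isOpen.mem_nhds hU)).differentiableAt (by simp)).hasFDerivAt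
    have h4 : HasDerivWithinAt (fun t ↦ A (p t).1) (fderiv ℝ A (p t).1 (hamField ι A (p t)).1)
      (Icc 0 τ) t := hA.comp_hasDerivWithinAt t h1
    refine ((h3.clm_apply (h4.clm_apply h2)).const_mul (1 / 2 : ℝ)).congr_deriv ?_
    rw [map_add, h.symm hU (p t).2 (hamField ι A (p t)).2, hamField_snd]
    have : (hamField ι A (p t)).1 = A (p t).1 (p t).2 := rfl
    rw [this]
    ring
  refine constant_of_has_deriv_right_zero (fun t ht ↦ (hd t ht).continuousWithinAt) ?_
  intro t ht
  exact HasDerivWithinAt.Icc_to_Ici (hd t ⟨ht.1, ht.2.le⟩) ht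

/-- The sign of `ℓ` is constant along the velocity of a causal geodesic. -/
lemma covector_velocity_neg (h : LorentzChart ι G A ℓ U) {τ : ℝ} (hτ : 0 < τ) {p : ℝ → E × E}
    (hp : IsHamCurve ι A U τ p) (h0 : ham ι A (p 0) ≤ 0) (hne : ∀ t ∈ Icc 0 τ, (p t).2 ≠ 0)
    (hℓ : ℓ ((p τ).1 - (p 0).1) ≤ 0) : ∀ t ∈ Icc 0 τ, ℓ (A (p t).1 (p t).2) < 0 := by
  have hd : ∀ t ∈ Icc 0 τ, HasDerivWithinAt (fun t ↦ ℓ (p t).1) (ℓ (A (p t).1 (p t).2))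
      (Icc 0 τ) t := fun t ht ↦
    (ℓ ∘L ContinuousLinearMap.fst ℝ E E).hasFDerivAt.comp_hasDerivWithinAt t (hp t ht).2
  have hcp : ContinuousOn p (Icc 0 τ) := fun t ht ↦ (hp t ht).2.continuousWithinAt
  have hc : ContinuousOn (fun t ↦ ℓ (A (p t).1 (p t).2)) (Icc 0 τ) := by
    refine ℓ.continuous.comp_continuousOn (ContinuousOn.clm_apply ?_ hcp.snd)
    exact h.smooth.continuousOn.comp hcp.fst fun t ht ↦ (hp t ht).1
  -- The velocity stays causal by conservation of energy and stays nonzero, and the timelike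
  -- covector `ℓ` does not vanish on such vectors.
  have hne' : ∀ t ∈ Icc 0 τ, ℓ (A (p t).1 (p t).2) ≠ 0 := by
    intro t ht
    refine h.covector_ne_zero (hp t ht).1 (fun h1 ↦ hne t ht (h.eq_zero (hp t ht).1 h1)) ?_
    rw [← h.ham_eq (hp t ht).1, h.ham_eq_of_curve hp t ht]
    linarith
  -- If `ℓ` were nonnegative on some velocity, it would be positive on all of them by continuity,
  -- and would strictly increase from the initial to the final point.
  by_contra hcon
  push Not at hcon
  obtain ⟨t₀, ht₀, hpos⟩ := hcon
  have hall : ∀ t ∈ Icc 0 τ, 0 < ℓ (A (p t).1 (p t).2) := by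
    intro t ht
    by_contra hneg
    push Not at hneg
    obtain ⟨s, hs, hs0⟩ := isPreconnected_Icc.intermediate_value ht ht₀ hc ⟨hneg, hpos⟩
    exact hne' s hs hs0
  have hmono : StrictMonoOn (fun t ↦ ℓ (p t).1) (Icc 0 τ) := by
    refine strictMonoOn_of_deriv_pos (convex_Icc 0 τ)
      (fun t ht ↦ (hd t ht).continuousWithinAt) fun t ht ↦ ?_
    rw [interior_Icc] at ht
    rw [((hd t (Ioo_subset_Icc_self ht)).hasDerivAt (Icc_mem_nhds ht.1 ht.2)).deriv]
    exact hall t (Ioo_subset_Icc_self ht)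
  have := hmono (left_mem_Icc.2 hτ.le) (right_mem_Icc.2 hτ.le) hτ
  rw [map_sub] at hℓ
  linarith

/-- First variation: the energy of neighbouring geodesics from the same point. -/
lemma abs_sub_le (h : LorentzChart ι G A ℓ U) {τ C δ : ℝ} (hτ : 0 ≤ τ) (hC : 0 ≤ C)
    {p q : ℝ → E × E}
    (hp : IsHamCurve ι A U τ p) (hq : IsHamCurve ι A U τ q) (h0 : (p 0).1 = (q 0).1)
    (hp1 : ∀ t ∈ Icc 0 τ, ‖(p t).2‖ ≤ 1) (hδ : ∀ t ∈ Icc 0 τ, ‖q t - p t‖ ≤ δ)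
    (hA : ∀ t ∈ Icc 0 τ, ‖A (q t).1‖ ≤ C ∧ ‖A (q t).1 - A (p t).1 -
      fderiv ℝ A (p t).1 ((q t).1 - (p t).1)‖ ≤ C * ‖(q t).1 - (p t).1‖ ^ 2) :
    |ι (p τ).2 ((q τ).1 - (p τ).1) - τ * (ham ι A (q 0) - ham ι A (p 0))| ≤
      ‖(ι : E →L[ℝ] E →L[ℝ] ℝ)‖ * C * δ ^ 2 * τ := by
  set K := ‖(ι : E →L[ℝ] E →L[ℝ] ℝ)‖ with hK
  have hι : ∀ ξ v, |ι ξ v| ≤ K * ‖ξ‖ * ‖v‖ := fun ξ v ↦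
    (ι : E →L[ℝ] E →L[ℝ] ℝ).le_opNorm₂ ξ v
  -- Using both conserved energies, all terms of first order in `q - p` cancel. There remain half
  -- the Taylor remainder of `A` and half the energy of the momentum difference, both of order `δ²`.
  have hd : ∀ t ∈ Icc 0 τ, HasDerivWithinAt
      (fun t ↦ ι (p t).2 ((q t).1 - (p t).1) - t * (ham ι A (q 0) - ham ι A (p 0)))
      (1 / 2 * ι (p t).2 ((A (q t).1 - A (p t).1 - fderiv ℝ A (p t).1 ((q t).1 - (p t).1)) (p t).2)
        - 1 / 2 * ι ((q t).2 - (p t).2) (A (q t).1 ((q t).2 - (p t).2))) (Icc 0 τ) t := by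
    intro t ht
    obtain ⟨hpU, hpt⟩ := hp t ht
    obtain ⟨hqU, hqt⟩ := hq t ht
    have h1 : HasDerivWithinAt (fun t ↦ (p t).1) (A (p t).1 (p t).2) (Icc 0 τ) t :=
      (ContinuousLinearMap.fst ℝ E E).hasFDerivAt.comp_hasDerivWithinAt t hpt
    have h1' : HasDerivWithinAt (fun t ↦ (q t).1) (A (q t).1 (q t).2) (Icc 0 τ) t :=
      (ContinuousLinearMap.fst ℝ E E).hasFDerivAt.comp_hasDerivWithinAt t hqt
    have h2 : HasDerivWithinAt (fun t ↦ (p t).2) (hamField ι A (p t)).2 (Icc 0 τ) t :=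
      (ContinuousLinearMap.snd ℝ E E).hasFDerivAt.comp_hasDerivWithinAt t hpt
    have h3 : HasDerivWithinAt (fun t ↦ ι (p t).2) (ι (hamField ι A (p t)).2) (Icc 0 τ) t :=
      ι.hasFDerivAt.comp_hasDerivWithinAt t h2
    refine ((h3.clm_apply (h1'.sub h1)).sub ((hasDerivWithinAt_id t _).mul_const _)).congr_deriv ?_
    rw [hamField_snd, ← h.ham_eq_of_curve hq t ht, ← h.ham_eq_of_curve hp t ht]
    simp only [ham, map_sub, sub_apply, Pi.sub_apply]
    have e1 := h.symm hqU (p t).2 (q t).2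
    rw [e1]
    ring
  have hbd := norm_image_sub_le_of_norm_deriv_le_segment' (C := K * C * δ ^ 2) hd ?_ τ
    (right_mem_Icc.2 hτ)
  · simpa [h0] using hbd
  · intro t ht
    have ht' : t ∈ Icc 0 τ := ⟨ht.1, ht.2.le⟩
    obtain ⟨hA1, hA2⟩ := hA t ht'
    have hδ1 : ‖(q t).1 - (p t).1‖ ≤ δ := (norm_fst_le (q t - p t)).trans (hδ t ht')
    have hδ2 : ‖(q t).2 - (p t).2‖ ≤ δ := (norm_snd_le (q t - p t)).trans (hδ t ht')
    have hδ0 : 0 ≤ δ := (norm_nonneg _).trans hδ1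
    have hK0 : 0 ≤ K := (ι : E →L[ℝ] E →L[ℝ] ℝ).opNorm_nonneg
    have b1 : |ι (p t).2 ((A (q t).1 - A (p t).1 -
        fderiv ℝ A (p t).1 ((q t).1 - (p t).1)) (p t).2)| ≤ K * C * δ ^ 2 := by
      calc _ ≤ K * ‖(p t).2‖ * ‖(A (q t).1 - A (p t).1 -
            fderiv ℝ A (p t).1 ((q t).1 - (p t).1)) (p t).2‖ := hι _ _
        _ ≤ K * 1 * (C * δ ^ 2 * 1) := by
          gcongr
          · exact hp1 t ht'
          · refine (ContinuousLinearMap.le_opNorm _ _).trans ?_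
            gcongr
            · exact hA2.trans (by gcongr)
            · exact hp1 t ht'
        _ = _ := by ring
    have b2 : |ι ((q t).2 - (p t).2) (A (q t).1 ((q t).2 - (p t).2))| ≤ K * C * δ ^ 2 := by
      calc _ ≤ K * ‖(q t).2 - (p t).2‖ * ‖A (q t).1 ((q t).2 - (p t).2)‖ := hι _ _
        _ ≤ K * δ * (C * δ) := by
          gcongr
          exact (ContinuousLinearMap.le_opNorm _ _).trans (by gcongr)
        _ = _ := by ring
    rw [Real.norm_eq_abs]
    rw [abs_le] at b1 b2 ⊢
    constructor <;> linarith [b1.1, b1.2, b2.1, b2.2]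

end LorentzChart

end LorentzChart

/-! ### Geodesics between nearby points and the gradient of the world function -/

section WorldFunction

open Metric NNReal

set_option linter.unusedSectionVars false

variable {E : Type*} [NormedAddCommGroup E] [NormedSpace ℝ E] {ι : E ≃L[ℝ] (E →L[ℝ] ℝ)}
variable {G : E → E →L[ℝ] E →L[ℝ] ℝ} {A : E → E →L[ℝ] E} {ℓ : E →L[ℝ] ℝ} {U : Set E} {x y₀ : E}

lemma IsHamCurve.mono {U V : Set E} {τ : ℝ} {p : ℝ → E × E} (h : IsHamCurve ι A U τ p)
    (hUV : U ⊆ V) : IsHamCurve ι A V τ p := fun t ht ↦ ⟨hUV (h t ht).1, (h t ht).2⟩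

/-- A function with a quadratic Taylor estimate is differentiable. -/
lemma hasFDerivAt_of_eventually_abs_le {f : E → ℝ} {L : E →L[ℝ] ℝ} {y : E} {C : ℝ}
    (h : ∀ᶠ y' in 𝓝 y, |L (y' - y) - (f y' - f y)| ≤ C * ‖y' - y‖ ^ 2) : HasFDerivAt f L y := by
  have h1 : HasFDerivAt (fun y' ↦ L (y' - y) - (f y' - f y)) (0 : E →L[ℝ] ℝ) y := by
    refine Asymptotics.IsBigO.hasFDerivAt (n := 2) (Asymptotics.IsBigO.of_bound C ?_) (by norm_num)
    filter_upwards [h] with y' hy'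
    simpa using hy'
  have h2 : HasFDerivAt (fun y' ↦ L (y' - y)) L y :=
    L.hasFDerivAt.comp y ((hasFDerivAt_id y).sub_const y)
  refine ((h2.sub h1).add_const (f y)).congr_fderiv (by simp) |>.congr_of_eventuallyEq ?_
  exact Eventually.of_forall fun y' ↦ by simp

set_option synthInstance.maxHeartbeats 200000 in
-- `β b y` is the geodesic that runs from `b` to `y` in time `τ`. It comes from inverting `(b, ξ) ↦
-- (b, endpoint)` near zero momentum, where the linearization of the flow makes this map a local
-- homeomorphism. By the first variation, `τ` times its energy, as a function of `y`, has the final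
-- momentum as differential; this is the world function of `b` up to a factor. The last clause says
-- that points slightly to the past of `b`, in the direction dual to `ℓ`, see `b` along a timelike
-- geodesic.
lemma LorentzChart.exists_geodesics [CompleteSpace E] (h : LorentzChart ι G A ℓ U) (hy₀ : y₀ ∈ U)
    {O : Set E} (hO : O ∈ 𝓝 y₀) :
    ∃ τ > 0, ∃ ρ > 0, ∃ β : E → E → ℝ → E × E,
      (∀ b ∈ ball y₀ ρ, ∀ y ∈ ball y₀ ρ, (β b y 0).1 = b ∧ (β b y τ).1 = y ∧
        IsHamCurve ι A (U ∩ O) τ (β b y) ∧ (b ≠ y → ∀ t ∈ Icc 0 τ, (β b y t).2 ≠ 0) ∧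
        HasFDerivAt (fun y ↦ τ * ham ι A (β b y 0)) (ι (β b y τ).2) y) ∧
      ContinuousOn (fun z : E × E ↦ ham ι A (β z.1 z.2 0)) (ball y₀ ρ ×ˢ ball y₀ ρ) ∧
      ∀ b ∈ ball y₀ ρ, ∀ᶠ s in 𝓝[>] (0 : ℝ),
        ham ι A (β (b - s • A y₀ (ι.symm ℓ)) b 0) < 0 := by
  obtain ⟨C, hC, rT, hrT, hTU, hT⟩ := exists_taylor_bound h.isOpen h.smooth hy₀
  have hFs : ContDiffAt ℝ 1 (hamField ι A) (y₀, 0) :=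
    ((contDiffOn_hamField h.isOpen h.smooth).contDiffAt
      ((h.isOpen.prod isOpen_univ).mem_nhds ⟨hy₀, mem_univ _⟩)).of_le (by simp)
  set B : E × E →L[ℝ] E × E := ((A y₀).comp (ContinuousLinearMap.snd ℝ E E)).prod 0 with hB
  have hF0 : ∀ b, hamField ι A (b, 0) = 0 := fun b ↦ by simp [hamField]
  -- The prescribed neighbourhood keeps positions inside the Taylor ball and momenta below norm `1`,
  -- as the first variation estimate requires.
  obtain ⟨τ, hτ, r, hr, α, hα, hαl, hα0, hαc, hαd⟩ := exists_flow hFs (hF0 y₀)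
    (hasFDerivAt_hamField h.isOpen h.smooth hy₀) (fun v ↦ by simp)
    (O := (O ∩ ball y₀ rT) ×ˢ ball 0 1)
    (prod_mem_nhds (inter_mem hO (ball_mem_nhds _ hrT)) (ball_mem_nhds _ one_pos))
  -- `f1` linearizes `(b, ξ) ↦ (b, endpoint)` at zero momentum; `f2` is its inverse, since `ι⁻¹ G`
  -- inverts `A`.
  let f1 : E × E →L[ℝ] E × E := (ContinuousLinearMap.fst ℝ E E).prod
    (ContinuousLinearMap.fst ℝ E E + τ • (A y₀).comp (ContinuousLinearMap.snd ℝ E E))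
  let f2 : E × E →L[ℝ] E × E := (ContinuousLinearMap.fst ℝ E E).prod
    (τ⁻¹ • ((ι.symm : (E →L[ℝ] ℝ) →L[ℝ] E) ∘L (G y₀) ∘L
      (ContinuousLinearMap.snd ℝ E E - ContinuousLinearMap.fst ℝ E E)))
  have hιG : ∀ k, ι.symm (G y₀ (A y₀ k)) = k := fun k ↦ by
    rw [ContinuousLinearEquiv.symm_apply_eq]
    ext v
    exact h.inv y₀ hy₀ k v
  let e : (E × E) ≃L[ℝ] (E × E) := ContinuousLinearEquiv.equivOfInverse f1 f2
    (by
      rintro ⟨a, k⟩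
      simp [f1, f2, hιG, hτ.ne'])
    (by
      rintro ⟨a, y⟩
      simp [f1, f2, smul_smul, hτ.ne', h.apply_symm hy₀])
  have hΨ : HasStrictFDerivAt (fun p : E × E ↦ (p.1, (α p τ).1)) (e : E × E →L[ℝ] E × E)
      (y₀, 0) := by
    have h1 : HasStrictFDerivAt (fun p : E × E ↦ (p.1, (α p τ).1)) _ (y₀, 0) :=
      hasStrictFDerivAt_fst.prodMk ((ContinuousLinearMap.fst ℝ E E).hasStrictFDerivAt.comp
        (y₀, (0 : E)) hαd)
    refine h1.congr_fderiv ?_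
    ext <;> simp [e, f1]
  have hm0 : (y₀, (0 : E)) ∈ ball (y₀, (0 : E)) r := mem_ball_self hr
  have hΨ0 : ((y₀, (0 : E)).1, (α (y₀, 0) τ).1) = (y₀, y₀) := by
    rw [hαc _ hm0 (hF0 _) τ (right_mem_Icc.2 hτ.le)]
  set Θ := hΨ.localInverse with hΘ
  have hΘd := hΨ.to_localInverse
  have hΘr := hΨ.eventually_right_inverse
  have hΘl := hΨ.eventually_left_inverse
  have hΘ0 := hΨ.localInverse_apply_image
  rw [← hΘ] at hΘd hΘr hΘl hΘ0
  simp only [hΨ0] at hΘd hΘr hΘ0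
  obtain ⟨K, sK, hsK, hK⟩ := hΘd.exists_lipschitzOnWith
  have hΘb : ∀ᶠ z in 𝓝 (y₀, y₀), Θ z ∈ ball (y₀, (0 : E)) r := by
    have := hΘd.hasFDerivAt.continuousAt
    rw [ContinuousAt, hΘ0] at this
    exact this (ball_mem_nhds _ hr)
  -- the energy is negative near the covector `ℓ`
  set lam := ι.symm ℓ with hlam
  set w := A y₀ lam with hw
  have hneg : ∀ᶠ p in 𝓝 (y₀, τ⁻¹ • lam), ham ι A p < 0 := by
    refine ((contDiffOn_ham h.smooth).continuousOn.continuousAt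
      ((h.isOpen.prod isOpen_univ).mem_nhds ⟨hy₀, mem_univ _⟩)).eventually (gt_mem_nhds ?_)
    have := h.timelike y₀ hy₀
    simp only [ham, map_smul, smul_apply, smul_eq_mul, hlam,
      ContinuousLinearEquiv.apply_symm_apply]
    have : 0 < τ⁻¹ := by positivity
    have h5 := mul_pos_of_neg_of_neg (h.timelike y₀ hy₀) (neg_neg_of_pos (mul_pos this this))
    linarith
  obtain ⟨δ, hδ, hδn⟩ := Metric.eventually_nhds_iff_ball.1 hneg
  -- This constant makes the linearization error between `(b - s w, b)` and `(b, b)`, at most the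
  -- constant times `s ‖w‖`, smaller than `δ s`.
  have hc := hΘd.isLittleO.bound (c := δ / (2 * (‖w‖ + 1))) (by positivity)
  rw [Metric.eventually_nhds_iff_ball] at hc
  obtain ⟨r2, hr2, hc⟩ := hc
  have hleft : ∀ᶠ b in 𝓝 y₀, Θ (b, b) = (b, 0) := by
    have h1 : Tendsto (fun b : E ↦ (b, (0 : E))) (𝓝 y₀) (𝓝 (y₀, 0)) := by
      exact (Continuous.tendsto (by fun_prop) y₀)
    filter_upwards [h1.eventually hΘl, h1 (ball_mem_nhds _ hr)] with b hb hb'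
    rwa [hαc _ hb' (hF0 b) τ (right_mem_Icc.2 hτ.le)] at hb
  have hnear : ∀ᶠ z in 𝓝 (y₀, y₀), (((Θ z).1, (α (Θ z) τ).1) = z ∧ z ∈ sK) ∧
      Θ z ∈ ball (y₀, (0 : E)) r := (hΘr.and hsK).and hΘb
  obtain ⟨r1, hr1, hn⟩ := Metric.eventually_nhds_iff_ball.1 hnear
  obtain ⟨r3, hr3, hl⟩ := Metric.eventually_nhds_iff_ball.1 hleft
  set ρ := min (min r1 r2) (min r3 δ) with hρ
  have hρ0 : 0 < ρ := lt_min (lt_min hr1 hr2) (lt_min hr3 hδ)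
  have hρ1 : ρ ≤ r1 := (min_le_left _ _).trans (min_le_left _ _)
  have hρ2 : ρ ≤ r2 := (min_le_left _ _).trans (min_le_right _ _)
  have hρ3 : ρ ≤ r3 := (min_le_right _ _).trans (min_le_left _ _)
  have hρ4 : ρ ≤ δ := (min_le_right _ _).trans (min_le_right _ _)
  have hn' : ∀ b ∈ ball y₀ ρ, ∀ y ∈ ball y₀ ρ, (((Θ (b, y)).1, (α (Θ (b, y)) τ).1) = (b, y) ∧
      (b, y) ∈ sK) ∧ Θ (b, y) ∈ ball (y₀, (0 : E)) r := by
    intro b hb y hy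
    refine hn (b, y) ?_
    rw [← ball_prod_same]
    exact ⟨ball_subset_ball hρ1 hb, ball_subset_ball hρ1 hy⟩
  have hcurve : ∀ b ∈ ball y₀ ρ, ∀ y ∈ ball y₀ ρ, IsHamCurve ι A (U ∩ O) τ (α (Θ (b, y))) := by
    intro b hb y hy t ht
    obtain ⟨⟨⟨h1, h2⟩, h3⟩, h4⟩ := (hα _ (hn' b hb y hy).2).2 t ht
    exact ⟨⟨hTU h2, h1⟩, h4⟩
  have hα00 : ∀ b ∈ ball y₀ ρ, ∀ y ∈ ball y₀ ρ, α (Θ (b, y)) 0 = Θ (b, y) :=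
    fun b hb y hy ↦ (hα _ (hn' b hb y hy).2).1
  have hΘ1 : ∀ b ∈ ball y₀ ρ, ∀ y ∈ ball y₀ ρ, (Θ (b, y)).1 = b :=
    fun b hb y hy ↦ (Prod.ext_iff.1 (hn' b hb y hy).1.1).1
  have hΘ2 : ∀ b ∈ ball y₀ ρ, ∀ y ∈ ball y₀ ρ, (α (Θ (b, y)) τ).1 = y :=
    fun b hb y hy ↦ (Prod.ext_iff.1 (hn' b hb y hy).1.1).2
  refine ⟨τ, hτ, ρ, hρ0, fun b y ↦ α (Θ (b, y)), fun b hb y hy ↦ ⟨?_, ?_, ?_, ?_, ?_⟩, ?_, ?_⟩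
  · beta_reduce
    rw [hα00 b hb y hy, hΘ1 b hb y hy]
  · exact hΘ2 b hb y hy
  · exact hcurve b hb y hy
  -- Zero momentum is an equilibrium of the flow, so the geodesic is constant and its endpoints
  -- coincide.
  · intro hby t ht h0
    have hz : hamField ι A (α (Θ (b, y)) t) = 0 := by
      rw [← hF0 (α (Θ (b, y)) t).1, ← h0]
    have h1 := hα0 _ (hn' b hb y hy).2 t ht hz
    rw [h1] at hz
    have h2 := hαc _ (hn' b hb y hy).2 hz τ (right_mem_Icc.2 hτ.le)
    apply hby
    rw [← hΘ2 b hb y hy, h2, hΘ1 b hb y hy]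
  -- The geodesics depend on `y` with Lipschitz constant `2 K`: `K` from the local inverse and `2`
  -- from the flow.
  · refine hasFDerivAt_of_eventually_abs_le (C := ‖(ι : E →L[ℝ] E →L[ℝ] ℝ)‖ * C * (2 * K) ^ 2 * τ) ?_
    filter_upwards [isOpen_ball.mem_nhds hy] with y' hy'
    have hδ' : ∀ t ∈ Icc 0 τ, ‖α (Θ (b, y')) t - α (Θ (b, y)) t‖ ≤ 2 * (K * ‖y' - y‖) := by
      intro t ht
      refine (hαl _ (hn' b hb y' hy').2 _ (hn' b hb y hy).2 t ht).trans ?_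
      gcongr
      have := hK.norm_sub_le (hn' b hb y' hy').1.2 (hn' b hb y hy).1.2
      simpa [Prod.norm_def] using this
    have key := h.abs_sub_le hτ.le hC ((hcurve b hb y hy).mono inter_subset_left)
      ((hcurve b hb y' hy').mono inter_subset_left)
      (by rw [hα00 b hb y hy, hα00 b hb y' hy', hΘ1 b hb y hy, hΘ1 b hb y' hy'])
      (fun t ht ↦ ?_) hδ' (fun t ht ↦ ?_)
    · rw [hΘ2 b hb y hy, hΘ2 b hb y' hy'] at key
      rw [← mul_sub]
      refine key.trans (le_of_eq ?_)
      ring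
    · have := ((hα _ (hn' b hb y hy).2).2 t ht).1.2
      exact (mem_ball_zero_iff.1 this).le
    · have h3 := ((hα _ (hn' b hb y' hy').2).2 t ht).1.1.2
      exact ⟨(hT _ h3).1, (hT _ ((hα _ (hn' b hb y hy).2).2 t ht).1.1.2).2 _ h3⟩
  · have hcont : ContinuousOn Θ (ball y₀ ρ ×ˢ ball y₀ ρ) :=
      hK.continuousOn.mono fun z hz ↦ (hn' z.1 hz.1 z.2 hz.2).1.2
    have : ContinuousOn (fun z ↦ ham ι A (Θ z)) (ball y₀ ρ ×ˢ ball y₀ ρ) := by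
      refine (contDiffOn_ham h.smooth).continuousOn.comp hcont fun z hz ↦ ⟨?_, mem_univ _⟩
      have := (hcurve z.1 hz.1 z.2 hz.2 0 (left_mem_Icc.2 hτ.le)).1.1
      rwa [hα00 z.1 hz.1 z.2 hz.2] at this
    refine this.congr fun z hz ↦ ?_
    simp only
    rw [hα00 z.1 hz.1 z.2 hz.2]
  -- Strict differentiability, with `Θ (b, b) = (b, 0)`, gives the initial momentum from `b - s w`
  -- to `b` as `s τ⁻¹ λ` up to an error below `δ s`, where `λ` represents `ℓ`. Dividing by `s` lands
  -- in the region of negative energy around `τ⁻¹ λ`, and the energy is quadratic in the momentum.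
  · intro b hb
    have hbs : ∀ᶠ s in 𝓝[>] (0 : ℝ), b - s • w ∈ ball y₀ ρ := by
      have : Tendsto (fun s : ℝ ↦ b - s • w) (𝓝 0) (𝓝 (b - (0 : ℝ) • w)) :=
        Continuous.tendsto (by fun_prop) 0
      rw [zero_smul, sub_zero] at this
      exact nhdsWithin_le_nhds (this (isOpen_ball.mem_nhds hb))
    filter_upwards [hbs, self_mem_nhdsWithin] with s hs hs0
    have hs0 : 0 < s := hs0
    rw [hα00 _ hs b hb]
    have h1 := hc ((b - s • w, b), (b, b)) (by
      rw [← ball_prod_same, ← ball_prod_same]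
      exact ⟨⟨ball_subset_ball hρ2 hs, ball_subset_ball hρ2 hb⟩,
        ball_subset_ball hρ2 hb, ball_subset_ball hρ2 hb⟩)
    simp only [hl b (ball_subset_ball hρ3 hb)] at h1
    have he : (e.symm : E × E →L[ℝ] E × E) ((b - s • w, b) - (b, b)) =
        (-(s • w), τ⁻¹ • s • lam) := by
      have : (e.symm : E × E →L[ℝ] E × E) = f2 := rfl
      rw [this]
      have h4 := hιG lam
      rw [← hw] at h4
      simp [f2, h4]
    rw [he] at h1
    have h2 : ‖(Θ (b - s • w, b)).2 - τ⁻¹ • s • lam‖ ≤ δ / (2 * (‖w‖ + 1)) * (s * ‖w‖) := by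
      have h6 := norm_snd_le (Θ (b - s • w, b) - (b, 0) - (-(s • w), τ⁻¹ • s • lam))
      have h7 : ‖((b - s • w, b) : E × E) - (b, b)‖ = s * ‖w‖ := by
        simp [Prod.norm_def, norm_smul, abs_of_pos hs0]
        positivity
      rw [h7] at h1
      have := h6.trans h1
      simpa using this
    have h3 : ‖s⁻¹ • (Θ (b - s • w, b)).2 - τ⁻¹ • lam‖ < δ := by
      have : s⁻¹ • (Θ (b - s • w, b)).2 - τ⁻¹ • lam =
          s⁻¹ • ((Θ (b - s • w, b)).2 - τ⁻¹ • s • lam) := by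
        rw [smul_sub, smul_comm τ⁻¹ s lam, smul_smul, inv_mul_cancel₀ hs0.ne', one_smul]
      rw [this, norm_smul, norm_inv, Real.norm_of_nonneg hs0.le]
      calc s⁻¹ * _ ≤ s⁻¹ * (δ / (2 * (‖w‖ + 1)) * (s * ‖w‖)) := by gcongr
        _ = δ * (‖w‖ / (2 * (‖w‖ + 1))) := by field_simp
        _ < δ * 1 := by
          gcongr
          rw [div_lt_one (by positivity)]
          linarith [norm_nonneg w]
        _ = δ := mul_one _
    have h8 := hδn (b - s • w, s⁻¹ • (Θ (b - s • w, b)).2) (by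
      rw [← ball_prod_same]
      exact ⟨ball_subset_ball hρ4 hs, by rwa [mem_ball_iff_norm]⟩)
    have h9 : Θ (b - s • w, b) = (b - s • w, (Θ (b - s • w, b)).2) := Prod.ext (hΘ1 _ hs b hb) rfl
    rw [h9]
    have h10 : ham ι A (b - s • w, (Θ (b - s • w, b)).2) =
        s ^ 2 * ham ι A (b - s • w, s⁻¹ • (Θ (b - s • w, b)).2) := by
      simp only [ham, map_smul, smul_apply, smul_eq_mul]
      field_simp
    rw [h10]
    exact mul_neg_of_pos_of_neg (by positivity) h8

end WorldFunction

/-! ### Local closedness of the causal relation in coordinates -/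

section LocalClosedness

open Metric NNReal

set_option linter.unusedSectionVars false

variable {E : Type*} [NormedAddCommGroup E] [NormedSpace ℝ E] {ι : E ≃L[ℝ] (E →L[ℝ] ℝ)}
variable {G : E → E →L[ℝ] E →L[ℝ] ℝ} {A : E → E →L[ℝ] E} {ℓ : E →L[ℝ] ℝ} {U : Set E} {x y₀ : E}

/-- There is a differentiable causal path in `W` from `p` to `q`, for the metric `G` on a vector
space; the future is where `ℓ < 0`. -/
def CoordStep (G : E → E →L[ℝ] E →L[ℝ] ℝ) (ℓ : E →L[ℝ] ℝ) (W : Set E) (p q : E) : Prop :=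
  ∃ y y' : ℝ → E, y 0 = p ∧ y 1 = q ∧ ∀ t ∈ Icc (0 : ℝ) 1, y t ∈ W ∧
    HasDerivWithinAt y (y' t) (Icc 0 1) t ∧ y' t ≠ 0 ∧ G (y t) (y' t) (y' t) ≤ 0 ∧ ℓ (y' t) < 0

lemma strictAntiOn_of_hasDerivWithinAt_neg {f f' : ℝ → ℝ} {a b : ℝ}
    (hd : ∀ t ∈ Icc a b, HasDerivWithinAt f (f' t) (Icc a b) t) (hneg : ∀ t ∈ Icc a b, f' t < 0) :
    StrictAntiOn f (Icc a b) := by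
  refine strictAntiOn_of_deriv_neg (convex_Icc a b)
    (fun t ht ↦ (hd t ht).continuousWithinAt) fun t ht ↦ ?_
  rw [interior_Icc] at ht
  rw [((hd t (Ioo_subset_Icc_self ht)).hasDerivAt (Icc_mem_nhds ht.1 ht.2)).deriv]
  exact hneg t (Ioo_subset_Icc_self ht)

/-- The world function of a point decreases along future causal paths in its timelike future. -/
lemma LorentzChart.ham_neg_of_step (h : LorentzChart ι G A ℓ U) {τ : ℝ} (hτ : 0 < τ) {Q : Set E}
    {β : E → ℝ → E × E} {b : E}
    (hβ : ∀ y ∈ Q, (β y 0).1 = b ∧ (β y τ).1 = y ∧ IsHamCurve ι A U τ (β y) ∧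
      (b ≠ y → ∀ t ∈ Icc 0 τ, (β y t).2 ≠ 0) ∧
      HasFDerivAt (fun y ↦ τ * ham ι A (β y 0)) (ι (β y τ).2) y)
    {p q : E} (hpq : CoordStep G ℓ Q p q) (hp : ham ι A (β p 0) < 0) (hℓ : ℓ (p - b) < 0) :
    ham ι A (β q 0) < 0 ∧ ℓ (q - b) < 0 := by
  obtain ⟨y, y', rfl, rfl, hy⟩ := hpq
  have hd : ∀ t ∈ Icc (0 : ℝ) 1, HasDerivWithinAt (fun t ↦ ℓ (y t)) (ℓ (y' t)) (Icc 0 1) t :=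
    fun t ht ↦ ℓ.hasFDerivAt.comp_hasDerivWithinAt t (hy t ht).2.1
  have hanti := strictAntiOn_of_hasDerivWithinAt_neg hd fun t ht ↦ (hy t ht).2.2.2.2
  have hℓt : ∀ t ∈ Icc (0 : ℝ) 1, ℓ (y t - b) < 0 := by
    intro t ht
    have : ℓ (y t) ≤ ℓ (y 0) := hanti.antitoneOn (left_mem_Icc.2 zero_le_one) ht ht.1
    rw [map_sub] at hℓ ⊢
    linarith
  refine ⟨?_, hℓt 1 (right_mem_Icc.2 zero_le_one)⟩
  have hf : ∀ t ∈ Icc (0 : ℝ) 1, HasDerivWithinAt (fun t ↦ τ * ham ι A (β (y t) 0))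
      (ι (β (y t) τ).2 (y' t)) (Icc 0 1) t := fun t ht ↦
    (hβ (y t) (hy t ht).1).2.2.2.2.comp_hasDerivWithinAt t (hy t ht).2.1
  -- The comparison principle needs a negative derivative only when the world function equals its
  -- initial, negative value. At such a time the geodesic from `b` is timelike, and it is
  -- future-directed because `ℓ (y t - b) < 0`, so its final momentum is negative on the velocity of
  -- the path.
  have key := image_le_of_deriv_right_lt_deriv_boundary (a := 0) (b := 1)
    (f := fun t ↦ τ * ham ι A (β (y t) 0)) (f' := fun t ↦ ι (β (y t) τ).2 (y' t))
    (B := fun _ ↦ τ * ham ι A (β (y 0) 0)) (B' := fun _ ↦ 0)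
    (fun t ht ↦ (hf t ht).continuousWithinAt)
    (fun t ht ↦ HasDerivWithinAt.Icc_to_Ici (hf t ⟨ht.1, ht.2.le⟩) ht) le_rfl
    (fun t ↦ hasDerivAt_const t _) ?_ (right_mem_Icc.2 zero_le_one)
  · have := (mul_le_mul_iff_right₀ hτ).1 key
    exact this.trans_lt hp
  · intro t ht heq
    have ht' : t ∈ Icc (0 : ℝ) 1 := ⟨ht.1, ht.2.le⟩
    obtain ⟨h0, h1, h2, h3, -⟩ := hβ (y t) (hy t ht').1
    have hneg : ham ι A (β (y t) 0) < 0 := by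
      have : ham ι A (β (y t) 0) = ham ι A (β (y 0) 0) := mul_left_cancel₀ hτ.ne' heq
      rwa [this]
    have hne : b ≠ y t := by
      rintro hb
      have := hℓt t ht'
      rw [← hb] at this
      simp at this
    have hτm : τ ∈ Icc 0 τ := right_mem_Icc.2 hτ.le
    have h4 := h.covector_velocity_neg hτ h2 hneg.le (h3 hne)
      (by rw [h0, h1]; exact (hℓt t ht').le) τ hτm
    have h5 := h.ham_eq_of_curve h2 τ hτm
    have hU := (h2 τ hτm).1
    rw [← h5] at hneg
    rw [h1] at h4 hU
    have h6 : β (y t) τ = (y t, (β (y t) τ).2) := Prod.ext h1 rfl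
    rw [h6] at hneg
    exact h.neg_of_future hU (hy t ht').2.2.1 (hy t ht').2.2.2.1 (hy t ht').2.2.2.2 hneg h4

/-- The causal relation is locally closed. -/
lemma LorentzChart.exists_closed_nhds [CompleteSpace E] (h : LorentzChart ι G A ℓ U) (hy₀ : y₀ ∈ U)
    {O : Set E} (hO : O ∈ 𝓝 y₀) : ∃ ρ > 0, ∀ {κ : Type*} (l : Filter κ) [NeBot l] (p q : κ → E)
      (b c : E), (∀ᶠ i in l, Relation.ReflTransGen (CoordStep G ℓ (ball y₀ ρ)) (p i) (q i)) →
      Tendsto p l (𝓝 b) → Tendsto q l (𝓝 c) → b ∈ ball y₀ ρ → c ∈ ball y₀ ρ → b = c ∨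
      ∃ y : ℝ → E, ContDiffOn ℝ ∞ y (Icc 0 1) ∧ y 0 = b ∧ y 1 = c ∧ ∀ t ∈ Icc (0 : ℝ) 1,
        y t ∈ U ∩ O ∧ ∃ v, HasDerivWithinAt y v (Icc 0 1) t ∧ v ≠ 0 ∧ G (y t) v v ≤ 0 ∧ ℓ v < 0 := by
  obtain ⟨τ, hτ, ρ, hρ, β, hβ, hcont, hsmall⟩ := h.exists_geodesics hy₀ hO
  refine ⟨ρ, hρ, fun {κ} l _ p q b c hpq hp hq hb hc ↦ ?_⟩
  have hτm : τ ∈ Icc 0 τ := right_mem_Icc.2 hτ.le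
  have hτ0 : (0 : ℝ) ∈ Icc 0 τ := left_mem_Icc.2 hτ.le
  set w := A y₀ (ι.symm ℓ) with hw
  have hℓw : ℓ w < 0 := h.timelike y₀ hy₀
  have hbs : Tendsto (fun s : ℝ ↦ b - s • w) (𝓝[>] 0) (𝓝 b) := by
    have : Tendsto (fun s : ℝ ↦ b - s • w) (𝓝 0) (𝓝 (b - (0 : ℝ) • w)) :=
      Continuous.tendsto (by fun_prop) 0
    rw [zero_smul, sub_zero] at this
    exact this.mono_left nhdsWithin_le_nhds
  have hS : ∀ b' ∈ ball y₀ ρ, ∀ y ∈ ball y₀ ρ,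
      ContinuousAt (fun y ↦ ham ι A (β b' y 0)) y := by
    intro b' hb' y hy
    have h1 := hcont.continuousAt (x := (b', y))
      ((isOpen_ball.prod isOpen_ball).mem_nhds ⟨hb', hy⟩)
    have h2 : ContinuousAt (fun y : E ↦ (b', y)) y := by fun_prop
    exact ContinuousAt.comp (f := fun y : E ↦ (b', y)) h1 h2
  -- Moving the base point to `b - s w`, slightly to the past, makes the starting conditions strict.
  -- They hold at `p i` for late `i`, propagate to `q i`, and pass to the limit `c` as weak
  -- inequalities; `s → 0` then returns to `b`.
  have key : ∀ᶠ s in 𝓝[>] (0 : ℝ), ham ι A (β (b - s • w) c 0) ≤ 0 ∧ ℓ (c - (b - s • w)) ≤ 0 := by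
    filter_upwards [hsmall b hb, hbs (isOpen_ball.mem_nhds hb), self_mem_nhdsWithin]
      with s hs1 hs2 hs0
    have hs0 : 0 < s := hs0
    have hℓc : ∀ z, ContinuousAt (fun y ↦ ℓ (y - (b - s • w))) z := fun z ↦ by fun_prop
    have e1 : ∀ᶠ i in l, ham ι A (β (b - s • w) (p i) 0) < 0 :=
      ((hS _ hs2 b hb).tendsto.comp hp).eventually (gt_mem_nhds hs1)
    have e2 : ∀ᶠ i in l, ℓ (p i - (b - s • w)) < 0 := by
      refine ((hℓc b).tendsto.comp hp).eventually (gt_mem_nhds ?_)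
      simp only [sub_sub_cancel, map_smul, smul_eq_mul]
      exact mul_neg_of_pos_of_neg hs0 hℓw
    have e3 : ∀ᶠ i in l, ham ι A (β (b - s • w) (q i) 0) < 0 ∧ ℓ (q i - (b - s • w)) < 0 := by
      filter_upwards [e1, e2, hpq] with i h1 h2 h3
      generalize q i = z at h3
      induction h3 with
      | refl => exact ⟨h1, h2⟩
      | tail _ hst ih =>
        exact h.ham_neg_of_step hτ (fun y hy ↦ ⟨(hβ _ hs2 y hy).1, (hβ _ hs2 y hy).2.1,
          (hβ _ hs2 y hy).2.2.1.mono inter_subset_left, (hβ _ hs2 y hy).2.2.2⟩) hst ih.1 ih.2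
    exact ⟨le_of_tendsto ((hS _ hs2 c hc).tendsto.comp hq) (e3.mono fun i hi ↦ hi.1.le),
      le_of_tendsto ((hℓc c).tendsto.comp hq) (e3.mono fun i hi ↦ hi.2.le)⟩
  have hS0 : ham ι A (β b c 0) ≤ 0 := by
    have h1 := (hcont.continuousAt (x := (b, c))
      ((isOpen_ball.prod isOpen_ball).mem_nhds ⟨hb, hc⟩)).tendsto
    exact le_of_tendsto (h1.comp (hbs.prodMk_nhds tendsto_const_nhds)) (key.mono fun s hs ↦ hs.1)
  have hℓ0 : ℓ (c - b) ≤ 0 := by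
    have h1 : ContinuousAt (fun z ↦ ℓ (c - z)) b := by fun_prop
    exact le_of_tendsto (h1.tendsto.comp hbs) (key.mono fun s hs ↦ hs.2)
  by_cases hbc : b = c
  · exact Or.inl hbc
  right
  obtain ⟨h0, h1, h2, h3, -⟩ := hβ b hb c hc
  have h2' := h2.mono (inter_subset_left (s := U) (t := O))
  have hneg := h.covector_velocity_neg hτ h2' hS0 (h3 hbc) (by rwa [h0, h1])
  -- The geodesic from `b` to `c` is the required path; it is smooth because it solves a smooth
  -- autonomous equation.
  have hsm : ContDiffOn ℝ ∞ (β b c) (Icc 0 τ) := by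
    refine ODE.contDiffOn_enat_Icc_of_hasDerivWithinAt (n := ⊤) (f := fun _ ↦ hamField ι A)
      (u := U ×ˢ univ) ?_ (fun t ht ↦ (h2' t ht).2) fun t ht ↦ ⟨(h2' t ht).1, mem_univ _⟩
    exact (contDiffOn_hamField h.isOpen h.smooth).comp contDiff_snd.contDiffOn fun z hz ↦ hz.2
  have hmap : MapsTo (fun t ↦ τ * t) (Icc 0 1) (Icc 0 τ) := fun t ht ↦
    ⟨mul_nonneg hτ.le ht.1, mul_le_of_le_one_right hτ.le ht.2⟩
  refine ⟨fun t ↦ (β b c (τ * t)).1, ?_, by simpa using h0, by simpa using h1, fun t ht ↦ ?_⟩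
  · exact contDiff_fst.comp_contDiffOn (hsm.comp (contDiff_const.mul contDiff_id).contDiffOn hmap)
  · have hm := hmap ht
    obtain ⟨h5, h6⟩ := h2 _ hm
    refine ⟨h5, τ • A (β b c (τ * t)).1 (β b c (τ * t)).2, ?_, ?_, ?_, ?_⟩
    · have h7 : HasDerivWithinAt (fun t ↦ (β b c t).1) (A (β b c (τ * t)).1 (β b c (τ * t)).2)
          (Icc 0 τ) (τ * t) :=
        (ContinuousLinearMap.fst ℝ E E).hasFDerivAt.comp_hasDerivWithinAt _ h6
      have h8 : HasDerivWithinAt (fun t ↦ τ * t) τ (Icc 0 1) t := by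
        simpa using (hasDerivWithinAt_id t (Icc 0 1)).const_mul τ
      exact h7.scomp t h8 hmap
    · exact smul_ne_zero hτ.ne' fun h9 ↦ h3 hbc _ hm (h.eq_zero h5.1 h9)
    · have : G (β b c (τ * t)).1 (A (β b c (τ * t)).1 (β b c (τ * t)).2)
          (A (β b c (τ * t)).1 (β b c (τ * t)).2) ≤ 0 := by
        rw [← h.ham_eq h5.1, h.ham_eq_of_curve h2' _ hm]
        linarith
      simp only [map_smul, smul_apply, smul_eq_mul]
      exact mul_nonpos_of_nonneg_of_nonpos hτ.le (mul_nonpos_of_nonneg_of_nonpos hτ.le this)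
    · rw [map_smul, smul_eq_mul]
      exact mul_neg_of_pos_of_neg hτ (hneg _ hm)

/-- Existence of a Lorentzian chart with a given timelike direction. -/
lemma exists_lorentzChart [FiniteDimensional ℝ E] {ζ : E → E} (hU : IsOpen U)
    (hG : ContDiffOn ℝ ∞ G U) (hL : ∀ x ∈ U, IsLorentzForm (G x)) (hζ : ContinuousOn ζ U)
    (hζt : ∀ x ∈ U, G x (ζ x) (ζ x) < 0) (hy₀ : y₀ ∈ U) :
    ∃ (ι : E ≃L[ℝ] (E →L[ℝ] ℝ)) (A : E → E →L[ℝ] E) (ℓ : E →L[ℝ] ℝ) (U' : Set E), U' ⊆ U ∧ y₀ ∈ U' ∧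
      LorentzChart ι G A ℓ U' ∧
      ∀ x ∈ U', ∀ v, v ≠ 0 → G x v v ≤ 0 → (G x (ζ x) v < 0 ↔ ℓ v < 0) := by
  have : CompleteSpace E := FiniteDimensional.complete ℝ E
  have hbij : ∀ x ∈ U, Function.Injective (G x) := fun x hx ↦ (hL x hx).injective
  have hdim : Module.finrank ℝ E = Module.finrank ℝ (E →L[ℝ] ℝ) := by
    rw [← Subspace.dual_finrank_eq (K := ℝ) (V := E)]
    exact LinearEquiv.finrank_eq LinearMap.toContinuousLinearMap
  -- Covectors are represented by vectors by means of the metric at the single point `y₀`, so `A` is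
  -- the inverse of `ι⁻¹ G` and equals the identity at `y₀`.
  let ι : E ≃L[ℝ] (E →L[ℝ] ℝ) := (LinearEquiv.ofInjectiveOfFinrankEq (G y₀ : E →ₗ[ℝ] (E →L[ℝ] ℝ))
      (hbij y₀ hy₀) hdim).toContinuousLinearEquiv
  let ex : ∀ x ∈ U, E ≃L[ℝ] E := fun x hx ↦
    ((LinearEquiv.ofInjectiveOfFinrankEq (G x : E →ₗ[ℝ] (E →L[ℝ] ℝ))
      (hbij x hx) hdim).toContinuousLinearEquiv).trans ι.symm
  let D : E → E →L[ℝ] E := fun x ↦ (ι.symm : (E →L[ℝ] ℝ) →L[ℝ] E) ∘L G x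
  have hD : ∀ x (hx : x ∈ U), D x = ex x hx := fun x hx ↦ by ext v; rfl
  let A : E → E →L[ℝ] E := fun x ↦ (D x).inverse
  have hA : ContDiffOn ℝ ∞ A U := by
    intro x hx
    have h1 : ContDiffAt ℝ ∞ D x :=
      contDiffAt_const.clm_comp (hG.contDiffAt (hU.mem_nhds hx))
    have h2 : ContDiffAt ℝ ∞ ContinuousLinearMap.inverse (D x) := by
      rw [hD x hx]; exact contDiffAt_map_inverse _
    exact (h2.comp x h1).contDiffWithinAt
  have hinv : ∀ x ∈ U, ∀ ξ, G x (A x ξ) = ι ξ := by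
    intro x hx ξ
    have : D x (A x ξ) = ξ := by
      simp only [A]
      rw [hD x hx, ContinuousLinearMap.inverse_equiv]
      simp
    simp only [D, ContinuousLinearMap.comp_apply] at this
    exact (ι.symm_apply_eq.1 this)
  set ℓ : E →L[ℝ] ℝ := G y₀ (ζ y₀) with hℓ
  have hιℓ : ∀ x ∈ U, G x (A x (ι.symm ℓ)) = ℓ := fun x hx ↦ by
    rw [hinv x hx, ContinuousLinearEquiv.apply_symm_apply]
  have hζ0 : A y₀ (ι.symm ℓ) = ζ y₀ := hbij y₀ hy₀ (by rw [hιℓ y₀ hy₀])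
  have hc1 : ContinuousOn (fun x ↦ ℓ (A x (ι.symm ℓ))) U :=
    ℓ.continuous.comp_continuousOn (hA.continuousOn.clm_apply continuousOn_const)
  have hc2 : ContinuousOn (fun x ↦ ℓ (ζ x)) U := ℓ.continuous.comp_continuousOn hζ
  -- On `U'` the dual vector of `ℓ` is timelike and lies in the same cone as `ζ`. Hence `ℓ < 0` and
  -- `G x (ζ x) < 0` select the same causal vectors.
  let U' : Set E := U ∩ {x | ℓ (A x (ι.symm ℓ)) < 0 ∧ ℓ (ζ x) < 0}
  have hU' : IsOpen U' := by
    have h1 := hc1.isOpen_inter_preimage hU isOpen_Iio (t := Iio 0)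
    have h2 := hc2.isOpen_inter_preimage hU isOpen_Iio (t := Iio 0)
    convert h1.inter h2 using 1
    ext x
    simp only [U', mem_inter_iff, mem_ofPred_eq, mem_preimage, mem_Iio]
    tauto
  refine ⟨ι, A, ℓ, U', inter_subset_left, ⟨hy₀, ?_, hζt y₀ hy₀⟩, ⟨hU', hA.mono inter_subset_left,
    fun x hx ↦ hL x hx.1, fun x hx ξ v ↦ by rw [hinv x hx.1], fun x hx ↦ hx.2.1⟩, ?_⟩
  · rw [hζ0]; exact hζt y₀ hy₀
  · rintro x ⟨hx, h1, h2⟩ v hv hvv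
    have e : ∀ u, ℓ u = G x (A x (ι.symm ℓ)) u := fun u ↦ by rw [hιℓ x hx]
    rw [e] at h1 h2
    rw [e]
    constructor
    · intro h3
      exact (hL x hx).neg_of_same_cone (hζt x hx) h1 (by rwa [(hL x hx).symm]) hv hvv h3
    · intro h3
      exact (hL x hx).neg_of_same_cone h1 (hζt x hx) h2 hv hvv h3

end LocalClosedness

/-! ### Causal paths in open sets of a manifold and their local properties -/

section LocalCausality

open Metric

set_option linter.unusedSectionVars false

variable {X : Type*} [TopologicalSpace X] [ChartedSpace ModelH X] [IsManifold I₄ ∞ X]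
  {g : MetricField X} {Z : VecField X}

/-- `(g, Z)` is a smooth time-oriented Lorentzian metric on the open set `s`. -/
structure IsSpacetimeOn (g : MetricField X) (Z : VecField X) (s : Set X) : Prop where
  isOpen : IsOpen s
  lorentzian : IsLorentzianOn g s
  smooth : ContMDiffOn I₄ I₄.tangent ∞ (fun x ↦ (⟨x, Z x⟩ : TangentBundle I₄ X)) s
  timelike : ∀ x ∈ s, g x (Z x) (Z x) < 0

/-- There is a smooth future-pointing causal path in `W` from `p` to `q`. -/
def StepIn (g : MetricField X) (Z : VecField X) (W : Set X) (p q : X) : Prop :=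
  ∃ γ : ℝ → X, ContMDiffOn 𝓘(ℝ, ℝ) I₄ ∞ γ (Icc 0 1) ∧ γ 0 = p ∧ γ 1 = q ∧
    ∀ t ∈ Icc (0 : ℝ) 1, γ t ∈ W ∧ IsFutureCausal g Z (γ t) (velocity γ (Icc 0 1) t)

/-- There is a piecewise smooth future-pointing causal path in `W` from `p` to `q`, or `p = q`. -/
def LEIn (g : MetricField X) (Z : VecField X) (W : Set X) : X → X → Prop :=
  Relation.ReflTransGen (StepIn g Z W)

lemma StepIn.mono {W W' : Set X} (hW : W ⊆ W') {p q : X} (h : StepIn g Z W p q) :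
    StepIn g Z W' p q := by
  obtain ⟨γ, h1, h2, h3, h4⟩ := h
  exact ⟨γ, h1, h2, h3, fun t ht ↦ ⟨hW (h4 t ht).1, (h4 t ht).2⟩⟩

lemma LEIn.mono {W W' : Set X} (hW : W ⊆ W') {p q : X} (h : LEIn g Z W p q) :
    LEIn g Z W' p q := Relation.ReflTransGen.mono (fun _ _ ↦ StepIn.mono hW) _ _ h

lemma LEIn.trans {W : Set X} {p q r : X} (h : LEIn g Z W p q) (h' : LEIn g Z W q r) :
    LEIn g Z W p r := Relation.ReflTransGen.trans h h'

lemma stepIn_univ_iff {p q : X} : StepIn g Z univ p q ↔ CausalStep g Z p q := by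
  simp [StepIn, CausalStep]

lemma leIn_univ_iff {p q : X} : LEIn g Z univ p q ↔ CausalLE g Z p q := by
  have : StepIn g Z univ = CausalStep g Z := by
    ext p q; exact stepIn_univ_iff
  rw [LEIn, this, CausalLE]

lemma StepIn.mem_right {W : Set X} {p q : X} (h : StepIn g Z W p q) : q ∈ W := by
  obtain ⟨γ, -, -, rfl, h4⟩ := h
  exact (h4 1 (right_mem_Icc.2 zero_le_one)).1

/-- The velocity of a reparametrized curve. -/
lemma velocity_reparam {γ : ℝ → X} {s s' : Set ℝ} {r : ℝ → ℝ} {r' t : ℝ}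
    (hs : UniqueDiffWithinAt ℝ s' t) (hr : HasDerivWithinAt r r' s' t) (hm : MapsTo r s' s)
    (hγ : MDifferentiableWithinAt 𝓘(ℝ, ℝ) I₄ γ s (r t)) :
    velocity (fun t ↦ γ (r t)) s' t = r' • velocity γ s (r t) := by
  have h1 : HasMFDerivWithinAt 𝓘(ℝ, ℝ) 𝓘(ℝ, ℝ) r s' t (ContinuousLinearMap.toSpanSingleton ℝ r') :=
    hasMFDerivWithinAt_iff_hasFDerivWithinAt.2 hr.hasFDerivWithinAt
  have h2 := (hγ.hasMFDerivWithinAt.comp t h1 hm).mfderivWithin hs.uniqueMDiffWithinAt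
  have h3 : velocity (fun t ↦ γ (r t)) s' t = mfderivWithin 𝓘(ℝ, ℝ) I₄ (γ ∘ r) s' t (1 : ℝ) := rfl
  rw [h3, h2]
  have h5 : ContinuousLinearMap.toSpanSingleton ℝ r' (1 : ℝ) = r' • (1 : ℝ) := by simp
  have h4 : mfderivWithin 𝓘(ℝ, ℝ) I₄ γ s (r t) ((r' : ℝ) • (1 : ℝ)) = r' • velocity γ s (r t) :=
    ContinuousLinearMap.map_smul _ r' (1 : ℝ)
  exact (congrArg (mfderivWithin 𝓘(ℝ, ℝ) I₄ γ s (r t)) h5).trans h4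

lemma IsFutureCausal.smul {x : X} {v : TangentSpace I₄ x} {c : ℝ} (hc : 0 < c)
    (h : IsFutureCausal g Z x v) : IsFutureCausal g Z x (c • v) := by
  obtain ⟨h1, h2, h3⟩ := h
  refine ⟨smul_ne_zero hc.ne' h1, ?_, ?_⟩
  · simp only [map_smul, smul_apply, smul_eq_mul]
    exact mul_nonpos_of_nonneg_of_nonpos hc.le (mul_nonpos_of_nonneg_of_nonpos hc.le h2)
  · simp only [map_smul, smul_eq_mul]
    exact mul_neg_of_pos_of_neg hc h3

/-- A causal curve with an arbitrary parameter interval gives a step between any two of its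
points. -/
lemma stepIn_of_curve {W : Set X} {γ : ℝ → X} {s : Set ℝ} {a b : ℝ} (hab : a < b)
    (hs : Icc a b ⊆ s) (hγ : ContMDiffOn 𝓘(ℝ, ℝ) I₄ ∞ γ s)
    (hc : ∀ t ∈ Icc a b, γ t ∈ W ∧ IsFutureCausal g Z (γ t) (velocity γ s t)) :
    StepIn g Z W (γ a) (γ b) := by
  have hm : MapsTo (fun t ↦ a + (b - a) * t) (Icc 0 1) (Icc a b) := fun t ht ↦
    ⟨by nlinarith [ht.1], by nlinarith [ht.2]⟩
  refine ⟨fun t ↦ γ (a + (b - a) * t), ?_, by simp, by simp, fun t ht ↦ ?_⟩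
  · have h1 : ContMDiff 𝓘(ℝ, ℝ) 𝓘(ℝ, ℝ) ∞ fun t : ℝ ↦ a + (b - a) * t :=
      (contDiff_const.add (contDiff_const.mul contDiff_id)).contMDiff
    exact hγ.comp h1.contMDiffOn fun t ht ↦ hs (hm ht)
  · obtain ⟨h1, h2⟩ := hc _ (hm ht)
    refine ⟨h1, ?_⟩
    have hd : HasDerivWithinAt (fun t ↦ a + (b - a) * t) (b - a) (Icc 0 1) t := by
      simpa using ((hasDerivWithinAt_id t (Icc 0 1)).const_mul (b - a)).const_add a
    rw [velocity_reparam (uniqueDiffOn_Icc_zero_one t ht) hd (fun t ht ↦ hs (hm ht))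
      ((hγ _ (hs (hm ht))).mdifferentiableWithinAt (by simp))]
    exact h2.smul (sub_pos.2 hab)

/-- Time reversal. -/
lemma StepIn.reverse {W : Set X} {p q : X} (h : StepIn g Z W p q) :
    StepIn g (fun x ↦ -Z x) W q p := by
  obtain ⟨γ, h1, rfl, rfl, h4⟩ := h
  have hm : MapsTo (fun t : ℝ ↦ 1 - t) (Icc 0 1) (Icc 0 1) := fun t ht ↦
    ⟨by linarith [ht.2], by linarith [ht.1]⟩
  refine ⟨fun t ↦ γ (1 - t), ?_, by simp, by simp, fun t ht ↦ ⟨(h4 _ (hm ht)).1, ?_⟩⟩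
  · have h2 : ContMDiff 𝓘(ℝ, ℝ) 𝓘(ℝ, ℝ) ∞ fun t : ℝ ↦ 1 - t :=
      (contDiff_const.sub contDiff_id).contMDiff
    exact h1.comp h2.contMDiffOn hm
  · obtain ⟨a1, a2, a3⟩ := (h4 _ (hm ht)).2
    have hd : HasDerivWithinAt (fun t : ℝ ↦ 1 - t) (-1) (Icc 0 1) t := by
      simpa using (hasDerivWithinAt_id t (Icc 0 1)).const_sub 1
    rw [velocity_reparam (uniqueDiffOn_Icc_zero_one t ht) hd hm
      ((h1 _ (hm ht)).mdifferentiableWithinAt (by simp))]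
    refine ⟨smul_ne_zero (by norm_num) a1, ?_, ?_⟩
    · simpa using a2
    · simpa using a3

lemma LEIn.reverse {W : Set X} {p q : X} (h : LEIn g Z W p q) :
    LEIn g (fun x ↦ -Z x) W q p := by
  induction h with
  | refl => exact Relation.ReflTransGen.refl
  | tail _ h ih => exact Relation.ReflTransGen.head h.reverse ih

lemma StepIn.of_reverse {W : Set X} {p q : X} (h : StepIn g (fun x ↦ -Z x) W q p) :
    StepIn g Z W p q := by simpa using h.reverse

lemma LEIn.of_reverse {W : Set X} {p q : X} (h : LEIn g (fun x ↦ -Z x) W q p) :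
    LEIn g Z W p q := by simpa using h.reverse

lemma IsSpacetimeOn.reverse {s : Set X} (h : IsSpacetimeOn g Z s) :
    IsSpacetimeOn g (fun x ↦ -Z x) s := by
  refine ⟨h.isOpen, h.lorentzian, fun x hx ↦ ?_, fun x hx ↦ by simpa using h.timelike x hx⟩
  have h1 := (contMDiffWithinAt_vecField_iff (mem_chart_source ModelH x)).1 (h.smooth x hx)
  refine (contMDiffWithinAt_vecField_iff (mem_chart_source ModelH x)).2 ?_
  simpa using h1.neg

/-- Smooth coordinate curves are smooth curves in the manifold. -/
lemma exists_curve_of_coord {x₀ : X} {y : ℝ → ℝ × E3} {s : Set ℝ}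
    (hs : UniqueDiffOn ℝ s) (hy : ContDiffOn ℝ ∞ y s)
    (ht : ∀ t ∈ s, y t ∈ (extChartAt I₄ x₀).target) :
    ContMDiffOn 𝓘(ℝ, ℝ) I₄ ∞ (fun t ↦ (extChartAt I₄ x₀).symm (y t)) s ∧
    ∀ t ∈ s, ∀ v, HasDerivWithinAt y v s t →
      chartVec x₀ ((extChartAt I₄ x₀).symm (y t))
        (velocity (fun t ↦ (extChartAt I₄ x₀).symm (y t)) s t) = v := by
  have h1 : ContMDiffOn 𝓘(ℝ, ℝ) I₄ ∞ (fun t ↦ (extChartAt I₄ x₀).symm (y t)) s :=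
    (contMDiffOn_extChartAt_symm x₀).comp hy.contMDiffOn ht
  refine ⟨h1, fun t hts v hv ↦ ?_⟩
  have hmem : (extChartAt I₄ x₀).symm (y t) ∈ (chartAt ModelH x₀).source := by
    rw [← extChartAt_source I₄]; exact (extChartAt I₄ x₀).map_target (ht t hts)
  have h2 := hasDerivWithinAt_chart ((h1 t hts).mdifferentiableWithinAt (by simp)) hmem
  have h3 : HasDerivWithinAt y (chartVec x₀ ((extChartAt I₄ x₀).symm (y t))
      (velocity (fun t ↦ (extChartAt I₄ x₀).symm (y t)) s t)) s t := by
    refine h2.congr (fun t' ht' ↦ ?_) ?_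
    · rw [(extChartAt I₄ x₀).right_inv (ht t' ht')]
    · rw [(extChartAt I₄ x₀).right_inv (ht t hts)]
  exact (hs t hts).eq_deriv _ h3 hv

lemma isFutureCausal_of_chart {x₀ x : X} (hx : x ∈ (chartAt ModelH x₀).source)
    {v : TangentSpace I₄ x} {u : ℝ × E3} (hv : chartVec x₀ x v = u) (h0 : u ≠ 0)
    (h1 : chartForm g x₀ x u u ≤ 0) (h2 : chartForm g x₀ x (chartVec x₀ x (Z x)) u < 0) :
    IsFutureCausal g Z x v := by
  subst hv
  rw [chartForm_chartVec g hx] at h1 h2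
  exact ⟨fun h ↦ h0 (by rw [h, map_zero]), h1, h2⟩

/-- The coordinate expression of a spacetime. -/
lemma IsSpacetimeOn.coord {s : Set X} (h : IsSpacetimeOn g Z s) (x₀ : X) :
    IsOpen ((extChartAt I₄ x₀).target ∩ (extChartAt I₄ x₀).symm ⁻¹' s) ∧
    ContDiffOn ℝ ∞ (fun y ↦ chartForm g x₀ ((extChartAt I₄ x₀).symm y))
      ((extChartAt I₄ x₀).target ∩ (extChartAt I₄ x₀).symm ⁻¹' s) ∧
    ContDiffOn ℝ ∞ (fun y ↦ chartVec x₀ ((extChartAt I₄ x₀).symm y)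
      (Z ((extChartAt I₄ x₀).symm y)))
      ((extChartAt I₄ x₀).target ∩ (extChartAt I₄ x₀).symm ⁻¹' s) := by
  have hsrc : ∀ y ∈ (extChartAt I₄ x₀).target,
      (extChartAt I₄ x₀).symm y ∈ (chartAt ModelH x₀).source := fun y hy ↦ by
    rw [← extChartAt_source I₄]; exact (extChartAt I₄ x₀).map_target hy
  refine ⟨(continuousOn_extChartAt_symm x₀).isOpen_inter_preimage (isOpen_extChartAt_target x₀)
    h.isOpen, fun y hy ↦ ?_, fun y hy ↦ ?_⟩
  · have h1 := (contMDiffWithinAt_metric_iff (hsrc y hy.1)).1 (h.lorentzian.smooth _ hy.2)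
    rw [← contMDiffWithinAt_iff_contDiffWithinAt]
    exact h1.comp y ((contMDiffOn_extChartAt_symm x₀ y hy.1).mono inter_subset_left)
      fun z hz ↦ hz.2
  · have h1 := (contMDiffWithinAt_vecField_iff (hsrc y hy.1)).1 (h.smooth _ hy.2)
    rw [← contMDiffWithinAt_iff_contDiffWithinAt]
    exact h1.comp y ((contMDiffOn_extChartAt_symm x₀ y hy.1).mono inter_subset_left)
      fun z hz ↦ hz.2

/-- The causal relation is locally closed. -/
lemma IsSpacetimeOn.exists_closed_nhds {s : Set X} (h : IsSpacetimeOn g Z s) {x₀ : X}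
    (hx₀ : x₀ ∈ s) {O : Set X} (hO : O ∈ 𝓝 x₀) :
    ∃ W : Set X, IsOpen W ∧ x₀ ∈ W ∧ ∀ {κ : Type*} (l : Filter κ) [NeBot l] (p q : κ → X)
      (b c : X), (∀ᶠ i in l, LEIn g Z W (p i) (q i)) →
      Tendsto p l (𝓝 b) → Tendsto q l (𝓝 c) → b ∈ W → c ∈ W → LEIn g Z (s ∩ O) b c := by
  obtain ⟨hU, hG, hζ⟩ := h.coord x₀
  set φ := extChartAt I₄ x₀ with hφ
  set U := φ.target ∩ φ.symm ⁻¹' s with hUdef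
  have hsrc : ∀ y ∈ φ.target, φ.symm y ∈ (chartAt ModelH x₀).source := fun y hy ↦ by
    rw [← extChartAt_source I₄]; exact φ.map_target hy
  have hx₀s : x₀ ∈ φ.source := mem_extChartAt_source x₀
  have hy₀ : φ x₀ ∈ U := ⟨φ.map_source hx₀s, by rwa [mem_preimage, φ.left_inv hx₀s]⟩
  obtain ⟨ι, A, ℓ, U', hU'U, hyU', hch, hℓ⟩ := exists_lorentzChart hU hG
    (fun y hy ↦ IsLorentzForm.chartForm (hsrc y hy.1) (h.lorentzian.lorentz _ hy.2))
    hζ.continuousOn (fun y hy ↦ by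
      rw [chartForm_chartVec g (hsrc y hy.1)]; exact h.timelike _ hy.2) hy₀
  have hO' : φ.symm ⁻¹' O ∈ 𝓝 (φ x₀) := by
    refine (continuousAt_extChartAt_symm x₀).preimage_mem_nhds ?_
    rwa [extChartAt_to_inv]
  obtain ⟨ρ, hρ, key⟩ := hch.exists_closed_nhds hyU' hO'
  refine ⟨φ.source ∩ φ ⁻¹' (U' ∩ ball (φ x₀) ρ), ?_, ⟨hx₀s, hyU', mem_ball_self hρ⟩, ?_⟩
  · exact (continuousOn_extChartAt x₀).isOpen_inter_preimage (isOpen_extChartAt_source x₀)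
      (hch.isOpen.inter isOpen_ball)
  intro κ l _ p q b c hpq hp hq hb hc
  have hstep : ∀ x y, StepIn g Z (φ.source ∩ φ ⁻¹' (U' ∩ ball (φ x₀) ρ)) x y →
      CoordStep (fun y ↦ chartForm g x₀ (φ.symm y)) ℓ (ball (φ x₀) ρ) (φ x) (φ y) := by
    rintro x y ⟨γ, hγ, rfl, rfl, hγ'⟩
    refine ⟨fun t ↦ φ (γ t), fun t ↦ chartVec x₀ (γ t) (velocity γ (Icc 0 1) t), rfl, rfl,
      fun t ht ↦ ?_⟩
    obtain ⟨⟨m1, m2, m3⟩, f1, f2, f3⟩ := hγ' t ht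
    have m1' : γ t ∈ (chartAt ModelH x₀).source := by rwa [← extChartAt_source I₄]
    have e1 : chartVec x₀ (γ t) (velocity γ (Icc 0 1) t) ≠ 0 := chartVec_ne_zero m1' f1
    have e2 : chartForm g x₀ (φ.symm (φ (γ t))) (chartVec x₀ (γ t) (velocity γ (Icc 0 1) t))
        (chartVec x₀ (γ t) (velocity γ (Icc 0 1) t)) ≤ 0 := by
      rw [φ.left_inv m1, chartForm_chartVec g m1']
      exact f2
    refine ⟨m3, hasDerivWithinAt_chart ((hγ t ht).mdifferentiableWithinAt (by simp)) m1',
      e1, e2, (hℓ _ m2 _ e1 e2).1 ?_⟩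
    have e3 : ∀ x' w, x' = γ t → chartForm g x₀ x' (chartVec x₀ x' (Z x')) w =
        chartForm g x₀ (γ t) (chartVec x₀ (γ t) (Z (γ t))) w := by
      rintro _ _ rfl; rfl
    rw [e3 _ _ (φ.left_inv m1), chartForm_chartVec g m1']
    exact f3
  have hcont : ∀ z ∈ φ.source, Tendsto φ (𝓝 z) (𝓝 (φ z)) := fun z hz ↦
    (continuousAt_extChartAt' hz).tendsto
  rcases key l (fun i ↦ φ (p i)) (fun i ↦ φ (q i)) (φ b) (φ c)
    (hpq.mono fun i hi ↦ Relation.ReflTransGen.lift φ hstep _ _ hi)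
    ((hcont b hb.1).comp hp) ((hcont c hc.1).comp hq) hb.2.2 hc.2.2 with hbc | ⟨y, hy, y0, y1, hyt⟩
  · rw [φ.injOn hb.1 hc.1 hbc]
    exact Relation.ReflTransGen.refl
  · obtain ⟨hγ, hvel⟩ := exists_curve_of_coord (x₀ := x₀) uniqueDiffOn_Icc_zero_one hy
      fun t ht ↦ (hU'U (hyt t ht).1.1).1
    refine Relation.ReflTransGen.single ⟨_, hγ, ?_, ?_, fun t ht ↦ ?_⟩
    · rw [y0]; exact φ.left_inv hb.1
    · rw [y1]; exact φ.left_inv hc.1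
    · obtain ⟨⟨m1, m2⟩, v, hv, v0, v1, v2⟩ := hyt t ht
      have m3 := hU'U m1
      exact ⟨⟨m3.2, m2⟩, isFutureCausal_of_chart (hsrc _ m3.1) (hvel t ht v hv) v0 v1
        ((hℓ _ m1 _ v0 v1).2 v2)⟩

/-- Every point near `x₀` is in the past of a common point. -/
lemma IsSpacetimeOn.exists_future_point {s : Set X} (h : IsSpacetimeOn g Z s) {x₀ : X}
    (hx₀ : x₀ ∈ s) {O : Set X} (hO : O ∈ 𝓝 x₀) :
    ∃ z ∈ s ∩ O, ∀ᶠ x in 𝓝 x₀, StepIn g Z (s ∩ O) x z := by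
  obtain ⟨hU, hG, hζ⟩ := h.coord x₀
  set φ := extChartAt I₄ x₀ with hφ
  set U := φ.target ∩ φ.symm ⁻¹' s with hUdef
  have hsrc : ∀ y ∈ φ.target, φ.symm y ∈ (chartAt ModelH x₀).source := fun y hy ↦ by
    rw [← extChartAt_source I₄]; exact φ.map_target hy
  have hx₀s : x₀ ∈ φ.source := mem_extChartAt_source x₀
  have hy₀ : φ x₀ ∈ U := ⟨φ.map_source hx₀s, by rwa [mem_preimage, φ.left_inv hx₀s]⟩
  have hO' : φ.symm ⁻¹' O ∈ 𝓝 (φ x₀) := by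
    refine (continuousAt_extChartAt_symm x₀).preimage_mem_nhds ?_
    rwa [extChartAt_to_inv]
  set G := fun y ↦ chartForm g x₀ (φ.symm y) with hGdef
  set ζ := fun y ↦ chartVec x₀ (φ.symm y) (Z (φ.symm y)) with hζdef
  set v := ζ (φ x₀) with hv
  have hv0 : G (φ x₀) v v < 0 := by
    simp only [hGdef, hv, hζdef]
    rw [chartForm_chartVec g (hsrc _ hy₀.1)]; exact h.timelike _ hy₀.2
  have hnb : ∀ᶠ z : (ℝ × E3) × (ℝ × E3) in 𝓝 (φ x₀, v), (z.1 ∈ U ∧ φ.symm z.1 ∈ O) ∧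
      G z.1 z.2 z.2 < 0 ∧ G z.1 (ζ z.1) z.2 < 0 := by
    have c1 : ContinuousAt G (φ x₀) := hG.continuousOn.continuousAt (hU.mem_nhds hy₀)
    have c2 : ContinuousAt ζ (φ x₀) := hζ.continuousOn.continuousAt (hU.mem_nhds hy₀)
    have c1' : ContinuousAt (fun z : (ℝ × E3) × (ℝ × E3) ↦ G z.1) (φ x₀, v) :=
      ContinuousAt.comp (f := Prod.fst) (g := G) (x := (φ x₀, v)) c1 continuousAt_fst
    have c2' : ContinuousAt (fun z : (ℝ × E3) × (ℝ × E3) ↦ ζ z.1) (φ x₀, v) :=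
      ContinuousAt.comp (f := Prod.fst) (g := ζ) (x := (φ x₀, v)) c2 continuousAt_fst
    have c3 : ContinuousAt (fun z : (ℝ × E3) × (ℝ × E3) ↦ z.2) (φ x₀, v) := continuousAt_snd
    have d1 := (c1'.clm_apply c3).clm_apply c3
    have d2 := (c1'.clm_apply c2').clm_apply c3
    exact (Eventually.prod_inl_nhds ((hU.eventually_mem hy₀).and hO') v).and
      ((d1.eventually (gt_mem_nhds hv0)).and (d2.eventually (gt_mem_nhds hv0)))
  obtain ⟨r, hr, hrb⟩ := Metric.eventually_nhds_iff_ball.1 hnb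
  have hgood : ∀ y ∈ ball (φ x₀) r, ∀ u ∈ ball v r, (y ∈ U ∧ φ.symm y ∈ O) ∧
      G y u u < 0 ∧ G y (ζ y) u < 0 := fun y hy u hu ↦ hrb (y, u) (by
    rw [← ball_prod_same]; exact ⟨hy, hu⟩)
  -- The common future point has coordinates `φ x₀ + ε v`, inside the good ball. The straight
  -- segment to it from a nearby `x` has velocity `ε u`, where `u` differs from `v` by `ε⁻¹ (φ x₀ -
  -- φ x)`, hence by less than `r`, and is still timelike and future-directed.
  set ε := r / (2 * (‖v‖ + 1)) with hε
  have hε0 : 0 < ε := by positivity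
  have hend : φ x₀ + ε • v ∈ ball (φ x₀) r := by
    rw [mem_ball_iff_norm, add_sub_cancel_left, norm_smul, Real.norm_of_nonneg hε0.le, hε,
      div_mul_eq_mul_div, div_lt_iff₀ (by positivity)]
    nlinarith [norm_nonneg v]
  obtain ⟨⟨⟨m1, m2⟩, m3⟩, -⟩ := hgood _ hend v (mem_ball_self hr)
  refine ⟨φ.symm (φ x₀ + ε • v), ⟨m2, m3⟩, ?_⟩
  have hφc : Tendsto φ (𝓝 x₀) (𝓝 (φ x₀)) := (continuousAt_extChartAt x₀).tendsto
  filter_upwards [hφc (ball_mem_nhds _ hr), hφc (ball_mem_nhds _ (mul_pos hε0 hr)),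
    extChartAt_source_mem_nhds (I := I₄) x₀] with x hx1 hx2 hx3
  set u := v + ε⁻¹ • (φ x₀ - φ x) with hu
  have hur : u ∈ ball v r := by
    rw [mem_ball_iff_norm, hu, add_sub_cancel_left, norm_smul, norm_inv,
      Real.norm_of_nonneg hε0.le, inv_mul_lt_iff₀ hε0, norm_sub_rev]
    exact mem_ball_iff_norm.1 hx2
  set y : ℝ → ℝ × E3 := fun t ↦ φ x + t • (ε • u) with hy
  have hy1 : y 1 = φ x₀ + ε • v := by
    simp only [hy, hu, one_smul, smul_add, smul_smul, mul_inv_cancel₀ hε0.ne']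
    module
  have hyb : ∀ t ∈ Icc (0 : ℝ) 1, y t ∈ ball (φ x₀) r := by
    intro t ht
    have : y t = (1 - t) • φ x + t • (φ x₀ + ε • v) := by
      rw [← hy1]; simp only [hy]; module
    rw [this]
    exact convex_ball _ _ hx1 hend (by linarith [ht.2]) ht.1 (by ring)
  obtain ⟨hγ, hvel⟩ := exists_curve_of_coord (x₀ := x₀) (y := y) uniqueDiffOn_Icc_zero_one
    (contDiff_const.add (contDiff_id.smul contDiff_const)).contDiffOn
    fun t ht ↦ (hgood _ (hyb t ht) v (mem_ball_self hr)).1.1.1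
  refine ⟨_, hγ, ?_, ?_, fun t ht ↦ ?_⟩
  · simp only [hy, zero_smul, add_zero]; exact φ.left_inv hx3
  · rw [hy1]
  · obtain ⟨⟨⟨m1, m2⟩, m3⟩, n1, n2⟩ := hgood _ (hyb t ht) u hur
    have hd : HasDerivWithinAt y (ε • u) (Icc 0 1) t := by
      exact (((hasDerivWithinAt_id t (Icc 0 1)).smul_const (ε • u)).const_add (φ x)).congr_deriv
        (one_smul ℝ _)
    have hu0 : u ≠ 0 := by
      rintro h0; rw [h0] at n1; simp at n1
    refine ⟨⟨m2, m3⟩, isFutureCausal_of_chart (hsrc _ m1) (hvel t ht _ hd)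
      (smul_ne_zero hε0.ne' hu0) ?_ ?_⟩
    · simp only [map_smul, smul_apply, smul_eq_mul]
      exact (mul_neg_of_pos_of_neg hε0 (mul_neg_of_pos_of_neg hε0 n1)).le
    · rw [map_smul, smul_eq_mul]
      exact mul_neg_of_pos_of_neg hε0 n2

/-- Every point near `x₀` is in the future of a common point. -/
lemma IsSpacetimeOn.exists_past_point {s : Set X} (h : IsSpacetimeOn g Z s) {x₀ : X}
    (hx₀ : x₀ ∈ s) {O : Set X} (hO : O ∈ 𝓝 x₀) :
    ∃ z ∈ s ∩ O, ∀ᶠ x in 𝓝 x₀, StepIn g Z (s ∩ O) z x := by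
  obtain ⟨z, hz, hx⟩ := h.reverse.exists_future_point hx₀ hO
  exact ⟨z, hz, hx.mono fun x hx ↦ hx.of_reverse⟩

/-- A point `p ≤ q` is joined to `q` by a continuous path that is monotone for the causal
relation. -/
lemma LEIn.exists_path {W : Set X} {p q : X} (h : LEIn g Z W p q) (hp : p ∈ W) :
    ∃ γ : ℝ → X, ContinuousOn γ (Icc 0 1) ∧ γ 0 = p ∧ γ 1 = q ∧ (∀ t ∈ Icc (0 : ℝ) 1, γ t ∈ W) ∧
      ∀ t ∈ Icc (0 : ℝ) 1, ∀ t' ∈ Icc (0 : ℝ) 1, t ≤ t' → LEIn g Z W (γ t) (γ t') := by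
  induction h with
  | refl =>
    exact ⟨fun _ ↦ p, continuousOn_const, rfl, rfl, fun _ _ ↦ hp,
      fun _ _ _ _ _ ↦ Relation.ReflTransGen.refl⟩
  | @tail m q _ hst ih =>
    obtain ⟨γ₁, hc₁, h01, h11, hW1, hm₁⟩ := ih
    obtain ⟨γ₂, hs₂, h02, h12, hγ₂⟩ := hst
    have hm₂ : ∀ t ∈ Icc (0 : ℝ) 1, ∀ t' ∈ Icc (0 : ℝ) 1, t ≤ t' →
        LEIn g Z W (γ₂ t) (γ₂ t') := by
      intro t ht t' ht' htt'
      rcases htt'.eq_or_lt with rfl | hlt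
      · exact Relation.ReflTransGen.refl
      · exact Relation.ReflTransGen.single (stepIn_of_curve hlt (Icc_subset_Icc ht.1 ht'.2) hs₂
          fun u hu ↦ hγ₂ u (Icc_subset_Icc ht.1 ht'.2 hu))
    have e1 : ∀ t ∈ Icc (0 : ℝ) 1, t ≤ 1 / 2 → 2 * t ∈ Icc (0 : ℝ) 1 := fun t ht h ↦
      ⟨by linarith [ht.1], by linarith⟩
    have e2 : ∀ t ∈ Icc (0 : ℝ) 1, ¬ t ≤ 1 / 2 → 2 * t - 1 ∈ Icc (0 : ℝ) 1 := fun t ht h ↦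
      ⟨by linarith, by linarith [ht.2]⟩
    refine ⟨fun t ↦ if t ≤ 1 / 2 then γ₁ (2 * t) else γ₂ (2 * t - 1), ?_, by simp [h01],
      by norm_num [h12], fun t ht ↦ ?_, fun t ht t' ht' htt' ↦ ?_⟩
    · refine ContinuousOn.if ?_ ?_ ?_
      · rintro t ⟨-, ht⟩
        have : t = 1 / 2 := by
          have := frontier_le_subset_eq continuous_id continuous_const ht
          exact this
        subst this
        norm_num [h02, h11]
      · have : {a : ℝ | a ≤ 1 / 2} = Iic (1 / 2) := rfl
        rw [this, isClosed_Iic.closure_eq]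
        exact hc₁.comp (by fun_prop) fun t ht ↦ e1 t ht.1 ht.2
      · have : closure {a : ℝ | ¬ a ≤ 1 / 2} = Ici (1 / 2) := by
          have : {a : ℝ | ¬ a ≤ 1 / 2} = Ioi (1 / 2) := by ext; simp
          rw [this, closure_Ioi]
        rw [this]
        exact (hs₂.continuousOn).comp (by fun_prop) fun t ht ↦
          ⟨by linarith [mem_Ici.1 ht.2], by linarith [ht.1.2]⟩
    · dsimp only
      split_ifs with h
      · exact hW1 _ (e1 t ht h)
      · exact (hγ₂ _ (e2 t ht h)).1
    · dsimp only
      split_ifs with h h' h'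
      · exact hm₁ _ (e1 t ht h) _ (e1 t' ht' h') (by linarith)
      · refine (hm₁ _ (e1 t ht h) 1 (right_mem_Icc.2 zero_le_one) (e1 t ht h).2).trans ?_
        rw [h11, ← h02]
        exact hm₂ 0 (left_mem_Icc.2 zero_le_one) _ (e2 t' ht' h') (e2 t' ht' h').1
      · exact absurd (htt'.trans h') h
      · exact hm₂ _ (e2 t ht h) _ (e2 t' ht' h') (by linarith)

end LocalCausality

/-! ### The standard metric of the cylinder in coordinates -/

section CylinderMetric

/-- The differential of the inclusion of `ℝ × S³` in `ℝ × ℝ⁴`. -/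
def cylD (p : Cyl) : TangentSpace I₄ p →L[ℝ] ℝ × E4 := mfderiv I₄ 𝓘(ℝ, ℝ × E4) cylIncl p

lemma cylD_time (p : Cyl) : cylD p (cylTime p) = (1, 0) := mfderiv_cylIncl_time p

lemma cylMetric_apply (p : Cyl) (v w : TangentSpace I₄ p) :
    cylMetric p v w = inner ℝ (cylD p v).2 (cylD p w).2 - (cylD p v).1 * (cylD p w).1 := rfl

lemma cylMetric_self (p : Cyl) (v : TangentSpace I₄ p) :
    cylMetric p v v = ‖(cylD p v).2‖ ^ 2 - (cylD p v).1 ^ 2 := by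
  rw [cylMetric_apply, real_inner_self_eq_norm_sq, sq (cylD p v).1]

lemma cylMetric_time (p : Cyl) (v : TangentSpace I₄ p) :
    cylMetric p (cylTime p) v = -(cylD p v).1 := by
  rw [cylMetric_apply, cylD_time]; simp

lemma cylD_injective (p : Cyl) : Function.Injective (cylD p) := by
  have := finrank_E4
  have hc : MDifferentiableAt (𝓡 3) 𝓘(ℝ, E4) (fun x : S3 ↦ (x : E4)) p.2 :=
    (contMDiff_coe_sphere (n := 3) (m := ∞)).mdifferentiableAt (by simp)
  have h1 : HasMFDerivAt I₄ 𝓘(ℝ, E4) (fun p : Cyl ↦ (p.2 : E4)) p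
      ((mfderiv (𝓡 3) 𝓘(ℝ, E4) (fun x : S3 ↦ (x : E4)) p.2).comp
        (ContinuousLinearMap.snd ℝ (TangentSpace 𝓘(ℝ, ℝ) p.1) (TangentSpace (𝓡 3) p.2))) :=
    HasMFDerivAt.comp p hc.hasMFDerivAt (hasMFDerivAt_snd p)
  have h2 : HasMFDerivAt I₄ 𝓘(ℝ, ℝ) (fun p : Cyl ↦ p.1) p
      (ContinuousLinearMap.fst ℝ (TangentSpace 𝓘(ℝ, ℝ) p.1) (TangentSpace (𝓡 3) p.2)) :=
    hasMFDerivAt_fst p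
  have hinj := mfderiv_coe_sphere_injective (n := 3) p.2
  have h0 := (mdifferentiableAt_cylIncl p).hasMFDerivAt
  have h3 := hasMFDerivAt_unique
    ((ContinuousLinearMap.fst ℝ ℝ E4).hasFDerivAt.hasMFDerivAt.comp p h0) h2
  have h4 := hasMFDerivAt_unique
    ((ContinuousLinearMap.snd ℝ ℝ E4).hasFDerivAt.hasMFDerivAt.comp p h0) h1
  have h5 : ∀ v : TangentSpace I₄ p, (cylD p v).1 = v.1 := fun v ↦
    congrArg (fun L : (ℝ × E3) →L[ℝ] ℝ ↦ L v) h3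
  have h6 : ∀ v : TangentSpace I₄ p, (cylD p v).2 =
      mfderiv (𝓡 3) 𝓘(ℝ, E4) (fun x : S3 ↦ (x : E4)) p.2 v.2 := fun v ↦
    congrArg (fun L : (ℝ × E3) →L[ℝ] E4 ↦ L v) h4
  intro v w hvw
  refine Prod.ext ?_ (hinj ?_)
  · rw [← h5, ← h5, hvw]
  · exact (h6 v).symm.trans ((congrArg Prod.snd hvw).trans (h6 w))

lemma isLorentzForm_cylMetric (p : Cyl) : IsLorentzForm (cylMetric p) where
  symm v w := by rw [cylMetric_apply, cylMetric_apply, real_inner_comm, mul_comm]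
  signature := by
    refine ⟨cylTime p, by rw [cylMetric_time, cylD_time]; norm_num, fun w hw h0 ↦ ?_⟩
    rw [cylMetric_time, neg_eq_zero] at h0
    rw [cylMetric_self, h0]
    have : (cylD p w).2 ≠ 0 := fun h1 ↦ hw (cylD_injective p (by
      rw [map_zero]; exact Prod.ext h0 h1))
    simpa using pow_pos (norm_pos_iff.2 this) 2

lemma isLorentzianOn_cylMetric : IsLorentzianOn cylMetric univ := by
  refine ⟨fun p _ ↦ ?_, fun p _ ↦ isLorentzForm_cylMetric p⟩
  refine (contMDiffWithinAt_metric_iff (mem_chart_source ModelH p)).2 ?_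
  refine ContMDiffAt.contMDiffWithinAt ?_
  refine contMDiffAt_chartForm_pullback (J := 𝓘(ℝ, ℝ × E4)) (Y := ℝ × E4)
    (q := fun _ ↦ ambientForm) contMDiff_cylIncl.contMDiffAt ?_
  have : (fun y : ℝ × E4 ↦ pullback (W := ℝ × E4) ambientForm
      ((trivializationAt (ℝ × E4) (TangentSpace 𝓘(ℝ, ℝ × E4)) (cylIncl p)).symmL ℝ y)) =
      fun _ ↦ ambientForm := by
    funext y
    rw [TangentBundle.symmL_model_space]
    rfl
  exact (contMDiffAt_const (c := ambientForm)).congr_of_eventuallyEq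
    (Eventually.of_forall fun y ↦ congrFun this y)

/-- The charts of `ℝ × S³` are products with the identity in the time variable, so `∂/∂T` is
constant in all of them. -/
lemma chartVec_cylTime {p₀ p : Cyl} (hp : p ∈ (chartAt ModelH p₀).source) :
    chartVec p₀ p (cylTime p) = (1, 0) := by
  have h1 : HasMFDerivAt 𝓘(ℝ, ℝ) I₄ (fun t : ℝ ↦ ((t, p.2) : Cyl)) p.1
      ((ContinuousLinearMap.id ℝ ℝ).prod 0) :=
    (hasMFDerivAt_id p.1).prodMk (hasMFDerivAt_const p.2 p.1)
  have : IsManifold I₄ 1 Cyl := .of_le (n := ∞) (by simp)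
  have h2 := (mdifferentiableAt_extChartAt (I := I₄) hp).hasMFDerivAt.comp p.1 h1
  have h3 : HasFDerivAt (fun t : ℝ ↦ (t, (extChartAt I₄ p₀ p).2))
      ((ContinuousLinearMap.id ℝ ℝ).prod (0 : ℝ →L[ℝ] E3)) p.1 :=
    (hasFDerivAt_id p.1).prodMk (hasFDerivAt_const _ _)
  have h4 := hasMFDerivAt_unique h2 h3.hasMFDerivAt
  have h5 := congrArg (fun L : ℝ →L[ℝ] ℝ × E3 ↦ L 1) h4
  have h6 : ((ContinuousLinearMap.id ℝ ℝ).prod (0 : ℝ →L[ℝ] E3)) 1 = ((1 : ℝ), (0 : E3)) := by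
    simp
  rw [chartVec_eq_mfderiv hp]
  exact h5.trans h6

/-- The inclusion of `ℝ × S³` in `ℝ × ℝ⁴` in the coordinates around `p₀`. -/
def coordIncl (p₀ : Cyl) (y : ℝ × E3) : ℝ × E4 := cylIncl ((extChartAt I₄ p₀).symm y)

lemma contDiffOn_coordIncl (p₀ : Cyl) : ContDiffOn ℝ ∞ (coordIncl p₀) (extChartAt I₄ p₀).target := by
  rw [← contMDiffOn_iff_contDiffOn]
  exact contMDiff_cylIncl.comp_contMDiffOn (contMDiffOn_extChartAt_symm p₀)

lemma cylD_eq_fderiv {p₀ p : Cyl} (hp : p ∈ (chartAt ModelH p₀).source) (v : TangentSpace I₄ p) :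
    cylD p v = fderiv ℝ (coordIncl p₀) (extChartAt I₄ p₀ p) (chartVec p₀ p v) := by
  have : IsManifold I₄ 1 Cyl := .of_le (n := ∞) (by simp)
  have hp' : p ∈ (extChartAt I₄ p₀).source := by rwa [extChartAt_source]
  have h1 := mdifferentiableAt_extChartAt (I := I₄) hp
  have h2 : DifferentiableAt ℝ (coordIncl p₀) (extChartAt I₄ p₀ p) :=
    ((contDiffOn_coordIncl p₀).contDiffAt
      (extChartAt_target_mem_nhds' ((extChartAt I₄ p₀).map_source hp'))).differentiableAt (by simp)
  have h3 := (h2.hasFDerivAt.hasMFDerivAt.comp p h1.hasMFDerivAt).congr_of_eventuallyEq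
    (f₁ := cylIncl) (by
      filter_upwards [extChartAt_source_mem_nhds' (I := I₄) hp'] with q hq
      simp only [Function.comp_apply, coordIncl]
      rw [(extChartAt I₄ p₀).left_inv hq])
  have h4 := h3.mfderiv
  rw [chartVec_eq_mfderiv hp]
  change mfderiv I₄ 𝓘(ℝ, ℝ × E4) cylIncl p v = _
  rw [h4]
  rfl

end CylinderMetric


/-! ### Light cones of the collar metric near the non-physical part -/

section Collar

open Metric

/-- The non-physical piece `N^σ` for `σ = ±1`. -/
def nSig (σ : ℝ) : Set Cyl :=
  {p | Real.pi ≤ σ * p.1 + polarAngle p.2 ∧ σ * p.1 - polarAngle p.2 < Real.pi}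

lemma nSig_one : nSig 1 = nPlus := by
  ext p; rw [mem_nPlus_iff]; simp [nSig]

lemma nSig_neg_one : nSig (-1) = nMinus := by
  ext p; rw [mem_nMinus_iff]; simp [nSig]

/-- `σ = ±1`. -/
def IsSign (σ : ℝ) : Prop := σ = 1 ∨ σ = -1

lemma IsSign.mul_self {σ : ℝ} (h : IsSign σ) : σ * σ = 1 := by
  rcases h with rfl | rfl <;> norm_num

lemma IsSign.neg {σ : ℝ} (h : IsSign σ) : IsSign (-σ) := by
  rcases h with rfl | rfl <;> simp [IsSign]

lemma IsSign.abs_mul {σ : ℝ} (h : IsSign σ) (a : ℝ) : |σ * a| = |a| := by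
  rcases h with rfl | rfl <;> simp

lemma IsSign.ne_zero {σ : ℝ} (h : IsSign σ) : σ ≠ 0 := by
  rcases h with rfl | rfl <;> norm_num

/-- The non-physical part `N⁺ ∪ N⁻` of the cylinder. -/
abbrev nonphysical : Set Cyl := nPlus ∪ nMinus

lemma nSig_subset {σ : ℝ} (h : IsSign σ) : nSig σ ⊆ nonphysical := by
  rcases h with rfl | rfl
  · rw [nSig_one]; exact subset_union_left
  · rw [nSig_neg_one]; exact subset_union_right

/-- A Lorentzian metric on an open neighbourhood of `N⁺ ∪ N⁻` in `ℝ × S³` that is standard on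
`N⁺ ∪ N⁻`. -/
structure IsCollarMetric (gC : MetricField Cyl) (Co : Set Cyl) : Prop where
  isOpen : IsOpen Co
  lorentzian : IsLorentzianOn gC Co
  nonphysical_subset : nonphysical ⊆ Co
  subset : Co ⊆ physical ∪ nonphysical
  eq : ∀ p ∈ nonphysical, gC p = cylMetric p

/-- The time orientation `σ ∂/∂T` of `ℝ × S³`. -/
def sigTime (σ : ℝ) : VecField Cyl := fun p ↦ σ • cylTime p

lemma contMDiff_sigTime (σ : ℝ) : ContMDiff I₄ I₄.tangent ∞
    (fun p ↦ (⟨p, sigTime σ p⟩ : TangentBundle I₄ Cyl)) := by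
  intro p
  refine (contMDiffWithinAt_vecField_iff (mem_chart_source ModelH p)).2 ?_
  refine ContMDiffAt.contMDiffWithinAt ?_
  refine (contMDiffAt_const (c := σ • ((1 : ℝ), (0 : E3)))).congr_of_eventuallyEq ?_
  filter_upwards [chart_source_mem_nhds ModelH p] with q hq
  rw [sigTime, map_smul, chartVec_cylTime hq]

/-- The points at which `∂/∂T` is timelike and the light cone is at most twice as wide as the
standard one. -/
def conePts (gC : MetricField Cyl) (Co : Set Cyl) : Set Cyl :=
  {p | p ∈ Co ∧ gC p (cylTime p) (cylTime p) < 0 ∧ ∀ v : TangentSpace I₄ p, v ≠ 0 → gC p v v ≤ 0 →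
    ‖(cylD p v).2‖ ≤ 2 * |(cylD p v).1|}

/-- The interior of `conePts`. -/
def coneRegion (gC : MetricField Cyl) (Co : Set Cyl) : Set Cyl := interior (conePts gC Co)

variable {gC : MetricField Cyl} {Co : Set Cyl} {σ : ℝ}

lemma coneRegion_subset : coneRegion gC Co ⊆ Co := fun _ hp ↦ (interior_subset hp).1

lemma IsCollarMetric.isSpacetimeOn (h : IsCollarMetric gC Co) (hσ : IsSign σ) :
    IsSpacetimeOn gC (sigTime σ) (coneRegion gC Co) where
  isOpen := isOpen_interior
  lorentzian := ⟨h.lorentzian.smooth.mono coneRegion_subset,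
    fun p hp ↦ h.lorentzian.lorentz p (coneRegion_subset hp)⟩
  smooth := (contMDiff_sigTime σ).contMDiffOn
  timelike p hp := by
    have h1 := (interior_subset hp).2.1
    simp only [sigTime, map_smul, smul_apply, smul_eq_mul, ← mul_assoc, hσ.mul_self, one_mul]
    exact h1

/-- The product form of metrics in coordinates is jointly continuous. -/
lemma continuousAt_chartForm_self {p : Cyl} {u : ℝ × E3} {g : MetricField Cyl}
    (hg : ContinuousAt (chartForm g p) p) :
    ContinuousAt (fun z : Cyl × (ℝ × E3) ↦ chartForm g p z.1 z.2 z.2) (p, u) := by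
  have c1 : ContinuousAt (fun z : Cyl × (ℝ × E3) ↦ chartForm g p z.1) (p, u) :=
    ContinuousAt.comp (f := Prod.fst) (g := chartForm g p) (x := (p, u)) hg continuousAt_fst
  exact (c1.clm_apply continuousAt_snd).clm_apply continuousAt_snd

lemma IsCollarMetric.continuousAt_chartForm (h : IsCollarMetric gC Co) {p : Cyl} (hp : p ∈ Co) :
    ContinuousAt (chartForm gC p) p :=
  (((contMDiffWithinAt_metric_iff (mem_chart_source ModelH p)).1
    (h.lorentzian.smooth p hp)).contMDiffAt (h.isOpen.mem_nhds hp)).continuousAt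

lemma continuousAt_fderiv_coordIncl (p : Cyl) :
    ContinuousAt (fun q ↦ fderiv ℝ (coordIncl p) (extChartAt I₄ p q)) p := by
  have h1 : ContinuousAt (fderiv ℝ (coordIncl p)) (extChartAt I₄ p p) :=
    ((contDiffOn_coordIncl p).fderiv_of_isOpen (m := ∞) (isOpen_extChartAt_target p)
      (by simp)).continuousOn.continuousAt (extChartAt_target_mem_nhds p)
  exact h1.comp (continuousAt_extChartAt p)

/-- At a non-physical point the metric is standard, so causal directions satisfy `‖b‖ ≤ |a| < 2 |a|`
for sphere component `b` and time component `a`. The strict inequality persists nearby, uniformly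
over the compact unit sphere of directions. The factor `2` is only room for this perturbation. -/
lemma IsCollarMetric.nonphysical_subset_coneRegion (h : IsCollarMetric gC Co) :
    nonphysical ⊆ coneRegion gC Co := by
  intro p hp
  have hpCo := h.nonphysical_subset hp
  have hc := h.continuousAt_chartForm hpCo
  have hmem := mem_chart_source ModelH p
  rw [coneRegion, mem_interior_iff_mem_nhds]
  -- In coordinates `∂/∂T` is the constant vector `(1, 0)`, so its timelikeness at `p` spreads to
  -- nearby points by continuity alone.
  have e1 : ∀ᶠ q in 𝓝 p, chartForm gC p q (1, 0) (1, 0) < 0 := by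
    refine ((hc.clm_apply continuousAt_const).clm_apply continuousAt_const).eventually
      (gt_mem_nhds ?_)
    dsimp only
    rw [← chartVec_cylTime hmem, chartForm_chartVec gC hmem, h.eq p hp, cylMetric_time, cylD_time]
    norm_num
  have e2 : ∀ᶠ q in 𝓝 p, ∀ u ∈ sphere (0 : ℝ × E3) 1, 0 < chartForm gC p q u u ∨
      ‖(fderiv ℝ (coordIncl p) (extChartAt I₄ p q) u).2‖ <
        2 * |(fderiv ℝ (coordIncl p) (extChartAt I₄ p q) u).1| := by
    refine (isCompact_sphere _ _).eventually_forall_of_forall_eventually fun u hu ↦ ?_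
    have c1 := continuousAt_chartForm_self (u := u) hc
    have c2 : ContinuousAt (fun z : Cyl × (ℝ × E3) ↦
        fderiv ℝ (coordIncl p) (extChartAt I₄ p z.1) z.2) (p, u) := by
      have := ContinuousAt.comp (f := Prod.fst) (x := (p, u)) (continuousAt_fderiv_coordIncl p)
        continuousAt_fst
      exact this.clm_apply continuousAt_snd
    by_cases hu0 : 0 < chartForm gC p p u u
    · exact (c1.eventually (lt_mem_nhds hu0)).mono fun z hz ↦ Or.inl hz
    · refine ((c2.snd.norm.eventually_lt (c2.fst.abs.const_mul 2) ?_)).mono fun z hz ↦ Or.inr hz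
      have hv := chartVec_symmL hmem u
      set v := (trivializationAt (ℝ × E3) (TangentSpace I₄) p).symmL ℝ p u with hvdef
      have hD := cylD_eq_fderiv hmem v
      rw [hv] at hD
      rw [← hv, chartForm_chartVec gC hmem, h.eq p hp, cylMetric_self, hD] at hu0
      dsimp only
      set a := (fderiv ℝ (coordIncl p) (extChartAt I₄ p p) u).1
      set b := (fderiv ℝ (coordIncl p) (extChartAt I₄ p p) u).2
      have hle : ‖b‖ ≤ |a| := by
        refine (sq_le_sq₀ (norm_nonneg _) (abs_nonneg a)).1 ?_
        rw [sq_abs]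
        linarith
      rcases (abs_nonneg a).eq_or_lt with ha | ha
      · exfalso
        have hb0 : b = 0 := norm_le_zero_iff.1 (hle.trans ha.ge)
        have ha0 : a = 0 := abs_eq_zero.1 ha.symm
        have hv0 : v = 0 := cylD_injective p (by
          rw [map_zero, hD]; exact Prod.ext ha0 hb0)
        rw [hv0, map_zero] at hv
        rw [← hv] at hu
        simp at hu
      · linarith
  filter_upwards [e1, e2, h.isOpen.mem_nhds hpCo, chart_source_mem_nhds ModelH p]
    with q h1 h2 h3 h4
  refine ⟨h3, ?_, fun v hv hvv ↦ ?_⟩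
  · rwa [← chartVec_cylTime h4, chartForm_chartVec gC h4] at h1
  · have hu := chartVec_ne_zero h4 hv
    have hn : 0 < ‖chartVec p q v‖ := norm_pos_iff.2 hu
    rcases h2 (‖chartVec p q v‖⁻¹ • chartVec p q v) (by
      simp [norm_smul, hn.ne']) with h5 | h5
    · rw [← map_smul, chartForm_chartVec gC h4] at h5
      simp only [map_smul, smul_apply, smul_eq_mul] at h5
      have := mul_nonpos_of_nonneg_of_nonpos (inv_pos.2 hn).le
        (mul_nonpos_of_nonneg_of_nonpos (inv_pos.2 hn).le hvv)
      linarith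
    · rw [← map_smul, ← cylD_eq_fderiv h4] at h5
      simp only [map_smul, Prod.smul_fst, Prod.smul_snd, norm_smul, norm_inv, norm_norm, smul_eq_mul,
        abs_mul, abs_inv, abs_norm] at h5
      have h6 : ‖chartVec p q v‖⁻¹ * ‖(cylD q v).2‖ <
          ‖chartVec p q v‖⁻¹ * (2 * |(cylD q v).1|) := by linarith
      exact (lt_of_mul_lt_mul_left h6 (inv_pos.2 hn).le).le

/-- In the cone region the time component of causal vectors determines their time orientation. -/
lemma IsCollarMetric.isFutureCausal_iff (h : IsCollarMetric gC Co) (hσ : IsSign σ) {p : Cyl}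
    (hp : p ∈ conePts gC Co) (v : TangentSpace I₄ p) :
    IsFutureCausal gC (sigTime σ) p v ↔ gC p v v ≤ 0 ∧ 0 < σ * (cylD p v).1 := by
  have hL := h.lorentzian.lorentz p hp.1
  have hT := hp.2.1
  have ha : ∀ w : TangentSpace I₄ p, w ≠ 0 → gC p w w ≤ 0 → (cylD p w).1 ≠ 0 := by
    intro w hw hww h0
    have h1 := hp.2.2 w hw hww
    rw [h0, abs_zero, mul_zero] at h1
    exact hw (cylD_injective p (by
      rw [map_zero]; exact Prod.ext h0 (norm_le_zero_iff.1 h1)))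
  have key : ∀ w : TangentSpace I₄ p, gC p w w ≤ 0 → gC p (cylTime p) w < 0 →
      0 < (cylD p w).1 := by
    intro w hww hw
    by_contra hneg
    push Not at hneg
    -- some convex combination of `w` and `∂/∂T` has vanishing time component
    set s := -(cylD p w).1 with hs
    have hs0 : 0 ≤ s := by linarith
    set u := w + s • cylTime p with hu
    have hu0 : gC p (cylTime p) u < 0 := by
      simp only [hu, map_add, map_smul, smul_eq_mul]
      linarith [mul_nonpos_of_nonneg_of_nonpos hs0 hT.le]
    have huu : gC p u u ≤ 0 := by
      have : gC p u u = gC p w w + 2 * s * gC p (cylTime p) w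
          + s ^ 2 * gC p (cylTime p) (cylTime p) := by
        simp only [hu, map_add, map_smul, add_apply, smul_apply, smul_eq_mul, hL.symm w (cylTime p)]
        ring
      rw [this]
      have e1 := mul_nonpos_of_nonneg_of_nonpos (by linarith : 0 ≤ 2 * s) hw.le
      have e2 := mul_nonpos_of_nonneg_of_nonpos (sq_nonneg s) hT.le
      linarith
    refine ha u ?_ huu ?_
    · rintro h0; rw [h0, map_zero] at hu0; exact lt_irrefl _ hu0
    · simp [hu, cylD_time, hs]
  constructor
  · rintro ⟨h0, h1, h2⟩
    refine ⟨h1, ?_⟩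
    simp only [sigTime, map_smul, smul_apply, smul_eq_mul] at h2
    have h3 := key (σ • v) ?_ ?_
    · simpa using h3
    · simp only [map_smul, smul_apply, smul_eq_mul, ← mul_assoc, hσ.mul_self, one_mul]
      exact h1
    · simpa using h2
  · rintro ⟨h1, h2⟩
    have hv : v ≠ 0 := by
      rintro rfl; simp at h2
    refine ⟨hv, h1, ?_⟩
    simp only [sigTime, map_smul, smul_apply, smul_eq_mul]
    by_contra hneg
    push Not at hneg
    have hne := hL.ne_zero_of_causal hT hv h1
    have hpos : 0 < σ * gC p (cylTime p) v :=
      lt_of_le_of_ne hneg (mul_ne_zero hσ.ne_zero hne).symm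
    have h3 := key (-(σ • v)) ?_ ?_
    · simp at h3; linarith
    · simp only [map_neg, map_smul, neg_apply, smul_apply, smul_eq_mul]
      have : -(σ * -(σ * gC p v v)) = (σ * σ) * gC p v v := by ring
      rwa [this, hσ.mul_self, one_mul]
    · simpa using hpos

lemma IsCollarMetric.norm_le (hσ : IsSign σ) {p : Cyl}
    (hp : p ∈ conePts gC Co) {v : TangentSpace I₄ p} (h : IsCollarMetric gC Co)
    (hv : IsFutureCausal gC (sigTime σ) p v) :
    0 < σ * (cylD p v).1 ∧ ‖(cylD p v).2‖ ≤ 2 * (σ * (cylD p v).1) := by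
  have h1 := ((h.isFutureCausal_iff hσ hp v).1 hv).2
  refine ⟨h1, (hp.2.2 v hv.1 hv.2.1).trans ?_⟩
  rw [← hσ.abs_mul, abs_of_pos h1]

/-- On the non-physical part, the causal vectors are the standard ones. -/
lemma IsCollarMetric.isFutureCausal_nonphysical (h : IsCollarMetric gC Co) {p : Cyl}
    (hp : p ∈ nonphysical) (v : TangentSpace I₄ p) :
    IsFutureCausal gC (sigTime σ) p v ↔ IsFutureCausal cylMetric (sigTime σ) p v := by
  simp only [IsFutureCausal, h.eq p hp]

/-- The time coordinate increases along causal steps in the cone region, and bounds the motion on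
the sphere. -/
lemma IsCollarMetric.step_bound (h : IsCollarMetric gC Co) (hσ : IsSign σ) {p q : Cyl}
    (hpq : StepIn gC (sigTime σ) (coneRegion gC Co) p q) :
    σ * p.1 < σ * q.1 ∧ ‖(q.2 : E4) - p.2‖ ≤ 2 * (σ * q.1 - σ * p.1) := by
  obtain ⟨γ, hγ, rfl, rfl, hc⟩ := hpq
  have hd : ∀ t ∈ Icc (0 : ℝ) 1, HasDerivWithinAt (fun t ↦ cylIncl (γ t))
      (cylD (γ t) (velocity γ (Icc 0 1) t)) (Icc 0 1) t := fun t ht ↦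
    hasDerivWithinAt_cyl ((hγ t ht).mdifferentiableWithinAt (by simp))
  have hb : ∀ t ∈ Icc (0 : ℝ) 1, _ := fun t ht ↦
    h.norm_le hσ (interior_subset (hc t ht).1) (hc t ht).2
  have hT : ∀ t ∈ Icc (0 : ℝ) 1, HasDerivWithinAt (fun t ↦ σ * (γ t).1)
      (σ * (cylD (γ t) (velocity γ (Icc 0 1) t)).1) (Icc 0 1) t := fun t ht ↦
    ((ContinuousLinearMap.fst ℝ ℝ E4).hasFDerivAt.comp_hasDerivWithinAt t (hd t ht)).const_mul σ
  constructor
  · have := strictAntiOn_of_hasDerivWithinAt_neg (fun t ht ↦ (hT t ht).neg)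
      (fun t ht ↦ neg_neg_of_pos (hb t ht).1) (left_mem_Icc.2 zero_le_one)
      (right_mem_Icc.2 zero_le_one) zero_lt_one
    simpa using this
  · have hx : ∀ t ∈ Icc (0 : ℝ) 1, HasDerivWithinAt (fun t ↦ ((γ t).2 : E4) - (γ 0).2)
      (cylD (γ t) (velocity γ (Icc 0 1) t)).2 (Icc 0 1) t := fun t ht ↦
      ((ContinuousLinearMap.snd ℝ ℝ E4).hasFDerivAt.comp_hasDerivWithinAt t (hd t ht)).sub_const _
    have hB : ∀ t ∈ Icc (0 : ℝ) 1, HasDerivWithinAt (fun t ↦ 2 * (σ * (γ t).1 - σ * (γ 0).1))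
      (2 * (σ * (cylD (γ t) (velocity γ (Icc 0 1) t)).1)) (Icc 0 1) t := fun t ht ↦
      ((hT t ht).sub_const _).const_mul 2
    refine image_norm_le_of_norm_deriv_right_le_deriv_boundary'
      (fun t ht ↦ (hx t ht).continuousWithinAt)
      (fun t ht ↦ HasDerivWithinAt.Icc_to_Ici (hx t ⟨ht.1, ht.2.le⟩) ht) (by simp)
      (fun t ht ↦ (hB t ht).continuousWithinAt)
      (fun t ht ↦ HasDerivWithinAt.Icc_to_Ici (hB t ⟨ht.1, ht.2.le⟩) ht)
      (fun t ht ↦ (hb t ⟨ht.1, ht.2.le⟩).2) (right_mem_Icc.2 zero_le_one)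

/-- Elapsed time controls distance. This replaces arc length in the compactness arguments: a path of
short duration stays close to its starting point. -/
lemma IsCollarMetric.le_bound (h : IsCollarMetric gC Co) (hσ : IsSign σ) {p q : Cyl}
    (hpq : LEIn gC (sigTime σ) (coneRegion gC Co) p q) :
    dist p q ≤ 2 * (σ * q.1 - σ * p.1) := by
  have key : σ * p.1 ≤ σ * q.1 ∧ ‖(q.2 : E4) - p.2‖ ≤ 2 * (σ * q.1 - σ * p.1) := by
    induction hpq with
    | refl => simp
    | @tail m q _ hst ih =>
      obtain ⟨h1, h2⟩ := h.step_bound hσ hst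
      refine ⟨ih.1.trans h1.le, ?_⟩
      have := norm_sub_le_norm_sub_add_norm_sub (q.2 : E4) m.2 p.2
      linarith [ih.2]
  rw [Prod.dist_eq]
  refine max_le ?_ ?_
  · rw [Real.dist_eq, abs_sub_comm, ← hσ.abs_mul, mul_sub, abs_of_nonneg (by linarith [key.1])]
    linarith [key.1]
  · rw [Subtype.dist_eq, dist_comm, dist_eq_norm]
    exact key.2

end Collar

/-! ### Restricting causal paths to subsets -/

section Restrict

variable {X : Type*} [TopologicalSpace X] [ChartedSpace ModelH X] [IsManifold I₄ ∞ X]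
  {g : MetricField X} {Z : VecField X}

/-- The steps to and from the points of the path of a step. -/
lemma StepIn.exists_curve {W : Set X} {p q : X} (h : StepIn g Z W p q) :
    ∃ γ : ℝ → X, ContMDiffOn 𝓘(ℝ, ℝ) I₄ ∞ γ (Icc 0 1) ∧ γ 0 = p ∧ γ 1 = q ∧
      ∀ t ∈ Icc (0 : ℝ) 1, γ t ∈ W ∧ IsFutureCausal g Z (γ t) (velocity γ (Icc 0 1) t) ∧
        LEIn g Z W p (γ t) ∧ LEIn g Z W (γ t) q := by
  obtain ⟨γ, hs, rfl, rfl, hγ⟩ := h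
  have hm : ∀ t ∈ Icc (0 : ℝ) 1, ∀ t' ∈ Icc (0 : ℝ) 1, t ≤ t' → LEIn g Z W (γ t) (γ t') := by
    intro t ht t' ht' htt'
    rcases htt'.eq_or_lt with rfl | hlt
    · exact Relation.ReflTransGen.refl
    · exact Relation.ReflTransGen.single (stepIn_of_curve hlt (Icc_subset_Icc ht.1 ht'.2) hs
        fun u hu ↦ hγ u (Icc_subset_Icc ht.1 ht'.2 hu))
  exact ⟨γ, hs, rfl, rfl, fun t ht ↦ ⟨(hγ t ht).1, (hγ t ht).2,
    hm 0 (left_mem_Icc.2 zero_le_one) t ht ht.1, hm t ht 1 (right_mem_Icc.2 zero_le_one) ht.2⟩⟩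

/-- A causal path whose points all lie in a subset is a path in this subset. -/
lemma LEIn.restrict {W W' : Set X} {p q : X} (h : LEIn g Z W p q)
    (hW : ∀ m ∈ W, LEIn g Z W p m → LEIn g Z W m q → m ∈ W') : LEIn g Z W' p q := by
  induction h with
  | refl => exact Relation.ReflTransGen.refl
  | @tail m q hpm hst ih =>
    refine (ih fun m' hm' h1 h2 ↦ hW m' hm' h1 (h2.tail hst)).tail ?_
    obtain ⟨γ, hs, h0, h1, hγ⟩ := hst.exists_curve
    exact ⟨γ, hs, h0, h1, fun t ht ↦ ⟨hW _ (hγ t ht).1 (hpm.trans (hγ t ht).2.2.1)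
      (hγ t ht).2.2.2, (hγ t ht).2.1⟩⟩

end Restrict

/-! ### Closedness of the causal relation in compact parts of the collar -/

section CollarClosed

open Metric

variable {gC : MetricField Cyl} {Co : Set Cyl} {σ : ℝ}

/-- Limits of causally related points of a compact subset of the cone region, with paths in this
subset, are causally related. -/
lemma IsCollarMetric.leIn_of_tendsto (h : IsCollarMetric gC Co) (hσ : IsSign σ) {K : Set Cyl}
    (hK : IsCompact K) (hKC : K ⊆ coneRegion gC Co) {κ : Type*} (l : Ultrafilter κ)
    {p q : κ → Cyl} {b c : Cyl} (hpK : ∀ᶠ i in l, p i ∈ K)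
    (hpq : ∀ᶠ i in l, LEIn gC (sigTime σ) K (p i) (q i))
    (hp : Tendsto p l (𝓝 b)) (hq : Tendsto q l (𝓝 c)) :
    LEIn gC (sigTime σ) (coneRegion gC Co) b c := by
  have hst := h.isSpacetimeOn hσ
  choose! W hWo hWm hW using fun x (hx : x ∈ coneRegion gC Co) ↦
    hst.exists_closed_nhds hx (O := univ) univ_mem
  -- With `δ` a Lebesgue number of the cover by sets where limits are controlled, a path of duration
  -- at most `δ / 8` stays within `δ / 4` of its start, and so inside one set of the cover.
  obtain ⟨δ, hδ, hleb⟩ := lebesgue_number_lemma_of_metric (s := K) (c := fun x : K ↦ W x) hK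
    (fun x ↦ hWo x (hKC x.2)) (fun x hx ↦ mem_iUnion.2 ⟨⟨x, hx⟩, hWm x (hKC hx)⟩)
  -- short paths
  have short : ∀ (p q : κ → Cyl) (b c : Cyl), (∀ᶠ i in l, p i ∈ K) →
      (∀ᶠ i in l, LEIn gC (sigTime σ) K (p i) (q i)) → Tendsto p l (𝓝 b) → Tendsto q l (𝓝 c) →
      (∀ᶠ i in l, σ * (q i).1 - σ * (p i).1 ≤ δ / 8) →
      LEIn gC (sigTime σ) (coneRegion gC Co) b c := by
    intro p q b c hpK hpq hp hq hs
    have hbK : b ∈ K := hK.isClosed.mem_of_tendsto hp hpK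
    obtain ⟨x, hx⟩ := hleb b hbK
    have hd : ∀ᶠ i in l, dist (p i) b < δ / 4 := hp (ball_mem_nhds b (by linarith))
    have hd' : ∀ᶠ i in l, dist (q i) c < δ / 4 := hq (ball_mem_nhds c (by linarith))
    have hpath : ∀ᶠ i in l, LEIn gC (sigTime σ) (W x) (p i) (q i) := by
      filter_upwards [hpq, hd, hs] with i h1 h2 h3
      refine h1.restrict fun m hm hpm hmq ↦ hx ?_
      have e1 := h.le_bound hσ (hpm.mono hKC)
      have e2 := h.le_bound hσ (hmq.mono hKC)
      have e3 : 0 ≤ dist m (q i) := dist_nonneg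
      have e4 := dist_triangle m (p i) b
      rw [dist_comm m (p i)] at e4
      rw [mem_ball]
      linarith
    have hcW : c ∈ W x := by
      refine hx ?_
      obtain ⟨i, h1, h2, h3, h4⟩ := (hpq.and (hd.and (hs.and hd'))).exists
      have e1 := h.le_bound hσ (h1.mono hKC)
      have e4 := dist_triangle4 c (q i) (p i) b
      rw [dist_comm c (q i), dist_comm (q i) (p i)] at e4
      rw [mem_ball]
      linarith
    have := hW x (hKC x.2) (l : Filter κ) p q b c hpath hp hq (hx (mem_ball_self hδ)) hcW
    rwa [inter_univ] at this
  -- Induction on the number of time slabs of height `δ / 8`. The ultrafilter decides whether the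
  -- paths fit into one slab. If not, they are cut at the points `m i` whose time is exactly `δ / 8`
  -- after that of `p i`; these converge by compactness of `K`.
  have main : ∀ (n : ℕ) (p : κ → Cyl) (b : Cyl), (∀ᶠ i in l, p i ∈ K) →
      (∀ᶠ i in l, LEIn gC (sigTime σ) K (p i) (q i)) → Tendsto p l (𝓝 b) →
      (∀ᶠ i in l, σ * (q i).1 - σ * (p i).1 ≤ (n + 1) * (δ / 8)) →
      LEIn gC (sigTime σ) (coneRegion gC Co) b c := by
    intro n
    induction n with
    | zero =>
      intro p b hpK hpq hp hs
      exact short p q b c hpK hpq hp hq (by simpa using hs)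
    | succ n ih =>
      intro p b hpK hpq hp hs
      by_cases hcase : ∀ᶠ i in l, σ * (q i).1 - σ * (p i).1 ≤ δ / 8
      · exact short p q b c hpK hpq hp hq hcase
      have hcase' : ∀ᶠ i in l, δ / 8 < σ * (q i).1 - σ * (p i).1 := by
        have := Ultrafilter.eventually_not.2 hcase
        exact this.mono fun i hi ↦ not_le.1 hi
      have hmid : ∀ i, ∃ m, (p i ∈ K ∧ LEIn gC (sigTime σ) K (p i) (q i) ∧
          δ / 8 < σ * (q i).1 - σ * (p i).1) → m ∈ K ∧ LEIn gC (sigTime σ) K (p i) m ∧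
          LEIn gC (sigTime σ) K m (q i) ∧ σ * m.1 = σ * (p i).1 + δ / 8 := by
        intro i
        by_cases hi : p i ∈ K ∧ LEIn gC (sigTime σ) K (p i) (q i) ∧
          δ / 8 < σ * (q i).1 - σ * (p i).1
        · obtain ⟨h1, h2, h3⟩ := hi
          obtain ⟨γ, hγ, g0, g1, gK, gm⟩ := h2.exists_path h1
          have hcont : ContinuousOn (fun t ↦ σ * (γ t).1) (Icc 0 1) := by fun_prop
          obtain ⟨t, ht, htT⟩ := intermediate_value_Icc zero_le_one hcont
            (show σ * (p i).1 + δ / 8 ∈ _ by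
              simp only [g0, g1]; exact ⟨by linarith, by linarith⟩)
          refine ⟨γ t, fun _ ↦ ⟨gK t ht, ?_, ?_, htT⟩⟩
          · rw [← g0]; exact gm 0 (left_mem_Icc.2 zero_le_one) t ht ht.1
          · rw [← g1]; exact gm t ht 1 (right_mem_Icc.2 zero_le_one) ht.2
        · exact ⟨p i, fun h ↦ absurd h hi⟩
      choose m hm using hmid
      have hm' : ∀ᶠ i in l, m i ∈ K ∧ LEIn gC (sigTime σ) K (p i) (m i) ∧
          LEIn gC (sigTime σ) K (m i) (q i) ∧ σ * (m i).1 = σ * (p i).1 + δ / 8 := by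
        filter_upwards [hpK, hpq, hcase'] with i h1 h2 h3 using hm i ⟨h1, h2, h3⟩
      obtain ⟨z, hz, hmz⟩ := hK.ultrafilter_le_nhds (l.map m)
        (le_principal_iff.2 (hm'.mono fun i hi ↦ hi.1))
      have e1 := short p m b z hpK (hm'.mono fun i hi ↦ hi.2.1) hp hmz
        (hm'.mono fun i hi ↦ by rw [hi.2.2.2]; linarith)
      refine e1.trans (ih m z (hm'.mono fun i hi ↦ hi.1) (hm'.mono fun i hi ↦ hi.2.2.1) hmz ?_)
      filter_upwards [hm', hs] with i h1 h2
      rw [h1.2.2.2]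
      push_cast at h2
      linarith
  obtain ⟨n, hn⟩ := exists_nat_gt ((σ * c.1 - σ * b.1 + 1) / (δ / 8))
  refine main n p b hpK hpq hp ?_
  have hlim : Tendsto (fun i ↦ σ * (q i).1 - σ * (p i).1) l (𝓝 (σ * c.1 - σ * b.1)) :=
    (((continuous_fst.tendsto c).comp hq).const_mul σ).sub
      (((continuous_fst.tendsto b).comp hp).const_mul σ)
  filter_upwards [hlim.eventually (gt_mem_nhds (lt_add_one _))] with i hi
  rw [div_lt_iff₀ (by positivity)] at hn
  linarith

end CollarClosed


/-! ### Growth of angles along curves on the sphere -/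

section Slope

open InnerProductGeometry

/-- The angle of a moving unit vector with a fixed vector grows at most like its speed. -/
lemma eventually_slope_angle_lt {x : ℝ → E4} (hx : ∀ t, ‖x t‖ = 1) {s : ℝ} {b : E4}
    (hb : HasDerivWithinAt x b (Ici s) s) (e : E4) {r : ℝ} (hr : ‖b‖ < r) :
    ∀ᶠ z in 𝓝[>] s, slope (fun t ↦ angle e (x t)) s z < r := by
  have hne : ∀ t, x t ≠ 0 := fun t ↦ by rw [← norm_ne_zero_iff, hx]; exact one_ne_zero
  have hb' : HasDerivWithinAt x b (Ioi s) s := hb.Ioi_of_Ici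
  set θ : ℝ → ℝ := fun z ↦ angle (x s) (x z) with hθ
  have hθ0 : Tendsto θ (𝓝[>] s) (𝓝 0) := by
    have h1 := continuousAt_angle (x := (x s, x s)) (hne s) (hne s)
    have h2 : Tendsto (fun t ↦ (x s, x t)) (𝓝[>] s) (𝓝 (x s, x s)) :=
      tendsto_const_nhds.prodMk_nhds hb'.continuousWithinAt
    have h3 := h1.tendsto.comp h2
    simpa [hθ, angle_self (hne s), Function.comp_def] using h3
  have hslope : Tendsto (fun z ↦ ‖x z - x s‖ / (z - s)) (𝓝[>] s) (𝓝 ‖b‖) := by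
    have h2 := (hasDerivWithinAt_iff_tendsto_slope' (by simp)).1 hb'
    refine h2.norm.congr' ?_
    filter_upwards [self_mem_nhdsWithin] with z hz
    have hz : s < z := hz
    rw [slope_def_module, norm_smul, norm_inv, Real.norm_of_nonneg (by linarith)]
    field_simp
  -- The factor `1 - θ² / 4` absorbs the difference between chord and angle; it tends to `1`, so it
  -- does not affect the limiting slope.
  have hfac : Tendsto (fun z ↦ ‖x z - x s‖ / (z - s) / (1 - θ z ^ 2 / 4)) (𝓝[>] s) (𝓝 ‖b‖) := by
    have : Tendsto (fun z ↦ 1 - θ z ^ 2 / 4) (𝓝[>] s) (𝓝 1) := by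
      have := ((hθ0.pow 2).div_const 4).const_sub 1
      simpa using this
    have h5 := hslope.div this one_ne_zero
    rw [div_one] at h5
    exact h5
  filter_upwards [self_mem_nhdsWithin, hfac.eventually (gt_mem_nhds hr),
    hθ0.eventually (gt_mem_nhds (zero_lt_one))] with z hz hz1 hz2
  refine lt_of_le_of_lt ?_ hz1
  have hz : s < z := hz
  have hzs : 0 < z - s := by linarith
  have hθn : 0 ≤ θ z := angle_nonneg _ _
  have hden : 0 < 1 - θ z ^ 2 / 4 := by nlinarith
  -- The chord is `2 sin (θ / 2)`, and `sin x > x - x³ / 4` leaves ample room.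
  have hchord : θ z * (1 - θ z ^ 2 / 4) ≤ ‖x z - x s‖ := by
    have hcos : ‖x z - x s‖ ^ 2 = (2 * Real.sin (θ z / 2)) ^ 2 := by
      rw [norm_sub_sq_real, hx, hx, real_inner_comm, inner_eq_cos_angle_of_norm_eq_one (hx s) (hx z)]
      have : Real.cos (θ z) = 1 - 2 * Real.sin (θ z / 2) ^ 2 := by
        have h1 := Real.cos_two_mul (θ z / 2)
        have h2 := Real.sin_sq_add_cos_sq (θ z / 2)
        rw [show 2 * (θ z / 2) = θ z by ring] at h1
        linarith
      change 1 ^ 2 - 2 * Real.cos (θ z) + 1 ^ 2 = _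
      rw [this]; ring
    have hsn : 0 ≤ Real.sin (θ z / 2) :=
      Real.sin_nonneg_of_nonneg_of_le_pi (by linarith) (by linarith [Real.pi_gt_three])
    have heq := (sq_eq_sq₀ (norm_nonneg _) (by positivity)).1 hcos
    rw [heq]
    rcases hθn.eq_or_lt with h0 | h0
    · rw [← h0]; simp
    · have := Real.sin_gt_sub_cube (x := θ z / 2) (by linarith)
      nlinarith [pow_pos h0 3]
  rw [slope_def_field]
  have htri : angle e (x z) - angle e (x s) ≤ θ z := by
    have := angle_le_angle_add_angle e (x s) (x z)
    simp only [hθ]; linarith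
  rw [div_div, div_le_div_iff₀ hzs (by positivity)]
  calc (angle e (x z) - angle e (x s)) * ((z - s) * (1 - θ z ^ 2 / 4))
      ≤ θ z * ((z - s) * (1 - θ z ^ 2 / 4)) := by gcongr
    _ = (θ z * (1 - θ z ^ 2 / 4)) * (z - s) := by ring
    _ ≤ _ := by gcongr

end Slope

/-! ### Future-directed causal curves do not leave `N^σ` -/

section FutureSet

open Metric NNReal

variable {gC : MetricField Cyl} {Co : Set Cyl} {σ : ℝ}

/-- On the physical and non-physical parts together, the inequality that excludes `J^σ(i_σ)` is
automatic. So there `N^σ` is given by one closed condition. -/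
lemma mem_nSig_iff (hσ : IsSign σ) {p : Cyl} (hp : p ∈ physical ∪ nonphysical) :
    p ∈ nSig σ ↔ Real.pi ≤ σ * p.1 + polarAngle p.2 := by
  refine ⟨fun h ↦ h.1, fun h1 ↦ ⟨h1, ?_⟩⟩
  have hR := polarAngle_nonneg p.2
  have hpi := polarAngle_le_pi p.2
  have := Real.pi_pos
  rcases hp with h2 | h2
  · rw [mem_physical_iff] at h2
    rcases hσ with rfl | rfl
    · linarith
    · linarith
  · rw [mem_union, mem_nPlus_iff, mem_nMinus_iff] at h2
    rcases hσ with rfl | rfl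
    · rcases h2 with h2 | h2 <;> linarith
    · rcases h2 with h2 | h2 <;> linarith

lemma cylD_fst {p₀ p : Cyl} (hp : p ∈ (chartAt ModelH p₀).source) (v : TangentSpace I₄ p) :
    (cylD p v).1 = (chartVec p₀ p v).1 := by
  have hp' : p ∈ (extChartAt I₄ p₀).source := by rwa [extChartAt_source]
  have h2 : DifferentiableAt ℝ (coordIncl p₀) (extChartAt I₄ p₀ p) :=
    ((contDiffOn_coordIncl p₀).contDiffAt
      (extChartAt_target_mem_nhds' ((extChartAt I₄ p₀).map_source hp'))).differentiableAt (by simp)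
  have h3 := ((ContinuousLinearMap.fst ℝ ℝ E4).hasFDerivAt.comp (extChartAt I₄ p₀ p)
    h2.hasFDerivAt).unique (ContinuousLinearMap.fst ℝ ℝ E3).hasFDerivAt
  rw [cylD_eq_fderiv hp]
  exact congrArg (fun L : (ℝ × E3) →L[ℝ] ℝ ↦ L (chartVec p₀ p v)) h3

lemma norm_le_of_norm_sub_sub_le {E : Type*} [SeminormedAddCommGroup E] {a b c d : E} {r : ℝ}
    (h : c = d) (hr : ‖a - b - (c - d)‖ ≤ r) : ‖a - b‖ ≤ r := by
  rwa [h, sub_self, sub_zero] at hr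

set_option synthInstance.maxHeartbeats 200000 in
/-- Near a point of `N^σ`, the metric differs from the standard one by at most a constant times the
distance from `N^σ`. -/
lemma IsCollarMetric.exists_chartForm_sub_le (h : IsCollarMetric gC Co) (hσ : IsSign σ) {p : Cyl}
    (hp : p ∈ nSig σ) : ∃ K : ℝ≥0, ∀ᶠ q in 𝓝 p, ‖chartForm gC p q - chartForm cylMetric p q‖ ≤
      K * max (Real.pi - polarAngle q.2 - σ * q.1) 0 := by
  have hpCo : p ∈ Co := h.nonphysical_subset (nSig_subset hσ hp)
  set φ := extChartAt I₄ p with hφ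
  have hmem : p ∈ φ.source := mem_extChartAt_source p
  have hsm : ∀ g : MetricField Cyl, IsLorentzianOn g Co →
      ContDiffAt ℝ 1 (fun y ↦ chartForm g p (φ.symm y)) (φ p) := by
    intro g hg
    have h1 := ((contMDiffWithinAt_metric_iff (mem_chart_source ModelH p)).1
      (hg.smooth p hpCo)).contMDiffAt (h.isOpen.mem_nhds hpCo)
    have h2 : ContMDiffAt 𝓘(ℝ, ℝ × E3) I₄ ∞ φ.symm (φ p) :=
      (contMDiffOn_extChartAt_symm p).contMDiffAt (extChartAt_target_mem_nhds p)
    rw [← φ.left_inv hmem] at h1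
    have h3 := h1.comp (φ p) h2
    rw [φ.left_inv hmem] at h3
    exact (contMDiffAt_iff_contDiffAt.1 h3).of_le (by simp)
  have hcyl : IsLorentzianOn cylMetric Co :=
    ⟨isLorentzianOn_cylMetric.smooth.mono (subset_univ _), fun p _ ↦ isLorentzForm_cylMetric p⟩
  -- In coordinates, the difference of the two metrics is locally Lipschitz and vanishes on `N^σ`.
  -- Comparing `q` with the point reached by moving it in time by `d q` gives the estimate, since
  -- the chart is the identity in time.
  obtain ⟨K, s, hs, hl⟩ := ((hsm gC h.lorentzian).sub (hsm _ hcyl)).exists_lipschitzOnWith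
  refine ⟨K, ?_⟩
  -- the point of `N^σ` above or below `q`
  set d : Cyl → ℝ := fun q ↦ max (Real.pi - polarAngle q.2 - σ * q.1) 0 with hd
  have hdc : Continuous d := by
    have := continuous_polarAngle
    fun_prop
  have hd0 : d p = 0 := by
    refine max_eq_right ?_
    linarith [hp.1]
  set q' : Cyl → Cyl := fun q ↦ (q.1 + σ * d q, q.2) with hq'
  have hqc : Continuous q' := by fun_prop
  have hqp : q' p = p := by simp [hq', hd0]
  have hq'φ : ∀ q, φ (q' q) = φ q + (σ * d q, 0) := by
    intro q
    have h1 : ∀ q : Cyl, φ q = (q.1, (extChartAt 𝓘(ℝ, E3) p.2) q.2) := fun q ↦ rfl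
    rw [h1, h1]
    simp [hq']
  have hnear : ∀ᶠ q in 𝓝 p, (q ∈ φ.source ∧ φ q ∈ s) ∧ q ∈ Co := by
    filter_upwards [extChartAt_source_mem_nhds (I := I₄) p,
      (continuousAt_extChartAt (I := I₄) p).preimage_mem_nhds hs, h.isOpen.mem_nhds hpCo]
      with q a b c using ⟨⟨a, b⟩, c⟩
  have hnear' : ∀ᶠ q in 𝓝 p, (q' q ∈ φ.source ∧ φ (q' q) ∈ s) ∧ q' q ∈ Co := by
    have h1 : Tendsto q' (𝓝 p) (𝓝 p) := by
      have := hqc.tendsto p; rwa [hqp] at this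
    exact h1.eventually hnear
  filter_upwards [hnear, hnear'] with q ⟨⟨a1, a2⟩, a3⟩ ⟨⟨b1, b2⟩, b3⟩
  have hN : q' q ∈ nSig σ := by
    rw [mem_nSig_iff hσ (h.subset b3)]
    simp only [hq']
    have e1 : Real.pi - polarAngle q.2 - σ * q.1 ≤ d q := le_max_left _ _
    have : σ * (q.1 + σ * d q) = σ * q.1 + (σ * σ) * d q := by ring
    rw [this, hσ.mul_self]
    linarith
  have h0 : chartForm gC p (q' q) = chartForm cylMetric p (q' q) := by
    rw [chartForm, chartForm, h.eq _ (nSig_subset hσ hN)]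
  have key := hl.norm_sub_le a2 b2
  simp only [φ.left_inv a1, φ.left_inv b1] at key
  rw [hq'φ] at key
  refine (norm_le_of_norm_sub_sub_le h0 key).trans ?_
  gcongr
  have e2 : 0 ≤ d q := le_max_right _ _
  rw [sub_add_cancel_left, norm_neg, Prod.norm_def]
  simp only [norm_zero, Real.norm_eq_abs]
  rw [hσ.abs_mul, abs_of_nonneg e2, max_eq_left e2]

open InnerProductGeometry in
/-- Causal curves that start in `N^σ` remain there for some time. -/
lemma IsCollarMetric.exists_forall_mem_nSig (h : IsCollarMetric gC Co) (hσ : IsSign σ) {γ : ℝ → Cyl}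
    {t₀ t₁ : ℝ} (ht : t₀ < t₁) (hγ : ContMDiffOn 𝓘(ℝ, ℝ) I₄ ∞ γ (Icc t₀ t₁))
    (hc : ∀ t ∈ Icc t₀ t₁, γ t ∈ Co ∧
      IsFutureCausal gC (sigTime σ) (γ t) (velocity γ (Icc t₀ t₁) t))
    (h0 : γ t₀ ∈ nSig σ) : ∃ t₂ ∈ Ioc t₀ t₁, ∀ t ∈ Icc t₀ t₂, γ t ∈ nSig σ := by
  set p := γ t₀ with hp
  obtain ⟨K, hK⟩ := h.exists_chartForm_sub_le hσ h0
  have hpc : p ∈ coneRegion gC Co := h.nonphysical_subset_coneRegion (nSig_subset hσ h0)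
  have hnb : ∀ᶠ q in 𝓝 p, (‖chartForm gC p q - chartForm cylMetric p q‖ ≤
      K * max (Real.pi - polarAngle q.2 - σ * q.1) 0) ∧ q ∈ coneRegion gC Co ∧
      q ∈ (chartAt ModelH p).source :=
    hK.and ((isOpen_interior.eventually_mem hpc).and (chart_source_mem_nhds ModelH p))
  have hcont : ContinuousWithinAt γ (Icc t₀ t₁) t₀ :=
    hγ.continuousOn t₀ (left_mem_Icc.2 ht.le)
  have hev : ∀ᶠ t in 𝓝[≥] t₀, (‖chartForm gC p (γ t) - chartForm cylMetric p (γ t)‖ ≤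
      K * max (Real.pi - polarAngle (γ t).2 - σ * (γ t).1) 0) ∧ γ t ∈ coneRegion gC Co ∧
      γ t ∈ (chartAt ModelH p).source := by
    have h1 := hcont.tendsto.eventually hnb
    rwa [nhdsWithin_Icc_eq_nhdsGE ht] at h1
  obtain ⟨u, hu, hul⟩ := mem_nhdsGE_iff_exists_Icc_subset.1 hev
  set t₂ := min u t₁ with ht₂
  have ht₂0 : t₀ < t₂ := lt_min hu ht
  have hsub : Icc t₀ t₂ ⊆ Icc t₀ t₁ := Icc_subset_Icc le_rfl (min_le_right _ _)
  have hgood : ∀ t ∈ Icc t₀ t₂, _ := fun t ht ↦ hul (Icc_subset_Icc le_rfl (min_le_left _ _) ht)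
  have hγ' : ContMDiffOn 𝓘(ℝ, ℝ) I₄ ∞ γ (Icc t₀ t₂) := hγ.mono hsub
  have hmd : ∀ t ∈ Icc t₀ t₂, MDifferentiableWithinAt 𝓘(ℝ, ℝ) I₄ γ (Icc t₀ t₂) t := fun t ht ↦
    (hγ' t ht).mdifferentiableWithinAt (by simp)
  have hud := uniqueDiffOn_Icc ht₂0
  set V : ∀ t, TangentSpace I₄ (γ t) := fun t ↦ velocity γ (Icc t₀ t₂) t with hV
  have hc' : ∀ t ∈ Icc t₀ t₂, IsFutureCausal gC (sigTime σ) (γ t) (V t) := by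
    intro t ht
    have := (hc t (hsub ht)).2
    rwa [← velocity_subset hsub (hud t ht)
      ((hγ t (hsub ht)).mdifferentiableWithinAt (by simp))] at this
  -- the velocity in coordinates
  set y : ℝ → ℝ × E3 := fun t ↦ extChartAt I₄ p (γ t) with hy
  have hyd : ∀ t ∈ Icc t₀ t₂, HasDerivWithinAt y (chartVec p (γ t) (V t)) (Icc t₀ t₂) t :=
    fun t ht ↦ hasDerivWithinAt_chart (hmd t ht) (hgood t ht).2.2
  have hys : ContDiffOn ℝ ∞ y (Icc t₀ t₂) := by
    rw [← contMDiffOn_iff_contDiffOn]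
    exact (contMDiffOn_extChartAt (x := p)).comp hγ' fun t ht ↦ (hgood t ht).2.2
  have hyc : ContinuousOn (fun t ↦ chartVec p (γ t) (V t)) (Icc t₀ t₂) :=
    (hys.continuousOn_derivWithin hud (by simp)).congr
      fun t ht ↦ ((hyd t ht).derivWithin (hud t ht)).symm
  obtain ⟨M, hM⟩ := isCompact_Icc.exists_bound_of_continuousOn hyc
  have hpos : ∀ t ∈ Icc t₀ t₂, 0 < σ * (chartVec p (γ t) (V t)).1 := fun t ht ↦ by
    rw [← cylD_fst (hgood t ht).2.2]
    exact (h.norm_le hσ (interior_subset (hgood t ht).2.1) (hc' t ht)).1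
  have hac : ContinuousOn (fun t ↦ σ * (chartVec p (γ t) (V t)).1) (Icc t₀ t₂) :=
    continuousOn_const.mul hyc.fst
  obtain ⟨tm, htm, hmin⟩ := isCompact_Icc.exists_isMinOn (nonempty_Icc.2 ht₂0.le) hac
  set m := σ * (chartVec p (γ tm) (V tm)).1 with hm
  have hm0 : 0 < m := hpos tm htm
  have hmle : ∀ t ∈ Icc t₀ t₂, m ≤ σ * (cylD (γ t) (V t)).1 := fun t ht ↦ by
    rw [cylD_fst (hgood t ht).2.2]
    exact hmin ht
  -- `f = π - R - σ T` is nonpositive exactly on `N^σ` within `Co`. Written as an angle with the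
  -- south pole, it grows at most at the rate `‖b‖ - σ a`, where `a` and `b` are the time and sphere
  -- components of the velocity.
  set f : ℝ → ℝ := fun t ↦ angle (southPole : E4) ((γ t).2 : E4) - σ * (γ t).1 with hf
  have hf' : ∀ t, f t = Real.pi - polarAngle (γ t).2 - σ * (γ t).1 := fun t ↦ by
    simp only [hf]; rw [angle_southPole]
  set C := K * M ^ 2 / m with hC
  have hC0 : 0 ≤ C := by positivity
  -- Causality for the perturbed metric gives `‖b‖² - a² ≤ K max(f, 0) M²`. Dividing by `‖b‖ + σ a ≥
  -- m` yields the linear bound with `C = K M² / m`.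
  have hspeed : ∀ t ∈ Icc t₀ t₂, ‖(cylD (γ t) (V t)).2‖ - σ * (cylD (γ t) (V t)).1 ≤
      C * max (f t) 0 := by
    intro t ht
    obtain ⟨g1, g2, g3⟩ := hgood t ht
    set a := (cylD (γ t) (V t)).1 with ha
    set b := (cylD (γ t) (V t)).2 with hb
    set w := chartVec p (γ t) (V t) with hw
    have e1 : ‖b‖ ^ 2 - a ^ 2 ≤ K * max (f t) 0 * M ^ 2 := by
      have e2 : chartForm gC p (γ t) w w ≤ 0 := by
        rw [chartForm_chartVec gC g3]; exact (hc' t ht).2.1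
      have e3 : chartForm cylMetric p (γ t) w w = ‖b‖ ^ 2 - a ^ 2 := by
        rw [chartForm_chartVec cylMetric g3, cylMetric_self]
      have e4 : |(chartForm gC p (γ t) - chartForm cylMetric p (γ t)) w w| ≤
          K * max (f t) 0 * M * M := by
        refine (ContinuousLinearMap.le_opNorm₂
          (chartForm gC p (γ t) - chartForm cylMetric p (γ t) : Bilin) w w).trans ?_
        have hMt := hM t ht
        have hM0 : 0 ≤ M := (norm_nonneg _).trans hMt
        rw [hf']
        gcongr
      rw [sub_apply, sub_apply, e3] at e4
      have := (abs_le.1 e4).1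
      nlinarith
    have hmt := hmle t ht
    have haa : a ^ 2 = (σ * a) ^ 2 := by
      rw [mul_pow, sq σ, hσ.mul_self, one_mul]
    have hmx : 0 ≤ max (f t) 0 := le_max_right _ _
    by_contra hcon
    push Not at hcon
    have e5 : C * max (f t) 0 * m = K * max (f t) 0 * M ^ 2 := by
      rw [hC]; field_simp
    have e6 : 0 ≤ C * max (f t) 0 := by positivity
    have e7 : ‖b‖ ^ 2 - a ^ 2 = (‖b‖ - σ * a) * (‖b‖ + σ * a) := by rw [haa]; ring
    have e8 : C * max (f t) 0 * m < (‖b‖ - σ * a) * (‖b‖ + σ * a) := by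
      have : m ≤ ‖b‖ + σ * a := by linarith [norm_nonneg b]
      calc C * max (f t) 0 * m ≤ C * max (f t) 0 * (‖b‖ + σ * a) := by gcongr
        _ < (‖b‖ - σ * a) * (‖b‖ + σ * a) := by
          apply mul_lt_mul_of_pos_right hcon
          linarith
    linarith
  have hxn : ∀ t, ‖((γ t).2 : E4)‖ = 1 := fun t ↦ mem_sphere_zero_iff_norm.1 (γ t).2.2
  have hfc : ContinuousOn f (Icc t₀ t₂) := by
    have h1 : ContinuousOn γ (Icc t₀ t₂) := hγ'.continuousOn
    have := continuous_polarAngle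
    rw [show f = _ from funext hf']
    fun_prop
  -- Grönwall by comparison with a barrier. The angle need not be differentiable, so only upper
  -- right slopes are used. The exponent `C + 1` instead of `C` makes the comparison strict on
  -- contact, and `ε → 0` then gives `f ≤ 0`.
  have hle : ∀ ε > 0, ∀ t ∈ Icc t₀ t₂, f t ≤ ε * Real.exp ((C + 1) * (t - t₀)) := by
    intro ε hε t ht
    refine image_le_of_liminf_slope_right_lt_deriv_boundary (f := f)
      (f' := fun t ↦ C * max (f t) 0)
      (B := fun t ↦ ε * Real.exp ((C + 1) * (t - t₀)))
      (B' := fun t ↦ (C + 1) * (ε * Real.exp ((C + 1) * (t - t₀))))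
      hfc ?_ ?_ ?_ ?_ ht
    · intro s hs r hr
      apply Eventually.frequently
      have hs' : s ∈ Icc t₀ t₂ := ⟨hs.1, hs.2.le⟩
      have hd : HasDerivWithinAt (fun t ↦ cylIncl (γ t)) (cylD (γ s) (V s)) (Ici s) s :=
        HasDerivWithinAt.Icc_to_Ici (hasDerivWithinAt_cyl (hmd s hs')) hs
      have hd1 : HasDerivWithinAt (fun t ↦ σ * (γ t).1) (σ * (cylD (γ s) (V s)).1) (Ici s) s :=
        ((ContinuousLinearMap.fst ℝ ℝ E4).hasFDerivAt.comp_hasDerivWithinAt s hd).const_mul σ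
      have hd2 : HasDerivWithinAt (fun t ↦ ((γ t).2 : E4)) (cylD (γ s) (V s)).2 (Ici s) s :=
        (ContinuousLinearMap.snd ℝ ℝ E4).hasFDerivAt.comp_hasDerivWithinAt s hd
      set η := (r - C * max (f s) 0) / 2 with hη
      have hη0 : 0 < η := by
        have : C * max (f s) 0 < r := hr
        rw [hη]; linarith
      have h1 := eventually_slope_angle_lt hxn hd2 (southPole : E4)
        (lt_add_of_pos_right ‖(cylD (γ s) (V s)).2‖ hη0)
      have h2 := ((hasDerivWithinAt_iff_tendsto_slope' (by simp)).1 hd1.Ioi_of_Ici).eventually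
        (lt_mem_nhds (sub_lt_self (σ * (cylD (γ s) (V s)).1) hη0))
      filter_upwards [h1, h2] with z h3 h4
      have h5 : slope f s z = slope (fun t ↦ angle (southPole : E4) ((γ t).2 : E4)) s z -
          slope (fun t ↦ σ * (γ t).1) s z := by
        simp only [slope_def_field, hf]; ring
      rw [h5]
      have := hspeed s hs'
      rw [hη] at h3 h4
      linarith
    · have : f t₀ ≤ 0 := by rw [hf']; linarith [h0.1]
      simp only [sub_self, mul_zero, Real.exp_zero, mul_one]
      linarith
    · intro t
      have h1 : HasDerivAt (fun t ↦ (C + 1) * (t - t₀)) (C + 1) t := by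
        simpa using ((hasDerivAt_id t).sub_const t₀).const_mul (C + 1)
      refine (h1.exp.const_mul ε).congr_deriv (by ring)
    · intro s hs hfs
      have h1 : 0 < ε * Real.exp ((C + 1) * (s - t₀)) := by positivity
      rw [hfs, max_eq_left h1.le]
      linarith
  refine ⟨t₂, ⟨ht₂0, min_le_right _ _⟩, fun t ht ↦ ?_⟩
  rw [mem_nSig_iff hσ (h.subset (hc t (hsub ht)).1)]
  have hft : f t ≤ 0 := by
    have h1 : Tendsto (fun ε : ℝ ↦ ε * Real.exp ((C + 1) * (t - t₀))) (𝓝[>] 0) (𝓝 0) := by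
      have : Continuous fun ε : ℝ ↦ ε * Real.exp ((C + 1) * (t - t₀)) := by fun_prop
      have h2 := this.tendsto 0
      rw [zero_mul] at h2
      exact h2.mono_left nhdsWithin_le_nhds
    refine ge_of_tendsto h1 ?_
    filter_upwards [self_mem_nhdsWithin] with ε hε using hle ε hε t ht
  rw [hf'] at hft
  linarith

end FutureSet


/-! ### The continuation of the conformal factor to the cylinder -/

section Height

/-- The function `cos T + cos R` on `ℝ × S³`. -/
def cylHeight (p : Cyl) : ℝ := Real.cos p.1 + p.2.1 0

lemma continuous_cylHeight : Continuous cylHeight := by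
  have h : Continuous fun x : S3 ↦ x.1 0 :=
    (EuclideanSpace.proj (𝕜 := ℝ) (0 : Fin 4)).continuous.comp continuous_subtype_val
  exact (Real.continuous_cos.comp continuous_fst).add (h.comp continuous_snd)

/-- The conformal factor thus has a continuous extension to the whole cylinder. -/
lemma cylHeight_penroseMap (x : Minkowski) : cylHeight (penroseMap x) = conformalFactor x := by
  have h1 : cylHeight (penroseMap x) = 2 * cc x := by
    change Real.cos (penroseT x) + Real.cos (penroseR x) = _
    rw [cos_penroseT, cos_penroseR]; ring
  rw [h1, cc, conformalFactor, Real.cos_arctan, Real.cos_arctan, Real.sqrt_mul (by positivity)]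
  field_simp

/-- Write `cos T + cos R = 2 cos ((T + R) / 2) cos ((T - R) / 2)`. On `N⁺` the first half-angle is
in `[π/2, 3π/2]` and the second in `[-π/2, π/2]`; on `N⁻` the roles are exchanged up to sign. -/
lemma cylHeight_nonpos {p : Cyl} (hp : p ∈ nonphysical) : cylHeight p ≤ 0 := by
  have hR := polarAngle_nonneg p.2
  have hpi := polarAngle_le_pi p.2
  have h1 : cylHeight p = 2 * (Real.cos ((p.1 + polarAngle p.2) / 2) *
      Real.cos ((p.1 - polarAngle p.2) / 2)) := by
    rw [cylHeight, ← cos_polarAngle, Real.cos_add_cos]; ring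
  rw [h1]
  rcases hp with hp | hp
  · rw [mem_nPlus_iff] at hp
    have h2 := Real.cos_nonpos_of_pi_div_two_le_of_le (x := (p.1 + polarAngle p.2) / 2)
      (by linarith) (by linarith)
    have h3 := Real.cos_nonneg_of_neg_pi_div_two_le_of_le (x := (p.1 - polarAngle p.2) / 2)
      (by linarith) (by linarith)
    nlinarith
  · rw [mem_nMinus_iff] at hp
    have h2 := Real.cos_nonpos_of_pi_div_two_le_of_le (x := -((p.1 - polarAngle p.2) / 2))
      (by linarith) (by linarith)
    have h3 := Real.cos_nonneg_of_neg_pi_div_two_le_of_le (x := (p.1 + polarAngle p.2) / 2)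
      (by linarith) (by linarith)
    rw [Real.cos_neg] at h2
    nlinarith

end Height

namespace MinkowskianInfinity

variable {M : Type*} [TopologicalSpace M] [ChartedSpace ModelH M]
  {g : MetricField M} {Z : VecField M} (𝓔 : MinkowskianInfinity g Z)

/-! ### The extension is Hausdorff and second countable -/

section Topology

variable (ωM : M → ℝ)

/-- The function on `N_ext` that is `ωM` on `N` and `cos T + cos R` on `N⁺ ∪ N⁻`. -/
def extHeight : 𝓔.Ext → ℝ
  | Ext.incl m => ωM m
  | Ext.nonphys p _ => cylHeight p

variable {ωM}

lemma extHeight_glue (hωE : ∀ m ∈ 𝓔.iso.source, ωM m = conformalFactor (𝓔.iso m)) {p : Cyl}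
    (hp : p ∈ 𝓔.collar) : 𝓔.extHeight ωM (𝓔.glue p) = cylHeight p := by
  rcases hp with h | h
  · rw [glue_of_target _ h]
    have h1 : 𝓔.psi.symm p ∈ 𝓔.iso.source := by
      rw [← psi_source]; exact 𝓔.psi.map_target h
    change ωM (𝓔.psi.symm p) = _
    rw [hωE _ h1, ← cylHeight_penroseMap]
    exact congrArg cylHeight (𝓔.psi.right_inv h)
  · rw [glue_of_mem _ h]; rfl

lemma continuous_extHeight (hω : Continuous ωM)
    (hωE : ∀ m ∈ 𝓔.iso.source, ωM m = conformalFactor (𝓔.iso m)) :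
    Continuous (𝓔.extHeight ωM) := by
  refine ⟨fun O hO ↦ 𝓔.isOpen_iff.2 ⟨hω.isOpen_preimage O hO, ?_⟩⟩
  have : 𝓔.collar ∩ 𝓔.glue ⁻¹' (𝓔.extHeight ωM ⁻¹' O) = 𝓔.collar ∩ cylHeight ⁻¹' O := by
    ext p
    refine and_congr_right fun hp ↦ ?_
    rw [mem_preimage, mem_preimage, extHeight_glue 𝓔 hωE hp, mem_preimage]
  rw [this]
  exact 𝓔.isOpen_collar.inter (continuous_cylHeight.isOpen_preimage O hO)

lemma nonphys_mem_source {p : Cyl} (hp : p ∈ nonphysical) :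
    Ext.nonphys p hp ∈ 𝓔.homeoCyl.source := ⟨p, Or.inr hp, 𝓔.glue_of_mem hp⟩

/-- Distinct points in the source of a partial homeomorphism to a Hausdorff space are
separated. -/
lemma _root_.OpenPartialHomeomorph.exists_separation {X Y : Type*} [TopologicalSpace X]
    [TopologicalSpace Y] [T2Space Y] (e : OpenPartialHomeomorph X Y) {x y : X}
    (hx : x ∈ e.source) (hy : y ∈ e.source) (hxy : x ≠ y) :
    ∃ u v : Set X, IsOpen u ∧ IsOpen v ∧ x ∈ u ∧ y ∈ v ∧ Disjoint u v := by
  obtain ⟨u, v, hu, hv, hxu, hyv, huv⟩ := t2_separation (e.injOn.ne hx hy hxy)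
  refine ⟨_, _, e.isOpen_inter_preimage hu, e.isOpen_inter_preimage hv, ⟨hx, hxu⟩, ⟨hy, hyv⟩, ?_⟩
  exact (huv.preimage e).mono inter_subset_right inter_subset_right

/-- Two points of `N`, or two new points, lie in a common Hausdorff open piece. A point of `N` and a
new point are separated by the height function, positive at the first and nonpositive at the second.
-/
lemma t2Space [T2Space M] (hω : Continuous ωM) (hpos : ∀ m, 0 < ωM m)
    (hωE : ∀ m ∈ 𝓔.iso.source, ωM m = conformalFactor (𝓔.iso m)) : T2Space 𝓔.Ext := by
  have hc := 𝓔.continuous_extHeight hω hωE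
  have hne : ∀ m p hp, 𝓔.extHeight ωM (Ext.incl m) ≠ 𝓔.extHeight ωM (Ext.nonphys p hp) :=
    fun m p hp ↦ ((cylHeight_nonpos hp).trans_lt (hpos m)).ne'
  refine ⟨fun x y hxy ↦ ?_⟩
  rcases x with m | ⟨p, hp⟩ <;> rcases y with m' | ⟨p', hp'⟩
  · exact 𝓔.homeoM.exists_separation (mem_range_self m) (mem_range_self m') hxy
  · exact separated_by_continuous hc (hne m p' hp')
  · exact separated_by_continuous hc (hne m' p hp).symm
  · exact 𝓔.homeoCyl.exists_separation (𝓔.nonphys_mem_source hp) (𝓔.nonphys_mem_source hp') hxy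

lemma mem_source_or (x : 𝓔.Ext) : x ∈ 𝓔.homeoM.source ∨ x ∈ 𝓔.homeoCyl.source := by
  rcases x with m | ⟨p, hp⟩
  · exact Or.inl (mem_range_self m)
  · exact Or.inr (𝓔.nonphys_mem_source hp)

lemma secondCountable [SecondCountableTopology M] : SecondCountableTopology 𝓔.Ext := by
  have h1 : SecondCountableTopology 𝓔.homeoM.source :=
    𝓔.homeoM.toHomeomorphSourceTarget.secondCountableTopology
  have h2 : SecondCountableTopology 𝓔.homeoCyl.source :=
    𝓔.homeoCyl.toHomeomorphSourceTarget.secondCountableTopology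
  have h3 : ∀ b : Bool, SecondCountableTopology
      (↑(bif b then 𝓔.homeoM.source else 𝓔.homeoCyl.source) : Type _) := by
    rintro (_ | _)
    · exact h2
    · exact h1
  refine TopologicalSpace.secondCountableTopology_of_countable_cover
    (U := fun b : Bool ↦ bif b then 𝓔.homeoM.source else 𝓔.homeoCyl.source) ?_ ?_
  · rintro (_ | _)
    · exact 𝓔.homeoCyl.open_source
    · exact 𝓔.homeoM.open_source
  · refine eq_univ_of_forall fun x ↦ mem_iUnion.2 ?_
    rcases 𝓔.mem_source_or x with h | h
    · exact ⟨true, h⟩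
    · exact ⟨false, h⟩

end Topology

/-! ### Smoothness of the identifications with `N` and with the collar -/

section Smooth

/-- The chart of `N_ext` at a point of `N` is the chart of `N` there composed with `toM`, so the
coordinate expression of `toM` is the identity. The same remark serves for `incl`, and for `toCyl`
and `glue` at non-physical points. -/
lemma contMDiffOn_toM : ContMDiffOn I₄ I₄ ∞ 𝓔.toM (range 𝓔.incl) := by
  rintro _ ⟨m, rfl⟩
  refine ContMDiffAt.contMDiffWithinAt ?_
  have hm : 𝓔.incl m ∈ 𝓔.homeoM.source := mem_range_self m
  rw [contMDiffAt_iff]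
  refine ⟨𝓔.homeoM.continuousAt hm, ?_⟩
  refine (contDiffWithinAt_id (𝕜 := ℝ)).congr_of_eventuallyEq ?_ ?_
  · refine mem_nhdsWithin_of_mem_nhds ?_
    filter_upwards [extChartAt_target_mem_nhds (I := I₄) (𝓔.incl m)] with y hy
    exact (extChartAt I₄ (𝓔.incl m)).right_inv hy
  · exact (extChartAt I₄ (𝓔.incl m)).right_inv ((extChartAt I₄ (𝓔.incl m)).map_source
      (mem_extChartAt_source _))

lemma contMDiff_incl : ContMDiff I₄ I₄ ∞ 𝓔.incl := by
  intro m
  rw [contMDiffAt_iff]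
  refine ⟨𝓔.homeoM.symm.continuousAt (mem_univ m), ?_⟩
  refine (contDiffWithinAt_id (𝕜 := ℝ)).congr_of_eventuallyEq ?_ ?_
  · refine mem_nhdsWithin_of_mem_nhds ?_
    filter_upwards [extChartAt_target_mem_nhds (I := I₄) m] with y hy
    exact (extChartAt I₄ m).right_inv hy
  · exact (extChartAt I₄ m).right_inv ((extChartAt I₄ m).map_source (mem_extChartAt_source _))

lemma toCyl_eq_psi {x : 𝓔.Ext} (hx : x ∈ range 𝓔.incl) : 𝓔.toCyl x = 𝓔.psi (𝓔.toM x) := by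
  obtain ⟨m, rfl⟩ := hx; rfl

lemma mem_psi_source {m : M} (hm : 𝓔.incl m ∈ 𝓔.homeoCyl.source) : m ∈ 𝓔.psi.source := by
  obtain ⟨p, hp | hp, hpm⟩ := hm
  · rw [glue_of_target _ hp] at hpm
    have : 𝓔.psi.symm p = m := Ext.incl.inj hpm
    rw [← this]
    exact 𝓔.psi.map_target hp
  · rw [glue_of_mem _ hp] at hpm
    cases hpm

lemma contMDiffOn_toCyl : ContMDiffOn I₄ I₄ ∞ 𝓔.toCyl 𝓔.homeoCyl.source := by
  intro x hx
  refine ContMDiffAt.contMDiffWithinAt ?_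
  rcases x with m | ⟨p, hp⟩
  · have h1 : ContMDiffAt I₄ I₄ ∞ 𝓔.psi m :=
      (𝓔.contMDiffOn_psi m (𝓔.mem_psi_source hx)).contMDiffAt
        (𝓔.psi.open_source.mem_nhds (𝓔.mem_psi_source hx))
    have h2 : ContMDiffAt I₄ I₄ ∞ 𝓔.toM (𝓔.incl m) :=
      (𝓔.contMDiffOn_toM _ (mem_range_self m)).contMDiffAt
        (𝓔.homeoM.open_source.mem_nhds (mem_range_self m))
    refine (ContMDiffAt.comp (𝓔.incl m) h1 h2).congr_of_eventuallyEq ?_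
    filter_upwards [𝓔.homeoM.open_source.mem_nhds (mem_range_self m)] with y hy
    exact 𝓔.toCyl_eq_psi hy
  · have hm : Ext.nonphys p hp ∈ 𝓔.homeoCyl.source := hx
    rw [contMDiffAt_iff]
    refine ⟨𝓔.homeoCyl.continuousAt hm, ?_⟩
    refine (contDiffWithinAt_id (𝕜 := ℝ)).congr_of_eventuallyEq ?_ ?_
    · refine mem_nhdsWithin_of_mem_nhds ?_
      filter_upwards [extChartAt_target_mem_nhds (I := I₄) (Ext.nonphys p hp : 𝓔.Ext)] with y hy
      exact (extChartAt I₄ (Ext.nonphys p hp : 𝓔.Ext)).right_inv hy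
    · exact (extChartAt I₄ (Ext.nonphys p hp : 𝓔.Ext)).right_inv
        ((extChartAt I₄ (Ext.nonphys p hp : 𝓔.Ext)).map_source (mem_extChartAt_source _))

lemma contMDiffOn_glue : ContMDiffOn I₄ I₄ ∞ 𝓔.glue 𝓔.collar := by
  intro p hp
  refine ContMDiffAt.contMDiffWithinAt ?_
  rcases hp with h | h
  · have h1 : ContMDiffAt I₄ I₄ ∞ 𝓔.psi.symm p :=
      (𝓔.contMDiffOn_psi_symm p h).contMDiffAt (𝓔.psi.open_target.mem_nhds h)
    refine (𝓔.contMDiff_incl.contMDiffAt.comp p h1).congr_of_eventuallyEq ?_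
    filter_upwards [𝓔.psi.open_target.mem_nhds h] with q hq using 𝓔.glue_of_target hq
  · have hc : p ∈ 𝓔.homeoCyl.symm.source := Or.inr h
    have hch : extChartAt I₄ (𝓔.glue p) = extChartAt I₄ (Ext.nonphys p h : 𝓔.Ext) := by
      rw [𝓔.glue_of_mem h]
    rw [contMDiffAt_iff]
    refine ⟨𝓔.homeoCyl.symm.continuousAt hc, ?_⟩
    rw [hch]
    have key : ∀ y ∈ (extChartAt I₄ p).target, (extChartAt I₄ p).symm y ∈ 𝓔.collar →
        (extChartAt I₄ (Ext.nonphys p h : 𝓔.Ext)) (𝓔.glue ((extChartAt I₄ p).symm y)) = y := by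
      intro y hy hy'
      have : (extChartAt I₄ (Ext.nonphys p h : 𝓔.Ext)) (𝓔.glue ((extChartAt I₄ p).symm y)) =
        extChartAt I₄ p (𝓔.toCyl (𝓔.glue ((extChartAt I₄ p).symm y))) := rfl
      rw [this, 𝓔.toCyl_glue hy', (extChartAt I₄ p).right_inv hy]
    refine (contDiffWithinAt_id (𝕜 := ℝ)).congr_of_eventuallyEq ?_ ?_
    · refine mem_nhdsWithin_of_mem_nhds ?_
      have h4 : ContinuousAt (extChartAt I₄ p).symm (extChartAt I₄ p p) :=
        continuousAt_extChartAt_symm p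
      have h5 := h4.preimage_mem_nhds (by
        rw [extChartAt_to_inv]; exact 𝓔.isOpen_collar.mem_nhds (Or.inr h))
      filter_upwards [extChartAt_target_mem_nhds (I := I₄) p, h5] with y hy hy'
      exact key y hy hy'
    · refine key _ ((extChartAt I₄ p).map_source (mem_extChartAt_source _)) ?_
      rw [extChartAt_to_inv]; exact Or.inr h

end Smooth

end MinkowskianInfinity


/-! ### Transport of metrics, vector fields and causal paths by local diffeomorphisms -/

section Transport

set_option linter.unusedSectionVars false

variable {X Y : Type*} [TopologicalSpace X] [ChartedSpace ModelH X] [IsManifold I₄ ∞ X]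
  [TopologicalSpace Y] [ChartedSpace ModelH Y] [IsManifold I₄ ∞ Y]
  {gX : MetricField X} {gY : MetricField Y} {ZX : VecField X} {ZY : VecField Y}
  {f : X → Y} {k : Y → X} {x : X}

lemma mfderiv_mfderiv_of_leftInverse (hf : MDifferentiableAt I₄ I₄ f x)
    (hk : MDifferentiableAt I₄ I₄ k (f x)) (h : ∀ᶠ z in 𝓝 x, k (f z) = z) (v : ℝ × E3) :
    (mfderiv I₄ I₄ k (f x) (mfderiv I₄ I₄ f x v) : ℝ × E3) = v := by
  have h1 := hk.hasMFDerivAt.comp x hf.hasMFDerivAt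
  have h2 : HasMFDerivAt I₄ I₄ (k ∘ f) x (ContinuousLinearMap.id ℝ (TangentSpace I₄ x)) :=
    (hasMFDerivAt_id x).congr_of_eventuallyEq h
  have h3 := hasMFDerivAt_unique h1 h2
  exact congrArg (fun L : (ℝ × E3) →L[ℝ] (ℝ × E3) ↦ L v) h3

lemma tangentBundle_mk_eq {y y' : Y} (h : y = y') (v : ℝ × E3) :
    (⟨y, v⟩ : TangentBundle I₄ Y) = ⟨y', v⟩ := by
  subst h; rfl

/-- The push-forward of a smooth vector field by a diffeomorphism `f` with inverse `k`. -/
lemma contMDiffOn_pushforward {s : Set X} {t : Set Y} (hs : IsOpen s)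
    (hf : ContMDiffOn I₄ I₄ ∞ f s) (hk : ContMDiffOn I₄ I₄ ∞ k t) (hkt : MapsTo k t s)
    (hfk : ∀ y ∈ t, f (k y) = y)
    (hZ : ContMDiffOn I₄ I₄.tangent ∞ (fun x ↦ (⟨x, ZX x⟩ : TangentBundle I₄ X)) s) :
    ContMDiffOn I₄ I₄.tangent ∞
      (fun y ↦ (⟨y, mfderiv I₄ I₄ f (k y) (ZX (k y))⟩ : TangentBundle I₄ Y)) t := by
  have h1 := hf.contMDiffOn_tangentMapWithin (m := ∞) (by simp) hs.uniqueMDiffOn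
  have h2 := h1.comp (hZ.comp hk hkt) fun y hy ↦ hkt hy
  refine h2.congr fun y hy ↦ ?_
  have h3 : mfderivWithin I₄ I₄ f s (k y) = mfderiv I₄ I₄ f (k y) :=
    mfderivWithin_of_isOpen hs (hkt hy)
  refine (tangentBundle_mk_eq (hfk y hy).symm _).trans ?_
  simp only [Function.comp_apply, tangentMapWithin, h3]

/-- The product of two vector fields is continuous. -/
lemma continuousOn_metric {s : Set X} {Z Z' : VecField X} (hg : IsLorentzianOn gX s)
    (hZ : ContMDiffOn I₄ I₄.tangent ∞ (fun x ↦ (⟨x, Z x⟩ : TangentBundle I₄ X)) s)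
    (hZ' : ContMDiffOn I₄ I₄.tangent ∞ (fun x ↦ (⟨x, Z' x⟩ : TangentBundle I₄ X)) s) :
    ContinuousOn (fun x ↦ gX x (Z x) (Z' x)) s := by
  intro x hx
  have hx1 := mem_chart_source ModelH x
  have h1 := ((contMDiffWithinAt_metric_iff hx1).1 (hg.smooth x hx)).continuousWithinAt
  have h2 := ((contMDiffWithinAt_vecField_iff hx1).1 (hZ x hx)).continuousWithinAt
  have h3 := ((contMDiffWithinAt_vecField_iff hx1).1 (hZ' x hx)).continuousWithinAt
  refine ((h1.clm_apply h2).clm_apply h3).congr_of_eventuallyEq ?_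
    (chartForm_chartVec gX hx1 _ _).symm
  filter_upwards [mem_nhdsWithin_of_mem_nhds (chart_source_mem_nhds ModelH x)] with y hy
  exact (chartForm_chartVec gX hy _ _).symm

lemma isFutureCausal_congr {Z' : VecField X} (h : IsLorentzForm (gX x))
    (h1 : gX x (ZX x) (ZX x) < 0) (h2 : gX x (Z' x) (Z' x) < 0) (h3 : gX x (ZX x) (Z' x) < 0)
    (v : TangentSpace I₄ x) : IsFutureCausal gX ZX x v ↔ IsFutureCausal gX Z' x v := by
  refine ⟨fun ⟨a, b, c⟩ ↦ ⟨a, b, h.neg_of_same_cone h1 h2 h3 a b c⟩,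
    fun ⟨a, b, c⟩ ↦ ⟨a, b, h.neg_of_same_cone h2 h1 ?_ a b c⟩⟩
  rwa [h.symm]

lemma isFutureCausal_pullback (h : gX x = pullback (gY (f x)) (mfderiv I₄ I₄ f x))
    (hZ : mfderiv I₄ I₄ f x (ZX x) = ZY (f x)) (hi : Function.Injective (mfderiv I₄ I₄ f x))
    (v : TangentSpace I₄ x) :
    IsFutureCausal gX ZX x v ↔ IsFutureCausal gY ZY (f x) (mfderiv I₄ I₄ f x v) := by
  simp only [IsFutureCausal, h, pullback_apply, hZ]
  rw [Ne, Ne, map_eq_zero_iff _ hi]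

/-- The image of a causal step. -/
lemma StepIn.map {s W : Set X} (hs : IsOpen s) (hf : ContMDiffOn I₄ I₄ ∞ f s) (hW : W ⊆ s)
    (hfc : ∀ x ∈ W, ∀ v, IsFutureCausal gX ZX x v →
      IsFutureCausal gY ZY (f x) (mfderiv I₄ I₄ f x v)) {p q : X} (h : StepIn gX ZX W p q) :
    StepIn gY ZY (f '' W) (f p) (f q) := by
  obtain ⟨γ, hγ, rfl, rfl, hc⟩ := h
  refine ⟨f ∘ γ, hf.comp hγ fun t ht ↦ hW (hc t ht).1, rfl, rfl, fun t ht ↦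
    ⟨mem_image_of_mem _ (hc t ht).1, ?_⟩⟩
  rw [velocity_comp (uniqueDiffOn_Icc zero_lt_one t ht)
    ((hγ t ht).mdifferentiableWithinAt (by simp))
    (((hf _ (hW (hc t ht).1)).contMDiffAt (hs.mem_nhds (hW (hc t ht).1))).mdifferentiableAt
      (by simp))]
  exact hfc _ (hc t ht).1 _ (hc t ht).2

lemma LEIn.map {s W : Set X} (hs : IsOpen s) (hf : ContMDiffOn I₄ I₄ ∞ f s) (hW : W ⊆ s)
    (hfc : ∀ x ∈ W, ∀ v, IsFutureCausal gX ZX x v →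
      IsFutureCausal gY ZY (f x) (mfderiv I₄ I₄ f x v)) {p q : X} (h : LEIn gX ZX W p q) :
    LEIn gY ZY (f '' W) (f p) (f q) :=
  Relation.ReflTransGen.lift f (fun _ _ ↦ StepIn.map hs hf hW hfc) _ _ h

set_option synthInstance.maxHeartbeats 200000 in
set_option maxHeartbeats 400000 in
lemma isLorentzianOn_conformalMetric {w : X → ℝ} (hw : ContMDiff I₄ 𝓘(ℝ, ℝ) ∞ w)
    (hpos : ∀ x, 0 < w x) {s : Set X} (h : IsLorentzianOn gX s) :
    IsLorentzianOn (conformalMetric w gX) s where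
  smooth x hx := by
    have hx1 := mem_chart_source ModelH x
    refine (contMDiffWithinAt_metric_iff hx1).2 ?_
    have h1 := (contMDiffWithinAt_metric_iff hx1).1 (h.smooth x hx)
    have h2 : ContMDiffWithinAt I₄ 𝓘(ℝ, ℝ) ∞ (fun x ↦ w x ^ 2) s x :=
      (hw.pow 2).contMDiffAt.contMDiffWithinAt
    have h3 : ∀ y, chartForm (conformalMetric w gX) x y = w y ^ 2 • chartForm gX x y := fun y ↦
      ContinuousLinearMap.ext fun v ↦ ContinuousLinearMap.ext fun v' ↦ rfl
    rw [show chartForm (conformalMetric w gX) x = _ from funext h3]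
    exact h2.smul h1
  lorentz x hx := (h.lorentz x hx).const_smul (pow_pos (hpos x) 2)

lemma isFutureCausal_conformalMetric {w : X → ℝ} (hpos : ∀ x, 0 < w x) (v : TangentSpace I₄ x) :
    IsFutureCausal (conformalMetric w gX) ZX x v ↔ IsFutureCausal gX ZX x v := by
  have h := pow_pos (hpos x) 2
  have h1 : ∀ a : ℝ, w x ^ 2 * a ≤ 0 ↔ a ≤ 0 := fun a ↦ by
    rw [mul_nonpos_iff]; constructor
    · rintro (h' | h') <;> [exact h'.2; linarith]
    · exact fun h' ↦ Or.inl ⟨h.le, h'⟩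
  have h2 : ∀ a : ℝ, w x ^ 2 * a < 0 ↔ a < 0 := fun a ↦ by
    rw [← not_le, ← not_le, mul_nonneg_iff_of_pos_left h]
  change (v ≠ 0 ∧ w x ^ 2 * _ ≤ 0 ∧ w x ^ 2 * _ < 0) ↔ _
  rw [h1, h2]
  rfl

end Transport

/-! ### The extended metric and its smoothness -/

section CollarMetric

set_option linter.unusedSectionVars false

open InnerProductGeometry

lemma eq_of_angle_eq_zero {x y : S3} (h : angle (x : E4) (y : E4) = 0) : x = y := by
  have hx : ‖(x : E4)‖ = 1 := mem_sphere_zero_iff_norm.1 x.2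
  have hy : ‖(y : E4)‖ = 1 := mem_sphere_zero_iff_norm.1 y.2
  refine Subtype.ext ?_
  rw [← sub_eq_zero, ← norm_eq_zero, ← pow_eq_zero_iff two_ne_zero, norm_sub_sq_real, hx, hy,
    inner_eq_cos_angle_of_norm_eq_one hx hy, h, Real.cos_zero]
  norm_num

lemma eq_southPole {x : S3} (h : polarAngle x = Real.pi) : x = southPole :=
  (eq_of_angle_eq_zero (by rw [angle_southPole, h, sub_self])).symm

/-- The frontier points of the physical region outside `ℐ⁺ ∪ ℐ⁻ ∪ {i₀}` are `i₊` and `i₋`, and these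
were removed from `N⁺` and `N⁻` with `J⁺(i₊)` and `J⁻(i₋)`. So the metric given on `Vh` covers every
place where the two regions touch. -/
lemma closure_physical_inter_subset :
    closure physical ∩ nonphysical ⊆ scriPlus ∪ scriMinus ∪ {iZero} := by
  rintro p ⟨hp, hn⟩
  have hnp : p ∉ physical := fun h ↦ Set.disjoint_left.1 disjoint_physical h hn
  have hf : p ∈ frontier physical := ⟨hp, fun h ↦ hnp (interior_subset h)⟩
  have h1 := frontier_physical_subset hf
  have hpi := polarAngle_le_pi p.2
  rcases lt_trichotomy p.1 0 with h0 | h0 | h0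
  · refine Or.inl (Or.inr ⟨hf, ?_, h0⟩)
    rcases hn with h | h
    · rw [mem_nPlus_iff] at h; linarith
    · rw [mem_nMinus_iff] at h; linarith [h1.2.1]
  · refine Or.inr (Prod.ext h0 (eq_southPole ?_))
    rcases h1.2.2 with h | h <;> linarith
  · refine Or.inl (Or.inl ⟨hf, h0, ?_⟩)
    rcases hn with h | h
    · rw [mem_nPlus_iff] at h; linarith [h1.1]
    · rw [mem_nMinus_iff] at h; linarith

variable {M : Type*} [TopologicalSpace M] [ChartedSpace ModelH M] [IsManifold I₄ ∞ M]
  {g : MetricField M} {Z : VecField M} (𝓔 : MinkowskianInfinity g Z)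

namespace MinkowskianInfinity

lemma mdifferentiableAt_toM (m : M) : MDifferentiableAt I₄ I₄ 𝓔.toM (𝓔.incl m) :=
  ((𝓔.contMDiffOn_toM _ (mem_range_self m)).contMDiffAt
    (𝓔.homeoM.open_source.mem_nhds (mem_range_self m))).mdifferentiableAt (by simp)

lemma mdifferentiableAt_incl (m : M) : MDifferentiableAt I₄ I₄ 𝓔.incl m :=
  𝓔.contMDiff_incl.contMDiffAt.mdifferentiableAt (by simp)

lemma mdifferentiableAt_toCyl {x : 𝓔.Ext} (hx : x ∈ 𝓔.homeoCyl.source) :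
    MDifferentiableAt I₄ I₄ 𝓔.toCyl x :=
  ((𝓔.contMDiffOn_toCyl _ hx).contMDiffAt
    (𝓔.homeoCyl.open_source.mem_nhds hx)).mdifferentiableAt (by simp)

lemma mdifferentiableAt_glue {p : Cyl} (hp : p ∈ 𝓔.collar) : MDifferentiableAt I₄ I₄ 𝓔.glue p :=
  ((𝓔.contMDiffOn_glue _ hp).contMDiffAt (𝓔.isOpen_collar.mem_nhds hp)).mdifferentiableAt (by simp)

lemma mfderiv_toM_incl (m : M) (v : ℝ × E3) :
    (mfderiv I₄ I₄ 𝓔.toM (𝓔.incl m) (mfderiv I₄ I₄ 𝓔.incl m v) : ℝ × E3) = v :=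
  mfderiv_mfderiv_of_leftInverse (f := 𝓔.incl) (k := 𝓔.toM) (𝓔.mdifferentiableAt_incl m)
    (𝓔.mdifferentiableAt_toM m) (Eventually.of_forall fun _ ↦ rfl) v

lemma mfderiv_incl_toM (m : M) (v : ℝ × E3) :
    (mfderiv I₄ I₄ 𝓔.incl m (mfderiv I₄ I₄ 𝓔.toM (𝓔.incl m) v) : ℝ × E3) = v :=
  mfderiv_mfderiv_of_leftInverse (f := 𝓔.toM) (k := 𝓔.incl) (x := 𝓔.incl m)
    (𝓔.mdifferentiableAt_toM m) (𝓔.mdifferentiableAt_incl m)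
    (by filter_upwards [𝓔.homeoM.open_source.mem_nhds (mem_range_self m)] with y hy
        exact 𝓔.homeoM.left_inv hy) v

lemma mfderiv_toCyl_glue {x : 𝓔.Ext} (hx : x ∈ 𝓔.homeoCyl.source) (v : ℝ × E3) :
    (mfderiv I₄ I₄ 𝓔.toCyl x (mfderiv I₄ I₄ 𝓔.glue (𝓔.toCyl x) v) : ℝ × E3) = v := by
  have hp : 𝓔.toCyl x ∈ 𝓔.collar := 𝓔.homeoCyl.map_source hx
  have hgx : 𝓔.glue (𝓔.toCyl x) = x := 𝓔.homeoCyl.left_inv hx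
  have h := mfderiv_mfderiv_of_leftInverse (f := 𝓔.glue) (k := 𝓔.toCyl) (x := 𝓔.toCyl x)
    (𝓔.mdifferentiableAt_glue hp) (by rw [hgx]; exact 𝓔.mdifferentiableAt_toCyl hx)
    (by filter_upwards [𝓔.isOpen_collar.mem_nhds hp] with y hy
        exact 𝓔.toCyl_glue hy) v
  rwa [hgx] at h

lemma mfderiv_glue_toCyl {x : 𝓔.Ext} (hx : x ∈ 𝓔.homeoCyl.source) (v : ℝ × E3) :
    (mfderiv I₄ I₄ 𝓔.glue (𝓔.toCyl x) (mfderiv I₄ I₄ 𝓔.toCyl x v) : ℝ × E3) = v :=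
  mfderiv_mfderiv_of_leftInverse (f := 𝓔.toCyl) (k := 𝓔.glue) (x := x)
    (𝓔.mdifferentiableAt_toCyl hx) (𝓔.mdifferentiableAt_glue (𝓔.homeoCyl.map_source hx))
    (by filter_upwards [𝓔.homeoCyl.open_source.mem_nhds hx] with y hy
        exact 𝓔.homeoCyl.left_inv hy) v

lemma bijective_mfderiv_toM (m : M) : Function.Bijective (mfderiv I₄ I₄ 𝓔.toM (𝓔.incl m)) :=
  ⟨Function.LeftInverse.injective (𝓔.mfderiv_incl_toM m),
    Function.RightInverse.surjective (𝓔.mfderiv_toM_incl m)⟩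

lemma bijective_mfderiv_toCyl {x : 𝓔.Ext} (hx : x ∈ 𝓔.homeoCyl.source) :
    Function.Bijective (mfderiv I₄ I₄ 𝓔.toCyl x) :=
  ⟨Function.LeftInverse.injective (𝓔.mfderiv_glue_toCyl hx),
    Function.RightInverse.surjective (𝓔.mfderiv_toCyl_glue hx)⟩

/-- The metric of `N_ext` near the non-physical part, as a metric on a subset of `ℝ × S³`. -/
lemma exists_collarMetric {ωM : M → ℝ}
    (hωE : ∀ m ∈ 𝓔.iso.source, ωM m = conformalFactor (𝓔.iso m)) :
    ∃ gC : MetricField Cyl, IsCollarMetric gC 𝓔.collar ∧ ∀ x ∈ 𝓔.homeoCyl.source,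
      𝓔.extMetric (conformalMetric ωM g) x =
        pullback (gC (𝓔.toCyl x)) (mfderiv I₄ I₄ 𝓔.toCyl x) := by
  classical
  obtain ⟨-, Vh, gh, hV, hsub, hVV, hgh, hgh0, hgV⟩ := 𝓔.nbhd
  have htar : 𝓔.psi.target = Vh ∩ physical := by
    rw [psi_target, hVV, image_preimage_eq_inter_range]
    exact inter_eq_left.2 inter_subset_right
  -- This equals `gh` on all of `Vh`, since `gh` is standard off the physical region, and it is the
  -- standard metric off the physical region.
  set gC : MetricField Cyl := fun p ↦ if p ∈ physical then gh p else cylMetric p with hgC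
  have hgC1 : ∀ p ∈ Vh, gC p = gh p := fun p hp ↦ by
    by_cases h : p ∈ physical
    · simp [hgC, h]
    · simp [hgC, h, hgh0 p ⟨hp, h⟩]
  have hgC2 : ∀ p ∉ physical, gC p = cylMetric p := fun p hp ↦ by simp [hgC, hp]
  -- A collar point outside `Vh` has a neighbourhood disjoint from the physical region, so `gC` is
  -- standard near it; every other collar point lies in the open set `Vh`.
  have hnear : ∀ p ∈ 𝓔.collar, p ∉ Vh → ∀ᶠ q in 𝓝 p, q ∉ physical := by
    intro p hp hpV
    have hpn : p ∈ nonphysical := by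
      rcases hp with h | h
      · rw [htar] at h; exact absurd h.1 hpV
      · exact h
    have : p ∉ closure physical := fun h ↦ hpV (hsub (closure_physical_inter_subset ⟨h, hpn⟩))
    filter_upwards [isClosed_closure.isOpen_compl.mem_nhds this] with q hq h
    exact hq (subset_closure h)
  refine ⟨gC, ⟨𝓔.isOpen_collar, ⟨fun p hp ↦ ?_, fun p hp ↦ ?_⟩, subset_union_right, ?_, fun p hp ↦
    hgC2 p fun h ↦ Set.disjoint_left.1 disjoint_physical h hp⟩, fun x hx ↦ ?_⟩
  · refine ContMDiffAt.contMDiffWithinAt ?_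
    by_cases hpV : p ∈ Vh
    · refine ((hgh.smooth p hpV).contMDiffAt (hV.mem_nhds hpV)).congr_of_eventuallyEq ?_
      filter_upwards [hV.mem_nhds hpV] with q hq
      rw [hgC1 q hq]
    · refine ((isLorentzianOn_cylMetric.smooth p (mem_univ p)).contMDiffAt
        univ_mem).congr_of_eventuallyEq ?_
      filter_upwards [hnear p hp hpV] with q hq
      rw [hgC2 q hq]
  · by_cases hpV : p ∈ Vh
    · rw [hgC1 p hpV]; exact hgh.lorentz p hpV
    · rw [hgC2 p (hnear p hp hpV).self_of_nhds]; exact isLorentzForm_cylMetric p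
  · rw [collar, htar]; exact union_subset_union_left _ inter_subset_right
  · rcases x with m | ⟨p, hp⟩
    · have hm := 𝓔.mem_psi_source hx
      have hmi : m ∈ 𝓔.iso.source := by rwa [← psi_source]
      have hV' : 𝓔.psi m ∈ Vh := by
        have := 𝓔.psi.map_source hm
        rw [htar] at this; exact this.1
      have hiso : MDifferentiableAt I₄ I₄ 𝓔.iso m :=
        ((𝓔.smooth_iso m hmi).contMDiffAt (𝓔.iso.open_source.mem_nhds hmi)).mdifferentiableAt
          (by simp)
      have hpen : MDifferentiableAt I₄ I₄ penroseMap (𝓔.iso m) :=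
        contMDiff_penroseMap.contMDiffAt.mdifferentiableAt (by simp)
      have hd : HasMFDerivAt I₄ I₄ 𝓔.toCyl (𝓔.incl m) (((mfderiv I₄ I₄ penroseMap (𝓔.iso m)).comp
          (mfderiv I₄ I₄ 𝓔.iso m)).comp (mfderiv I₄ I₄ 𝓔.toM (𝓔.incl m))) := by
        have h1 : HasMFDerivAt I₄ I₄ (penroseMap ∘ 𝓔.iso) m _ :=
          hpen.hasMFDerivAt.comp m hiso.hasMFDerivAt
        have h2 := HasMFDerivAt.comp (𝓔.incl m) (f := 𝓔.toM) h1
          (𝓔.mdifferentiableAt_toM m).hasMFDerivAt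
        refine h2.congr_of_eventuallyEq ?_
        filter_upwards [𝓔.homeoM.open_source.mem_nhds (mem_range_self m)] with y hy
        exact 𝓔.toCyl_eq_psi hy
      rw [hd.mfderiv]
      have e1 : 𝓔.toCyl (𝓔.incl m) = penroseMap (𝓔.iso m) := rfl
      have e2 := hgV (𝓔.iso m) (𝓔.iso.map_source hmi)
      have e3 : gC (𝓔.toCyl (𝓔.incl m)) = gh (penroseMap (𝓔.iso m)) := hgC1 _ hV'
      rw [e3]
      -- On the glued part `toCyl` is `Φ ∘ F ∘ toM`. As `ωM = Ω ∘ F` there and `F` is an isometry,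
      -- the assertion becomes the defining relation `Ω² g_V = Φ^* gh`.
      refine ContinuousLinearMap.ext fun v ↦ ContinuousLinearMap.ext fun w ↦ ?_
      have e4 := congrArg (fun B : Bilin ↦ B (mfderiv I₄ I₄ 𝓔.iso m
        (mfderiv I₄ I₄ 𝓔.toM (𝓔.incl m) v)) (mfderiv I₄ I₄ 𝓔.iso m
        (mfderiv I₄ I₄ 𝓔.toM (𝓔.incl m) w))) e2
      refine Eq.trans ?_ e4
      change ωM m ^ 2 * g m _ _ = conformalFactor (𝓔.iso m) ^ 2 * _
      rw [hωE m hmi, 𝓔.isometry m hmi]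
      rfl
    · have : gC (𝓔.toCyl (Ext.nonphys p hp)) = cylMetric p :=
        hgC2 p fun h ↦ Set.disjoint_left.1 disjoint_physical h hp
      rw [this]
      rfl

lemma extMetric_incl (gN : MetricField M) {x : 𝓔.Ext} (hx : x ∈ range 𝓔.incl) :
    𝓔.extMetric gN x = pullback (gN (𝓔.toM x)) (mfderiv I₄ I₄ 𝓔.toM x) := by
  obtain ⟨m, rfl⟩ := hx; rfl

lemma isLorentzianOn_extMetric {gN : MetricField M} (hgN : IsLorentzianOn gN univ)
    {gC : MetricField Cyl} (hgC : IsCollarMetric gC 𝓔.collar)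
    (hext : ∀ x ∈ 𝓔.homeoCyl.source, 𝓔.extMetric gN x =
      pullback (gC (𝓔.toCyl x)) (mfderiv I₄ I₄ 𝓔.toCyl x)) :
    IsLorentzianOn (𝓔.extMetric gN) univ where
  smooth x _ := by
    refine (contMDiffWithinAt_metric_iff (mem_chart_source ModelH x)).2 ?_
    refine ContMDiffAt.contMDiffWithinAt ?_
    rcases 𝓔.mem_source_or x with hx | hx
    · obtain ⟨m, rfl⟩ := hx
      have h1 : ContMDiffAt I₄ I₄ ∞ 𝓔.toM (𝓔.incl m) :=
        (𝓔.contMDiffOn_toM _ (mem_range_self m)).contMDiffAt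
          (𝓔.homeoM.open_source.mem_nhds (mem_range_self m))
      have h2 := ((contMDiffWithinAt_metric_iff (mem_chart_source ModelH m)).1
        (hgN.smooth m (mem_univ m))).contMDiffAt univ_mem
      refine (contMDiffAt_chartForm_pullback h1 (q := gN) h2).congr_of_eventuallyEq ?_
      filter_upwards [𝓔.homeoM.open_source.mem_nhds (mem_range_self m)] with y hy
      rw [chartForm, chartForm, 𝓔.extMetric_incl gN hy]
    · have hp : 𝓔.toCyl x ∈ 𝓔.collar := 𝓔.homeoCyl.map_source hx
      have h1 : ContMDiffAt I₄ I₄ ∞ 𝓔.toCyl x :=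
        (𝓔.contMDiffOn_toCyl _ hx).contMDiffAt (𝓔.homeoCyl.open_source.mem_nhds hx)
      have h2 := ((contMDiffWithinAt_metric_iff (mem_chart_source ModelH (𝓔.toCyl x))).1
        (hgC.lorentzian.smooth _ hp)).contMDiffAt (𝓔.isOpen_collar.mem_nhds hp)
      refine (contMDiffAt_chartForm_pullback h1 (q := gC) h2).congr_of_eventuallyEq ?_
      filter_upwards [𝓔.homeoCyl.open_source.mem_nhds hx] with y hy
      rw [chartForm, chartForm, hext y hy]
  lorentz x _ := by
    rcases 𝓔.mem_source_or x with hx | hx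
    · obtain ⟨m, rfl⟩ := hx
      exact (hgN.lorentz m (mem_univ m)).pullback (𝓔.bijective_mfderiv_toM m)
    · rw [hext x hx]
      exact (hgC.lorentzian.lorentz _ (𝓔.homeoCyl.map_source hx)).pullback
        (𝓔.bijective_mfderiv_toCyl hx)

end MinkowskianInfinity

end CollarMetric


/-! ### Constancy of the relative orientation near the non-physical part -/

section Sign

lemma mem_physical_iff_abs {p : Cyl} : p ∈ physical ↔ |p.1| < Real.pi - polarAngle p.2 := by
  rw [mem_physical_iff, abs_lt]
  constructor <;> rintro ⟨h1, h2⟩ <;> constructor <;> linarith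

/-- The slice `T = 0` of the physical region is the sphere without its south pole, and this is dense
because the sphere has no isolated point. -/
lemma iZero_mem_closure_physical : iZero ∈ closure physical := by
  have h1 : PreconnectedSpace S3 := isPreconnected_iff_preconnectedSpace.1
    (isPreconnected_sphere (by rw [← Module.finrank_eq_rank]; simp) (0 : E4) 1)
  have h2 : Nontrivial S3 := ⟨northPole, southPole, fun h ↦ by
    have h3 := polarAngle_southPole
    have h4 := angle_northPole northPole
    rw [InnerProductGeometry.angle_self (by simp [northPole])] at h4
    rw [← h, ← h4] at h3
    exact Real.pi_pos.ne h3⟩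
  have : ConnectedSpace S3 := { toNonempty := ⟨northPole⟩ }
  have h3 : southPole ∈ closure ({southPole}ᶜ : Set S3) := by
    rw [closure_compl_singleton]; trivial
  have h4 : Continuous fun x : S3 ↦ ((0, x) : Cyl) := by fun_prop
  refine closure_mono ?_ (image_closure_subset_closure_image h4 (mem_image_of_mem _ h3))
  rintro _ ⟨x, hx, rfl⟩
  rw [mem_physical_iff_abs, abs_zero, sub_pos]
  exact lt_of_le_of_ne (polarAngle_le_pi x) fun h ↦ hx (eq_southPole h)

/-- The end point of the vertical segment of `physical` through `x` in the time direction `σ`. -/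
def scriPoint (σ : ℝ) (x : S3) : Cyl := (σ * (Real.pi - polarAngle x), x)

lemma continuous_scriPoint (σ : ℝ) : Continuous (scriPoint σ) := by
  have := continuous_polarAngle
  unfold scriPoint
  fun_prop

lemma scriPoint_mem {σ : ℝ} (hσ : IsSign σ) {x : S3} (h0 : 0 < polarAngle x) :
    scriPoint σ x ∈ nonphysical := by
  refine nSig_subset hσ ⟨?_, ?_⟩ <;> simp only [scriPoint, ← mul_assoc, hσ.mul_self] <;> linarith

lemma scriPoint_mem_closure {σ : ℝ} (hσ : IsSign σ) {x : S3} (h1 : polarAngle x < Real.pi) :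
    scriPoint σ x ∈ closure physical := by
  refine frontier_subset_closure (mem_frontier_physical ?_)
  rcases hσ with rfl | rfl
  · left; simp only [scriPoint]; constructor <;> linarith
  · right; simp only [scriPoint]; constructor <;> linarith

/-- A nowhere zero continuous function on the physical part of a neighbourhood of `N⁺ ∪ N⁻` has
constant sign near `N⁺ ∪ N⁻`. -/
lemma exists_sign_near_nonphysical {A : Set Cyl} (hA : IsOpen A) (hN : nonphysical ⊆ A)
    {s : Cyl → ℝ} (hs : ContinuousOn s (A ∩ physical)) (h0 : ∀ p ∈ A ∩ physical, s p ≠ 0) :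
    ∃ ε, IsSign ε ∧ ∃ Co, IsOpen Co ∧ nonphysical ⊆ Co ∧ Co ⊆ A ∧
      ∀ p ∈ Co ∩ physical, ε * s p < 0 := by
  have hWo : IsOpen (A ∩ physical) := hA.inter isOpen_physical
  have hsgn : ∀ p ∈ A ∩ physical, ∃ ε, IsSign ε ∧ ε * s p < 0 := by
    intro p hp
    rcases lt_or_gt_of_ne (h0 p hp) with h | h
    · exact ⟨1, Or.inl rfl, by linarith⟩
    · exact ⟨-1, Or.inr rfl, by linarith⟩
  have huniq : ∀ {ε ε' a : ℝ}, IsSign ε → IsSign ε' → ε * a < 0 → ε' * a < 0 → ε = ε' := by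
    rintro ε ε' a (rfl | rfl) (rfl | rfl) h1 h2 <;> first | rfl | (exfalso; linarith)
  -- the sign is constant on vertical segments
  have seg : ∀ (x : S3) (J : Set ℝ), J.OrdConnected → (∀ t ∈ J, (t, x) ∈ A ∩ physical) →
      ∀ ε, ∀ t₀ ∈ J, ∀ t ∈ J, ε * s (t₀, x) < 0 → IsSign ε → ε * s (t, x) < 0 := by
    intro x J hJ hJW ε t₀ ht₀ t ht hε hεs
    have hc : ContinuousOn (fun t ↦ ε * s (t, x)) J :=
      continuousOn_const.mul (hs.comp (by fun_prop) hJW)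
    by_contra hcon
    push Not at hcon
    obtain ⟨t₁, ht₁, h1⟩ := hJ.isPreconnected.intermediate_value ht₀ ht hc ⟨hε.le, hcon⟩
    rcases mul_eq_zero.1 h1 with h | h
    · exact hεs.ne_zero h
    · exact h0 _ (hJW t₁ ht₁) h
  have box : ∀ p ∈ A, ∃ δ > 0, ∃ C ∈ 𝓝 p.2, ∀ t x, |t - p.1| < δ → x ∈ C → (t, x) ∈ A := by
    intro p hp
    obtain ⟨u, hu, C, hC, huC⟩ := mem_nhds_prod_iff.1 (hA.mem_nhds hp)
    obtain ⟨δ, hδ, hδu⟩ := Metric.mem_nhds_iff.1 hu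
    exact ⟨δ, hδ, C, hC, fun t x ht hx ↦ huC ⟨hδu (by rwa [Metric.mem_ball, Real.dist_eq]), hx⟩⟩
  -- `G ε` collects the points near which every physical point lies in `A` with the sign recorded by
  -- `ε`. It is open, and at points adherent to the physical region at most one `ε` is possible.
  set G : ℝ → Set Cyl := fun ε ↦ {p | ∀ᶠ q in 𝓝 p, q ∈ physical → q ∈ A ∧ ε * s q < 0} with hG
  have hGo : ∀ ε, IsOpen (G ε) := fun ε ↦ isOpen_setOfPred_eventually_nhds
  have hGu : ∀ p ∈ closure physical, ∀ ε ε', IsSign ε → IsSign ε' → p ∈ G ε → p ∈ G ε' →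
      ε = ε' := by
    intro p hp ε ε' h1 h2 h3 h4
    obtain ⟨q, hq, h5, h6⟩ := ((mem_closure_iff_frequently.1 hp).and_eventually (h3.and h4)).exists
    exact huniq h1 h2 (h5 hq).2 (h6 hq).2
  -- Below or above a point of `ℐ^σ`, pick one physical height `t₀` inside a product box. The sign
  -- at height `t₀` is locally constant in the sphere variable and is carried along vertical
  -- segments to all nearby physical points.
  have hscri : ∀ σ, IsSign σ → ∀ x : S3, 0 < polarAngle x → polarAngle x < Real.pi →
      ∃ ε, IsSign ε ∧ scriPoint σ x ∈ G ε := by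
    intro σ hσ x hx0 hx1
    obtain ⟨δ, hδ, C, hC, hbox⟩ := box _ (hN (scriPoint_mem hσ hx0))
    set τ := Real.pi - polarAngle x with hτ
    have hτ0 : 0 < τ := by linarith
    set a := min δ τ / 2 with ha
    have ha0 : 0 < a := by positivity
    have haδ : a < δ := by have := min_le_left δ τ; linarith
    have haτ : a < τ := by have := min_le_right δ τ; linarith
    set t₀ := σ * (τ - a) with ht₀
    have ht₀' : |t₀ - σ * τ| < δ := by
      rw [ht₀, ← mul_sub, hσ.abs_mul, abs_lt]; constructor <;> linarith
    have hx₀ : (t₀, x) ∈ A ∩ physical := by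
      refine ⟨hbox _ _ ht₀' (mem_of_mem_nhds hC), ?_⟩
      rw [mem_physical_iff_abs]
      simp only
      rw [ht₀, hσ.abs_mul, abs_of_nonneg (by linarith)]
      linarith
    obtain ⟨ε, hε, hεs⟩ := hsgn _ hx₀
    refine ⟨ε, hε, ?_⟩
    have hop : IsOpen ((A ∩ physical) ∩ (fun p ↦ ε * s p) ⁻¹' Iio 0) :=
      (continuousOn_const.mul hs).isOpen_inter_preimage hWo isOpen_Iio
    have e1 : ∀ᶠ q : Cyl in 𝓝 (scriPoint σ x),
        (t₀, q.2) ∈ (A ∩ physical) ∩ (fun p ↦ ε * s p) ⁻¹' Iio 0 := by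
      have : Continuous fun q : Cyl ↦ ((t₀, q.2) : Cyl) := by fun_prop
      exact this.continuousAt.preimage_mem_nhds (hop.mem_nhds ⟨hx₀, hεs⟩)
    have e2 : ∀ᶠ q : Cyl in 𝓝 (scriPoint σ x), q.2 ∈ C := continuousAt_snd.preimage_mem_nhds hC
    have e3 : ∀ᶠ q : Cyl in 𝓝 (scriPoint σ x), |q.1 - σ * τ| < δ := by
      have : Continuous fun q : Cyl ↦ |q.1 - σ * τ| := by fun_prop
      refine this.continuousAt.eventually_lt_const ?_
      simp only [scriPoint, ← hτ, sub_self, abs_zero]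
      exact hδ
    filter_upwards [e1, e2, e3] with q h1 h2 h3 hq
    have hJ : OrdConnected (Ioo (-(Real.pi - polarAngle q.2)) (Real.pi - polarAngle q.2) ∩
        Ioo (σ * τ - δ) (σ * τ + δ)) := ordConnected_Ioo.inter ordConnected_Ioo
    have hq2 : ∀ t, |t - σ * τ| < δ → (t, q.2) ∈ physical →
      t ∈ (Ioo (-(Real.pi - polarAngle q.2)) (Real.pi - polarAngle q.2) ∩
        Ioo (σ * τ - δ) (σ * τ + δ)) := by
      intro t h4 h5
      rw [mem_physical_iff_abs, abs_lt] at h5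
      rw [abs_lt] at h4
      exact ⟨h5, by linarith [h4.1], by linarith [h4.2]⟩
    refine ⟨hbox _ _ h3 h2, seg q.2 _ hJ (fun t ht ↦ ⟨hbox t _ ?_ h2, ?_⟩) ε t₀ (hq2 _ ht₀' h1.1.2)
      q.1 (hq2 _ h3 hq) h1.2 hε⟩
    · rw [abs_lt]; constructor
      · have := ht.2.1; simp only [scriPoint, ← hτ]; linarith
      · have := ht.2.2; simp only [scriPoint, ← hτ]; linarith
    · rw [mem_physical_iff_abs, abs_lt]; exact ht.1
  -- `ℐ^σ` is a graph over the sphere without its poles, which is the image of the connected set `ℝ³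
  -- \ {0}` under the Penrose map at time zero. So one sign serves for all of it.
  have hscri' : ∀ σ, IsSign σ → ∃ ε, IsSign ε ∧ ∀ x : S3, 0 < polarAngle x →
      polarAngle x < Real.pi → scriPoint σ x ∈ G ε := by
    intro σ hσ
    set X : E3 → S3 := fun y ↦ (penroseMap (0, y)).2 with hX
    have hXc : Continuous X := by
      have : Continuous fun y : E3 ↦ penroseMap (0, y) :=
        contMDiff_penroseMap.continuous.comp (by fun_prop)
      exact continuous_snd.comp this
    have hXR : ∀ y ≠ 0, 0 < polarAngle (X y) ∧ polarAngle (X y) < Real.pi := by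
      intro y hy
      have h1 : polarAngle (X y) = 2 * Real.arctan ‖y‖ := by
        rw [hX, polarAngle_penroseMap]
        simp only [penroseR, vCoord, uCoord, zero_add, zero_sub, Real.arctan_neg]
        ring
      have h2 := Real.arctan_lt_pi_div_two ‖y‖
      have h3 : 0 < Real.arctan ‖y‖ := Real.arctan_pos.2 (norm_pos_iff.2 hy)
      rw [h1]; constructor <;> linarith
    have hXs : ∀ x : S3, 0 < polarAngle x → polarAngle x < Real.pi → ∃ y ≠ 0, X y = x := by
      intro x hx0 hx1
      have h1 : ((0, x) : Cyl) ∈ physical := by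
        rw [mem_physical_iff_abs, abs_zero]; linarith
      obtain ⟨⟨t, y⟩, hy⟩ := h1
      have h2 := penroseInv_penroseMap (t, y)
      rw [hy] at h2
      have ht : t = 0 := by
        have := congrArg Prod.fst h2
        simpa [penroseInv] using this.symm
      subst ht
      refine ⟨y, ?_, by simp only [hX, hy]⟩
      rintro rfl
      have h3 := polarAngle_penroseMap (0, 0)
      rw [hy] at h3
      simp [penroseR, vCoord, uCoord] at h3
      linarith
    have hconn : IsPreconnected ({0}ᶜ : Set E3) :=
      (isConnected_compl_singleton_of_one_lt_rank
        (by rw [← Module.finrank_eq_rank]; simp) 0).isPreconnected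
    have hc := (continuous_scriPoint σ).comp hXc
    have hcov : ({0}ᶜ : Set E3) ⊆ (scriPoint σ ∘ X) ⁻¹' G 1 ∪ (scriPoint σ ∘ X) ⁻¹' G (-1) := by
      intro y hy
      obtain ⟨ε, hε, h⟩ := hscri σ hσ (X y) (hXR y hy).1 (hXR y hy).2
      rcases hε with rfl | rfl
      · exact Or.inl h
      · exact Or.inr h
    have hdis : ({0}ᶜ : Set E3) ∩ ((scriPoint σ ∘ X) ⁻¹' G 1 ∩ (scriPoint σ ∘ X) ⁻¹' G (-1)) = ∅ := by
      rw [eq_empty_iff_forall_notMem]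
      rintro y ⟨hy, h1, h2⟩
      have := hGu _ (scriPoint_mem_closure hσ (hXR y hy).2) 1 (-1) (Or.inl rfl) (Or.inr rfl) h1 h2
      norm_num at this
    have hor := isPreconnected_iff_subset_of_disjoint.1 hconn _ _ ((hGo 1).preimage hc)
      ((hGo (-1)).preimage hc) hcov hdis
    rcases hor with h | h
    · refine ⟨1, Or.inl rfl, fun x hx0 hx1 ↦ ?_⟩
      obtain ⟨y, hy, rfl⟩ := hXs x hx0 hx1
      exact h hy
    · refine ⟨-1, Or.inr rfl, fun x hx0 hx1 ↦ ?_⟩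
      obtain ⟨y, hy, rfl⟩ := hXs x hx0 hx1
      exact h hy
  -- Close to `i₀` the vertical physical segments are so short that they lie entirely in `A`. The
  -- sign of `ℐ^σ` thus propagates along them, and `i₀` has the sign of `ℐ⁺` as well as that of
  -- `ℐ⁻`.
  have hzero : ∀ σ ε, IsSign σ → IsSign ε → (∀ x : S3, 0 < polarAngle x →
      polarAngle x < Real.pi → scriPoint σ x ∈ G ε) → iZero ∈ G ε := by
    intro σ ε hσ hε h
    obtain ⟨δ, hδ, C, hC, hbox⟩ := box _ (hN iZero_mem)
    have e2 : ∀ᶠ q : Cyl in 𝓝 iZero, q.2 ∈ C := continuousAt_snd.preimage_mem_nhds hC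
    have hRc : Continuous fun q : Cyl ↦ polarAngle q.2 := continuous_polarAngle.comp continuous_snd
    have e3 : ∀ᶠ q : Cyl in 𝓝 iZero, max 0 (Real.pi - δ) < polarAngle q.2 := by
      refine hRc.continuousAt.eventually_const_lt ?_
      simp only [iZero, polarAngle_southPole]
      exact max_lt Real.pi_pos (by linarith)
    filter_upwards [e2, e3] with q h2 h3 hq
    have hR0 : 0 < polarAngle q.2 := (le_max_left _ _).trans_lt h3
    have hRδ : Real.pi - polarAngle q.2 < δ := by
      have := (le_max_right 0 (Real.pi - δ)).trans_lt h3; linarith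
    have hqa := mem_physical_iff_abs.1 hq
    have hR1 : polarAngle q.2 < Real.pi := by linarith [abs_nonneg q.1]
    have hG1 := h q.2 hR0 hR1
    set τ := Real.pi - polarAngle q.2 with hτ
    have hlim : Tendsto (fun a : ℝ ↦ ((σ * (τ - a), q.2) : Cyl)) (𝓝[>] 0)
        (𝓝 (scriPoint σ q.2)) := by
      have : Continuous fun a : ℝ ↦ ((σ * (τ - a), q.2) : Cyl) := by fun_prop
      have h4 := this.tendsto 0
      simp only [sub_zero] at h4
      exact h4.mono_left nhdsWithin_le_nhds
    obtain ⟨a, h4, h5⟩ := ((hlim.eventually hG1).and (Ioo_mem_nhdsGT (show (0 : ℝ) < τ by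
      linarith))).exists
    have h6 : σ * (τ - a) ∈ Ioo (-τ) τ := by
      refine abs_lt.1 ?_
      rw [hσ.abs_mul, abs_of_nonneg (by linarith [h5.2])]
      linarith [h5.1]
    have hJ : ∀ t ∈ Ioo (-τ) τ, (t, q.2) ∈ A ∩ physical := by
      intro t ht
      have : |t| < τ := abs_lt.2 ht
      refine ⟨hbox _ _ ?_ h2, mem_physical_iff_abs.2 this⟩
      simp only [iZero, sub_zero]
      linarith
    refine ⟨(hJ q.1 (abs_lt.1 hqa)).1, seg q.2 _ ordConnected_Ioo hJ ε _ h6 q.1 (abs_lt.1 hqa)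
      (h4 (hJ _ h6).2).2 hε⟩
  obtain ⟨ε, hε, h1⟩ := hscri' 1 (Or.inl rfl)
  obtain ⟨ε', hε', h2⟩ := hscri' (-1) (Or.inr rfl)
  have hz := hzero 1 ε (Or.inl rfl) hε h1
  have heq : ε = ε' := hGu _ iZero_mem_closure_physical _ _ hε hε' hz
    (hzero (-1) ε' (Or.inr rfl) hε' h2)
  subst heq
  refine ⟨ε, hε, A ∩ G ε, hA.inter (hGo ε), fun p hp ↦ ⟨hN hp, ?_⟩, inter_subset_left,
    fun p hp ↦ (hp.1.2.self_of_nhds hp.2).2⟩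
  by_cases hcl : p ∈ closure physical
  · rcases closure_physical_inter_subset ⟨hcl, hp⟩ with (h | h) | h
    · have h3 := frontier_physical_subset h.1
      have h4 := h.2.1
      have h6 := h.2.2
      have h5 := polarAngle_le_pi p.2
      have h7 : Real.pi = p.1 + polarAngle p.2 := by
        rcases h3.2.2 with h8 | h8 <;> linarith [h3.1, h3.2.1]
      have := h1 p.2 (by linarith) (by linarith)
      have h8 : scriPoint 1 p.2 = p := Prod.ext (by simp only [scriPoint]; linarith) rfl
      rwa [h8] at this
    · have h3 := frontier_physical_subset h.1
      have h4 := h.2.1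
      have h6 := h.2.2
      have h5 := polarAngle_le_pi p.2
      have h7 : Real.pi = -p.1 + polarAngle p.2 := by
        rcases h3.2.2 with h8 | h8 <;> linarith [h3.1, h3.2.1]
      have := h2 p.2 (by linarith) (by linarith)
      have h8 : scriPoint (-1) p.2 = p := Prod.ext (by simp only [scriPoint]; linarith) rfl
      rwa [h8] at this
    · rw [mem_singleton_iff.1 h]; exact hz
  · have : ∀ᶠ q in 𝓝 p, q ∈ (closure physical)ᶜ := isClosed_closure.isOpen_compl.mem_nhds hcl
    filter_upwards [this] with q hq h
    exact absurd (subset_closure h) hq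

end Sign


section Reverse

variable {X : Type*} [TopologicalSpace X] [ChartedSpace ModelH X]
  {g : MetricField X} {Z : VecField X}

lemma isFutureCausal_neg {x : X} (v : TangentSpace I₄ x) :
    IsFutureCausal g (fun x ↦ -Z x) x v ↔ IsFutureCausal g Z x (-v) := by
  simp [IsFutureCausal]

end Reverse

/-! ### The time orientation of the extension -/

namespace MinkowskianInfinity

set_option linter.unusedSectionVars false

variable {M : Type*} [TopologicalSpace M] [ChartedSpace ModelH M] [IsManifold I₄ ∞ M]
  {g : MetricField M} {Z : VecField M} (𝓔 : MinkowskianInfinity g Z)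

/-- A vector field on `N`, as a vector field on `N ⊆ N_ext`. -/
def pushM (Y : VecField M) : VecField 𝓔.Ext := fun x ↦ mfderiv I₄ I₄ 𝓔.incl (𝓔.toM x) (Y (𝓔.toM x))

/-- The vector field `∂/∂T` near the non-physical part of `N_ext`. -/
def pushTime : VecField 𝓔.Ext := fun x ↦
  mfderiv I₄ I₄ 𝓔.glue (𝓔.toCyl x) (cylTime (𝓔.toCyl x))

lemma mfderiv_toM_pushM (Y : VecField M) (m : M) :
    mfderiv I₄ I₄ 𝓔.toM (𝓔.incl m) (𝓔.pushM Y (𝓔.incl m)) = Y m :=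
  𝓔.mfderiv_toM_incl m (Y m)

lemma mfderiv_toCyl_pushTime {x : 𝓔.Ext} (hx : x ∈ 𝓔.homeoCyl.source) :
    mfderiv I₄ I₄ 𝓔.toCyl x (𝓔.pushTime x) = cylTime (𝓔.toCyl x) :=
  𝓔.mfderiv_toCyl_glue hx _

lemma contMDiffOn_pushM {Y : VecField M}
    (hY : ContMDiff I₄ I₄.tangent ∞ (fun x ↦ (⟨x, Y x⟩ : TangentBundle I₄ M))) :
    ContMDiffOn I₄ I₄.tangent ∞ (fun x ↦ (⟨x, 𝓔.pushM Y x⟩ : TangentBundle I₄ 𝓔.Ext))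
      (range 𝓔.incl) :=
  contMDiffOn_pushforward (s := univ) (k := 𝓔.toM) isOpen_univ 𝓔.contMDiff_incl.contMDiffOn
    𝓔.contMDiffOn_toM (mapsTo_univ _ _) (fun _ hy ↦ 𝓔.homeoM.left_inv hy) hY.contMDiffOn

lemma contMDiffOn_pushTime :
    ContMDiffOn I₄ I₄.tangent ∞ (fun x ↦ (⟨x, 𝓔.pushTime x⟩ : TangentBundle I₄ 𝓔.Ext))
      𝓔.homeoCyl.source := by
  have h1 : ContMDiff I₄ I₄.tangent ∞ (fun p ↦ (⟨p, cylTime p⟩ : TangentBundle I₄ Cyl)) := by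
    have := contMDiff_sigTime 1
    simpa [sigTime] using this
  exact contMDiffOn_pushforward (k := 𝓔.toCyl) 𝓔.isOpen_collar 𝓔.contMDiffOn_glue
    𝓔.contMDiffOn_toCyl (fun _ hx ↦ 𝓔.homeoCyl.map_source hx)
    (fun _ hy ↦ 𝓔.homeoCyl.left_inv hy) h1.contMDiffOn

/-- The time orientation of `N_ext` at each of its points. -/
def orientRef (Y : VecField M) : VecField 𝓔.Ext
  | Ext.incl m => 𝓔.pushM Y (𝓔.incl m)
  | Ext.nonphys p hp => 𝓔.pushTime (Ext.nonphys p hp)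

/-- The space-time `(N_ext, gX)` with time orientation `ZX`, that of `(N, gN)` with time orientation
`ZN`, and that of a neighbourhood `Co` of the non-physical part in `ℝ × S³`, with time orientation
`σ ∂/∂T`, are compatible. -/
structure IsExtension (σ : ℝ) (gN : MetricField M) (ZN : VecField M) (ZX : VecField 𝓔.Ext)
    (gC : MetricField Cyl) (Co : Set Cyl) : Prop where
  isSign : IsSign σ
  collarMetric : IsCollarMetric gC Co
  subset : Co ⊆ 𝓔.collar
  spacetimeN : IsSpacetimeOn gN ZN univ
  spacetime : IsSpacetimeOn (𝓔.extMetric gN) ZX univ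
  metric_eq : ∀ x ∈ 𝓔.homeoCyl.source, 𝓔.extMetric gN x =
    pullback (gC (𝓔.toCyl x)) (mfderiv I₄ I₄ 𝓔.toCyl x)
  future_incl : ∀ x ∈ range 𝓔.incl, ∀ v, IsFutureCausal (𝓔.extMetric gN) ZX x v ↔
    IsFutureCausal gN ZN (𝓔.toM x) (mfderiv I₄ I₄ 𝓔.toM x v)
  future_glue : ∀ x ∈ 𝓔.glue '' Co, ∀ v, IsFutureCausal (𝓔.extMetric gN) ZX x v ↔
    IsFutureCausal gC (sigTime σ) (𝓔.toCyl x) (mfderiv I₄ I₄ 𝓔.toCyl x v)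

lemma mem_target_of_physical {p : Cyl} (hp : p ∈ 𝓔.collar) (h : p ∈ physical) :
    p ∈ 𝓔.psi.target :=
  hp.resolve_right (Set.disjoint_left.1 disjoint_physical h)

variable {𝓔} in
-- Time reversal turns `N^σ` into `N^{-σ}` as the future piece. Statements about futures in `N^σ`
-- thereby yield those about pasts in `N^{-σ}`.
lemma IsExtension.reverse {σ : ℝ} {gN : MetricField M} {ZN : VecField M} {ZX : VecField 𝓔.Ext}
    {gC : MetricField Cyl} {Co : Set Cyl} (h : 𝓔.IsExtension σ gN ZN ZX gC Co) :
    𝓔.IsExtension (-σ) gN (fun m ↦ -ZN m) (fun x ↦ -ZX x) gC Co where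
  isSign := h.isSign.neg
  collarMetric := h.collarMetric
  subset := h.subset
  spacetimeN := h.spacetimeN.reverse
  spacetime := h.spacetime.reverse
  metric_eq := h.metric_eq
  future_incl x hx v := by
    rw [isFutureCausal_neg, isFutureCausal_neg, h.future_incl x hx, map_neg]
  future_glue x hx v := by
    have : sigTime (-σ) = fun p ↦ -sigTime σ p := by
      funext p; simp [sigTime]
    rw [this, isFutureCausal_neg, isFutureCausal_neg, h.future_glue x hx, map_neg]

/-- The orientation of `N` agrees with that of the cylinder near the non-physical part, up to a
global sign. -/
lemma exists_coherent_sign {gN : MetricField M} (hgN : IsLorentzianOn gN univ)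
    {Y : VecField M} (hY : IsTimeOrientation gN Y) {gC : MetricField Cyl}
    (hgC : IsCollarMetric gC 𝓔.collar)
    (hext : ∀ x ∈ 𝓔.homeoCyl.source, 𝓔.extMetric gN x =
      pullback (gC (𝓔.toCyl x)) (mfderiv I₄ I₄ 𝓔.toCyl x)) :
    ∃ ε, IsSign ε ∧ ∃ Co, IsOpen Co ∧ nonphysical ⊆ Co ∧ Co ⊆ coneRegion gC 𝓔.collar ∧
      ∀ p ∈ Co ∩ physical, ε * 𝓔.extMetric gN (𝓔.glue p) (𝓔.pushM Y (𝓔.glue p))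
        (𝓔.pushTime (𝓔.glue p)) < 0 := by
  have hX := 𝓔.isLorentzianOn_extMetric hgN hgC hext
  have hmaps : ∀ p ∈ coneRegion gC 𝓔.collar ∩ physical,
      𝓔.glue p ∈ range 𝓔.incl ∩ 𝓔.homeoCyl.source := by
    rintro p ⟨hp, hph⟩
    have hpc := coneRegion_subset hp
    refine ⟨?_, 𝓔.homeoCyl.map_target hpc⟩
    rw [𝓔.glue_of_target (𝓔.mem_target_of_physical hpc hph)]
    exact mem_range_self _
  -- The function to which this is applied is the product of the orientation of `N` with `∂/∂T`. It
  -- has no zeros where both fields are timelike.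
  refine exists_sign_near_nonphysical isOpen_interior hgC.nonphysical_subset_coneRegion ?_ ?_
  · have h1 : ContinuousOn (fun x ↦ 𝓔.extMetric gN x (𝓔.pushM Y x) (𝓔.pushTime x))
        (range 𝓔.incl ∩ 𝓔.homeoCyl.source) :=
      continuousOn_metric ⟨hX.smooth.mono (subset_univ _), fun x _ ↦ hX.lorentz x (mem_univ x)⟩
        ((𝓔.contMDiffOn_pushM hY.smooth).mono inter_subset_left)
        (𝓔.contMDiffOn_pushTime.mono inter_subset_right)
    exact h1.comp (𝓔.homeoCyl.symm.continuousOn.mono fun p hp ↦ coneRegion_subset hp.1) hmaps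
  · intro p hp
    obtain ⟨⟨m, hm⟩, hsrc⟩ := hmaps p hp
    have hcone := (interior_subset hp.1).2.1
    have htc : 𝓔.toCyl (𝓔.glue p) = p := 𝓔.toCyl_glue (coneRegion_subset hp.1)
    have h1 : 𝓔.extMetric gN (𝓔.glue p) (𝓔.pushTime (𝓔.glue p)) (𝓔.pushTime (𝓔.glue p)) < 0 := by
      rw [hext _ hsrc, pullback_apply, 𝓔.mfderiv_toCyl_pushTime hsrc, htc]
      exact hcone
    have h2 : 𝓔.extMetric gN (𝓔.glue p) (𝓔.pushM Y (𝓔.glue p)) (𝓔.pushM Y (𝓔.glue p)) < 0 := by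
      rw [← hm, 𝓔.extMetric_incl gN (mem_range_self m), pullback_apply, 𝓔.mfderiv_toM_pushM]
      exact hY.timelike m
    exact (hX.lorentz _ (mem_univ _)).ne_zero_of_causal h2 (IsLorentzForm.ne_zero_of_timelike h1)
      h1.le

/-- The given field on `N`, multiplied by the global sign, and `∂/∂T` near the new points lie in the
same time cone wherever both are used. The cones are convex, so local sections patch to a global
smooth timelike field. -/
lemma exists_isExtension [T2Space 𝓔.Ext] [SecondCountableTopology 𝓔.Ext]
    {gN : MetricField M} (hgN : IsLorentzianOn gN univ)
    {Y : VecField M} (hY : IsTimeOrientation gN Y) {gC : MetricField Cyl}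
    (hgC : IsCollarMetric gC 𝓔.collar)
    (hext : ∀ x ∈ 𝓔.homeoCyl.source, 𝓔.extMetric gN x =
      pullback (gC (𝓔.toCyl x)) (mfderiv I₄ I₄ 𝓔.toCyl x)) :
    ∃ ε ZX Co, IsSign ε ∧ 𝓔.IsExtension 1 gN (fun m ↦ ε • Y m) ZX gC Co := by
  obtain ⟨ε, hε, Co, hCo, hNCo, hCoA, hsgn⟩ := 𝓔.exists_coherent_sign hgN hY hgC hext
  have hX := 𝓔.isLorentzianOn_extMetric hgN hgC hext
  set Y' : VecField M := fun m ↦ ε • Y m with hY'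
  have hYs' : ContMDiff I₄ I₄.tangent ∞ (fun x ↦ (⟨x, Y' x⟩ : TangentBundle I₄ M)) := by
    intro m
    have h1 := (contMDiffWithinAt_vecField_iff (mem_chart_source ModelH m)).1
      ((hY.smooth m).contMDiffWithinAt (s := univ))
    refine ((contMDiffWithinAt_vecField_iff (mem_chart_source ModelH m)).2 ?_).contMDiffAt univ_mem
    simp only [hY', map_smul]
    exact (contMDiffWithinAt_const (I' := 𝓘(ℝ, ℝ)) (c := ε)).smul h1
  have hYt' : ∀ m, gN m (Y' m) (Y' m) < 0 := fun m ↦ by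
    simp only [hY', map_smul, smul_apply, smul_eq_mul, ← mul_assoc, hε.mul_self, one_mul]
    exact hY.timelike m
  have hCoC : Co ⊆ 𝓔.collar := hCoA.trans coneRegion_subset
  have hsrc : ∀ x ∈ 𝓔.glue '' Co, x ∈ 𝓔.homeoCyl.source := by
    rintro _ ⟨p, hp, rfl⟩; exact 𝓔.homeoCyl.map_target (hCoC hp)
  have hCo' : IsOpen (𝓔.glue '' Co) := 𝓔.homeoCyl.symm.isOpen_image_of_subset_source hCo hCoC
  have hM : ∀ m, 𝓔.extMetric gN (𝓔.incl m) (𝓔.pushM Y' (𝓔.incl m)) (𝓔.pushM Y' (𝓔.incl m)) < 0 := by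
    intro m
    rw [𝓔.extMetric_incl gN (mem_range_self m), pullback_apply, 𝓔.mfderiv_toM_pushM]
    exact hYt' m
  have hT : ∀ x ∈ 𝓔.glue '' Co, 𝓔.extMetric gN x (𝓔.pushTime x) (𝓔.pushTime x) < 0 := by
    rintro _ ⟨p, hp, rfl⟩
    have hs := hsrc _ (mem_image_of_mem _ hp)
    rw [hext _ hs, pullback_apply, 𝓔.mfderiv_toCyl_pushTime hs, 𝓔.toCyl_glue (hCoC hp)]
    exact (interior_subset (hCoA hp)).2.1
  have hMT : ∀ m, 𝓔.incl m ∈ 𝓔.glue '' Co →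
      𝓔.extMetric gN (𝓔.incl m) (𝓔.pushM Y' (𝓔.incl m)) (𝓔.pushTime (𝓔.incl m)) < 0 := by
    rintro m ⟨p, hp, hpm⟩
    have hph : p ∈ physical := by
      rcases hgC.subset (hCoC hp) with h | h
      · exact h
      · rw [𝓔.glue_of_mem h] at hpm; cases hpm
    have h1 := hsgn p ⟨hp, hph⟩
    rw [hpm] at h1
    have h2 : 𝓔.pushM Y' (𝓔.incl m) = ε • 𝓔.pushM Y (𝓔.incl m) :=
      (mfderiv I₄ I₄ 𝓔.incl m).map_smul ε (Y m)
    rwa [h2, map_smul]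
  have hnon : ∀ p hp, (Ext.nonphys p hp : 𝓔.Ext) ∈ 𝓔.glue '' Co := fun p hp ↦
    ⟨p, hNCo hp, 𝓔.glue_of_mem hp⟩
  have href : ∀ x, 𝓔.extMetric gN x (𝓔.orientRef Y' x) (𝓔.orientRef Y' x) < 0 := by
    rintro (m | ⟨p, hp⟩)
    · exact hM m
    · exact hT _ (hnon p hp)
  have hrefT : ∀ x ∈ 𝓔.glue '' Co, 𝓔.extMetric gN x (𝓔.orientRef Y' x) (𝓔.pushTime x) < 0 := by
    rintro (m | ⟨p, hp⟩) hx
    · exact hMT m hx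
    · exact hT _ hx
  have : LocallyCompactSpace 𝓔.Ext := Manifold.locallyCompact_of_finiteDimensional I₄
  -- The reference field `orientRef` need not be continuous; it only names the cone at each point.
  -- The local sections are smooth, and `hrefT` says that they select the same cone on overlaps.
  obtain ⟨ZX, hZX⟩ := exists_contMDiffSection_forall_mem_convex_of_local (I := I₄) (M := 𝓔.Ext)
    (n := ⊤) (F_fiber := ℝ × E3) (TangentSpace I₄)
    (fun x ↦ {v | 𝓔.extMetric gN x v v < 0 ∧ 𝓔.extMetric gN x (𝓔.orientRef Y' x) v < 0})
    (fun x ↦ (hX.lorentz x (mem_univ x)).convex_cone (href x)) (by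
      rintro (m | ⟨p, hp⟩)
      · refine ⟨range 𝓔.incl, 𝓔.homeoM.open_source.mem_nhds (mem_range_self m), 𝓔.pushM Y',
          𝓔.contMDiffOn_pushM hYs', ?_⟩
        rintro _ ⟨m, rfl⟩
        exact ⟨hM m, hM m⟩
      · exact ⟨𝓔.glue '' Co, hCo'.mem_nhds (hnon p hp), 𝓔.pushTime,
          𝓔.contMDiffOn_pushTime.mono hsrc, fun x hx ↦ ⟨hT x hx, hrefT x hx⟩⟩)
  refine ⟨ε, ZX, Co, hε, ⟨Or.inl rfl, ⟨hCo, ⟨hgC.lorentzian.smooth.mono hCoC, fun p hp ↦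
    hgC.lorentzian.lorentz p (hCoC hp)⟩, hNCo, hCoC.trans hgC.subset, hgC.eq⟩, hCoC,
    ⟨isOpen_univ, hgN, hYs'.contMDiffOn, fun m _ ↦ hYt' m⟩,
    ⟨isOpen_univ, hX, ZX.contMDiff.contMDiffOn, fun x _ ↦ (hZX x).1⟩, hext, fun x hx v ↦ ?_,
    fun x hx v ↦ ?_⟩⟩
  · obtain ⟨m, rfl⟩ := hx
    rw [isFutureCausal_congr (Z' := 𝓔.pushM Y') (hX.lorentz _ (mem_univ _)) (hZX _).1 (hM m) (by
      rw [(hX.lorentz _ (mem_univ _)).symm]; exact (hZX (𝓔.incl m)).2)]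
    exact isFutureCausal_pullback (f := 𝓔.toM) rfl (𝓔.mfderiv_toM_pushM Y' m)
      (𝓔.bijective_mfderiv_toM m).1 v
  · have hL := hX.lorentz x (mem_univ x)
    rw [isFutureCausal_congr (Z' := 𝓔.pushTime) hL (hZX _).1 (hT x hx)
      (hL.neg_of_same_cone (href x) (hZX x).1 (hZX x).2 (IsLorentzForm.ne_zero_of_timelike (hT x hx))
        (hT x hx).le (hrefT x hx))]
    have h1 : sigTime 1 = cylTime := by funext p; simp [sigTime]
    rw [h1]
    exact isFutureCausal_pullback (f := 𝓔.toCyl) (hext x (hsrc x hx))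
      (𝓔.mfderiv_toCyl_pushTime (hsrc x hx)) (𝓔.bijective_mfderiv_toCyl (hsrc x hx)).1 v

end MinkowskianInfinity


/-! ### The causal relation of the cylinder restricted to `N^σ` -/

open InnerProductGeometry

section CylRelation

variable {σ : ℝ}

lemma sigTime_neg (σ : ℝ) : sigTime (-σ) = fun p ↦ -sigTime σ p := by
  funext p; simp [sigTime]

lemma sigTime_one : sigTime 1 = cylTime := by funext p; simp [sigTime]

lemma leIn_cylMetric_iff (hσ : IsSign σ) {p q : Cyl} :
    LEIn cylMetric (sigTime σ) univ p q ↔ angle (p.2 : E4) (q.2 : E4) ≤ σ * q.1 - σ * p.1 := by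
  rcases hσ with rfl | rfl
  · rw [leIn_univ_iff, sigTime_one, cyl_causalLE_iff, one_mul, one_mul]
  · rw [sigTime_neg, sigTime_one]
    have : LEIn cylMetric (fun p ↦ -cylTime p) univ p q ↔ LEIn cylMetric cylTime univ q p :=
      ⟨fun h ↦ h.of_reverse, fun h ↦ h.reverse⟩
    rw [this, leIn_univ_iff, cyl_causalLE_iff, angle_comm]
    constructor <;> intro h <;> linarith

lemma polarAngle_sub_le (x y : S3) : polarAngle x - polarAngle y ≤ angle (x : E4) (y : E4) := by
  have h := angle_le_angle_add_angle (northPole : E4) (y : E4) (x : E4)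
  rw [angle_northPole, angle_northPole, angle_comm] at h
  linarith

/-- Points of `ℝ × S³` between points of `N^σ` are in `N^σ`. -/
lemma mem_nSig_of_between {p m q : Cyl} (hp : p ∈ nSig σ) (hq : q ∈ nSig σ)
    (h1 : angle (p.2 : E4) (m.2 : E4) ≤ σ * m.1 - σ * p.1)
    (h2 : angle (m.2 : E4) (q.2 : E4) ≤ σ * q.1 - σ * m.1) : m ∈ nSig σ := by
  have h3 := polarAngle_sub_le p.2 m.2
  have h4 := polarAngle_sub_le q.2 m.2
  rw [angle_comm] at h4
  exact ⟨by linarith [hp.1], by linarith [hq.2]⟩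

/-- `N^σ` is causally convex in the cylinder, so paths between its points cannot leave it and the
restriction to `N^σ` costs nothing. -/
lemma leIn_nSig_iff (hσ : IsSign σ) {p q : Cyl} (hp : p ∈ nSig σ) (hq : q ∈ nSig σ) :
    LEIn cylMetric (sigTime σ) (nSig σ) p q ↔
      angle (p.2 : E4) (q.2 : E4) ≤ σ * q.1 - σ * p.1 := by
  rw [← leIn_cylMetric_iff hσ]
  refine ⟨fun h ↦ h.mono (subset_univ _), fun h ↦ h.restrict fun m _ h1 h2 ↦ ?_⟩
  rw [leIn_cylMetric_iff hσ] at h1 h2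
  exact mem_nSig_of_between hp hq h1 h2

lemma IsCollarMetric.leIn_nonphysical_iff {gC : MetricField Cyl} {Co W : Set Cyl}
    (h : IsCollarMetric gC Co) (hW : W ⊆ nonphysical) {p q : Cyl} :
    LEIn gC (sigTime σ) W p q ↔ LEIn cylMetric (sigTime σ) W p q := by
  have : StepIn gC (sigTime σ) W = StepIn cylMetric (sigTime σ) W := by
    ext p q
    refine exists_congr fun γ ↦ and_congr_right fun _ ↦ and_congr_right fun _ ↦
      and_congr_right fun _ ↦ forall₂_congr fun t _ ↦ and_congr_right fun ht ↦ ?_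
    exact h.isFutureCausal_nonphysical (hW ht) _
  rw [LEIn, LEIn, this]

end CylRelation

/-! ### `N^σ` as a future set of the extension -/

namespace MinkowskianInfinity

set_option linter.unusedSectionVars false

variable {M : Type*} [TopologicalSpace M] [ChartedSpace ModelH M] [IsManifold I₄ ∞ M]
  {g : MetricField M} {Z : VecField M} (𝓔 : MinkowskianInfinity g Z)

/-- The non-physical piece `N^σ` of `N_ext`. -/
def extN (σ : ℝ) : Set 𝓔.Ext := 𝓔.glue '' nSig σ

lemma collar_subset_union : 𝓔.collar ⊆ physical ∪ nonphysical :=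
  union_subset_union_left _ 𝓔.psi_target_subset

lemma nSig_subset_collar {σ : ℝ} (hσ : IsSign σ) : nSig σ ⊆ 𝓔.collar :=
  (nSig_subset hσ).trans subset_union_right

lemma glue_mem_extN {σ : ℝ} (hσ : IsSign σ) {p : Cyl} (hp : p ∈ 𝓔.collar) :
    𝓔.glue p ∈ 𝓔.extN σ ↔ p ∈ nSig σ := by
  refine ⟨?_, mem_image_of_mem _⟩
  rintro ⟨q, hq, hqp⟩
  rwa [← 𝓔.toCyl_glue hp, ← hqp, 𝓔.toCyl_glue (𝓔.nSig_subset_collar hσ hq)]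

lemma incl_notMem_extN {σ : ℝ} (hσ : IsSign σ) (m : M) : 𝓔.incl m ∉ 𝓔.extN σ := by
  rintro ⟨q, hq, hqp⟩
  rw [𝓔.glue_of_mem (nSig_subset hσ hq)] at hqp
  cases hqp

/-- Within the collar, `N^σ` is cut out by the closed condition `π ≤ σ T + R` alone, and `N` does
not meet it. -/
lemma isClosed_extN {σ : ℝ} (hσ : IsSign σ) : IsClosed (𝓔.extN σ) := by
  rw [← isOpen_compl_iff, 𝓔.isOpen_iff]
  constructor
  · have : 𝓔.incl ⁻¹' (𝓔.extN σ)ᶜ = univ := eq_univ_of_forall fun m ↦ 𝓔.incl_notMem_extN hσ m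
    rw [this]; exact isOpen_univ
  · have : 𝓔.collar ∩ 𝓔.glue ⁻¹' (𝓔.extN σ)ᶜ =
        𝓔.collar ∩ {p | σ * p.1 + polarAngle p.2 < Real.pi} := by
      ext p
      refine and_congr_right fun hp ↦ ?_
      rw [mem_preimage, mem_compl_iff, 𝓔.glue_mem_extN hσ hp,
        mem_nSig_iff hσ (𝓔.collar_subset_union hp), not_le]
      rfl
    rw [this]
    have := continuous_polarAngle
    exact 𝓔.isOpen_collar.inter (isOpen_lt (by fun_prop) continuous_const)

lemma mem_cases {σ : ℝ} (hσ : IsSign σ) (x : 𝓔.Ext) :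
    x ∈ range 𝓔.incl ∨ x ∈ 𝓔.extN σ ∨ x ∈ 𝓔.extN (-σ) := by
  rcases x with m | ⟨p, hp⟩
  · exact Or.inl (mem_range_self m)
  · right
    rw [← 𝓔.glue_of_mem hp, 𝓔.glue_mem_extN hσ (Or.inr hp), 𝓔.glue_mem_extN hσ.neg (Or.inr hp)]
    rcases hσ with rfl | rfl
    · rwa [nSig_one, nSig_neg_one]
    · rw [neg_neg, nSig_one, nSig_neg_one]; exact hp.symm

namespace IsExtension

variable {𝓔} {σ : ℝ} {gN : MetricField M} {ZN : VecField M} {ZX : VecField 𝓔.Ext}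
  {gC : MetricField Cyl} {Co : Set Cyl}

lemma isOpen_glue (h : 𝓔.IsExtension σ gN ZN ZX gC Co) {W : Set Cyl} (hW : IsOpen W)
    (hWC : W ⊆ Co) : IsOpen (𝓔.glue '' W) :=
  𝓔.homeoCyl.symm.isOpen_image_of_subset_source hW (hWC.trans h.subset)

lemma glue_subset_source (h : 𝓔.IsExtension σ gN ZN ZX gC Co) :
    𝓔.glue '' Co ⊆ 𝓔.homeoCyl.source := image_mono h.subset

lemma toCyl_glue_image (h : 𝓔.IsExtension σ gN ZN ZX gC Co) {W : Set Cyl} (hWC : W ⊆ Co) :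
    𝓔.toCyl '' (𝓔.glue '' W) = W := by
  rw [image_image]
  refine (image_congr fun p hp ↦ 𝓔.toCyl_glue (h.subset (hWC hp))).trans (image_id' W)

lemma nSig_subset_Co (h : 𝓔.IsExtension σ gN ZN ZX gC Co) : nSig σ ⊆ Co :=
  (nSig_subset h.isSign).trans h.collarMetric.nonphysical_subset

lemma nSig_subset_coneRegion (h : 𝓔.IsExtension σ gN ZN ZX gC Co) : nSig σ ⊆ coneRegion gC Co :=
  (nSig_subset h.isSign).trans h.collarMetric.nonphysical_subset_coneRegion

lemma future_toCyl (h : 𝓔.IsExtension σ gN ZN ZX gC Co) {W : Set Cyl} (hW : W ⊆ Co) :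
    ∀ x ∈ 𝓔.glue '' W, ∀ v, IsFutureCausal (𝓔.extMetric gN) ZX x v →
      IsFutureCausal gC (sigTime σ) (𝓔.toCyl x) (mfderiv I₄ I₄ 𝓔.toCyl x v) :=
  fun x hx v ↦ (h.future_glue x (image_mono hW hx) v).1

lemma stepIn_toCyl (h : 𝓔.IsExtension σ gN ZN ZX gC Co) {W : Set Cyl} (hW : W ⊆ Co) {x y : 𝓔.Ext}
    (hxy : StepIn (𝓔.extMetric gN) ZX (𝓔.glue '' W) x y) :
    StepIn gC (sigTime σ) W (𝓔.toCyl x) (𝓔.toCyl y) := by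
  have := hxy.map 𝓔.homeoCyl.open_source 𝓔.contMDiffOn_toCyl
    ((image_mono hW).trans h.glue_subset_source) (h.future_toCyl hW)
  rwa [h.toCyl_glue_image hW] at this

lemma leIn_toCyl (h : 𝓔.IsExtension σ gN ZN ZX gC Co) {W : Set Cyl} (hW : W ⊆ Co) {x y : 𝓔.Ext}
    (hxy : LEIn (𝓔.extMetric gN) ZX (𝓔.glue '' W) x y) :
    LEIn gC (sigTime σ) W (𝓔.toCyl x) (𝓔.toCyl y) :=
  Relation.ReflTransGen.lift 𝓔.toCyl (fun _ _ ↦ h.stepIn_toCyl hW) _ _ hxy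

lemma leIn_glue (h : 𝓔.IsExtension σ gN ZN ZX gC Co) {W : Set Cyl} (hW : W ⊆ Co) {p q : Cyl}
    (hpq : LEIn gC (sigTime σ) W p q) :
    LEIn (𝓔.extMetric gN) ZX (𝓔.glue '' W) (𝓔.glue p) (𝓔.glue q) := by
  refine hpq.map 𝓔.isOpen_collar 𝓔.contMDiffOn_glue (hW.trans h.subset) fun p hp v hv ↦ ?_
  rw [h.future_glue _ (mem_image_of_mem _ (hW hp))]
  have h1 : 𝓔.toCyl (𝓔.glue p) = p := 𝓔.toCyl_glue (h.subset (hW hp))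
  have h2 := 𝓔.mfderiv_toCyl_glue (𝓔.homeoCyl.map_target (h.subset (hW hp))) v
  change (mfderiv I₄ I₄ 𝓔.toCyl (𝓔.glue p) (mfderiv I₄ I₄ 𝓔.glue (𝓔.toCyl (𝓔.glue p)) v) : ℝ × E3)
    = v at h2
  rw [h1] at h2
  rw [h1]
  exact Eq.mpr (congrArg (fun w : ℝ × E3 ↦ IsFutureCausal gC (sigTime σ) p w) h2) hv

lemma stepIn_toM (h : 𝓔.IsExtension σ gN ZN ZX gC Co) {x y : 𝓔.Ext}
    (hxy : StepIn (𝓔.extMetric gN) ZX (range 𝓔.incl) x y) :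
    StepIn gN ZN univ (𝓔.toM x) (𝓔.toM y) :=
  (hxy.map 𝓔.homeoM.open_source 𝓔.contMDiffOn_toM subset_rfl
    fun x hx v ↦ (h.future_incl x hx v).1).mono (subset_univ _)

lemma leIn_toM (h : 𝓔.IsExtension σ gN ZN ZX gC Co) {x y : 𝓔.Ext}
    (hxy : LEIn (𝓔.extMetric gN) ZX (range 𝓔.incl) x y) :
    LEIn gN ZN univ (𝓔.toM x) (𝓔.toM y) :=
  Relation.ReflTransGen.lift 𝓔.toM (fun _ _ ↦ h.stepIn_toM) _ _ hxy

lemma leIn_incl (h : 𝓔.IsExtension σ gN ZN ZX gC Co) {m m' : M} (hm : LEIn gN ZN univ m m') :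
    LEIn (𝓔.extMetric gN) ZX (range 𝓔.incl) (𝓔.incl m) (𝓔.incl m') := by
  rw [← image_univ]
  refine hm.map isOpen_univ 𝓔.contMDiff_incl.contMDiffOn subset_rfl fun m _ v hv ↦ ?_
  rw [h.future_incl _ (mem_range_self m)]
  have h2 := 𝓔.mfderiv_toM_incl m v
  exact Eq.mpr (congrArg (fun w : ℝ × E3 ↦ IsFutureCausal gN ZN m w) h2) hv

/-- Future-directed causal curves do not leave `N^σ`. -/
lemma mem_extN_of_curve (h : 𝓔.IsExtension σ gN ZN ZX gC Co) {γ : ℝ → 𝓔.Ext} {a b : ℝ}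
    (hγ : ContMDiffOn 𝓘(ℝ, ℝ) I₄ ∞ γ (Icc a b))
    (hc : ∀ t ∈ Icc a b, IsFutureCausal (𝓔.extMetric gN) ZX (γ t) (velocity γ (Icc a b) t))
    (ha : γ a ∈ 𝓔.extN σ) : ∀ t ∈ Icc a b, γ t ∈ 𝓔.extN σ := by
  have hcl : IsClosed (γ ⁻¹' 𝓔.extN σ ∩ Icc a b) := by
    rw [inter_comm]
    exact hγ.continuousOn.preimage_isClosed_of_isClosed isClosed_Icc (𝓔.isClosed_extN h.isSign)
  -- Continuous induction on the parameter interval: the set of times in `N^σ` is closed, and the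
  -- Grönwall argument in the cylinder extends it to the right of each of its points.
  refine hcl.Icc_subset_of_forall_mem_nhdsWithin ha ?_
  rintro t ⟨ht, hta, htb⟩
  have htI : t ∈ Icc a b := ⟨hta, htb.le⟩
  have hop : IsOpen (𝓔.glue '' Co) := h.isOpen_glue h.collarMetric.isOpen subset_rfl
  have hmem : γ t ∈ 𝓔.glue '' Co := image_mono h.nSig_subset_Co ht
  have hev : ∀ᶠ u in 𝓝[≥] t, γ u ∈ 𝓔.glue '' Co := by
    have h1 := (hγ.continuousOn t htI).mono (Icc_subset_Icc hta le_rfl)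
    have h2 := h1.preimage_mem_nhdsWithin (hop.mem_nhds hmem)
    rwa [nhdsWithin_Icc_eq_nhdsGE htb] at h2
  obtain ⟨u, hu, hul⟩ := mem_nhdsGE_iff_exists_Icc_subset.1 hev
  set t₁ := min u b with ht₁
  have htt₁ : t < t₁ := lt_min hu htb
  have hsub : Icc t t₁ ⊆ Icc a b := Icc_subset_Icc hta (min_le_right _ _)
  have hG : ∀ s ∈ Icc t t₁, γ s ∈ 𝓔.glue '' Co := fun s hs ↦
    hul (Icc_subset_Icc le_rfl (min_le_left _ _) hs)
  have hγ' := hγ.mono hsub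
  have hs : ∀ s ∈ Icc t t₁, γ s ∈ 𝓔.homeoCyl.source := fun s hs ↦ h.glue_subset_source (hG s hs)
  have hcs : ContMDiffOn 𝓘(ℝ, ℝ) I₄ ∞ (𝓔.toCyl ∘ γ) (Icc t t₁) := 𝓔.contMDiffOn_toCyl.comp hγ' hs
  have h0 : (𝓔.toCyl ∘ γ) t ∈ nSig σ := by
    obtain ⟨p, hp, hpt⟩ := ht
    rw [Function.comp_apply, ← hpt, 𝓔.toCyl_glue (𝓔.nSig_subset_collar h.isSign hp)]
    exact hp
  obtain ⟨t₂, ht₂, h2⟩ := h.collarMetric.exists_forall_mem_nSig h.isSign htt₁ hcs (fun s hs' ↦ by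
    refine ⟨?_, ?_⟩
    · have := mem_image_of_mem 𝓔.toCyl (hG s hs')
      rwa [h.toCyl_glue_image subset_rfl] at this
    · rw [velocity_comp (uniqueDiffOn_Icc htt₁ s hs')
        ((hγ' s hs').mdifferentiableWithinAt (by simp)) (𝓔.mdifferentiableAt_toCyl (hs s hs')),
        velocity_subset hsub (uniqueDiffOn_Icc htt₁ s hs')
          ((hγ s (hsub hs')).mdifferentiableWithinAt (by simp))]
      exact (h.future_glue _ (hG s hs') _).1 (hc s (hsub hs'))) h0
  filter_upwards [Ioo_mem_nhdsGT ht₂.1] with s hs'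
  have h3 := h2 s ⟨hs'.1.le, hs'.2.le⟩
  exact ⟨_, h3, 𝓔.homeoCyl.left_inv (hs s ⟨hs'.1.le, hs'.2.le.trans ht₂.2⟩)⟩

lemma mem_extN_of_leIn (h : 𝓔.IsExtension σ gN ZN ZX gC Co) {x y : 𝓔.Ext}
    (hxy : LEIn (𝓔.extMetric gN) ZX univ x y) (hx : x ∈ 𝓔.extN σ) : y ∈ 𝓔.extN σ := by
  induction hxy with
  | refl => exact hx
  | tail _ hst ih =>
    obtain ⟨γ, hγ, rfl, rfl, hc⟩ := hst
    exact h.mem_extN_of_curve hγ (fun t ht ↦ (hc t ht).2) ih 1 (right_mem_Icc.2 zero_le_one)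

lemma mem_extN_neg_of_leIn (h : 𝓔.IsExtension σ gN ZN ZX gC Co) {x y : 𝓔.Ext}
    (hxy : LEIn (𝓔.extMetric gN) ZX univ x y) (hy : y ∈ 𝓔.extN (-σ)) : x ∈ 𝓔.extN (-σ) :=
  h.reverse.mem_extN_of_leIn hxy.reverse hy

/-- Causal paths from points of `N^σ` are paths in `N^σ`. -/
lemma leIn_extN (h : 𝓔.IsExtension σ gN ZN ZX gC Co) {x y : 𝓔.Ext}
    (hxy : LEIn (𝓔.extMetric gN) ZX univ x y) (hx : x ∈ 𝓔.extN σ) :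
    LEIn (𝓔.extMetric gN) ZX (𝓔.extN σ) x y :=
  hxy.restrict fun _ _ h1 _ ↦ h.mem_extN_of_leIn h1 hx

lemma toCyl_mem (h : 𝓔.IsExtension σ gN ZN ZX gC Co) {x : 𝓔.Ext} (hx : x ∈ 𝓔.extN σ) :
    𝓔.toCyl x ∈ nSig σ := by
  obtain ⟨p, hp, rfl⟩ := hx
  rwa [𝓔.toCyl_glue (𝓔.nSig_subset_collar h.isSign hp)]

lemma glue_toCyl (h : 𝓔.IsExtension σ gN ZN ZX gC Co) {x : 𝓔.Ext} (hx : x ∈ 𝓔.extN σ) :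
    𝓔.glue (𝓔.toCyl x) = x := by
  obtain ⟨p, hp, rfl⟩ := hx
  rw [𝓔.toCyl_glue (𝓔.nSig_subset_collar h.isSign hp)]

/-- The causal relation on `N^σ`. -/
lemma leIn_iff (h : 𝓔.IsExtension σ gN ZN ZX gC Co) {x y : 𝓔.Ext} (hx : x ∈ 𝓔.extN σ)
    (hy : y ∈ 𝓔.extN σ) : LEIn (𝓔.extMetric gN) ZX univ x y ↔
      angle ((𝓔.toCyl x).2 : E4) ((𝓔.toCyl y).2 : E4) ≤ σ * (𝓔.toCyl y).1 - σ * (𝓔.toCyl x).1 := by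
  rw [← leIn_nSig_iff h.isSign (h.toCyl_mem hx) (h.toCyl_mem hy),
    ← h.collarMetric.leIn_nonphysical_iff (nSig_subset h.isSign)]
  refine ⟨fun hxy ↦ h.leIn_toCyl h.nSig_subset_Co (h.leIn_extN hxy hx), fun hxy ↦ ?_⟩
  have := (h.leIn_glue h.nSig_subset_Co hxy).mono (subset_univ _)
  rwa [h.glue_toCyl hx, h.glue_toCyl hy] at this

/-- The causal relation on `N^{-σ}`. -/
lemma leIn_iff_neg (h : 𝓔.IsExtension σ gN ZN ZX gC Co) {x y : 𝓔.Ext} (hx : x ∈ 𝓔.extN (-σ))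
    (hy : y ∈ 𝓔.extN (-σ)) : LEIn (𝓔.extMetric gN) ZX univ x y ↔
      angle ((𝓔.toCyl x).2 : E4) ((𝓔.toCyl y).2 : E4) ≤ σ * (𝓔.toCyl y).1 - σ * (𝓔.toCyl x).1 := by
  have h1 := h.reverse.leIn_iff hy hx
  have h2 : LEIn (𝓔.extMetric gN) ZX univ x y ↔
      LEIn (𝓔.extMetric gN) (fun x ↦ -ZX x) univ y x := ⟨fun h ↦ h.reverse, fun h ↦ h.of_reverse⟩
  rw [h2, h1, angle_comm]
  constructor <;> intro h <;> linarith

end IsExtension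

end MinkowskianInfinity


/-! ### Closed causal relations and entry points of paths -/

open InnerProductGeometry

section Hyperbolic

set_option linter.unusedSectionVars false

variable {X : Type*} [TopologicalSpace X] [ChartedSpace ModelH X] [IsManifold I₄ ∞ X]
  {g : MetricField X} {Z : VecField X}

lemma IsCausallyHyperbolic.eq_of_le (h : IsCausallyHyperbolic g Z) {p q : X}
    (h1 : LEIn g Z univ p q) (h2 : LEIn g Z univ q p) : p = q := by
  rw [leIn_univ_iff] at h1 h2
  rcases Relation.reflTransGen_iff_eq_or_transGen.1 h1 with h3 | h3
  · exact h3.symm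
  · exact absurd (Relation.TransGen.trans_left h3 h2) (h.no_closed p)

/-- The definition only covers `p < q`. If `p = q`, the diamond is one point by antisymmetry, and if
`p ≤ q` fails it is empty. -/
lemma IsCausallyHyperbolic.isCompact_diamond (h : IsCausallyHyperbolic g Z) (p q : X) :
    IsCompact {x | LEIn g Z univ p x ∧ LEIn g Z univ x q} := by
  have heq : {x | LEIn g Z univ p x ∧ LEIn g Z univ x q} =
      causalFuture g Z {p} ∩ causalPast g Z {q} := by
    ext x
    simp [causalFuture, causalPast, leIn_univ_iff]
  by_cases hpq : LEIn g Z univ p q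
  · rw [leIn_univ_iff] at hpq
    rcases Relation.reflTransGen_iff_eq_or_transGen.1 hpq with h3 | h3
    · subst h3
      refine (subsingleton_of_forall_eq (s := {x | LEIn g Z univ q x ∧ LEIn g Z univ x q}) q
        fun x hx ↦ ?_).isCompact
      exact (h.eq_of_le hx.1 hx.2).symm
    · rw [heq]; exact h.compact_diamond p q h3
  · convert isCompact_empty
    rw [eq_empty_iff_forall_notMem]
    exact fun x hx ↦ hpq (hx.1.trans hx.2)

/-- Limits of causally related points of a globally hyperbolic space-time are causally related. -/
lemma IsCausallyHyperbolic.leIn_of_tendsto [T2Space X] (h : IsCausallyHyperbolic g Z)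
    (hs : IsSpacetimeOn g Z univ) {κ : Type*} {l : Filter κ} [NeBot l] {p q : κ → X} {b c : X}
    (hpq : ∀ᶠ i in l, LEIn g Z univ (p i) (q i)) (hp : Tendsto p l (𝓝 b))
    (hq : Tendsto q l (𝓝 c)) : LEIn g Z univ b c := by
  obtain ⟨b', -, hb'⟩ := hs.exists_past_point (mem_univ b) univ_mem
  -- If all points near `c` precede `z`, the `p i` eventually lie in the diamond from `b'` to `z`.
  -- This diamond is closed, so it contains `b`.
  have hbz : ∀ z, (∀ᶠ x in 𝓝 c, LEIn g Z univ x z) → LEIn g Z univ b z := by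
    intro z hz
    refine ((h.isCompact_diamond b' z).isClosed.mem_of_tendsto hp ?_).2
    filter_upwards [hpq, hp.eventually hb', hq.eventually hz] with i h1 h2 h3
    exact ⟨.single (h2.mono (subset_univ _)), h1.trans h3⟩
  obtain ⟨z₀, -, hz₀⟩ := hs.exists_future_point (mem_univ c) univ_mem
  -- Points `z` in the future of `c` and arbitrarily close to it satisfy `b ≤ z ≤ z₀`, so `c`
  -- adheres to the closed diamond from `b` to `z₀`.
  have hcl : c ∈ closure {x | LEIn g Z univ b x ∧ LEIn g Z univ x z₀} := by
    rw [mem_closure_iff_nhds]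
    intro O hO
    obtain ⟨z, hz, hcz⟩ := hs.exists_future_point (mem_univ c) (inter_mem hO hz₀)
    have hz1 : ∀ᶠ x in 𝓝 c, LEIn g Z univ x z :=
      hcz.mono fun x hx ↦ .single (hx.mono (subset_univ _))
    exact ⟨z, hz.2.1, hbz z hz1, .single (StepIn.mono (subset_univ _) hz.2.2)⟩
  exact ((h.isCompact_diamond b z₀).isClosed.closure_subset hcl).1

/-- A path that ends in the closed set `K` is a path in `K`, or it has a last entry point. -/
lemma LEIn.exists_entry {K : Set X} (hK : IsClosed K) {y c : X} (h : LEIn g Z univ y c)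
    (hc : c ∈ K) : (y ∈ K ∧ LEIn g Z K y c) ∨
      ∃ z ∈ K \ interior K, LEIn g Z univ y z ∧ LEIn g Z K z c := by
  induction h using Relation.ReflTransGen.head_induction_on with
  | refl => exact Or.inl ⟨hc, .refl⟩
  | @head y y₁ hst h1 ih =>
    rcases ih with ⟨hy₁, ih⟩ | ⟨z, hz, h2, h3⟩
    swap
    · exact Or.inr ⟨z, hz, .head hst h2, h3⟩
    obtain ⟨γ, hγ, rfl, rfl, hcau⟩ := hst
    by_cases hall : ∀ t ∈ Icc (0 : ℝ) 1, γ t ∈ K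
    · exact Or.inl ⟨hall 0 (left_mem_Icc.2 zero_le_one),
        .head ⟨γ, hγ, rfl, rfl, fun t ht ↦ ⟨hall t ht, (hcau t ht).2⟩⟩ ih⟩
    push Not at hall
    right
    -- The supremum of the times outside `K` is the entry time: the point there is in `K` because
    -- `K` is closed, and not in its interior because it is a limit of points outside.
    set S := {t | t ∈ Icc (0 : ℝ) 1 ∧ γ t ∉ K} with hS
    have hSn : S.Nonempty := hall
    have hSb : BddAbove S := ⟨1, fun t ht ↦ ht.1.2⟩
    set t₀ := sSup S with ht₀
    have h0 : 0 ≤ t₀ := by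
      obtain ⟨t, ht⟩ := hSn
      exact ht.1.1.trans (le_csSup hSb ht)
    have h1' : t₀ ≤ 1 := csSup_le hSn fun t ht ↦ ht.1.2
    have ht₀I : t₀ ∈ Icc (0 : ℝ) 1 := ⟨h0, h1'⟩
    have hafter : ∀ t, t₀ < t → t ≤ 1 → γ t ∈ K := by
      intro t ht ht1
      by_contra hcon
      exact absurd (le_csSup hSb (show t ∈ S from ⟨⟨h0.trans ht.le, ht1⟩, hcon⟩)) (not_le.2 ht)
    have hmem : γ t₀ ∈ K := by
      rcases h1'.eq_or_lt with h2 | h2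
      · rw [h2]; exact hy₁
      · have hcw : ContinuousWithinAt γ (Ioc t₀ 1) t₀ :=
          (hγ.continuousOn t₀ ht₀I).mono fun t ht ↦ ⟨h0.trans ht.1.le, ht.2⟩
        have : NeBot (𝓝[Ioc t₀ 1] t₀) := by
          rw [nhdsWithin_Ioc_eq_nhdsGT h2]; infer_instance
        refine hK.mem_of_tendsto hcw ?_
        filter_upwards [self_mem_nhdsWithin] with t ht using hafter t ht.1 ht.2
    have hnotin : γ t₀ ∉ interior K := by
      intro hcon
      have hcl : t₀ ∈ closure S := csSup_mem_closure hSn hSb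
      have hcw : ContinuousWithinAt γ S t₀ :=
        (hγ.continuousOn t₀ ht₀I).mono fun t ht ↦ ht.1
      have : NeBot (𝓝[S] t₀) := mem_closure_iff_nhdsWithin_neBot.1 hcl
      have hev : ∀ᶠ t in 𝓝[S] t₀, γ t ∈ interior K := hcw (isOpen_interior.mem_nhds hcon)
      obtain ⟨t, ht1, ht2⟩ := (hev.and self_mem_nhdsWithin).exists
      exact ht2.2 (interior_subset ht1)
    refine ⟨γ t₀, ⟨hmem, hnotin⟩, ?_, LEIn.trans ?_ ih⟩
    · rcases h0.eq_or_lt with h2 | h2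
      · rw [← h2]; exact .refl
      · exact .single (stepIn_of_curve h2 (Icc_subset_Icc le_rfl h1') hγ fun t ht ↦
          hcau t (Icc_subset_Icc le_rfl h1' ht))
    · rcases h1'.eq_or_lt with h2 | h2
      · rw [h2]; exact .refl
      · refine .single (stepIn_of_curve h2 (Icc_subset_Icc h0 le_rfl) hγ fun t ht ↦
          ⟨?_, (hcau t (Icc_subset_Icc h0 le_rfl ht)).2⟩)
        rcases ht.1.eq_or_lt with h3 | h3
        · rw [← h3]; exact hmem
        · exact hafter t h3 ht.2

end Hyperbolic

/-! ### Bounding points of the extension by points of `N` -/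

namespace MinkowskianInfinity.IsExtension

set_option linter.unusedSectionVars false

variable {M : Type*} [TopologicalSpace M] [ChartedSpace ModelH M] [IsManifold I₄ ∞ M]
  {g : MetricField M} {Z : VecField M} {𝓔 : MinkowskianInfinity g Z}
  {σ : ℝ} {gN : MetricField M} {ZN : VecField M} {ZX : VecField 𝓔.Ext}
  {gC : MetricField Cyl} {Co : Set Cyl}

/-- From `p`, vertical motion inside `N^{-σ}` reaches the frontier point `q` of the physical region,
which is not in `N^σ`. A common future point `z` of the neighbours of `q`, close to `q`, is not in
`N^{-σ}` either: some of these neighbours are physical, whereas the past of a point of `N^{-σ}`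
stays in `N^{-σ}`. So `z` is in `N`. -/
lemma exists_le_incl_of_polarAngle_lt (h : 𝓔.IsExtension σ gN ZN ZX gC Co) {p : Cyl}
    (hp : p ∈ nSig (-σ)) (hR : polarAngle p.2 < Real.pi) :
    ∃ m, LEIn (𝓔.extMetric gN) ZX univ (𝓔.glue p) (𝓔.incl m) := by
  have hσ := h.isSign
  have hR0 : 0 < polarAngle p.2 := by linarith [hp.1, hp.2]
  set q := scriPoint (-σ) p.2 with hq
  have hqn : q ∈ nonphysical := scriPoint_mem hσ.neg hR0
  have hqc : q ∈ 𝓔.collar := Or.inr hqn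
  have hpc : p ∈ 𝓔.collar := 𝓔.nSig_subset_collar hσ.neg hp
  have hσq : σ * q.1 = -(Real.pi - polarAngle p.2) := by
    simp only [hq, scriPoint, neg_mul, mul_neg, ← mul_assoc, hσ.mul_self, one_mul]
  have hqN : q ∈ nSig (-σ) := by
    rw [mem_nSig_iff hσ.neg (Or.inr hqn), neg_mul, hσq]
    simp only [hq, scriPoint]; linarith
  have hqN' : 𝓔.glue q ∉ 𝓔.extN σ := by
    rw [𝓔.glue_mem_extN hσ hqc]
    intro h1
    have := h1.1
    rw [hσq] at this
    simp only [hq, scriPoint] at this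
    linarith
  have hpq : LEIn (𝓔.extMetric gN) ZX univ (𝓔.glue p) (𝓔.glue q) := by
    rw [h.leIn_iff_neg (mem_image_of_mem _ hp) (mem_image_of_mem _ hqN), 𝓔.toCyl_glue hpc,
      𝓔.toCyl_glue hqc, hσq]
    have h1 : angle (p.2 : E4) (q.2 : E4) = 0 := angle_self fun h0 ↦ by
      have : ‖(p.2 : E4)‖ = 1 := mem_sphere_zero_iff_norm.1 p.2.2
      rw [h0, norm_zero] at this
      exact zero_ne_one this
    rw [h1]
    linarith [hp.1]
  obtain ⟨z, hz, hev⟩ := h.spacetime.exists_future_point (mem_univ (𝓔.glue q))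
    ((𝓔.isClosed_extN hσ).isOpen_compl.mem_nhds hqN')
  have hev' : ∀ᶠ x in 𝓝 (𝓔.glue q), LEIn (𝓔.extMetric gN) ZX univ x z :=
    hev.mono fun x hx ↦ .single (hx.mono (subset_univ _))
  have hz' : z ∉ 𝓔.extN (-σ) := by
    intro hcon
    have hcont : Tendsto 𝓔.glue (𝓝 q) (𝓝 (𝓔.glue q)) :=
      𝓔.homeoCyl.symm.continuousAt (show q ∈ 𝓔.homeoCyl.symm.source from hqc)
    have h1 := (hcont.eventually hev').and (𝓔.isOpen_collar.mem_nhds hqc)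
    obtain ⟨r, hr, hr1, hr2⟩ := ((mem_closure_iff_frequently.1
      (scriPoint_mem_closure hσ.neg hR)).and_eventually h1).exists
    have h2 := h.mem_extN_neg_of_leIn hr1 hcon
    rw [𝓔.glue_mem_extN hσ.neg hr2] at h2
    exact Set.disjoint_left.1 disjoint_physical hr (nSig_subset hσ.neg h2)
  rcases 𝓔.mem_cases hσ z with ⟨m, rfl⟩ | h1 | h1
  · exact ⟨m, hpq.trans hev'.self_of_nhds⟩
  · exact absurd h1 hz.2
  · exact absurd h1 hz'

/-- On the axis `R = π`, vertical motion would run into `i₀`, which belongs to `N^σ`. A short null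
segment, whose time difference equals its angle `π - R`, first leads off the axis while remaining in
`N^{-σ}`. The bound `R > π + σ T / 2` is exactly what keeps it there. -/
lemma exists_le_incl (h : 𝓔.IsExtension σ gN ZN ZX gC Co) {z : 𝓔.Ext} (hz : z ∉ 𝓔.extN σ) :
    ∃ m, LEIn (𝓔.extMetric gN) ZX univ z (𝓔.incl m) := by
  have hσ := h.isSign
  rcases 𝓔.mem_cases hσ z with ⟨m, rfl⟩ | h1 | h1
  · exact ⟨m, .refl⟩
  · exact absurd h1 hz
  obtain ⟨p, hp, rfl⟩ := h1
  rcases (polarAngle_le_pi p.2).lt_or_eq with hR | hR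
  · exact h.exists_le_incl_of_polarAngle_lt hp hR
  have hpc : p ∈ 𝓔.collar := 𝓔.nSig_subset_collar hσ.neg hp
  have hps : p.2 = southPole := eq_southPole hR
  rw [𝓔.glue_mem_extN hσ hpc, mem_nSig_iff hσ (𝓔.collar_subset_union hpc), hR, not_le] at hz
  have hT : σ * p.1 < 0 := by linarith
  -- a point near the axis
  obtain ⟨q, hq, hq1⟩ := ((mem_closure_iff_frequently.1
    iZero_mem_closure_physical).and_eventually (show ∀ᶠ q : Cyl in 𝓝 iZero,
      max 0 (Real.pi + σ * p.1 / 2) < polarAngle q.2 by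
    refine (continuous_polarAngle.comp continuous_snd).continuousAt.eventually_const_lt ?_
    simp only [iZero, Function.comp_apply, polarAngle_southPole]
    exact max_lt Real.pi_pos (by linarith))).exists
  have hq0 : 0 < polarAngle q.2 := (le_max_left _ _).trans_lt hq1
  have hq2 : Real.pi + σ * p.1 / 2 < polarAngle q.2 := (le_max_right _ _).trans_lt hq1
  have hqpi : polarAngle q.2 < Real.pi := by
    have := mem_physical_iff_abs.1 hq
    linarith [abs_nonneg q.1]
  set r : Cyl := (p.1 + σ * (Real.pi - polarAngle q.2), q.2) with hr
  have hσr : σ * r.1 = σ * p.1 + (Real.pi - polarAngle q.2) := by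
    simp only [hr, mul_add, ← mul_assoc, hσ.mul_self, one_mul]
  have hrN : r ∈ nSig (-σ) := by
    have h2 := hp.2
    refine ⟨?_, ?_⟩
    · rw [neg_mul, hσr]; simp only [hr]; linarith
    · rw [neg_mul, hσr]; simp only [hr]
      rw [neg_mul, hR] at h2
      linarith
  obtain ⟨m, hm⟩ := h.exists_le_incl_of_polarAngle_lt hrN hqpi
  refine ⟨m, LEIn.trans ?_ hm⟩
  rw [h.leIn_iff_neg (mem_image_of_mem _ hp) (mem_image_of_mem _ hrN), 𝓔.toCyl_glue hpc,
    𝓔.toCyl_glue (𝓔.nSig_subset_collar hσ.neg hrN), hσr, hps, angle_southPole]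
  simp only [hr]; linarith

/-- The points near a point outside `N^σ` are in the past of a common point of `N`. -/
lemma exists_eventually_le_incl (h : 𝓔.IsExtension σ gN ZN ZX gC Co) {z : 𝓔.Ext}
    (hz : z ∉ 𝓔.extN σ) :
    ∃ m, ∀ᶠ x in 𝓝 z, LEIn (𝓔.extMetric gN) ZX univ x (𝓔.incl m) := by
  obtain ⟨z', hz', hev⟩ := h.spacetime.exists_future_point (mem_univ z)
    ((𝓔.isClosed_extN h.isSign).isOpen_compl.mem_nhds hz)
  obtain ⟨m, hm⟩ := h.exists_le_incl hz'.2
  exact ⟨m, hev.mono fun x hx ↦ .head (hx.mono (subset_univ _)) hm⟩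

lemma exists_eventually_incl_le (h : 𝓔.IsExtension σ gN ZN ZX gC Co) {z : 𝓔.Ext}
    (hz : z ∉ 𝓔.extN (-σ)) :
    ∃ m, ∀ᶠ x in 𝓝 z, LEIn (𝓔.extMetric gN) ZX univ (𝓔.incl m) x := by
  obtain ⟨m, hm⟩ := h.reverse.exists_eventually_le_incl hz
  exact ⟨m, hm.mono fun x hx ↦ hx.of_reverse⟩

/-- A path that has entered `N^σ` cannot return to `N`, and a point of `N^{-σ}` cannot be reached
from `N`. -/
lemma mem_range_of_between (h : 𝓔.IsExtension σ gN ZN ZX gC Co) {m m' : M} {x : 𝓔.Ext}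
    (h1 : LEIn (𝓔.extMetric gN) ZX univ (𝓔.incl m) x)
    (h2 : LEIn (𝓔.extMetric gN) ZX univ x (𝓔.incl m')) : x ∈ range 𝓔.incl := by
  rcases 𝓔.mem_cases h.isSign x with h3 | h3 | h3
  · exact h3
  · exact absurd (h.mem_extN_of_leIn h2 h3) (𝓔.incl_notMem_extN h.isSign m')
  · exact absurd (h.mem_extN_neg_of_leIn h1 h3) (𝓔.incl_notMem_extN h.isSign.neg m)

/-- The causal relation of `N_ext` restricted to `N` is that of `N`. -/
lemma leIn_toM_of_between (h : 𝓔.IsExtension σ gN ZN ZX gC Co) {m m' : M} {x y : 𝓔.Ext}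
    (h1 : LEIn (𝓔.extMetric gN) ZX univ (𝓔.incl m) x)
    (hxy : LEIn (𝓔.extMetric gN) ZX univ x y)
    (h2 : LEIn (𝓔.extMetric gN) ZX univ y (𝓔.incl m')) :
    LEIn gN ZN univ (𝓔.toM x) (𝓔.toM y) :=
  h.leIn_toM (hxy.restrict fun _ _ h3 h4 ↦ h.mem_range_of_between (h1.trans h3) (h4.trans h2))

end MinkowskianInfinity.IsExtension


/-! ### Global hyperbolicity of the extension -/

open InnerProductGeometry

namespace MinkowskianInfinity.IsExtension

set_option linter.unusedSectionVars false

variable {M : Type*} [TopologicalSpace M] [T2Space M] [ChartedSpace ModelH M] [IsManifold I₄ ∞ M]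
  {g : MetricField M} {Z : VecField M} {𝓔 : MinkowskianInfinity g Z}
  {σ : ℝ} {gN : MetricField M} {ZN : VecField M} {ZX : VecField 𝓔.Ext}
  {gC : MetricField Cyl} {Co : Set Cyl} {κ : Type*}

/-- Limits of points between points that stay away from `N^{-σ}` and from `N^σ`, respectively. -/
lemma exists_tendsto_of_notMem [T2Space 𝓔.Ext] (h : 𝓔.IsExtension σ gN ZN ZX gC Co)
    (hyp : IsCausallyHyperbolic gN ZN) (l : Ultrafilter κ) {w x z : κ → 𝓔.Ext} {a b : 𝓔.Ext}
    (hwx : ∀ᶠ i in l, LEIn (𝓔.extMetric gN) ZX univ (w i) (x i))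
    (hxz : ∀ᶠ i in l, LEIn (𝓔.extMetric gN) ZX univ (x i) (z i))
    (hw : Tendsto w l (𝓝 a)) (hz : Tendsto z l (𝓝 b)) (ha : a ∉ 𝓔.extN (-σ))
    (hb : b ∉ 𝓔.extN σ) : ∃ c, Tendsto x l (𝓝 c) ∧ LEIn (𝓔.extMetric gN) ZX univ a c ∧
      LEIn (𝓔.extMetric gN) ZX univ c b := by
  -- The points `m` and `m'` of `N` bracket all three families eventually, so these lie in one
  -- compact diamond of `N`.
  obtain ⟨m, hm⟩ := h.exists_eventually_incl_le ha
  obtain ⟨m', hm'⟩ := h.exists_eventually_le_incl hb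
  have hall : ∀ᶠ i in l, LEIn (𝓔.extMetric gN) ZX univ (𝓔.incl m) (w i) ∧
      LEIn (𝓔.extMetric gN) ZX univ (w i) (x i) ∧ LEIn (𝓔.extMetric gN) ZX univ (x i) (z i) ∧
      LEIn (𝓔.extMetric gN) ZX univ (z i) (𝓔.incl m') := by
    filter_upwards [hw.eventually hm, hwx, hxz, hz.eventually hm'] with i h1 h2 h3 h4
    exact ⟨h1, h2, h3, h4⟩
  -- a convergent family of points of the diamond
  have key : ∀ y : κ → 𝓔.Ext, (∀ᶠ i in l, LEIn (𝓔.extMetric gN) ZX univ (𝓔.incl m) (y i) ∧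
      LEIn (𝓔.extMetric gN) ZX univ (y i) (𝓔.incl m')) → ∃ n, Tendsto (𝓔.toM ∘ y) l (𝓝 n) ∧
        Tendsto y l (𝓝 (𝓔.incl n)) := by
    intro y hy
    have h1 : ∀ᶠ i in l, 𝓔.toM (y i) ∈ {n | LEIn gN ZN univ m n ∧ LEIn gN ZN univ n m'} := by
      filter_upwards [hy] with i ⟨h2, h3⟩
      exact ⟨h.leIn_toM_of_between .refl h2 h3, h.leIn_toM_of_between h2 h3 .refl⟩
    obtain ⟨n, -, hn⟩ := (isCompact_iff_ultrafilter_le_nhds.1 (hyp.isCompact_diamond m m'))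
      (l.map (𝓔.toM ∘ y)) (le_principal_iff.2 h1)
    have hn' : Tendsto (𝓔.toM ∘ y) l (𝓝 n) := hn
    refine ⟨n, hn', ?_⟩
    refine (((𝓔.contMDiff_incl.continuous.tendsto n).comp hn').congr' ?_)
    filter_upwards [hy] with i ⟨h2, h3⟩
    exact 𝓔.homeoM.left_inv (h.mem_range_of_between h2 h3)
  obtain ⟨a', ha', hwa⟩ := key w (hall.mono fun i ⟨h1, h2, h3, h4⟩ ↦ ⟨h1, h2.trans (h3.trans h4)⟩)
  obtain ⟨c, hc, hxc⟩ := key x (hall.mono fun i ⟨h1, h2, h3, h4⟩ ↦ ⟨h1.trans h2, h3.trans h4⟩)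
  obtain ⟨b', hb', hzb⟩ := key z (hall.mono fun i ⟨h1, h2, h3, h4⟩ ↦ ⟨h1.trans (h2.trans h3), h4⟩)
  rw [tendsto_nhds_unique hw hwa, tendsto_nhds_unique hz hzb]
  have e1 : LEIn gN ZN univ a' c := hyp.leIn_of_tendsto h.spacetimeN (by
    filter_upwards [hall] with i ⟨h1, h2, h3, h4⟩
    exact h.leIn_toM_of_between h1 h2 (h3.trans h4)) ha' hc
  have e2 : LEIn gN ZN univ c b' := hyp.leIn_of_tendsto h.spacetimeN (by
    filter_upwards [hall] with i ⟨h1, h2, h3, h4⟩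
    exact h.leIn_toM_of_between (h1.trans h2) h3 h4) hc hb'
  exact ⟨𝓔.incl c, hxc, (h.leIn_incl e1).mono (subset_univ _),
    (h.leIn_incl e2).mono (subset_univ _)⟩

/-- Points in the past of points that converge to a point of `N^σ` converge, or the paths leave
the neighbourhood of `N^σ`. -/
lemma tendsto_or_exists [T2Space 𝓔.Ext] (h : 𝓔.IsExtension σ gN ZN ZX gC Co) (l : Ultrafilter κ)
    {y c : κ → 𝓔.Ext} {c₀ : 𝓔.Ext}
    (hyc : ∀ᶠ i in l, LEIn (𝓔.extMetric gN) ZX univ (y i) (c i)) (hc : Tendsto c l (𝓝 c₀))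
    (hc₀ : c₀ ∈ 𝓔.extN σ) :
    (∃ b, Tendsto y l (𝓝 b) ∧ LEIn (𝓔.extMetric gN) ZX univ b c₀) ∨
      ∃ (z : κ → 𝓔.Ext) (b : 𝓔.Ext), Tendsto z l (𝓝 b) ∧ b ∉ 𝓔.extN σ ∧
        (∀ᶠ i in l, LEIn (𝓔.extMetric gN) ZX univ (y i) (z i)) ∧
        (∀ᶠ i in l, LEIn (𝓔.extMetric gN) ZX univ (z i) (c i)) ∧
        LEIn (𝓔.extMetric gN) ZX univ b c₀ := by
  have hσ := h.isSign
  obtain ⟨p₀, hp₀, rfl⟩ := hc₀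
  have hangc : Continuous fun p : Cyl ↦ angle (p.2 : E4) (p₀.2 : E4) := by
    rw [continuous_iff_continuousAt]
    intro p
    have hne : ∀ x : S3, (x : E4) ≠ 0 := fun x hx ↦ by
      have : ‖(x : E4)‖ = 1 := mem_sphere_zero_iff_norm.1 x.2
      rw [hx, norm_zero] at this
      exact zero_ne_one this
    exact (continuousAt_angle (x := ((p.2 : E4), (p₀.2 : E4))) (hne _) (hne _)).comp
      (f := fun p : Cyl ↦ ((p.2 : E4), (p₀.2 : E4))) (by fun_prop)
  -- `A` is the past of `p₀` within `N^σ`. It is compact, because `σ T` is nonnegative on `N^σ` and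
  -- at most `σ T(p₀)` in the past of `p₀`.
  set A : Set Cyl := {p | Real.pi ≤ σ * p.1 + polarAngle p.2 ∧
    angle (p.2 : E4) (p₀.2 : E4) ≤ σ * p₀.1 - σ * p.1} with hA
  have hAN : A ⊆ nSig σ := by
    rintro p ⟨h1, h2⟩
    have h3 := polarAngle_sub_le p₀.2 p.2
    rw [angle_comm] at h3
    exact ⟨h1, by linarith [hp₀.2]⟩
  have hAc : IsCompact A := by
    have hcl : IsClosed A := by
      have := continuous_polarAngle
      have e1 : IsClosed {p : Cyl | Real.pi ≤ σ * p.1 + polarAngle p.2} :=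
        isClosed_le continuous_const (by fun_prop)
      have e2 : IsClosed {p : Cyl | angle (p.2 : E4) (p₀.2 : E4) ≤ σ * p₀.1 - σ * p.1} :=
        isClosed_le hangc (by fun_prop)
      exact e1.inter e2
    refine IsCompact.of_isClosed_subset (s := Icc (-|p₀.1|) |p₀.1| ×ˢ univ)
      (isCompact_Icc.prod isCompact_univ) hcl ?_
    rintro p ⟨h1, h2⟩
    refine ⟨abs_le.1 ?_, mem_univ _⟩
    have h3 := angle_nonneg (p.2 : E4) (p₀.2 : E4)
    have h4 := polarAngle_le_pi p.2
    rw [← hσ.abs_mul p.1, ← hσ.abs_mul p₀.1, abs_of_nonneg (by linarith : 0 ≤ σ * p.1),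
      abs_of_nonneg (by linarith : 0 ≤ σ * p₀.1)]
    linarith
  obtain ⟨K, hK, hAK, hKC⟩ := exists_compact_between hAc isOpen_interior
    (hAN.trans h.nSig_subset_coneRegion)
  have hKCo : K ⊆ Co := hKC.trans coneRegion_subset
  have hp₀A : p₀ ∈ A := by
    refine ⟨hp₀.1, ?_⟩
    rw [angle_self, sub_self]
    intro hx
    have : ‖(p₀.2 : E4)‖ = 1 := mem_sphere_zero_iff_norm.1 p₀.2.2
    rw [hx, norm_zero] at this
    exact zero_ne_one this
  set K' := 𝓔.glue '' K with hK'
  have hgc : ContinuousOn 𝓔.glue K :=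
    𝓔.homeoCyl.symm.continuousOn.mono (hKCo.trans h.subset)
  have hK'c : IsClosed K' := (hK.image_of_continuousOn hgc).isClosed
  have hnotin : ∀ p ∈ K, 𝓔.glue p ∉ interior K' → p ∉ interior K := fun p hp h1 h2 ↦
    h1 (interior_maximal (image_mono interior_subset)
      (h.isOpen_glue isOpen_interior (interior_subset.trans hKCo)) (mem_image_of_mem _ h2))
  have hcK : ∀ᶠ i in l, c i ∈ K' := by
    have h1 : 𝓔.glue '' interior K ∈ 𝓝 (𝓔.glue p₀) :=
      (h.isOpen_glue isOpen_interior (interior_subset.trans hKCo)).mem_nhds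
        (mem_image_of_mem _ (hAK hp₀A))
    exact (hc.eventually h1).mono fun i hi ↦ image_mono interior_subset hi
  have hcc : Tendsto (fun i ↦ 𝓔.toCyl (c i)) l (𝓝 p₀) := by
    have h1 := (𝓔.homeoCyl.continuousAt (𝓔.homeoCyl.map_target
      (𝓔.nSig_subset_collar hσ hp₀))).tendsto.comp hc
    have h2 : 𝓔.homeoCyl (𝓔.homeoCyl.symm p₀) = p₀ :=
      𝓔.toCyl_glue (𝓔.nSig_subset_collar hσ hp₀)
    rw [h2] at h1
    exact h1
  -- convergence of points that are joined to `c i` in `K`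
  have key : ∀ z : κ → 𝓔.Ext, (∀ᶠ i in l, z i ∈ K' ∧
      LEIn (𝓔.extMetric gN) ZX K' (z i) (c i)) → ∃ b ∈ K, Tendsto (fun i ↦ 𝓔.toCyl (z i)) l (𝓝 b) ∧
        Tendsto z l (𝓝 (𝓔.glue b)) ∧
        LEIn (𝓔.extMetric gN) ZX univ (𝓔.glue b) (𝓔.glue p₀) := by
    intro z hz
    have h1 : ∀ᶠ i in l, 𝓔.toCyl (z i) ∈ K := hz.mono fun i hi ↦ by
      have := mem_image_of_mem 𝓔.toCyl hi.1
      rwa [h.toCyl_glue_image hKCo] at this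
    obtain ⟨b, hb, hlb⟩ := (isCompact_iff_ultrafilter_le_nhds.1 hK)
      (l.map fun i ↦ 𝓔.toCyl (z i)) (le_principal_iff.2 h1)
    have hlb' : Tendsto (fun i ↦ 𝓔.toCyl (z i)) l (𝓝 b) := hlb
    refine ⟨b, hb, hlb', ?_, ?_⟩
    · have h2 : ContinuousAt 𝓔.glue b := 𝓔.homeoCyl.symm.continuousAt
        (show b ∈ 𝓔.homeoCyl.symm.source from h.subset (hKCo hb))
      refine (h2.tendsto.comp hlb').congr' ?_
      filter_upwards [hz] with i hi
      exact 𝓔.homeoCyl.left_inv (h.glue_subset_source (image_mono hKCo hi.1))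
    · have h3 := h.collarMetric.leIn_of_tendsto hσ hK hKC l h1
        (hz.mono fun i hi ↦ h.leIn_toCyl hKCo hi.2) hlb' hcc
      exact (h.leIn_glue coneRegion_subset h3).mono (subset_univ _)
  -- The ultrafilter selects one alternative: either the paths to `c i` stay in `K'`, or they enter
  -- it for the last time at points outside its interior.
  have hent : ∀ᶠ i in l, (y i ∈ K' ∧ LEIn (𝓔.extMetric gN) ZX K' (y i) (c i)) ∨
      ∃ z ∈ K' \ interior K', LEIn (𝓔.extMetric gN) ZX univ (y i) z ∧
        LEIn (𝓔.extMetric gN) ZX K' z (c i) := by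
    filter_upwards [hyc, hcK] with i h1 h2 using h1.exists_entry hK'c h2
  rcases Ultrafilter.eventually_or.1 hent with h1 | h1
  · obtain ⟨b, -, -, hb1, hb2⟩ := key y h1
    exact Or.inl ⟨_, hb1, hb2⟩
  · right
    have : Nonempty 𝓔.Ext := ⟨𝓔.glue p₀⟩
    obtain ⟨z, hz⟩ := h1.choice
    obtain ⟨b, hb, hb0, hb1, hb2⟩ := key z (hz.mono fun i hi ↦ ⟨hi.1.1, hi.2.2⟩)
    refine ⟨z, 𝓔.glue b, hb1, fun hbN ↦ ?_, hz.mono fun i hi ↦ hi.2.1,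
      hz.mono fun i hi ↦ hi.2.2.mono (subset_univ _), hb2⟩
    -- If the limit `b` of the entry points were in `N^σ`, it would lie in `A`, hence in the
    -- interior of `K`, and so would the entry points eventually.
    have hbN' := (𝓔.glue_mem_extN hσ (h.subset (hKCo hb))).1 hbN
    have hbA : b ∈ A := by
      refine ⟨hbN'.1, ?_⟩
      have := (h.leIn_iff hbN (mem_image_of_mem _ hp₀)).1 hb2
      rwa [𝓔.toCyl_glue (h.subset (hKCo hb)),
        𝓔.toCyl_glue (𝓔.nSig_subset_collar hσ hp₀)] at this
    obtain ⟨i, h3, h4⟩ := ((hb0.eventually (isOpen_interior.mem_nhds (hAK hbA))).and hz).exists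
    obtain ⟨⟨⟨p, hp, hpz⟩, hzi⟩, -⟩ := h4
    rw [← hpz] at hzi h3
    refine hnotin p hp hzi ?_
    rwa [𝓔.toCyl_glue (h.subset (hKCo hp))] at h3

lemma tendsto_or_exists_neg [T2Space 𝓔.Ext] (h : 𝓔.IsExtension σ gN ZN ZX gC Co)
    (l : Ultrafilter κ) {y c : κ → 𝓔.Ext} {c₀ : 𝓔.Ext}
    (hyc : ∀ᶠ i in l, LEIn (𝓔.extMetric gN) ZX univ (c i) (y i)) (hc : Tendsto c l (𝓝 c₀))
    (hc₀ : c₀ ∈ 𝓔.extN (-σ)) :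
    (∃ b, Tendsto y l (𝓝 b) ∧ LEIn (𝓔.extMetric gN) ZX univ c₀ b) ∨
      ∃ (z : κ → 𝓔.Ext) (b : 𝓔.Ext), Tendsto z l (𝓝 b) ∧ b ∉ 𝓔.extN (-σ) ∧
        (∀ᶠ i in l, LEIn (𝓔.extMetric gN) ZX univ (z i) (y i)) ∧
        (∀ᶠ i in l, LEIn (𝓔.extMetric gN) ZX univ (c i) (z i)) ∧
        LEIn (𝓔.extMetric gN) ZX univ c₀ b := by
  rcases h.reverse.tendsto_or_exists l (hyc.mono fun i hi ↦ hi.reverse) hc hc₀ with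
    ⟨b, h1, h2⟩ | ⟨z, b, h1, h2, h3, h4, h5⟩
  · exact Or.inl ⟨b, h1, h2.of_reverse⟩
  · exact Or.inr ⟨z, b, h1, h2, h3.mono fun i hi ↦ hi.of_reverse,
      h4.mono fun i hi ↦ hi.of_reverse, h5.of_reverse⟩

/-- The causal relation of `N_ext` is closed. -/
lemma leIn_of_tendsto [T2Space 𝓔.Ext] (h : 𝓔.IsExtension σ gN ZN ZX gC Co)
    (hyp : IsCausallyHyperbolic gN ZN) (l : Ultrafilter κ) {p q : κ → 𝓔.Ext} {a b : 𝓔.Ext}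
    (hpq : ∀ᶠ i in l, LEIn (𝓔.extMetric gN) ZX univ (p i) (q i))
    (hp : Tendsto p l (𝓝 a)) (hq : Tendsto q l (𝓝 b)) :
    LEIn (𝓔.extMetric gN) ZX univ a b := by
  -- Here the upper limit lies outside `N^σ`. If the lower limit is in `N^{-σ}`, it is replaced by
  -- the limit of exit points, which lies outside `N^{-σ}`. The case `b ∈ N^σ` is afterwards reduced
  -- to this one through entry points.
  have step : ∀ (q : κ → 𝓔.Ext) (b : 𝓔.Ext),
      (∀ᶠ i in l, LEIn (𝓔.extMetric gN) ZX univ (p i) (q i)) → Tendsto q l (𝓝 b) →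
      b ∉ 𝓔.extN σ → LEIn (𝓔.extMetric gN) ZX univ a b := by
    intro q b hpq hq hb
    by_cases ha : a ∈ 𝓔.extN (-σ)
    · rcases h.tendsto_or_exists_neg l hpq hp ha with ⟨c, h1, h2⟩ | ⟨u, c, h1, h2, h3, -, h5⟩
      · rwa [tendsto_nhds_unique hq h1]
      · obtain ⟨c', h6, h7, h8⟩ := h.exists_tendsto_of_notMem hyp l
          (Eventually.of_forall fun i ↦ .refl) h3 h1 hq h2 hb
        exact h5.trans (h7.trans h8)
    · obtain ⟨c', h6, h7, h8⟩ := h.exists_tendsto_of_notMem hyp l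
        (Eventually.of_forall fun i ↦ .refl) hpq hp hq ha hb
      exact h7.trans h8
  by_cases hb : b ∈ 𝓔.extN σ
  · rcases h.tendsto_or_exists l hpq hq hb with ⟨c, h1, h2⟩ | ⟨z, c, h1, h2, h3, -, h5⟩
    · rwa [tendsto_nhds_unique hp h1]
    · exact (step z c h3 h1 h2).trans h5
  · exact step q b hpq hq hb

/-- Points between convergent points converge. -/
lemma exists_tendsto [T2Space 𝓔.Ext] (h : 𝓔.IsExtension σ gN ZN ZX gC Co)
    (hyp : IsCausallyHyperbolic gN ZN) (l : Ultrafilter κ) {w x z : κ → 𝓔.Ext} {a b : 𝓔.Ext}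
    (hwx : ∀ᶠ i in l, LEIn (𝓔.extMetric gN) ZX univ (w i) (x i))
    (hxz : ∀ᶠ i in l, LEIn (𝓔.extMetric gN) ZX univ (x i) (z i))
    (hw : Tendsto w l (𝓝 a)) (hz : Tendsto z l (𝓝 b)) : ∃ c, Tendsto x l (𝓝 c) := by
  have step : ∀ (z : κ → 𝓔.Ext) (b : 𝓔.Ext),
      (∀ᶠ i in l, LEIn (𝓔.extMetric gN) ZX univ (x i) (z i)) → Tendsto z l (𝓝 b) →
      b ∉ 𝓔.extN σ → ∃ c, Tendsto x l (𝓝 c) := by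
    intro z b hxz hz hb
    by_cases ha : a ∈ 𝓔.extN (-σ)
    · rcases h.tendsto_or_exists_neg l hwx hw ha with ⟨c, h1, -⟩ | ⟨u, c, h1, h2, h3, -, -⟩
      · exact ⟨c, h1⟩
      · obtain ⟨c', h6, -, -⟩ := h.exists_tendsto_of_notMem hyp l h3 hxz h1 hz h2 hb
        exact ⟨c', h6⟩
    · obtain ⟨c', h6, -, -⟩ := h.exists_tendsto_of_notMem hyp l hwx hxz hw hz ha hb
      exact ⟨c', h6⟩
  by_cases hb : b ∈ 𝓔.extN σ
  · rcases h.tendsto_or_exists l hxz hz hb with ⟨c, h1, -⟩ | ⟨z', c, h1, h2, h3, -, -⟩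
    · exact ⟨c, h1⟩
    · exact step z' c h3 h1 h2
  · exact step z b hxz hz hb

/-- There are no closed causal paths through points of `N^σ`. -/
lemma not_lt_self_of_mem (h : 𝓔.IsExtension σ gN ZN ZX gC Co) {x y : 𝓔.Ext}
    (hx : x ∈ 𝓔.extN σ) (hxy : StepIn (𝓔.extMetric gN) ZX univ x y)
    (hyx : LEIn (𝓔.extMetric gN) ZX univ y x) : False := by
  obtain ⟨γ, hγ, h0, h1, hc⟩ := hxy.exists_curve
  have h2 : StepIn (𝓔.extMetric gN) ZX (𝓔.extN σ) x y :=
    ⟨γ, hγ, h0, h1, fun t ht ↦ ⟨h.mem_extN_of_leIn (hc t ht).2.2.1 hx, (hc t ht).2.1⟩⟩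
  have h3 := h.stepIn_toCyl h.nSig_subset_Co h2
  have h4 := h.leIn_toCyl h.nSig_subset_Co (h.leIn_extN hyx h2.mem_right)
  have h5 := h.collarMetric.step_bound h.isSign (h3.mono h.nSig_subset_coneRegion)
  have h6 := h.collarMetric.le_bound h.isSign (h4.mono h.nSig_subset_coneRegion)
  have h7 : 0 ≤ dist (𝓔.toCyl y) (𝓔.toCyl x) := dist_nonneg
  linarith [h5.1]

/-- The extended space-time is globally hyperbolic. -/
lemma isCausallyHyperbolic [T2Space 𝓔.Ext] (h : 𝓔.IsExtension σ gN ZN ZX gC Co)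
    (hyp : IsCausallyHyperbolic gN ZN) : IsCausallyHyperbolic (𝓔.extMetric gN) ZX where
  no_closed x hx := by
    obtain ⟨y, hxy, hyx⟩ := Relation.TransGen.head'_iff.1 hx
    rw [← stepIn_univ_iff] at hxy
    change CausalLE _ _ _ _ at hyx
    rw [← leIn_univ_iff] at hyx
    rcases 𝓔.mem_cases h.isSign x with h1 | h1 | h1
    · obtain ⟨m, rfl⟩ := h1
      obtain ⟨γ, hγ, h0, h1, hc⟩ := hxy.exists_curve
      have h2 : StepIn (𝓔.extMetric gN) ZX (range 𝓔.incl) (𝓔.incl m) y :=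
        ⟨γ, hγ, h0, h1, fun t ht ↦ ⟨h.mem_range_of_between (hc t ht).2.2.1
          ((hc t ht).2.2.2.trans hyx), (hc t ht).2.1⟩⟩
      have h3 := h.stepIn_toM h2
      have h4 : LEIn gN ZN univ (𝓔.toM y) m :=
        h.leIn_toM_of_between (.single hxy) hyx .refl
      rw [stepIn_univ_iff] at h3
      rw [leIn_univ_iff] at h4
      exact hyp.no_closed m (Relation.TransGen.head' h3 h4)
    · exact h.not_lt_self_of_mem h1 hxy hyx
    · have h2 := h.mem_extN_neg_of_leIn hyx h1
      -- The reversed argument needs a step that starts at `x` after reversal, that is, the last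
      -- step of the closed path.
      rcases Relation.ReflTransGen.cases_tail hyx with h3 | ⟨z, h3, h4⟩
      · subst h3
        exact h.reverse.not_lt_self_of_mem h1 hxy.reverse .refl
      · exact h.reverse.not_lt_self_of_mem h1 h4.reverse
          (LEIn.reverse ((Relation.ReflTransGen.single hxy).trans h3))
  compact_diamond p q _ := by
    have heq : causalFuture (𝓔.extMetric gN) ZX {p} ∩ causalPast (𝓔.extMetric gN) ZX {q} =
        {x | LEIn (𝓔.extMetric gN) ZX univ p x ∧ LEIn (𝓔.extMetric gN) ZX univ x q} := by
      ext x
      simp [causalFuture, causalPast, leIn_univ_iff]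
    rw [heq, isCompact_iff_ultrafilter_le_nhds]
    intro f hf
    have hf' : ∀ᶠ x in f, LEIn (𝓔.extMetric gN) ZX univ p x ∧
      LEIn (𝓔.extMetric gN) ZX univ x q := le_principal_iff.1 hf
    obtain ⟨c, hc⟩ := h.exists_tendsto hyp f (w := fun _ ↦ p) (x := id) (z := fun _ ↦ q)
      (hf'.mono fun x hx ↦ hx.1) (hf'.mono fun x hx ↦ hx.2) tendsto_const_nhds tendsto_const_nhds
    exact ⟨c, ⟨h.leIn_of_tendsto hyp f (hf'.mono fun x hx ↦ hx.1) tendsto_const_nhds hc,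
      h.leIn_of_tendsto hyp f (hf'.mono fun x hx ↦ hx.2) hc tendsto_const_nhds⟩, hc⟩

end MinkowskianInfinity.IsExtension


/-! ### Reversal, conformal change, and limits of curves in `N^σ` -/

open InnerProductGeometry

section HyperbolicTransfer

set_option linter.unusedSectionVars false

variable {X : Type*} [TopologicalSpace X] [ChartedSpace ModelH X] [IsManifold I₄ ∞ X]
  {g : MetricField X} {Z : VecField X}

lemma IsCausallyHyperbolic.reverse (h : IsCausallyHyperbolic g Z) :
    IsCausallyHyperbolic g (fun x ↦ -Z x) where
  no_closed p hp := by
    obtain ⟨y, h1, h2⟩ := Relation.TransGen.head'_iff.1 hp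
    rw [← stepIn_univ_iff] at h1
    change CausalLE _ _ _ _ at h2
    rw [← leIn_univ_iff] at h2
    have h3 := (h2.of_reverse)
    rw [leIn_univ_iff] at h3
    exact h.no_closed p (Relation.TransGen.tail' h3 (stepIn_univ_iff.1 h1.of_reverse))
  compact_diamond p q _ := by
    convert h.isCompact_diamond q p using 1
    ext x
    simp only [causalFuture, causalPast, mem_singleton_iff, exists_eq_left, ← leIn_univ_iff,
      mem_inter_iff, mem_ofPred_eq]
    exact ⟨fun hx ↦ ⟨hx.2.of_reverse, hx.1.of_reverse⟩, fun hx ↦ ⟨hx.2.reverse, hx.1.reverse⟩⟩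

lemma IsCausallyHyperbolic.conformalMetric (h : IsCausallyHyperbolic g Z) {w : X → ℝ}
    (hw : ∀ x, 0 < w x) : IsCausallyHyperbolic (conformalMetric w g) Z := by
  have heq : CausalStep (Penrose.conformalMetric w g) Z = CausalStep g Z := by
    ext p q
    refine exists_congr fun γ ↦ and_congr_right fun _ ↦ and_congr_right fun _ ↦
      and_congr_right fun _ ↦ forall₂_congr fun t _ ↦ ?_
    exact isFutureCausal_conformalMetric hw _
  constructor
  · intro p
    rw [CausalLT, heq]
    exact h.no_closed p
  · intro p q
    simp only [CausalLT, causalFuture, causalPast, CausalLE, heq]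
    exact h.compact_diamond p q

/-- The product of a vector field with the velocity of a curve is continuous. -/
lemma continuousOn_metric_velocity (hs : IsSpacetimeOn g Z univ) {μ : ℝ → X} {a b : ℝ}
    (hμ : ContMDiffOn 𝓘(ℝ, ℝ) I₄ ∞ μ (Ioo a b)) :
    ContinuousOn (fun t ↦ g (μ t) (Z (μ t)) (velocity μ (Ioo a b) t)) (Ioo a b) := by
  intro t₀ ht₀
  refine ContinuousAt.continuousWithinAt ?_
  set x₀ := μ t₀ with hx₀
  have hμc : ContinuousAt μ t₀ := (hμ.continuousOn t₀ ht₀).continuousAt (isOpen_Ioo.mem_nhds ht₀)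
  set O := Ioo a b ∩ μ ⁻¹' (chartAt ModelH x₀).source with hO
  have hOo : IsOpen O :=
    hμ.continuousOn.isOpen_inter_preimage isOpen_Ioo (chartAt ModelH x₀).open_source
  have hO₀ : t₀ ∈ O := ⟨ht₀, mem_chart_source ModelH x₀⟩
  have hys : ContDiffOn ℝ ∞ (fun t ↦ extChartAt I₄ x₀ (μ t)) O := by
    rw [← contMDiffOn_iff_contDiffOn]
    exact (contMDiffOn_extChartAt (x := x₀)).comp (hμ.mono inter_subset_left) fun t ht ↦ ht.2
  have hyc := (hys.continuousOn_deriv_of_isOpen hOo (by simp)).continuousAt (hOo.mem_nhds hO₀)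
  have h1 : ContinuousAt (chartForm g x₀) x₀ :=
    (((contMDiffWithinAt_metric_iff (mem_chart_source ModelH x₀)).1
      (hs.lorentzian.smooth x₀ (mem_univ _))).contMDiffAt univ_mem).continuousAt
  have h2 : ContinuousAt (fun x ↦ chartVec x₀ x (Z x)) x₀ :=
    (((contMDiffWithinAt_vecField_iff (mem_chart_source ModelH x₀)).1
      (hs.smooth x₀ (mem_univ _))).contMDiffAt univ_mem).continuousAt
  have h3 : ContinuousAt (fun t ↦ chartForm g x₀ (μ t)) t₀ := ContinuousAt.comp (g := chartForm g x₀) h1 hμc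
  have h4 : ContinuousAt (fun t ↦ chartVec x₀ (μ t) (Z (μ t))) t₀ :=
    ContinuousAt.comp (g := fun x ↦ chartVec x₀ x (Z x)) h2 hμc
  refine ((h3.clm_apply h4).clm_apply hyc).congr ?_
  filter_upwards [hOo.mem_nhds hO₀] with t ht
  have h5 := (hasDerivWithinAt_chart ((hμ t ht.1).mdifferentiableWithinAt (by simp)) ht.2).hasDerivAt
    (isOpen_Ioo.mem_nhds ht.1)
  rw [h5.deriv, chartForm_chartVec g ht.2]

end HyperbolicTransfer

/-- A curve in `N^σ` that is parametrized towards the future has a past limit in `N^σ`. -/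
lemma exists_tendsto_nSig {σ : ℝ} {c : ℝ → Cyl} {a b : ℝ} (hab : a < b)
    (hc : ∀ t ∈ Ioo a b, c t ∈ nSig σ)
    (hd : ∀ s ∈ Ioo a b, ∀ t ∈ Ioo a b, s < t → dist (c s) (c t) ≤ 2 * (σ * (c t).1 - σ * (c s).1))
    (hR : ∀ s ∈ Ioo a b, ∀ t ∈ Ioo a b, s < t →
      σ * (c s).1 - polarAngle (c s).2 ≤ σ * (c t).1 - polarAngle (c t).2) :
    ∃ p ∈ nSig σ, Tendsto c (𝓝[>] a) (𝓝 p) := by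
  have hcau : Cauchy (map c (𝓝[>] a)) := by
    rw [Metric.cauchy_iff]
    refine ⟨inferInstance, fun ε hε ↦ ?_⟩
    -- On `N^σ` one has `σ T ≥ π - R ≥ 0`. So the monotone quantity `σ T` is bounded below, and as
    -- it controls distances the curve is Cauchy towards the past.
    set V := (fun t ↦ σ * (c t).1) '' Ioo a b with hV
    have hVn : V.Nonempty := (nonempty_Ioo.2 hab).image _
    have hVb : BddBelow V := by
      refine ⟨0, ?_⟩
      rintro _ ⟨t, ht, rfl⟩
      have h1 := (hc t ht).1
      have h2 := polarAngle_le_pi (c t).2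
      simp only
      linarith
    obtain ⟨_, ⟨t₀, ht₀, rfl⟩, h1⟩ := exists_lt_of_csInf_lt hVn
      (show sInf V < sInf V + ε / 4 by linarith)
    refine ⟨c '' Ioo a t₀, image_mem_map (Ioo_mem_nhdsGT ht₀.1), ?_⟩
    have hsub : Ioo a t₀ ⊆ Ioo a b := Ioo_subset_Ioo le_rfl ht₀.2.le
    have key : ∀ s ∈ Ioo a t₀, ∀ t ∈ Ioo a t₀, s < t → dist (c s) (c t) < ε := by
      intro s hs t ht hst
      have h2 := hd s (hsub hs) t (hsub ht) hst
      have h3 := hd t (hsub ht) t₀ ht₀ ht.2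
      have h4 : sInf V ≤ σ * (c s).1 := csInf_le hVb (mem_image_of_mem _ (hsub hs))
      have h5 : 0 ≤ dist (c t) (c t₀) := dist_nonneg
      simp only at h1
      linarith
    rintro _ ⟨s, hs, rfl⟩ _ ⟨t, ht, rfl⟩
    rcases lt_trichotomy s t with h2 | h2 | h2
    · exact key s hs t ht h2
    · rw [h2, dist_self]; exact hε
    · rw [dist_comm]; exact key t ht s hs h2
  obtain ⟨p, hp⟩ := cauchy_map_iff_exists_tendsto.1 hcau
  have hRc : Continuous fun q : Cyl ↦ polarAngle q.2 := continuous_polarAngle.comp continuous_snd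
  refine ⟨p, ⟨?_, ?_⟩, hp⟩
  · have h1 : Continuous fun q : Cyl ↦ σ * q.1 + polarAngle q.2 := by fun_prop
    refine ge_of_tendsto ((h1.tendsto p).comp hp) ?_
    filter_upwards [Ioo_mem_nhdsGT hab] with t ht using (hc t ht).1
  -- The strict inequality `σ T - R < π` survives the limit because `σ T - R` is nondecreasing: the
  -- limit is bounded by the value at a later parameter.
  · have h1 : Continuous fun q : Cyl ↦ σ * q.1 - polarAngle q.2 := by fun_prop
    obtain ⟨t, ht⟩ := nonempty_Ioo.2 hab
    refine lt_of_le_of_lt (le_of_tendsto ((h1.tendsto p).comp hp) ?_) (hc t ht).2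
    filter_upwards [Ioo_mem_nhdsGT ht.1] with s hs
    exact hR s ⟨hs.1, hs.2.trans ht.2⟩ t ht hs.2

/-! ### Cauchy surfaces of the extension -/

namespace MinkowskianInfinity.IsExtension

set_option linter.unusedSectionVars false

variable {M : Type*} [TopologicalSpace M] [T2Space M] [ChartedSpace ModelH M] [IsManifold I₄ ∞ M]
  {g : MetricField M} {Z : VecField M} {𝓔 : MinkowskianInfinity g Z}
  {σ : ℝ} {gN : MetricField M} {ZN : VecField M} {ZX : VecField 𝓔.Ext}
  {gC : MetricField Cyl} {Co : Set Cyl}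

lemma dist_toCyl_le (h : 𝓔.IsExtension σ gN ZN ZX gC Co) {x y : 𝓔.Ext} (hx : x ∈ 𝓔.extN σ)
    (hxy : LEIn (𝓔.extMetric gN) ZX univ x y) :
    dist (𝓔.toCyl x) (𝓔.toCyl y) ≤ 2 * (σ * (𝓔.toCyl y).1 - σ * (𝓔.toCyl x).1) ∧
      σ * (𝓔.toCyl x).1 - polarAngle (𝓔.toCyl x).2 ≤
        σ * (𝓔.toCyl y).1 - polarAngle (𝓔.toCyl y).2 := by
  refine ⟨h.collarMetric.le_bound h.isSign ((h.leIn_toCyl h.nSig_subset_Co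
    (h.leIn_extN hxy hx)).mono h.nSig_subset_coneRegion), ?_⟩
  have h1 := (h.leIn_iff hx (h.mem_extN_of_leIn hxy hx)).1 hxy
  have h2 := polarAngle_sub_le (𝓔.toCyl y).2 (𝓔.toCyl x).2
  rw [angle_comm] at h2
  linarith

/-- A curve in `N^σ` with parameters increasing to the future has a past limit. -/
lemma exists_tendsto_of_forall_mem (h : 𝓔.IsExtension σ gN ZN ZX gC Co) {μ : ℝ → 𝓔.Ext} {a b : ℝ}
    (hab : a < b) (hle : ∀ s ∈ Ioo a b, ∀ t ∈ Ioo a b, s < t →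
      LEIn (𝓔.extMetric gN) ZX univ (μ s) (μ t)) (hmem : ∀ t ∈ Ioo a b, μ t ∈ 𝓔.extN σ) :
    ∃ x, Tendsto μ (𝓝[>] a) (𝓝 x) := by
  obtain ⟨p, hp, hlim⟩ := exists_tendsto_nSig (c := 𝓔.toCyl ∘ μ) hab
    (fun t ht ↦ h.toCyl_mem (hmem t ht))
    (fun s hs t ht hst ↦ (h.dist_toCyl_le (hmem s hs) (hle s hs t ht hst)).1)
    (fun s hs t ht hst ↦ (h.dist_toCyl_le (hmem s hs) (hle s hs t ht hst)).2)
  refine ⟨𝓔.glue p, ?_⟩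
  have h2 : ContinuousAt 𝓔.glue p := 𝓔.homeoCyl.symm.continuousAt
    (show p ∈ 𝓔.homeoCyl.symm.source from 𝓔.nSig_subset_collar h.isSign hp)
  refine (h2.tendsto.comp hlim).congr' ?_
  filter_upwards [Ioo_mem_nhdsGT hab] with t ht using h.glue_toCyl (hmem t ht)

lemma exists_tendsto_of_forall_mem_neg (h : 𝓔.IsExtension σ gN ZN ZX gC Co) {μ : ℝ → 𝓔.Ext}
    {a b : ℝ} (hab : a < b) (hle : ∀ s ∈ Ioo a b, ∀ t ∈ Ioo a b, s < t →
      LEIn (𝓔.extMetric gN) ZX univ (μ s) (μ t)) (hmem : ∀ t ∈ Ioo a b, μ t ∈ 𝓔.extN (-σ)) :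
    ∃ x, Tendsto μ (𝓝[<] b) (𝓝 x) := by
  have hneg : ∀ t ∈ Ioo (-b) (-a), -t ∈ Ioo a b := fun t ht ↦
    ⟨by linarith [ht.2], by linarith [ht.1]⟩
  obtain ⟨x, hx⟩ := h.reverse.exists_tendsto_of_forall_mem (μ := fun t ↦ μ (-t)) (a := -b)
    (b := -a) (by linarith) (fun s hs t ht hst ↦ (hle _ (hneg t ht) _ (hneg s hs)
      (by linarith)).reverse) (fun t ht ↦ hmem _ (hneg t ht))
  refine ⟨x, ?_⟩
  have h1 : Tendsto (fun t : ℝ ↦ -t) (𝓝[<] b) (𝓝[>] (-b)) := tendsto_neg_nhdsLT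
  have h2 := hx.comp h1
  simpa [Function.comp_def] using h2

lemma iZeroExt_eq : 𝓔.iZeroExt = 𝓔.glue iZero := (𝓔.glue_of_mem iZero_mem).symm

lemma iZeroExt_mem : 𝓔.iZeroExt ∈ 𝓔.extN σ := by
  rw [iZeroExt_eq]
  refine mem_image_of_mem _ ⟨?_, ?_⟩ <;> simp [iZero, polarAngle_southPole]
  linarith [Real.pi_pos]

/-- The conditions `π ≤ ±σ T + R` together with `R ≤ π` force `T = 0` and `R = π`. This is the only
contact of the two pieces. -/
lemma eq_iZeroExt (h : 𝓔.IsExtension σ gN ZN ZX gC Co) {x : 𝓔.Ext} (h1 : x ∈ 𝓔.extN σ)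
    (h2 : x ∈ 𝓔.extN (-σ)) : x = 𝓔.iZeroExt := by
  rw [iZeroExt_eq, ← h.glue_toCyl h1]
  have h3 := (h.toCyl_mem h1).1
  have h4 := (h.reverse.toCyl_mem h2).1
  have h5 := polarAngle_le_pi (𝓔.toCyl x).2
  refine congrArg _ (Prod.ext ?_ (eq_southPole (by linarith)))
  have : σ * (𝓔.toCyl x).1 = 0 := by linarith
  exact (mul_eq_zero.1 this).resolve_left h.isSign.ne_zero

/-- The part in `N` of an inextendible timelike curve is inextendible. -/
lemma isInextendibleTimelike_toM [T2Space 𝓔.Ext] {μ : ℝ → 𝓔.Ext} {a b a' b' : ℝ}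
    (hμ : IsInextendibleTimelike (𝓔.extMetric gN) a b μ) (hab : a' < b')
    (hN : {t | t ∈ Ioo a b ∧ μ t ∈ range 𝓔.incl} = Ioo a' b') :
    IsInextendibleTimelike gN a' b' (𝓔.toM ∘ μ) := by
  have hmem : ∀ t ∈ Ioo a' b', t ∈ Ioo a b ∧ μ t ∈ range 𝓔.incl := fun t ht ↦ by
    rw [← hN] at ht; exact ht
  have hsub : Ioo a' b' ⊆ Ioo a b := fun t ht ↦ (hmem t ht).1
  obtain ⟨haa, hbb⟩ := (Ioo_subset_Ioo_iff hab).1 hsub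
  have hincl : ∀ t ∈ Ioo a' b', 𝓔.incl (𝓔.toM (μ t)) = μ t := fun t ht ↦
    𝓔.homeoM.left_inv (hmem t ht).2
  refine ⟨hab, 𝓔.contMDiffOn_toM.comp (hμ.smooth.mono hsub) fun t ht ↦ (hmem t ht).2,
    fun t ht ↦ ?_, ?_, ?_⟩
  · have hud : UniqueDiffWithinAt ℝ (Ioo a' b') t := isOpen_Ioo.uniqueDiffWithinAt ht
    have hd : MDifferentiableWithinAt 𝓘(ℝ, ℝ) I₄ μ (Ioo a b) t :=
      (hμ.smooth t (hsub ht)).mdifferentiableWithinAt (by simp)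
    have htoM : MDifferentiableAt I₄ I₄ 𝓔.toM (μ t) := by
      obtain ⟨m, hm⟩ := (hmem t ht).2
      rw [← hm]; exact 𝓔.mdifferentiableAt_toM m
    rw [velocity_comp hud (hd.mono hsub) htoM, velocity_subset hsub hud hd]
    have h1 := hμ.timelike t (hsub ht)
    rw [𝓔.extMetric_incl gN (hmem t ht).2] at h1
    exact h1
  -- A past endpoint in `N` is excluded in two ways: if `a' = a` it would be an endpoint of `μ`, and
  -- if `a < a'` continuity would place `μ a'` in `N`, although `a'` is not in the open interval of
  -- such parameters. The future end is treated alike.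
  · rintro ⟨m, hm⟩
    have hlim : Tendsto μ (𝓝[>] a') (𝓝 (𝓔.incl m)) := by
      refine ((𝓔.contMDiff_incl.continuous.tendsto m).comp hm).congr' ?_
      filter_upwards [Ioo_mem_nhdsGT hab] with t ht using hincl t ht
    rcases haa.eq_or_lt with h1 | h1
    · rw [← h1] at hlim; exact hμ.no_past_endpoint ⟨_, hlim⟩
    · have ha' : a' ∈ Ioo a b := ⟨h1, hab.trans_le hbb⟩
      have hc : ContinuousAt μ a' :=
        (hμ.smooth.continuousOn a' ha').continuousAt (isOpen_Ioo.mem_nhds ha')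
      have h2 := tendsto_nhds_unique hlim (hc.tendsto.mono_left nhdsWithin_le_nhds)
      have h3 : a' ∈ Ioo a' b' := by rw [← hN]; exact ⟨ha', m, h2⟩
      exact lt_irrefl _ h3.1
  · rintro ⟨m, hm⟩
    have hlim : Tendsto μ (𝓝[<] b') (𝓝 (𝓔.incl m)) := by
      refine ((𝓔.contMDiff_incl.continuous.tendsto m).comp hm).congr' ?_
      filter_upwards [Ioo_mem_nhdsLT hab] with t ht using hincl t ht
    rcases hbb.eq_or_lt with h1 | h1
    · rw [h1] at hlim; exact hμ.no_future_endpoint ⟨_, hlim⟩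
    · have hb' : b' ∈ Ioo a b := ⟨haa.trans_lt hab, h1⟩
      have hc : ContinuousAt μ b' :=
        (hμ.smooth.continuousOn b' hb').continuousAt (isOpen_Ioo.mem_nhds hb')
      have h2 := tendsto_nhds_unique hlim (hc.tendsto.mono_left nhdsWithin_le_nhds)
      have h3 : b' ∈ Ioo a' b' := by rw [← hN]; exact ⟨hb', m, h2⟩
      exact lt_irrefl _ h3.2

/-- Inextendible future-directed timelike curves meet the extended Cauchy surface once. -/
lemma existsUnique_mem [T2Space 𝓔.Ext] (h : 𝓔.IsExtension σ gN ZN ZX gC Co) {S : Set M}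
    (hS : IsCauchySurface gN S) {μ : ℝ → 𝓔.Ext} {a b : ℝ}
    (hμ : IsInextendibleTimelike (𝓔.extMetric gN) a b μ)
    (hfut : ∀ t ∈ Ioo a b, IsFutureCausal (𝓔.extMetric gN) ZX (μ t) (velocity μ (Ioo a b) t)) :
    ∃! t, t ∈ Ioo a b ∧ μ t ∈ 𝓔.incl '' S ∪ {𝓔.iZeroExt} := by
  have hσ := h.isSign
  have hst : ∀ s ∈ Ioo a b, ∀ t ∈ Ioo a b, s < t →
      StepIn (𝓔.extMetric gN) ZX univ (μ s) (μ t) := fun s hs t ht hlt ↦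
    stepIn_of_curve hlt (Icc_subset_Ioo hs.1 ht.2) hμ.smooth fun u hu ↦
      ⟨mem_univ _, hfut u (Icc_subset_Ioo hs.1 ht.2 hu)⟩
  have hle : ∀ s ∈ Ioo a b, ∀ t ∈ Ioo a b, s < t →
      LEIn (𝓔.extMetric gN) ZX univ (μ s) (μ t) := fun s hs t ht hlt ↦ .single (hst s hs t ht hlt)
  have hzero : ∀ m, 𝓔.incl m ≠ 𝓔.iZeroExt := fun m hm ↦ by cases hm
  -- As `i₀` lies in both pieces, a curve through it is in `N^{-σ}` before and in `N^σ` after. It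
  -- never meets `N`, and a second visit to `i₀` would close a causal path.
  by_cases hi : ∃ t ∈ Ioo a b, μ t = 𝓔.iZeroExt
  · obtain ⟨t₀, ht₀, hi⟩ := hi
    refine ⟨t₀, ⟨ht₀, Or.inr hi⟩, fun t ⟨ht, hmem⟩ ↦ ?_⟩
    have e1 : μ t₀ ∈ 𝓔.extN σ := by rw [hi]; exact iZeroExt_mem
    have e2 : μ t₀ ∈ 𝓔.extN (-σ) := by rw [hi]; exact iZeroExt_mem
    have hnot : ∀ u ∈ Ioo a b, μ u ∉ range 𝓔.incl := by
      rintro u hu ⟨m, hm⟩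
      rcases lt_trichotomy u t₀ with h1 | h1 | h1
      · have := h.mem_extN_neg_of_leIn (hle u hu t₀ ht₀ h1) e2
        rw [← hm] at this
        exact 𝓔.incl_notMem_extN hσ.neg m this
      · rw [h1, hi] at hm; exact hzero m hm
      · have := h.mem_extN_of_leIn (hle t₀ ht₀ u hu h1) e1
        rw [← hm] at this
        exact 𝓔.incl_notMem_extN hσ m this
    have hti : μ t = 𝓔.iZeroExt := by
      rcases hmem with ⟨m, -, hm⟩ | h1
      · exact absurd ⟨m, hm⟩ (hnot t ht)
      · exact h1
    rcases lt_trichotomy t t₀ with h1 | h1 | h1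
    · refine (h.not_lt_self_of_mem (x := μ t) (by rw [hti]; exact iZeroExt_mem)
        (hst t ht t₀ ht₀ h1) ?_).elim
      rw [hi, hti]; exact .refl
    · exact h1
    · refine (h.not_lt_self_of_mem e1 (hst t₀ ht₀ t ht h1) ?_).elim
      rw [hi, hti]; exact .refl
  push Not at hi
  set TN := {t | t ∈ Ioo a b ∧ μ t ∈ range 𝓔.incl} with hTN
  have hTNo : IsOpen TN :=
    hμ.smooth.continuousOn.isOpen_inter_preimage isOpen_Ioo 𝓔.homeoM.open_source
  -- A curve that misses `N` and `i₀` is covered by two disjoint closed pieces, so by connectedness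
  -- it stays in one. In `N^σ` it then has a past endpoint, in `N^{-σ}` a future endpoint.
  rcases TN.eq_empty_or_nonempty with hemp | hne
  · exfalso
    have hcl : ∀ τ, IsSign τ → IsClosed {t : Ioo a b | μ t ∈ 𝓔.extN τ} := fun τ hτ ↦
      (𝓔.isClosed_extN hτ).preimage hμ.smooth.continuousOn.domRestrict
    have hcov : ∀ t ∈ Ioo a b, μ t ∈ 𝓔.extN σ ∨ μ t ∈ 𝓔.extN (-σ) := fun t ht ↦
      (𝓔.mem_cases hσ (μ t)).resolve_left fun h1 ↦ by
        have : t ∈ TN := ⟨ht, h1⟩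
        rw [hemp] at this; exact this
    have hclo : IsClopen {t : Ioo a b | μ t ∈ 𝓔.extN σ} := by
      refine ⟨hcl σ hσ, ?_⟩
      have : {t : Ioo a b | μ t ∈ 𝓔.extN σ} = {t : Ioo a b | μ t ∈ 𝓔.extN (-σ)}ᶜ := by
        ext t
        refine ⟨fun h1 h2 ↦ hi t t.2 (h.eq_iZeroExt h1 h2), fun h1 ↦ (hcov t t.2).resolve_right h1⟩
      rw [this]
      exact (hcl _ hσ.neg).isOpen_compl
    have : PreconnectedSpace (Ioo a b) :=
      isPreconnected_iff_preconnectedSpace.1 isPreconnected_Ioo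
    rcases isClopen_iff.1 hclo with h1 | h1
    · refine hμ.no_future_endpoint (h.exists_tendsto_of_forall_mem_neg hμ.lt hle fun t ht ↦
        (hcov t ht).resolve_left fun h2 ↦ ?_)
      have h3 : (⟨t, ht⟩ : Ioo a b) ∈ {t : Ioo a b | μ t ∈ 𝓔.extN σ} := h2
      rw [h1] at h3; exact h3
    · refine hμ.no_past_endpoint (h.exists_tendsto_of_forall_mem hμ.lt hle fun t ht ↦ ?_)
      have h3 : (⟨t, ht⟩ : Ioo a b) ∈ {t : Ioo a b | μ t ∈ 𝓔.extN σ} := by rw [h1]; trivial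
      exact h3
  · have hbet : ∀ s ∈ TN, ∀ u ∈ TN, ∀ t, s < t → t < u → t ∈ TN := by
      rintro s ⟨hs, m, hm⟩ u ⟨hu, m', hm'⟩ t h1 h2
      have ht : t ∈ Ioo a b := ⟨hs.1.trans h1, h2.trans hu.2⟩
      refine ⟨ht, h.mem_range_of_between (m := m) (m' := m') ?_ ?_⟩
      · rw [hm]; exact hle s hs t ht h1
      · rw [hm']; exact hle t ht u hu h2
    have hpre : IsPreconnected TN := by
      refine OrdConnected.isPreconnected ⟨fun s hs u hu t ht ↦ ?_⟩
      rcases ht.1.eq_or_lt with h1 | h1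
      · rwa [← h1]
      rcases ht.2.eq_or_lt with h2 | h2
      · rwa [h2]
      exact hbet s hs u hu t h1 h2
    have hbb : BddBelow TN := ⟨a, fun t ht ↦ ht.1.1.le⟩
    have hba : BddAbove TN := ⟨b, fun t ht ↦ ht.1.2.le⟩
    -- The set of parameters in `N` is open and order-convex, hence an open interval, on which the
    -- hypothesis about `S` applies.
    have hIoo : TN = Ioo (sInf TN) (sSup TN) := by
      refine Subset.antisymm (fun t ht ↦ ⟨?_, ?_⟩)
        (IsConnected.Ioo_csInf_csSup_subset ⟨hne, hpre⟩ hbb hba)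
      · obtain ⟨s, hs, hs'⟩ := (hTNo.eventually_mem ht).exists_lt
        exact (csInf_le hbb hs').trans_lt hs
      · obtain ⟨s, hs, hs'⟩ := (hTNo.eventually_mem ht).exists_gt
        exact hs.trans_le (le_csSup hba hs')
    have hlt : sInf TN < sSup TN := by
      obtain ⟨t, ht⟩ := hne
      rw [hIoo] at ht
      exact ht.1.trans ht.2
    obtain ⟨t, ⟨ht, htS⟩, huniq⟩ := hS _ _ _ (isInextendibleTimelike_toM hμ hlt hIoo)
    have htN : t ∈ TN := by rw [hIoo]; exact ht
    refine ⟨t, ⟨htN.1, Or.inl ⟨_, htS, 𝓔.homeoM.left_inv htN.2⟩⟩, fun u ⟨hu, hmem⟩ ↦ ?_⟩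
    rcases hmem with ⟨m, hm, hmu⟩ | h1
    · have huN : u ∈ TN := ⟨hu, m, hmu⟩
      refine huniq u ⟨by rw [← hIoo]; exact huN, ?_⟩
      rw [Function.comp_apply, ← hmu]
      exact hm
    · exact absurd h1 (hi u hu)

/-- Adding `i₀` to a Cauchy surface of `N` gives a Cauchy surface of `N_ext`. -/
lemma isCauchySurface [T2Space 𝓔.Ext] (h : 𝓔.IsExtension σ gN ZN ZX gC Co) {S : Set M}
    (hS : IsCauchySurface gN S) :
    IsCauchySurface (𝓔.extMetric gN) (𝓔.incl '' S ∪ {𝓔.iZeroExt}) := by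
  intro a b μ hμ
  have hne : ∀ t ∈ Ioo a b, velocity μ (Ioo a b) t ≠ 0 := fun t ht ↦
    IsLorentzForm.ne_zero_of_timelike (hμ.timelike t ht)
  set f : ℝ → ℝ := fun t ↦ 𝓔.extMetric gN (μ t) (ZX (μ t)) (velocity μ (Ioo a b) t) with hf
  have hfc : ContinuousOn f (Ioo a b) := continuousOn_metric_velocity h.spacetime hμ.smooth
  have hf0 : ∀ t ∈ Ioo a b, f t ≠ 0 := fun t ht ↦
    (h.spacetime.lorentzian.lorentz _ (mem_univ _)).ne_zero_of_causal
      (h.spacetime.timelike _ (mem_univ _)) (hne t ht) (hμ.timelike t ht).le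
  -- The curve is only assumed timelike. Its product with the time orientation has no zero, so it is
  -- future-directed throughout or past-directed throughout; the second case is the first one after
  -- time reversal.
  have hsign : (∀ t ∈ Ioo a b, f t < 0) ∨ ∀ t ∈ Ioo a b, 0 < f t := by
    by_contra hcon
    push Not at hcon
    obtain ⟨⟨s, hs, hs0⟩, t, ht, ht0⟩ := hcon
    obtain ⟨u, hu, hu0⟩ := isPreconnected_Ioo.intermediate_value ht hs hfc ⟨ht0, hs0⟩
    exact hf0 u hu hu0
  rcases hsign with h1 | h1
  · exact h.existsUnique_mem hS hμ fun t ht ↦ ⟨hne t ht, (hμ.timelike t ht).le, h1 t ht⟩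
  · refine h.reverse.existsUnique_mem hS hμ fun t ht ↦ ⟨hne t ht, (hμ.timelike t ht).le, ?_⟩
    have := h1 t ht
    simp only [map_neg, neg_apply, Left.neg_neg_iff]
    exact this

end MinkowskianInfinity.IsExtension

end Penrose
end

/-! ### Assembly of the lemma -/

theorem lemma1p1 {M : Type*} [TopologicalSpace M] [T2Space M] [SecondCountableTopology M]
    [ChartedSpace ModelH M] [IsManifold I₄ ∞ M]
    (g : MetricField M) (Z : VecField M)
    (hg : IsLorentzianOn g univ) (hZ : IsTimeOrientation g Z) (hgh : IsCausallyHyperbolic g Z)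
    (𝓔 : MinkowskianInfinity g Z)
    (ωM : M → ℝ) (hω : ContMDiff I₄ 𝓘(ℝ, ℝ) ∞ ωM) (hpos : ∀ m, 0 < ωM m)
    (hωE : ∀ m ∈ 𝓔.iso.source, ωM m = conformalFactor (𝓔.iso m)) :
    T2Space 𝓔.Ext ∧ SecondCountableTopology 𝓔.Ext ∧
      IsGloballyHyperbolic (𝓔.extMetric (conformalMetric ωM g)) ∧
      ∀ S : Set M, IsCauchySurface (conformalMetric ωM g) S →
        IsCauchySurface (𝓔.extMetric (conformalMetric ωM g)) (𝓔.incl '' S ∪ {𝓔.iZeroExt}) := by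
  have hT2 : T2Space 𝓔.Ext := 𝓔.t2Space hω.continuous hpos hωE
  have hSC : SecondCountableTopology 𝓔.Ext := 𝓔.secondCountable
  have hgN : IsLorentzianOn (conformalMetric ωM g) univ := isLorentzianOn_conformalMetric hω hpos hg
  have hZN : IsTimeOrientation (conformalMetric ωM g) Z :=
    ⟨hZ.smooth, fun m ↦ mul_neg_of_pos_of_neg (pow_pos (hpos m) 2) (hZ.timelike m)⟩
  obtain ⟨gC, hgC, hext⟩ := 𝓔.exists_collarMetric hωE
  obtain ⟨ε, ZX, Co, hε, h⟩ := 𝓔.exists_isExtension hgN hZN hgC hext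
  -- Neither the conformal factor nor a global reversal of time affects the causality conditions, so
  -- global hyperbolicity passes to the orientation that matches `∂/∂T`.
  have hyp : IsCausallyHyperbolic (conformalMetric ωM g) (fun m ↦ ε • Z m) := by
    rcases hε with rfl | rfl
    · simpa only [one_smul] using hgh.conformalMetric hpos
    · simpa only [neg_smul, one_smul] using (hgh.conformalMetric hpos).reverse
  exact ⟨hT2, hSC, ⟨h.spacetime.lorentzian, ZX, ⟨contMDiffOn_univ.1 h.spacetime.smooth,
    fun x ↦ h.spacetime.timelike x (mem_univ x)⟩, h.isCausallyHyperbolic hyp⟩,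
    fun S hS ↦ h.isCauchySurface hS⟩
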